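/- Let $n\in\{2,3\}$, let $s$ be an integer with $s>1+n/2$, let $T>0$, and let $\Omega\subset\mathbb{R}^n$ be a nonempty bounded open set with $\Omega=\operatorname{int}\overline\Omega$ that is considered together with triangulations $\mathcal T_h$ of it: $\mathcal T_h$ is a finite conforming simplicial complex with $\bigcup_{K}K=\overline\Omega$, with $n$-dimensional elements $K$ and with $h=\max_K\operatorname{diam}K$. *Discrete spaces.* Let $\mathbf W_h$ be either the Raviart–Thomas space $\mathbf{RT}_s(\mathcal T_h)=\{\mathbf v\in \mathbf H(\mathrm{div},\Omega): \mathbf v|_K\in(\mathcal P_s)^n+\mathbf x\,\mathcal P_s\ \forall K\}$ or the Brezzi–Douglas–Marini space $\mathbf{BDM}_s(\mathcal T_h)=\{\mathbf v\in \mathbf H(\mathrm{div},\Omega): \mathbf v|_K\in(\mathcal P_s)^n\ \forall K\}$, and let $\mathring{\mathbf W}_h=\{\mathbf v\in\mathbf W_h:\operatorname{div}\mathbf v=0 \text{ in }\Omega,\ \mathbf v\cdot\mathbf n=0\text{ on }\partial\Omega\}$. *Scheme.* Let $\mathcal F^\circ$ be the set of interior facets (those shared by two elements). For $f\in\mathcal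 F^\circ$ fix a unit normal $\mathbf n_f$, let $K^+$ be the element from which $\mathbf n_f$ points outwards and $K^-$ the other one, and write $[\mathbf a]=\mathbf a^+-\mathbf a^-$, $\{\mathbf a\}=(\mathbf a^++\mathbf a^-)/2$. For $\boldsymbol\beta,\mathbf a,\mathbf b\in\mathring{\mathbf W}_h$ put $$(\mathsf X^h_{\boldsymbol\beta}\mathbf a,\mathbf b)_\Omega=\sum_K(\mathbf a,\operatorname{curl}(\boldsymbol\beta\times\mathbf b)-\boldsymbol\beta\operatorname{div}\mathbf b)_K+\sum_{f\in\mathcal F^\circ}\Big((\mathbf n_f\times\{\mathbf a\},[\boldsymbol\beta\times\mathbf b])_f+(c_f\,\mathbf n_f\times[\mathbf a],[\boldsymbol\beta\times\mathbf b])_f\Big)$$ with the upwind coefficient $c_f=\dfrac{\boldsymbol\beta\cdot\mathbf n_f}{2|\boldsymbol\beta\cdot\mathbf n_f|}$ where $\boldsymbol\beta\cdot\mathbf n_f\neq0$, and any measurable choice with $|c_f|\le\frac12$ where $\boldsymbol\beta\cdot\mathbf n_f=0$. (For $n=2$, $\mathbf a\times\mathbf b=a_1b_2-a_2b_1$ and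 $\operatorname{curl}\varphi=(\partial_2\varphi,-\partial_1\varphi)$.) A semi-discrete solution is an absolutely continuous $\mathbf u_h:[0,T]\to\mathring{\mathbf W}_h$ such that, for almost every $t$, $$(\dot{\mathbf u}_h,\mathbf v)_\Omega+(\mathsf X^h_{\mathbf u_h}\mathbf u_h,\mathbf v)_\Omega=0\qquad\text{for all }\mathbf v\in\mathring{\mathbf W}_h .$$ *Exact solution.* Let $\mathbf u$ be continuous on $[0,T]\times\Omega$ and solve $\partial_t\mathbf u+(\mathbf u\cdot\nabla)\mathbf u+\nabla p=0$, $\operatorname{div}\mathbf u=0$ in $(0,T)\times\Omega$ (in the sense of weak derivatives), $\mathbf u\cdot\mathbf n=0$ on $\partial\Omega$. **Theorem.** For all $\sigma,\kappa>0$ and $M,A\ge0$ there is a constant $C>0$, depending only on $n,s,\Omega,T,\sigma,\kappa,M,A$, with the following property. Suppose that $\|\mathbf u|_{t=0}\|_{\mathbf H^{s+1}(\Omega)}$, $\|\mathbf u\|_{H^1([0,T];\mathbf H^{s+1}(\Omega))}$ and $\|\mathbf u\|_{\mathbf W^{1,\infty}([0,T]\times\Omega)}$ are at most $M$; that $\mathcal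 T_h$ is shape regular and quasi-uniform, i.e. each element $K$ contains a ball of radius $\sigma\operatorname{diam}K$ and satisfies $\operatorname{diam}K\ge\kappa h$; and that $\mathbf u_h$ is a semi-discrete solution with initial value satisfying $$\|\mathbf u(0)-\mathbf u_h(0)\|_{L^2(\Omega)}\le A\big(\|\mathbf u(0)-\mathbf w\|_{L^2(\Omega)}+h^s\big)\qquad\text{for all }\mathbf w\in\mathring{\mathbf W}_h$$ (for instance, $\mathbf u_h(0)$ is the $L^2$-projection of $\mathbf u(0)$ onto $\mathring{\mathbf W}_h$, with $A=1$, or any element of $\mathring{\mathbf W}_h$ within $A h^s$ of $\mathbf u(0)$). Then $$\|\mathbf u(t)-\mathbf u_h(t)\|_{L^2(\Omega)}\le C\,h^s\qquad\text{for all }t\in[0,T].$$ In particular, $C$ does not depend on $h$. -/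

import Mathlib

open MeasureTheory Set
open scoped ENNReal NNReal ContDiff

noncomputable section

/-- Euclidean space `ℝⁿ`. -/
abbrev Euc (n : ℕ) := EuclideanSpace ℝ (Fin n)

/-! ### Weak derivatives, `H(div)`, Sobolev norms -/

section Weak

variable {V : Type*} [NormedAddCommGroup V] [NormedSpace ℝ V] [MeasureSpace V]

/-- `φ ∈ C_c^∞(Q)`. -/
structure IsTestFunction (Q : Set V) (φ : V → ℝ) : Prop where
  smooth : ContDiff ℝ ∞ φ
  compact : HasCompactSupport φ
  support : tsupport φ ⊆ Q

/-- `g` is the iterated weak derivative `∂_{w 0} ⋯ ∂_{w (k-1)} f` on the open set `Q`. -/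
structure HasWeakDeriv (Q : Set V) {k : ℕ} (w : Fin k → V) (f g : V → ℝ) : Prop where
  locInt_fun : LocallyIntegrableOn f Q
  locInt_deriv : LocallyIntegrableOn g Q
  parts : ∀ φ : V → ℝ, IsTestFunction Q φ →
    ∫ x in Q, f x * iteratedFDeriv ℝ k φ x w = (-1) ^ k * ∫ x in Q, g x * φ x

/-- The `L^p(Q)` norm of the weak derivative `∂_{w 0} ⋯ ∂_{w (k-1)} f` (which is unique up to null
sets), and `∞` if there is no such derivative. -/
def weakDerivNorm (Q : Set V) {k : ℕ} (w : Fin k → V) (f : V → ℝ) (p : ℝ≥0∞) : ℝ≥0∞ :=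
  ⨅ (g : V → ℝ) (_ : HasWeakDeriv Q w f g), eLpNorm g p (volume.restrict Q)

end Weak

variable {n : ℕ}

/-- The space `H(div, Ω)`. -/
def MemHDiv (Ω : Set (Euc n)) (w : Euc n → Euc n) : Prop :=
  MemLp w 2 (volume.restrict Ω) ∧ ∃ g : Euc n → ℝ, MemLp g 2 (volume.restrict Ω) ∧
    ∀ φ : Euc n → ℝ, IsTestFunction Ω φ →
      ∫ x in Ω, fderiv ℝ φ x (w x) = -∫ x in Ω, g x * φ x

/-- `w ∈ L²(Ω)` with `div w = 0` in `Ω` and `w · n = 0` on `∂Ω`, in the weak sense: the test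
functions `φ` need not vanish on `∂Ω`, so that Green's formula
`∫_Ω w · ∇φ = - ∫_Ω (div w) φ + ∫_∂Ω (w · n) φ` expresses both conditions. -/
def IsSolenoidal (Ω : Set (Euc n)) (w : Euc n → Euc n) : Prop :=
  MemLp w 2 (volume.restrict Ω) ∧
    ∀ φ : Euc n → ℝ, IsTestFunction univ φ → ∫ x in Ω, fderiv ℝ φ x (w x) = 0

/-- The norm of `H^m(Ω)` for vector fields. -/
def sobolevNorm (Ω : Set (Euc n)) (m : ℕ) (w : Euc n → Euc n) : ℝ≥0∞ :=
  (∑ i : Fin n, ∑ k ∈ Finset.range (m + 1), ∑ I : Fin k → Fin n,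
    weakDerivNorm Ω (fun l => EuclideanSpace.single (I l) (1 : ℝ)) (fun x => w x i) 2 ^ 2)
      ^ (1 / 2 : ℝ)

/-- The space-time cylinder `(0,T) × Ω`. -/
def cylinder (T : ℝ) (Ω : Set (Euc n)) : Set (ℝ × Euc n) := Ioo 0 T ×ˢ Ω

/-- The unit vector of the time axis. -/
def dirT : ℝ × Euc n := (1, 0)

/-- The unit vector of the `j`-th space axis. -/
def dirX (j : Fin n) : ℝ × Euc n := (0, EuclideanSpace.single j 1)

/-- The norm of `H¹([0,T]; H^m(Ω))` for vector fields: the `L²((0,T) × Ω)` norms of the weak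
derivatives `∂^I u` and `∂_t ∂^I u` with `|I| ≤ m`. -/
def sobolevTimeNorm (Ω : Set (Euc n)) (T : ℝ) (m : ℕ) (u : ℝ → Euc n → Euc n) : ℝ≥0∞ :=
  (∑ i : Fin n, ∑ k ∈ Finset.range (m + 1), ∑ I : Fin k → Fin n,
    (weakDerivNorm (cylinder T Ω) (fun l => dirX (I l)) (fun q => u q.1 q.2 i) 2 ^ 2 +
     weakDerivNorm (cylinder T Ω) (Fin.cons dirT (fun l => dirX (I l)) : Fin (k + 1) → ℝ × Euc n)
      (fun q => u q.1 q.2 i) 2 ^ 2)) ^ (1 / 2 : ℝ)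

/-- The norm of `W^{1,∞}([0,T] × Ω)` for vector fields. -/
def lipNorm (Ω : Set (Euc n)) (T : ℝ) (u : ℝ → Euc n → Euc n) : ℝ≥0∞ :=
  ∑ i : Fin n,
    (weakDerivNorm (cylinder T Ω) ![] (fun q => u q.1 q.2 i) ∞ +
     weakDerivNorm (cylinder T Ω) ![dirT] (fun q => u q.1 q.2 i) ∞ +
     ∑ j : Fin n, weakDerivNorm (cylinder T Ω) ![dirX j] (fun q => u q.1 q.2 i) ∞)

/-! ### The incompressible Euler equations -/

/-- `u` is a (continuous) solution of the incompressible Euler equations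
`∂_t u + (u · ∇) u + ∇p = 0`, `div u = 0` on `[0,T] × Ω` with `u · n = 0` on `∂Ω`. -/
structure IsEulerSolution (Ω : Set (Euc n)) (T : ℝ) (u : ℝ → Euc n → Euc n) : Prop where
  continuousOn : ContinuousOn (fun q : ℝ × Euc n => u q.1 q.2) (Icc 0 T ×ˢ Ω)
  solenoidal : ∀ t ∈ Icc 0 T, IsSolenoidal Ω (u t)
  momentum : ∃ (p : ℝ × Euc n → ℝ) (ut : Fin n → ℝ × Euc n → ℝ)
    (Du : Fin n → Fin n → ℝ × Euc n → ℝ) (Dp : Fin n → ℝ × Euc n → ℝ),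
    (∀ i, HasWeakDeriv (cylinder T Ω) ![dirT] (fun q => u q.1 q.2 i) (ut i)) ∧
    (∀ i j, HasWeakDeriv (cylinder T Ω) ![dirX j] (fun q => u q.1 q.2 i) (Du i j)) ∧
    (∀ i, HasWeakDeriv (cylinder T Ω) ![dirX i] p (Dp i)) ∧
    ∀ᵐ q ∂(volume.restrict (cylinder T Ω)), ∀ i,
      ut i q + ∑ j, u q.1 q.2 j * Du i j q + Dp i q = 0

/-! ### Triangulations -/

/-- A (conforming, finite) triangulation of the open set `Ω`; simplices are given by their sets of
vertices. -/
structure Triangulation (Ω : Set (Euc n)) where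
  complex : Geometry.SimplicialComplex ℝ (Euc n)
  finite : complex.faces.Finite
  space_eq : complex.space = closure Ω

namespace Triangulation

variable {Ω : Set (Euc n)} (𝒯 : Triangulation Ω)

/-- The elements `K` of the triangulation, i.e. its `n`-dimensional simplices. -/
def cells : Finset (Finset (Euc n)) := 𝒯.finite.toFinset.filter (fun K => K.card = n + 1)

open Classical in
/-- The interior facets: the `(n-1)`-dimensional simplices shared by two elements. -/
def interiorFacets : Finset (Finset (Euc n)) :=
  𝒯.finite.toFinset.filter (fun f => f.card = n ∧
    ∃ K ∈ 𝒯.cells, ∃ L ∈ 𝒯.cells, K ≠ L ∧ f ⊆ K ∧ f ⊆ L)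

/-- The maximum simplex diameter `h`. -/
def meshSize : ℝ :=
  sSup ((fun K : Finset (Euc n) => Metric.diam (convexHull ℝ (K : Set (Euc n)))) ''
    (𝒯.cells : Set (Finset (Euc n))))

/-- Shape regularity with parameter `σ`: each element `K` contains a ball of radius
`σ · diam K`. -/
def ShapeRegular (σ : ℝ) : Prop :=
  ∀ K ∈ 𝒯.cells, ∃ x : Euc n,
    Metric.closedBall x (σ * Metric.diam (convexHull ℝ (K : Set (Euc n)))) ⊆
      convexHull ℝ (K : Set (Euc n))

/-- Quasi-uniformity with parameter `κ`: each element has diameter at least `κ h`. -/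
def QuasiUniform (κ : ℝ) : Prop :=
  ∀ K ∈ 𝒯.cells, κ * 𝒯.meshSize ≤ Metric.diam (convexHull ℝ (K : Set (Euc n)))

/-- An orientation of the interior facets: the two elements `K⁺`, `K⁻` at each facet `f`, and the
unit normal `n_f` of `f` pointing outwards from `K⁺`. -/
structure Orientation where
  plus : Finset (Euc n) → Finset (Euc n)
  minus : Finset (Euc n) → Finset (Euc n)
  normal : Finset (Euc n) → Euc n
  plus_mem : ∀ f ∈ 𝒯.interiorFacets, plus f ∈ 𝒯.cells ∧ f ⊆ plus f
  minus_mem : ∀ f ∈ 𝒯.interiorFacets, minus f ∈ 𝒯.cells ∧ f ⊆ minus f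
  plus_ne_minus : ∀ f ∈ 𝒯.interiorFacets, plus f ≠ minus f
  norm_normal : ∀ f ∈ 𝒯.interiorFacets, ‖normal f‖ = 1
  normal_orthogonal : ∀ f ∈ 𝒯.interiorFacets, ∀ x ∈ f, ∀ y ∈ f, inner ℝ (normal f) (y - x) = 0
  normal_outward : ∀ f ∈ 𝒯.interiorFacets, ∀ x ∈ f, ∀ y ∈ plus f,
    inner ℝ (normal f) (y - x) ≤ 0

end Triangulation

/-! ### Finite element spaces -/

/-- A vector field with polynomial components. -/
abbrev PolyField (n : ℕ) := Fin n → MvPolynomial (Fin n) ℝ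

/-- A broken (piecewise) polynomial vector field: `v K` is the polynomial field that represents `v`
on the element `K`. (The values on vertex sets that are not elements are irrelevant.) -/
abbrev BrokenField (n : ℕ) := Finset (Euc n) → PolyField n

/-- The value at `x` (possibly on the boundary of `K`) of the restriction of `v` to `K`. -/
def trace (v : BrokenField n) (K : Finset (Euc n)) (x : Euc n) : Fin n → ℝ :=
  fun i => MvPolynomial.eval (fun j => x j) (v K i)

namespace Triangulation

variable {Ω : Set (Euc n)} (𝒯 : Triangulation Ω)

/-- The vector field on `Ω` (defined almost everywhere) given by a broken polynomial field. -/
def glue (v : BrokenField n) (x : Euc n) : Euc n :=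
  ∑ K ∈ 𝒯.cells, (interior (convexHull ℝ (K : Set (Euc n)))).indicator
    (fun y => WithLp.toLp 2 (trace v K y)) x

end Triangulation

/-- The two families of `H(div)` elements: Raviart-Thomas and Brezzi-Douglas-Marini. -/
inductive ElementFamily
  | RT
  | BDM

/-- The local space on an element: `(P_s)ⁿ + x P_s` for `RT_s` and `(P_s)ⁿ` for `BDM_s`. -/
def ElementFamily.localSpace (n : ℕ) (s : ℕ) : ElementFamily → Set (PolyField n)
  | RT => {p | ∃ (q : PolyField n) (r : MvPolynomial (Fin n) ℝ),
      (∀ i, (q i).totalDegree ≤ s) ∧ r.totalDegree ≤ s ∧ ∀ i, p i = q i + MvPolynomial.X i * r}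
  | BDM => {p | ∀ i, (p i).totalDegree ≤ s}

namespace Triangulation

variable {Ω : Set (Euc n)} (𝒯 : Triangulation Ω)

/-- The space `W_h = RT_s(𝒯)` or `W_h = BDM_s(𝒯)`. -/
def velocitySpace (F : ElementFamily) (s : ℕ) : Set (BrokenField n) :=
  {v | MemHDiv Ω (𝒯.glue v) ∧ ∀ K ∈ 𝒯.cells, v K ∈ F.localSpace n s}

/-- The space of all `v ∈ W_h` with `div v = 0` in `Ω` and `v · n = 0` on `∂Ω`. -/
def divFreeSpace (F : ElementFamily) (s : ℕ) : Set (BrokenField n) :=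
  {v | v ∈ 𝒯.velocitySpace F s ∧ IsSolenoidal Ω (𝒯.glue v)}

end Triangulation

/-! ### Cross products and curls

In order to treat `n = 2` and `n = 3` together, the cross product `a × b` is represented by the
antisymmetric array `a_i b_j - a_j b_i`. The lemmas below identify the operations with the usual
ones in dimension `3` and in dimension `2` (where `a × b` is a scalar). -/

/-- The cross product `a × b` as an antisymmetric array. -/
def cross {R : Type*} [CommRing R] (a b : Fin n → R) : Fin n → Fin n → R :=
  fun i j => a i * b j - a j * b i

/-- The Euclidean inner product of two cross products. -/
def crossInner (a b : Fin n → Fin n → ℝ) : ℝ := 2⁻¹ * ∑ i, ∑ j, a i j * b i j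

/-- The curl of (the antisymmetric array of) a polynomial field. -/
def polyCurl (a : Fin n → Fin n → MvPolynomial (Fin n) ℝ) : PolyField n :=
  fun i => ∑ j, MvPolynomial.pderiv j (a i j)

/-- The divergence of a polynomial field. -/
def polyDiv (b : PolyField n) : MvPolynomial (Fin n) ℝ := ∑ j, MvPolynomial.pderiv j (b j)

theorem crossInner_three (a b c d c' d' : Fin 3 → ℝ) :
    crossInner (cross a b) (cross c d - cross c' d') =
      crossProduct a b ⬝ᵥ (crossProduct c d - crossProduct c' d') := by
  simp [crossInner, cross, crossProduct, Fin.sum_univ_three, dotProduct]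
  ring

theorem crossInner_two (a b c d c' d' : Fin 2 → ℝ) :
    crossInner (cross a b) (cross c d - cross c' d') =
      (a 0 * b 1 - a 1 * b 0) *
        ((c 0 * d 1 - c 1 * d 0) - (c' 0 * d' 1 - c' 1 * d' 0)) := by
  simp [crossInner, cross, Fin.sum_univ_two]
  ring

theorem polyCurl_cross_three (a b : PolyField 3) :
    polyCurl (cross a b) =
      ![MvPolynomial.pderiv 1 (crossProduct a b 2) - MvPolynomial.pderiv 2 (crossProduct a b 1),
        MvPolynomial.pderiv 2 (crossProduct a b 0) - MvPolynomial.pderiv 0 (crossProduct a b 2),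
        MvPolynomial.pderiv 0 (crossProduct a b 1) -
          MvPolynomial.pderiv 1 (crossProduct a b 0)] := by
  ext1 i
  fin_cases i <;> simp [polyCurl, cross, crossProduct, Fin.sum_univ_three] <;> ring

theorem polyCurl_cross_two (a b : PolyField 2) :
    polyCurl (cross a b) =
      ![MvPolynomial.pderiv 1 (a 0 * b 1 - a 1 * b 0),
        -MvPolynomial.pderiv 0 (a 0 * b 1 - a 1 * b 0)] := by
  ext1 i
  fin_cases i <;> simp [polyCurl, cross, Fin.sum_univ_two]

/-! ### The discrete Lie derivative and the upwind scheme -/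

namespace Triangulation

variable {Ω : Set (Euc n)} (𝒯 : Triangulation Ω)

/-- The discrete Lie derivative in weak form,
`(X_β a, b)_Ω = ∑_K (a, curl(β × b) - β div b)_K
  + ∑_f [ (n_f × {a}, [β × b])_f + (c_f n_f × [a], [β × b])_f ]`,
the second sum being over the interior facets, with `{a} = (a⁺ + a⁻)/2`, `[a] = a⁺ - a⁻`. The
facets carry the `(n-1)`-dimensional surface measure. -/
def lieForm (o : 𝒯.Orientation) (c : Finset (Euc n) → Euc n → ℝ) (β a b : BrokenField n) : ℝ :=
  (∑ K ∈ 𝒯.cells, ∫ x in convexHull ℝ (K : Set (Euc n)),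
    ∑ i, trace a K x i * MvPolynomial.eval (fun j => x j)
      (polyCurl (cross (β K) (b K)) i - β K i * polyDiv (b K))) +
  ∑ f ∈ 𝒯.interiorFacets, ∫ x in convexHull ℝ (f : Set (Euc n)),
    (crossInner
        (cross (fun i => o.normal f i)
          ((2 : ℝ)⁻¹ • (trace a (o.plus f) x + trace a (o.minus f) x)))
        (cross (trace β (o.plus f) x) (trace b (o.plus f) x) -
          cross (trace β (o.minus f) x) (trace b (o.minus f) x)) +
      c f x * crossInner
        (cross (fun i => o.normal f i) (trace a (o.plus f) x - trace a (o.minus f) x))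
        (cross (trace β (o.plus f) x) (trace b (o.plus f) x) -
          cross (trace β (o.minus f) x) (trace b (o.minus f) x)))
    ∂(Measure.euclideanHausdorffMeasure (n - 1))

/-- The normal component `β · n_f` on a facet, taken from the side of `K⁺` (it is single-valued for
`β ∈ H(div)`). -/
def normalTrace (o : 𝒯.Orientation) (β : BrokenField n) (f : Finset (Euc n)) (x : Euc n) : ℝ :=
  ∑ i, trace β (o.plus f) x i * o.normal f i

/-- `c` is an upwind coefficient for `β`: `c_f = (β · n_f) / (2 |β · n_f|)` wherever
`β · n_f ≠ 0`. Where `β · n_f = 0` the quotient is not defined, and any (measurable) choice of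
modulus at most `1/2` is admitted. -/
def IsUpwindCoeff (o : 𝒯.Orientation) (β : BrokenField n)
    (c : Finset (Euc n) → Euc n → ℝ) : Prop :=
  ∀ f ∈ 𝒯.interiorFacets, Measurable (c f) ∧
    ∀ x ∈ convexHull ℝ (f : Set (Euc n)), |c f x| ≤ 1 / 2 ∧
      (𝒯.normalTrace o β f x ≠ 0 →
        c f x = 𝒯.normalTrace o β f x / (2 * |𝒯.normalTrace o β f x|))

/-- `uh : [0,T] → divFreeSpace` solves the semi-discrete upwind scheme
`(∂_t u_h, v)_Ω + (X_{u_h} u_h, v)_Ω = 0` for all `v ∈ divFreeSpace`. Since the upwind coefficient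
depends discontinuously on `u_h`, solutions are only asked to be absolutely continuous in time and
to satisfy the equation for almost every `t`; this includes the differentiable solutions. -/
structure IsUpwindSolution (o : 𝒯.Orientation) (F : ElementFamily) (s : ℕ) (T : ℝ)
    (uh : ℝ → BrokenField n) : Prop where
  mem : ∀ t ∈ Icc 0 T, uh t ∈ 𝒯.divFreeSpace F s
  absCont : ∀ K ∈ 𝒯.cells, ∀ (x : Euc n) (i : Fin n),
    AbsolutelyContinuousOnInterval (fun t => trace (uh t) K x i) 0 T
  equation : ∀ᵐ t ∂(volume.restrict (Icc 0 T)), ∃ ud ∈ 𝒯.divFreeSpace F s,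
    (∀ K ∈ 𝒯.cells, ∀ (x : Euc n) (i : Fin n),
      HasDerivAt (fun τ => trace (uh τ) K x i) (trace ud K x i) t) ∧
    ∃ c : Finset (Euc n) → Euc n → ℝ, 𝒯.IsUpwindCoeff o (uh t) c ∧
      ∀ v ∈ 𝒯.divFreeSpace F s,
        (∫ x in Ω, inner ℝ (𝒯.glue ud x) (𝒯.glue v x)) + 𝒯.lieForm o c (uh t) (uh t) v = 0

/-- The `L²(Ω)` distance of a vector field `w` and a broken polynomial field `v`. -/
def errorNorm (w : Euc n → Euc n) (v : BrokenField n) : ℝ≥0∞ :=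
  eLpNorm (fun x => w x - 𝒯.glue v x) 2 (volume.restrict Ω)

end Triangulation

end

open Finset (sum_congr mul_sum sum_mul sum_le_sum sum_add_distrib sum_nonneg sum_sub_distrib sum_comm
  mem_powersetCard sum_eq_zero sum_eq_single sum_const single_le_sum card_univ erase_subset
  sum_neg_distrib sum_coe_sort notMem_erase mem_filter mem_erase abs_sum_le_sum_abs)
open Metric (diam closedBall diam_nonneg)
open MvPolynomial (eval)

/-! ### Positive semidefinite bilinear forms -/

section BilinForm

variable {E : Type*} [AddCommGroup E] [Module ℝ E]

/-- The Cauchy-Schwarz inequality in the degenerate case. -/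
lemma bilin_eq_zero_of_self_eq_zero {β : LinearMap.BilinForm ℝ E} (hs : ∀ x y, β x y = β y x)
    (hp : ∀ x, 0 ≤ β x x) {y : E} (hy : β y y = 0) (z : E) : β y z = 0 := by
  have h : ∀ r : ℝ, 0 ≤ 2 * r * β y z + β z z := fun r => by
    have := hp (r • y + z)
    simp only [map_add, map_smul, LinearMap.add_apply, LinearMap.smul_apply, smul_eq_mul, hy,
      hs z y] at this
    linarith
  by_contra hne
  have := h (-(β z z + 1) / (2 * β y z))
  have h2 : 2 * (-(β z z + 1) / (2 * β y z)) * β y z = -(β z z + 1) := by field_simp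
  rw [h2] at this
  linarith

/-- A finite-dimensional space with a positive semidefinite form is spanned, up to the kernel of the
form, by an orthonormal family. -/
lemma exists_orthonormal_family [FiniteDimensional ℝ E] {β : LinearMap.BilinForm ℝ E}
    (hs : ∀ x y, β x y = β y x) (hp : ∀ x, 0 ≤ β x x) :
    ∃ (ι : Type) (_ : Fintype ι) (b : ι → E), (∀ i, β (b i) (b i) = 1) ∧
      (∀ i j, i ≠ j → β (b i) (b j) = 0) ∧
      ∀ x, β (x - ∑ i, β x (b i) • b i) (x - ∑ i, β x (b i) • b i) = 0 := by
  classical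
  obtain ⟨v, hv⟩ := LinearMap.BilinForm.exists_orthogonal_basis
    (LinearMap.BilinForm.isSymm_iff.1 ⟨hs⟩)
  have hv' : ∀ i j, i ≠ j → β (v i) (v j) = 0 := fun i j hij => hv hij
  let I := {i // β (v i) (v i) ≠ 0}
  have hpos : ∀ i : I, 0 < β (v i) (v i) := fun i => lt_of_le_of_ne (hp _) (Ne.symm i.2)
  refine ⟨I, inferInstance, fun i => (Real.sqrt (β (v i) (v i)))⁻¹ • v i, fun i => ?_,
    fun i j hij => ?_, fun x => ?_⟩
  · have := Real.mul_self_sqrt (hpos i).le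
    have h0 : Real.sqrt (β (v i) (v i)) ≠ 0 := (Real.sqrt_pos.2 (hpos i)).ne'
    simp only [map_smul, LinearMap.smul_apply, smul_eq_mul]
    field_simp
    linarith
  · simp [hv' _ _ (fun h => hij (Subtype.ext h))]
  · obtain ⟨a, rfl⟩ : ∃ a : _ → ℝ, x = ∑ i, a i • v i := ⟨v.repr x, (v.sum_repr x).symm⟩
    have hin : ∀ j, β (∑ i, a i • v i) (v j) = a j * β (v j) (v j) := fun j => by
      simp only [map_sum, map_smul, LinearMap.sum_apply, LinearMap.smul_apply, smul_eq_mul]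
      rw [sum_eq_single j (fun i _ hij => by simp [hv' i j hij]) (by simp)]
    have hterm : ∀ i : I, β (∑ i, a i • v i) ((Real.sqrt (β (v i) (v i)))⁻¹ • v i) •
        (Real.sqrt (β (v i) (v i)))⁻¹ • v i = a i • v i := fun i => by
      have h0 : Real.sqrt (β (v i) (v i)) ≠ 0 := (Real.sqrt_pos.2 (hpos i)).ne'
      have h1 := Real.mul_self_sqrt (hpos i).le
      rw [map_smul, hin, smul_smul]
      congr 1
      simp only [smul_eq_mul]
      field_simp
      linear_combination (-(a i)) * h1
    have hdiff : (∑ i, a i • v i) - ∑ i : I, β (∑ i, a i • v i)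
        ((Real.sqrt (β (v i) (v i)))⁻¹ • v i) • (Real.sqrt (β (v i) (v i)))⁻¹ • v i =
        ∑ i ∈ Finset.univ.filter (fun i => ¬ β (v i) (v i) ≠ 0), a i • v i := by
      rw [sum_congr rfl (fun i _ => hterm i), sub_eq_iff_eq_add,
        ← Finset.sum_filter_add_sum_filter_not Finset.univ (fun i => β (v i) (v i) ≠ 0), add_comm]
      congr 1
      exact Finset.sum_subtype _ (by simp) (fun i => a i • v i)
    rw [hdiff]
    simp only [map_sum, map_smul, LinearMap.sum_apply, LinearMap.smul_apply, smul_eq_mul]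
    refine sum_eq_zero fun i hi => mul_eq_zero_of_right _ (sum_eq_zero fun j hj => ?_)
    have hi' : β (v i) (v i) = 0 := by simpa using hi
    by_cases hij : j = i
    · subst hij; simp [hi']
    · simp [hv' j i hij]

end BilinForm

/-! ### Polynomial functions -/

/-- The polynomial functions of total degree at most `s` on `ℝⁿ`. -/
def polySpace (n s : ℕ) : Submodule ℝ (Euc n → ℝ) where
  carrier := {f | ∃ p : MvPolynomial (Fin n) ℝ, p.totalDegree ≤ s ∧
    ∀ x, f x = eval (fun j => x j) p}
  add_mem' := by
    rintro f g ⟨p, hp, hf⟩ ⟨q, hq, hg⟩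
    exact ⟨p + q, (MvPolynomial.totalDegree_add _ _).trans (max_le hp hq), fun x => by
      simp [hf, hg]⟩
  zero_mem' := ⟨0, by simp, by simp⟩
  smul_mem' := by
    rintro c f ⟨p, hp, hf⟩
    exact ⟨c • p, (MvPolynomial.totalDegree_smul_le _ _).trans hp, fun x => by
      simp [hf, MvPolynomial.smul_eval]⟩

section PolySpace

variable {n m s s' : ℕ} {f g : Euc n → ℝ}

lemma mem_polySpace : f ∈ polySpace n s ↔ ∃ p : MvPolynomial (Fin n) ℝ, p.totalDegree ≤ s ∧
    ∀ x, f x = eval (fun j => x j) p := Iff.rfl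

lemma eval_mem_polySpace {p : MvPolynomial (Fin n) ℝ} (hp : p.totalDegree ≤ s) :
    (fun x : Euc n => eval (fun j => x j) p) ∈ polySpace n s := ⟨p, hp, fun _ => rfl⟩

instance polySpace_finite : FiniteDimensional ℝ (polySpace n s) := by
  let L : MvPolynomial.restrictTotalDegree (Fin n) ℝ s →ₗ[ℝ] polySpace n s :=
    { toFun := fun p => ⟨_, eval_mem_polySpace ((MvPolynomial.mem_restrictTotalDegree _ _ _).1 p.2)⟩
      map_add' := fun p q => by ext x; simp
      map_smul' := fun c p => by ext x; simp [MvPolynomial.smul_eval] }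
  refine Module.Finite.of_surjective L fun f => ?_
  obtain ⟨p, hp, hf⟩ := f.2
  exact ⟨⟨p, (MvPolynomial.mem_restrictTotalDegree _ _ _).2 hp⟩, Subtype.ext (funext fun x =>
    (hf x).symm)⟩

lemma polySpace_mono (h : s ≤ s') (hf : f ∈ polySpace n s) : f ∈ polySpace n s' := by
  obtain ⟨p, hp, hf⟩ := hf
  exact ⟨p, hp.trans h, hf⟩

lemma polySpace_mul (hf : f ∈ polySpace n s) (hg : g ∈ polySpace n s') :
    (fun x => f x * g x) ∈ polySpace n (s + s') := by
  obtain ⟨p, hp, hf⟩ := hf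
  obtain ⟨q, hq, hg⟩ := hg
  exact ⟨p * q, (MvPolynomial.totalDegree_mul _ _).trans (add_le_add hp hq), fun x => by
    simp [hf, hg]⟩

lemma polySpace_const (c : ℝ) : (fun _ : Euc n => c) ∈ polySpace n s :=
  ⟨MvPolynomial.C c, by simp, by simp⟩

lemma polySpace_coord (j : Fin n) : (fun x : Euc n => x j) ∈ polySpace n 1 :=
  ⟨MvPolynomial.X j, by simp, by simp⟩

lemma polySpace_sum {ι : Type*} (t : Finset ι) {F : ι → Euc n → ℝ}
    (h : ∀ i ∈ t, F i ∈ polySpace n s) : (fun x => ∑ i ∈ t, F i x) ∈ polySpace n s := by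
  have := Submodule.sum_mem _ h
  convert! this using 1
  ext x
  simp

lemma polySpace_prod {ι : Type*} (t : Finset ι) {F : ι → Euc n → ℝ} {d : ι → ℕ}
    (h : ∀ i ∈ t, F i ∈ polySpace n (d i)) :
    (fun x => ∏ i ∈ t, F i x) ∈ polySpace n (∑ i ∈ t, d i) := by
  classical
  induction t using Finset.induction_on with
  | empty => simpa using polySpace_const (1 : ℝ)
  | insert i t hi ih =>
    simp only [Finset.prod_insert hi, Finset.sum_insert hi]
    exact polySpace_mul (h i (Finset.mem_insert_self _ _))
      (ih fun j hj => h j (Finset.mem_insert_of_mem hj))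

lemma polySpace_comp {f : Euc m → ℝ} (hf : f ∈ polySpace m s) {A : Euc n → Euc m}
    (hA : ∀ j, (fun x => A x j) ∈ polySpace n 1) : (fun x => f (A x)) ∈ polySpace n s := by
  obtain ⟨p, hp, hf⟩ := hf
  simp only [hf, MvPolynomial.eval_eq']
  refine polySpace_sum _ fun d hd => ?_
  have hd' : ∑ j, d j ≤ s := by
    refine le_trans ?_ ((MvPolynomial.le_totalDegree hd).trans hp)
    rw [Finsupp.sum_fintype _ _ (fun _ => rfl)]
  refine (polySpace n s).smul_mem (p.coeff d) (polySpace_mono hd' ?_)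
  refine polySpace_prod (F := fun j x => A x j ^ d j) _ fun j _ => ?_
  have := polySpace_prod (Finset.range (d j)) (F := fun _ x => A x j) (d := fun _ => 1)
    fun _ _ => hA j
  simpa using this

lemma polySpace_affine (l : Euc n →ᵃ[ℝ] ℝ) : (fun x => l x) ∈ polySpace n 1 := by
  have : ∀ x, l x = ∑ j, x j * l.linear (EuclideanSpace.single j 1) + l 0 := fun x => by
    have h1 : l x = l.linear x + l 0 := by
      have := l.map_vadd 0 x
      simpa using this
    have h2 : x = ∑ j, x j • EuclideanSpace.single j (1 : ℝ) := by
      ext i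
      simp [Pi.single_apply]
    rw [h1]
    conv_lhs => rw [h2]
    simp [map_sum]
  rw [show (fun x => l x) = _ from funext this]
  refine Submodule.add_mem _ (polySpace_sum _ fun j _ => ?_) (polySpace_const _)
  have := (polySpace n 1).smul_mem (l.linear (EuclideanSpace.single j 1)) (polySpace_coord j)
  convert! this using 1
  ext x
  simp [mul_comm]

lemma polySpace_contDiff (hf : f ∈ polySpace n s) : ContDiff ℝ ∞ f := by
  obtain ⟨p, hp, hf⟩ := hf
  have : f = fun x => eval (fun j => x j) p := funext hf
  rw [this]
  simp only [MvPolynomial.eval_eq']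
  refine ContDiff.sum fun d _ => contDiff_const.mul ?_
  refine contDiff_prod fun j _ => ContDiff.pow ?_ _
  fun_prop

lemma polySpace_continuous (hf : f ∈ polySpace n s) : Continuous f :=
  (polySpace_contDiff hf).continuous

lemma polySpace_differentiable (hf : f ∈ polySpace n s) : Differentiable ℝ f :=
  (polySpace_contDiff hf).differentiable (by simp)

/-- The Fréchet derivative of a polynomial function is given by the formal partial derivatives. -/
lemma fderiv_eval (p : MvPolynomial (Fin n) ℝ) (x t : Euc n) :
    fderiv ℝ (fun x : Euc n => eval (fun j => x j) p) x t =
      ∑ j, t j * eval (fun j => x j) (MvPolynomial.pderiv j p) := by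
  have hd : ∀ p : MvPolynomial (Fin n) ℝ, DifferentiableAt ℝ
      (fun x : Euc n => eval (fun j => x j) p) x := fun p =>
    polySpace_differentiable (eval_mem_polySpace le_rfl) x
  induction p using MvPolynomial.induction_on with
  | C a => simp
  | add p q hp hq =>
    simp only [map_add]
    rw [fderiv_fun_add (hd p) (hd q)]
    simp [hp, hq, mul_add, sum_add_distrib]
  | mul_X p i hp =>
    have hX : fderiv ℝ (fun x : Euc n => x i) x t = t i := by
      have : (fun x : Euc n => x i) = fun x => EuclideanSpace.proj (𝕜 := ℝ) i x := rfl
      rw [this, ContinuousLinearMap.fderiv]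
      rfl
    simp only [map_mul, MvPolynomial.eval_X, MvPolynomial.pderiv_mul, MvPolynomial.pderiv_X]
    rw [fderiv_fun_mul (hd p) (by fun_prop)]
    simp only [ContinuousLinearMap.add_apply, ContinuousLinearMap.smul_apply, smul_eq_mul, hp, hX,
      map_add, map_mul, MvPolynomial.eval_X]
    simp only [mul_add, sum_add_distrib, mul_sum]
    rw [add_comm]
    congr 1
    · exact sum_congr rfl fun j _ => by ring
    · rw [sum_eq_single i (fun j _ hj => by simp [Pi.single_apply, hj.symm]) (by simp)]
      simp
      ring

lemma totalDegree_pderiv_le (p : MvPolynomial (Fin n) ℝ) (j : Fin n) :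
    (MvPolynomial.pderiv j p).totalDegree ≤ p.totalDegree - 1 := by
  rw [p.as_sum, map_sum]
  refine (MvPolynomial.totalDegree_finsetSum _ _).trans (Finset.sup_le fun d hd => ?_)
  rw [MvPolynomial.pderiv_monomial, ← p.as_sum]
  by_cases h : d j = 0
  · simp [h]
  · refine (MvPolynomial.totalDegree_monomial_le _ _).trans ?_
    have h1 := MvPolynomial.le_totalDegree hd
    have h2 : d = (d - Finsupp.single j 1) + Finsupp.single j 1 := by
      ext i
      by_cases hi : i = j
      · subst hi; simp; omega
      · simp [Finsupp.single_apply, Ne.symm hi]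
    rw [h2, Finsupp.sum_add_index' (by simp) (by simp)] at h1
    simp at h1
    simp only [Function.id_def]
    omega

lemma polySpace_fderiv (hf : f ∈ polySpace n s) t :
    (fun x => fderiv ℝ f x t) ∈ polySpace n (s - 1) := by
  obtain ⟨p, hp, hf⟩ := hf
  have : f = fun x => eval (fun j => x j) p := funext hf
  subst this
  simp only [fderiv_eval]
  refine polySpace_sum _ fun j _ => ?_
  exact (polySpace n (s - 1)).smul_mem (t j) (eval_mem_polySpace
    ((totalDegree_pderiv_le p j).trans (Nat.sub_le_sub_right hp 1)))

lemma polySpace_fderiv_succ (hf : f ∈ polySpace n (s + 1)) t :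
    (fun x => fderiv ℝ f x t) ∈ polySpace n s := polySpace_fderiv hf t

lemma polySpace_locallyLipschitz (hf : f ∈ polySpace n s) : LocallyLipschitz f :=
  ((polySpace_contDiff hf).of_le (by simp)).locallyLipschitz

end PolySpace

/-! ### The reference simplex and affine parametrizations -/

/-- The linear map `ℝᵐ → ℝⁿ` with columns `c j`. -/
noncomputable def colMap {m n : ℕ} (c : Fin m → Euc n) : Euc m →ₗ[ℝ] Euc n where
  toFun y := ∑ j, y j • c j
  map_add' x y := by simp [add_smul, sum_add_distrib]
  map_smul' r x := by simp [mul_smul, Finset.smul_sum]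

/-- The reference simplex: the convex hull of the origin and the unit vectors. -/
def refSimplex (m : ℕ) : Set (Euc m) := {y | (∀ j, 0 ≤ y j) ∧ ∑ j, y j ≤ 1}

section Reference

variable {m n : ℕ}

lemma colMap_apply (c : Fin m → Euc n) (y : Euc m) : colMap c y = ∑ j, y j • c j := rfl

@[simp]
lemma colMap_single (c : Fin m → Euc n) (i : Fin m) :
    colMap c (EuclideanSpace.single i 1) = c i := by simp [colMap_apply]

lemma isClosed_refSimplex : IsClosed (refSimplex m) := by
  have : refSimplex m = (⋂ j, {y : Euc m | 0 ≤ y j}) ∩ {y | ∑ j, y j ≤ 1} := by aesop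
  rw [this]
  refine (isClosed_iInter fun j => isClosed_le continuous_const (by fun_prop)).inter
    (isClosed_le (by fun_prop) continuous_const)

lemma refSimplex_coord_le {y : Euc m} (hy : y ∈ refSimplex m) (j : Fin m) : y j ≤ 1 :=
  (single_le_sum (fun i _ => hy.1 i) (Finset.mem_univ j)).trans hy.2

lemma isCompact_refSimplex : IsCompact (refSimplex m) := by
  refine Metric.isCompact_of_isClosed_isBounded isClosed_refSimplex ?_
  refine (Metric.isBounded_iff_subset_closedBall 0).2 ⟨Real.sqrt m, fun y hy => ?_⟩
  rw [mem_closedBall_zero_iff, EuclideanSpace.norm_eq]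
  refine Real.sqrt_le_sqrt ?_
  calc ∑ i, ‖y i‖ ^ 2 ≤ ∑ _i : Fin m, (1 : ℝ) := sum_le_sum fun i _ => by
        rw [Real.norm_eq_abs, sq_abs]
        have := hy.1 i
        have := refSimplex_coord_le hy i
        nlinarith
    _ = m := by simp

lemma measurableSet_refSimplex : MeasurableSet (refSimplex m) := isClosed_refSimplex.measurableSet

lemma interior_refSimplex_nonempty : (interior (refSimplex m)).Nonempty := by
  let U : Set (Euc m) := (⋂ j, {y : Euc m | 0 < y j}) ∩ {y | ∑ j, y j < 1}
  have hU : IsOpen U := (isOpen_iInter_of_finite fun j =>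
    isOpen_lt continuous_const (by fun_prop)).inter (isOpen_lt (by fun_prop) continuous_const)
  have hsub : U ⊆ refSimplex m := fun y hy => by
    simp only [U, mem_inter_iff, mem_iInter, mem_setOf_eq] at hy
    exact ⟨fun j => (hy.1 j).le, hy.2.le⟩
  refine ⟨WithLp.toLp 2 fun _ => 1 / ((m : ℝ) + 1), interior_maximal hsub hU ?_⟩
  simp only [U, mem_inter_iff, mem_iInter, mem_setOf_eq]
  have hm : (0 : ℝ) < (m : ℝ) + 1 := by positivity
  refine ⟨fun j => by positivity, ?_⟩
  simp only [sum_const, card_univ, Fintype.card_fin, nsmul_eq_mul]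
  rw [mul_one_div, div_lt_one hm]
  linarith

lemma volume_refSimplex_pos : 0 < (volume : Measure (Euc m)).real (refSimplex m) := by
  refine ENNReal.toReal_pos ?_ isCompact_refSimplex.measure_lt_top.ne
  exact (lt_of_lt_of_le (isOpen_interior.measure_pos _ interior_refSimplex_nonempty)
    (measure_mono interior_subset)).ne'

/-- The affine image of the reference simplex is the simplex spanned by the images of its
vertices. -/
lemma image_refSimplex p (w : Fin m → Euc n) :
    (fun y => p + colMap (fun j => w j - p) y) '' refSimplex m =
      convexHull ℝ (insert p (range w)) := by
  have key : ∀ y : Euc m, p + colMap (fun j => w j - p) y =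
      (1 - ∑ j, y j) • p + ∑ j, y j • w j := fun y => by
    simp only [colMap_apply, smul_sub, sum_sub_distrib, sub_smul, one_smul, Finset.sum_smul]
    abel
  apply Subset.antisymm
  · rintro _ ⟨y, hy, rfl⟩
    simp only [key]
    have h := (convex_convexHull ℝ (insert p (range w))).sum_mem
      (t := Finset.univ) (w := fun o : Option (Fin m) => o.elim (1 - ∑ j, y j) (fun j => y j))
      (z := fun o : Option (Fin m) => o.elim p w) ?_ ?_ ?_
    · simp_all
    · rintro (_ | j) _
      · simpa using hy.2
      · exact hy.1 j
    · simp
    · rintro (_ | j) _ <;> apply subset_convexHull <;> simp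
  · refine convexHull_min ?_ ?_
    · rintro x (rfl | ⟨j, rfl⟩)
      · exact ⟨0, ⟨fun j => by simp, by simp⟩, by simp⟩
      · refine ⟨EuclideanSpace.single j 1, ⟨fun i => ?_, ?_⟩, by simp⟩
        · aesop
        · simp
    · rintro _ ⟨y, hy, rfl⟩ _ ⟨z, hz, rfl⟩ a b ha hb hab
      refine ⟨a • y + b • z, ⟨fun j => ?_, ?_⟩, ?_⟩
      · have := hy.1 j
        have := hz.1 j
        simp
        positivity
      · have h1 := mul_le_mul_of_nonneg_left hy.2 ha
        have h2 := mul_le_mul_of_nonneg_left hz.2 hb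
        simp [sum_add_distrib, ← mul_sum]
        linarith
      · obtain rfl : a = 1 - b := by linarith
        simp only [map_add, map_smul]
        module

/-- The surface measure on an affinely parametrized piece of an `m`-dimensional plane. -/
lemma hausdorff_restrict_image p (L : Euc m →ₗ[ℝ] Euc n) (hL : Function.Injective L)
    {S : Set (Euc m)} (hS : MeasurableSet S) :
    (Measure.euclideanHausdorffMeasure m : Measure (Euc n)).restrict ((fun y => p + L y) '' S) =
      ENNReal.ofReal L.normDet • Measure.map (fun y => p + L y) (volume.restrict S) := by
  have hc : Continuous fun y => p + L y :=
    continuous_const.add (LinearMap.continuous_of_finiteDimensional L)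
  have hinj : Function.Injective fun y => p + L y := fun a b h => hL (add_left_cancel h)
  ext A hA
  rw [Measure.restrict_apply hA, Measure.smul_apply, Measure.map_apply hc.measurable hA,
    Measure.restrict_apply (hc.measurable hA)]
  have h1 : A ∩ (fun y => p + L y) '' S =
      (fun z => p + z) '' (L '' ((fun y => p + L y) ⁻¹' A ∩ S)) := by
    ext x
    constructor
    · aesop
    · rintro ⟨_, ⟨y, ⟨hy1, hy2⟩, rfl⟩, rfl⟩
      aesop
  rw [h1, (isometry_add_left p).euclideanHausdorffMeasure_image]
  have := L.euclideanHausdorffMeasure_image_eq_normDet_mul_volume ((fun y => p + L y) ⁻¹' A ∩ S)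
  simp_all

lemma integral_hausdorff_image (p : Euc n) (L : Euc m →ₗ[ℝ] Euc n) (hL : Function.Injective L)
    {S : Set (Euc m)} (hS : MeasurableSet S) (g : Euc n → ℝ) :
    ∫ x in (fun y => p + L y) '' S, g x ∂(Measure.euclideanHausdorffMeasure m) =
      L.normDet * ∫ y in S, g (p + L y) := by
  have hc : Continuous fun y => p + L y :=
    continuous_const.add (LinearMap.continuous_of_finiteDimensional L)
  have hinj : Function.Injective fun y => p + L y := fun a b h => hL (add_left_cancel h)
  rw [hausdorff_restrict_image p L hL hS, integral_smul_measure,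
    (hc.measurableEmbedding hinj).integral_map, ENNReal.toReal_ofReal L.normDet_nonneg, smul_eq_mul]

/-- The volume factor of the linear map with columns `t, c₁, …, c_m` is the product of the surface
factor of `c₁, …, c_m` and of the component of `t` along the unit normal `N`. -/
lemma abs_det_colMap_cons {c : Fin m → Euc (m + 1)} (hc : LinearIndependent ℝ c)
    {N : Euc (m + 1)} (hN : ‖N‖ = 1) (hNc : ∀ j, inner ℝ N (c j) = (0 : ℝ)) (t : Euc (m + 1)) :
    |LinearMap.det (colMap (Fin.cons t c : Fin (m + 1) → Euc (m + 1)))| =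
      |inner ℝ N t| * (colMap c).normDet := by
  classical
  let e := (EuclideanSpace.basisFun (Fin (m + 1)) ℝ).toBasis
  have hdet : ∀ f : Fin (m + 1) → Euc (m + 1), LinearMap.det (colMap f) = e.det f := fun f => by
    rw [← LinearMap.det_toMatrix e, Module.Basis.det_apply]
    congr 1
    ext i j
    simp [LinearMap.toMatrix_apply, Module.Basis.toMatrix_apply, e]
  have hspan : t - (inner ℝ N t : ℝ) • N ∈ Submodule.span ℝ (range c) := by
    have hN0 : N ≠ 0 := by aesop
    have hle : Submodule.span ℝ (range c) ≤ (Submodule.span ℝ {N})ᗮ := by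
      rw [Submodule.span_le]
      rintro _ ⟨j, rfl⟩
      rw [SetLike.mem_coe, Submodule.mem_orthogonal_singleton_iff_inner_right]
      exact hNc j
    have heq : Submodule.span ℝ (range c) = (Submodule.span ℝ {N})ᗮ := by
      refine Submodule.eq_of_le_of_finrank_eq hle ?_
      haveI : Fact (Module.finrank ℝ (Euc (m + 1)) = m + 1) := ⟨by simp⟩
      rw [finrank_span_eq_card hc, Submodule.finrank_orthogonal_span_singleton (n := m) hN0]
      simp
    rw [heq, Submodule.mem_orthogonal_singleton_iff_inner_right]
    simp [inner_sub_right, inner_smul_right, hN]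
  obtain ⟨a, ha⟩ := (Submodule.mem_span_range_iff_exists_fun ℝ).1 hspan
  have ht : t = (inner ℝ N t : ℝ) • N + ∑ j, a j • c j := by simp_all
  have hcons : ∀ z : Euc (m + 1), (Fin.cons z c : Fin (m + 1) → Euc (m + 1)) =
      Function.update (Fin.cons N c) 0 z := by simp
  have h1 : e.det (Fin.cons t c : Fin (m + 1) → Euc (m + 1)) =
      (inner ℝ N t : ℝ) * e.det (Fin.cons N c : Fin (m + 1) → Euc (m + 1)) := by
    conv_lhs => rw [ht]
    rw [hcons, AlternatingMap.map_update_add, AlternatingMap.map_update_smul,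
      AlternatingMap.map_update_sum]
    rw [sum_eq_zero, add_zero, Function.update_eq_self_iff.2 (by simp), smul_eq_mul]
    intro j _
    rw [AlternatingMap.map_update_smul]
    have : c j = (Fin.cons N c : Fin (m + 1) → Euc (m + 1)) j.succ := by simp
    rw [this, AlternatingMap.map_update_self _ _ (Fin.succ_ne_zero j).symm, smul_zero]
  have h2 : |e.det (Fin.cons N c : Fin (m + 1) → Euc (m + 1))| = (colMap c).normDet := by
    rw [← hdet, ← LinearMap.normDet_eq_abs_det]
    have hg1 := LinearMap.normDet_sq_eq_det_gram (𝕜 := ℝ)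
      (colMap (Fin.cons N c : Fin (m + 1) → Euc (m + 1))) (EuclideanSpace.basisFun (Fin (m + 1)) ℝ)
    have hg2 := LinearMap.normDet_sq_eq_det_gram (𝕜 := ℝ) (colMap c)
      (EuclideanSpace.basisFun (Fin m) ℝ)
    simp only [EuclideanSpace.basisFun_apply, colMap_single] at hg1 hg2
    have hgram : (Matrix.gram ℝ (Fin.cons N c : Fin (m + 1) → Euc (m + 1))).det =
        (Matrix.gram ℝ c).det := by
      rw [Matrix.det_succ_row_zero, Fin.sum_univ_succ, sum_eq_zero]
      · simp [Matrix.gram, hN]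
        congr 1
      · intro j _
        simp [Matrix.gram, hNc]
    have : (colMap (Fin.cons N c : Fin (m + 1) → Euc (m + 1))).normDet ^ 2 =
        (colMap c).normDet ^ 2 := by
      have h3 := hg1.trans (hgram.trans hg2.symm)
      omega
    exact (sq_eq_sq₀ (LinearMap.normDet_nonneg _) (LinearMap.normDet_nonneg _)).1 this
  rw [hdet, h1, abs_mul, h2]

/-- Change of variables from a simplex to the reference simplex. -/
lemma setIntegral_affine_image (p : Euc n) (B : Euc n →ₗ[ℝ] Euc n) (hB : Function.Injective B)
    {S : Set (Euc n)} (hS : MeasurableSet S) (g : Euc n → ℝ) :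
    ∫ x in (fun y => p + B y) '' S, g x = |LinearMap.det B| * ∫ y in S, g (p + B y) := by
  have := integral_image_eq_integral_abs_det_fderiv_smul (volume : Measure (Euc n)) hS
    (f := fun y => p + B y) (f' := fun _ => LinearMap.toContinuousLinearMap B)
    (fun x _ => ((LinearMap.toContinuousLinearMap B).hasFDerivAt.const_add p).hasFDerivWithinAt)
    (fun a _ b _ h => hB (add_left_cancel h)) g
  rw [this, ← integral_const_mul]
  rfl

/-- Splitting off the first coordinate. -/
lemma measurePreserving_cons :
    MeasurePreserving (fun q : ℝ × Euc m => (WithLp.toLp 2 (Fin.cons q.1 q.2.ofLp) : Euc (m + 1)))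
      volume volume := by
  have h1 := (PiLp.volume_preserving_ofLp (Fin m))
  have h2 : MeasurePreserving (Prod.map id WithLp.ofLp : ℝ × Euc m → ℝ × (Fin m → ℝ))
      volume volume := (MeasurePreserving.id _).prod h1
  have h3 := (volume_preserving_piFinSuccAbove (fun _ : Fin (m + 1) => ℝ) 0).symm
  have h4 := (PiLp.volume_preserving_toLp (Fin (m + 1)))
  have := h4.comp (h3.comp h2)
  aesop

lemma measurableEmbedding_cons : MeasurableEmbedding
      (fun q : ℝ × Euc m => (WithLp.toLp 2 (Fin.cons q.1 q.2.ofLp) : Euc (m + 1))) := by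
  refine Continuous.measurableEmbedding ?_ ?_
  · fun_prop
  · rintro ⟨a, y⟩ ⟨b, z⟩ h
    aesop

end Reference

/-! ### Green's formula on a simplex -/

section Green

variable {m : ℕ}

/-- The divergence theorem on the reference simplex in the first coordinate direction. -/
lemma integral_refSimplex_lineDeriv {G : Euc (m + 1) → ℝ} {C : ℝ≥0} (hG : LipschitzWith C G) :
    ∫ x in refSimplex (m + 1), lineDeriv ℝ G x (EuclideanSpace.single 0 1) =
      ∫ y in refSimplex m, (G (WithLp.toLp 2 (Fin.cons (1 - ∑ j, y j) y.ofLp)) -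
        G (WithLp.toLp 2 (Fin.cons 0 y.ofLp))) := by
  set Φ : ℝ × Euc m → Euc (m + 1) := fun q => WithLp.toLp 2 (Fin.cons q.1 q.2.ofLp) with hΦ
  set e : Euc (m + 1) := EuclideanSpace.single 0 1 with he
  set F : Euc (m + 1) → ℝ := fun x => lineDeriv ℝ G x e with hF
  have hmem : ∀ r y, Φ (r, y) ∈ refSimplex (m + 1) ↔
      y ∈ refSimplex m ∧ r ∈ Icc 0 (1 - ∑ j, y j) := fun r y => by
    simp only [hΦ, refSimplex, mem_setOf_eq, Fin.forall_fin_succ, Fin.sum_univ_succ, Fin.cons_zero,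
      Fin.cons_succ, mem_Icc]
    bound
  have hFint : IntegrableOn F (refSimplex (m + 1)) := by
    refine Measure.integrableOn_of_bounded (M := C * ‖e‖) isCompact_refSimplex.measure_lt_top.ne
      (measurable_lineDeriv hG.continuous).aestronglyMeasurable ?_
    exact .of_forall fun x => norm_lineDeriv_le_of_lipschitz ℝ hG
  have hint : Integrable ((refSimplex (m + 1)).indicator F) :=
    (integrable_indicator_iff measurableSet_refSimplex).2 hFint
  rw [← integral_indicator measurableSet_refSimplex,
    ← measurePreserving_cons.integral_comp measurableEmbedding_cons, Measure.volume_eq_prod,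
    integral_prod_symm _ (by
      rw [← Measure.volume_eq_prod]
      exact (measurePreserving_cons.integrable_comp_emb measurableEmbedding_cons).2 hint),
    ← integral_indicator measurableSet_refSimplex]
  congr 1
  ext y
  by_cases hy : y ∈ refSimplex m
  · rw [indicator_of_mem hy]
    set γ : ℝ → ℝ := fun r => G (Φ (r, y)) with hγ
    have hadd : ∀ r τ : ℝ, Φ (r + τ, y) = Φ (r, y) + τ • e := fun r τ => by
      ext i
      refine Fin.cases ?_ (fun j => ?_) i
      · simp_all
      simp_all
    have hγL : LipschitzWith (C * ‖e‖₊) γ := by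
      refine LipschitzWith.of_dist_le_mul fun r r' => ?_
      have h1 := hG.dist_le_mul (Φ (r, y)) (Φ (r', y))
      have h2 : Φ (r, y) = Φ (r', y) + (r - r') • e := by rw [← hadd]; simp
      refine h1.trans ?_
      rw [h2, dist_eq_norm, add_sub_cancel_left, norm_smul, Real.dist_eq, Real.norm_eq_abs]
      simp_all
    have h0 : (0 : ℝ) ≤ 1 - ∑ j, y j := by have := hy.2; linarith
    have hind : (fun r => (refSimplex (m + 1)).indicator F (Φ (r, y))) =
        (Icc 0 (1 - ∑ j, y j)).indicator (deriv γ) := by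
      ext r
      by_cases hr : r ∈ Icc 0 (1 - ∑ j, y j)
      · rw [indicator_of_mem hr, indicator_of_mem ((hmem r y).2 ⟨hy, hr⟩)]
        simp only [hF, lineDeriv, ← hadd]
        have := deriv_comp_const_add (f := γ) r 0
        simp_all
      · rw [indicator_of_notMem hr, indicator_of_notMem fun h => hr ((hmem r y).1 h).2]
    calc ∫ r, (refSimplex (m + 1)).indicator F (Φ (r, y))
        = ∫ r in (0 : ℝ)..(1 - ∑ j, y j), deriv γ r := by
          rw [hind, integral_indicator measurableSet_Icc, integral_Icc_eq_integral_Ioc,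
            intervalIntegral.integral_of_le h0]
      _ = γ (1 - ∑ j, y j) - γ 0 :=
          (hγL.lipschitzOnWith.absolutelyContinuousOnInterval).integral_deriv_eq_sub
  simp_all

lemma colMap_injective {n : ℕ} {c : Fin m → Euc n} (hc : LinearIndependent ℝ c) :
    Function.Injective (colMap c) := by
  rw [← LinearMap.ker_eq_bot, LinearMap.ker_eq_bot']
  intro y hy
  ext i
  exact Fintype.linearIndependent_iff.1 hc (fun j => y j) hy i

lemma linearIndependent_sub_of_affineIndependent {n k : ℕ} {v : Fin (k + 1) → Euc n}
    (hv : AffineIndependent ℝ v) : LinearIndependent ℝ fun j : Fin k => v j.succ - v 0 := by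
  have h := (affineIndependent_iff_linearIndependent_vsub ℝ v 0).1 hv
  exact h.comp (fun j : Fin k => (⟨j.succ, Fin.succ_ne_zero j⟩ : {x // x ≠ (0 : Fin (k + 1))}))
    fun a b hab => Fin.succ_injective _ (congrArg Subtype.val hab)

lemma convexHull_eq_image {n k : ℕ} (v : Fin (k + 1) → Euc n) : convexHull ℝ (range v) =
      (fun y => v 0 + colMap (fun j => v j.succ - v 0) y) '' refSimplex k := by
  rw [image_refSimplex]
  congr 1
  ext x
  simp only [mem_range, mem_insert_iff, Fin.exists_fin_succ]
  tauto

lemma setIntegral_convexHull {v : Fin (m + 2) → Euc (m + 1)} (hv : AffineIndependent ℝ v)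
    (g : Euc (m + 1) → ℝ) :
    ∫ x in convexHull ℝ (range v), g x = |LinearMap.det (colMap fun j => v j.succ - v 0)| *
      ∫ y in refSimplex (m + 1), g (v 0 + colMap (fun j => v j.succ - v 0) y) := by
  rw [convexHull_eq_image, setIntegral_affine_image _ _
    (colMap_injective (linearIndependent_sub_of_affineIndependent hv)) measurableSet_refSimplex]

lemma lineDeriv_comp_affine {n k : ℕ} (g : Euc n → ℝ) (p : Euc n) (L : Euc k →ₗ[ℝ] Euc n)
    (y t : Euc k) : lineDeriv ℝ (fun y => g (p + L y)) y t = lineDeriv ℝ g (p + L y) (L t) := by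
  simp only [lineDeriv, map_add, map_smul, add_assoc]

lemma integral_lineDeriv_edge {v : Fin (m + 2) → Euc (m + 1)} (hv : AffineIndependent ℝ v)
    {g : Euc (m + 1) → ℝ} {C : ℝ≥0} (hg : LipschitzWith C g) :
    ∫ x in convexHull ℝ (range v), lineDeriv ℝ g x (v 1 - v 0) =
      |LinearMap.det (colMap fun j => v j.succ - v 0)| *
      ((∫ y in refSimplex m, g (v 1 + colMap (fun j => v j.succ.succ - v 1) y)) -
        ∫ y in refSimplex m, g (v 0 + colMap (fun j => v j.succ.succ - v 0) y)) := by
  set B := colMap fun j : Fin (m + 1) => v j.succ - v 0 with hB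
  have hBL : LipschitzWith (C * ‖LinearMap.toContinuousLinearMap B‖₊) fun y => g (v 0 + B y) := by
    refine hg.comp ?_
    have := (LinearMap.toContinuousLinearMap B).lipschitz
    refine LipschitzWith.of_dist_le_mul fun x y => ?_
    rw [dist_add_left]
    exact this.dist_le_mul x y
  have hcont : ∀ (p : Euc (m + 1)) (c : Fin m → Euc (m + 1)),
      IntegrableOn (fun y => g (p + colMap c y)) (refSimplex m) := fun p c =>
    (hg.continuous.comp (continuous_const.add
      (LinearMap.continuous_of_finiteDimensional _))).continuousOn.integrableOn_compact
      isCompact_refSimplex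
  rw [setIntegral_convexHull hv, ← hB, ← integral_sub (hcont _ _) (hcont _ _)]
  congr 1
  have h1 : ∀ y, lineDeriv ℝ g (v 0 + B y) (v 1 - v 0) =
      lineDeriv ℝ (fun y => g (v 0 + B y)) y (EuclideanSpace.single 0 1) := fun y => by
    rw [lineDeriv_comp_affine, hB, colMap_single]
    rfl
  simp only [h1]
  rw [integral_refSimplex_lineDeriv hBL]
  congr 1
  ext y
  congr 2
  · simp only [hB, colMap_apply, Fin.sum_univ_succ, Fin.cons_zero, Fin.cons_succ, Fin.succ_zero_eq_one,
      smul_sub, sum_sub_distrib, ← Finset.sum_smul, sub_smul, one_smul]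
    module
  · simp only [hB, colMap_apply, Fin.sum_univ_succ, Fin.cons_zero, Fin.cons_succ, zero_smul, zero_add]

/-- Surface integrals over the facet of a simplex that contains the vertex `v 0` but not the
vertex `v 1`. -/
lemma abs_inner_mul_integral_facet {v : Fin (m + 2) → Euc (m + 1)} (hv : AffineIndependent ℝ v)
    {N : Euc (m + 1)} (hN : ‖N‖ = 1)
    (hNv : ∀ j : Fin m, inner ℝ N (v j.succ.succ - v 0) = (0 : ℝ)) (g : Euc (m + 1) → ℝ) :
    |inner ℝ N (v 1 - v 0)| * ∫ x in convexHull ℝ (v '' {1}ᶜ), g x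
        ∂(Measure.euclideanHausdorffMeasure m) =
      |LinearMap.det (colMap fun j => v j.succ - v 0)| *
        ∫ y in refSimplex m, g (v 0 + colMap (fun j => v j.succ.succ - v 0) y) := by
  have hli := linearIndependent_sub_of_affineIndependent hv
  have hli' : LinearIndependent ℝ fun j : Fin m => v j.succ.succ - v 0 :=
    hli.comp (fun j : Fin m => j.succ) (Fin.succ_injective _)
  have himg : convexHull ℝ (v '' {1}ᶜ) =
      (fun y => v 0 + colMap (fun j : Fin m => v j.succ.succ - v 0) y) '' refSimplex m := by
    rw [image_refSimplex]
    congr 1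
    ext x
    simp only [mem_image, mem_compl_iff, mem_singleton_iff, Fin.exists_fin_succ, mem_insert_iff,
      mem_range]
    simp [Fin.ext_iff, eq_comm]
  have hcons : (fun j : Fin (m + 1) => v j.succ - v 0) =
      Fin.cons (v 1 - v 0) fun j : Fin m => v j.succ.succ - v 0 := by
    ext1 j
    refine Fin.cases ?_ (fun j => ?_) j <;> simp
  rw [himg, integral_hausdorff_image _ _ (colMap_injective hli') measurableSet_refSimplex, hcons,
    abs_det_colMap_cons hli' hN hNv, mul_assoc]

lemma abs_det_swap {v : Fin (m + 2) → Euc (m + 1)} (hv : AffineIndependent ℝ v) :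
    |LinearMap.det (colMap fun j : Fin (m + 1) => v (Equiv.swap 0 1 j.succ) - v (Equiv.swap 0 1 0))|
      = |LinearMap.det (colMap fun j : Fin (m + 1) => v j.succ - v 0)| := by
  have h1 := setIntegral_convexHull hv (fun _ => 1)
  have h2 := setIntegral_convexHull (v := v ∘ Equiv.swap 0 1)
    (hv.comp_embedding (Equiv.swap 0 1).toEmbedding) (fun _ => 1)
  rw [(Equiv.swap (0 : Fin (m + 2)) 1).surjective.range_comp, h1] at h2
  have hpos := volume_refSimplex_pos (m := m + 1)
  aesop

variable {ι : Type*} [Fintype ι]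

/-- The gradient of a barycentric coordinate. -/
noncomputable def baryGrad {n : ℕ} (b : AffineBasis ι ℝ (Euc n)) (i : ι) : Euc n :=
  (InnerProductSpace.toDual ℝ (Euc n)).symm (LinearMap.toContinuousLinearMap (b.coord i).linear)

/-- The outward unit normal on the facet opposite to the vertex `b i`. -/
noncomputable def outNormal {n : ℕ} (b : AffineBasis ι ℝ (Euc n)) (i : ι) : Euc n :=
  -(‖baryGrad b i‖⁻¹ • baryGrad b i)

/-- The facet opposite to the vertex `b i`. -/
def oppFacet {n : ℕ} (b : AffineBasis ι ℝ (Euc n)) (i : ι) : Set (Euc n) := convexHull ℝ (b '' {i}ᶜ)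

lemma inner_baryGrad {n : ℕ} (b : AffineBasis ι ℝ (Euc n)) (i : ι) t :
    inner ℝ (baryGrad b i) t = (b.coord i).linear t := by simp [baryGrad]

lemma linear_coord_sub {n : ℕ} (b : AffineBasis ι ℝ (Euc n)) (i : ι) (x y : Euc n) :
    (b.coord i).linear (x - y) = b.coord i x - b.coord i y := by
  have := (b.coord i).linearMap_vsub x y
  omega

lemma baryGrad_ne_zero [Nontrivial ι] {n : ℕ} (b : AffineBasis ι ℝ (Euc n)) (i : ι) :
    baryGrad b i ≠ 0 := by
  obtain ⟨j, hj⟩ := exists_ne i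
  intro h
  have := inner_baryGrad b i (b i - b j)
  rw [h, linear_coord_sub, b.coord_apply_eq, b.coord_apply_ne hj.symm] at this
  simp_all

lemma norm_outNormal [Nontrivial ι] {n : ℕ} (b : AffineBasis ι ℝ (Euc n)) (i : ι) :
    ‖outNormal b i‖ = 1 := by
  have := norm_ne_zero_iff.2 (baryGrad_ne_zero b i)
  rw [outNormal, norm_neg, norm_smul, norm_inv, norm_norm, inv_mul_cancel₀ this]

lemma inner_outNormal {n : ℕ} (b : AffineBasis ι ℝ (Euc n)) (i : ι) t :
    inner ℝ (outNormal b i) t = -(‖baryGrad b i‖⁻¹ * (b.coord i).linear t) := by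
  rw [outNormal, inner_neg_left, real_inner_smul_left, inner_baryGrad]

lemma green_edge (b : AffineBasis ι ℝ (Euc (m + 1))) {i j : ι} (hij : i ≠ j)
    {g : Euc (m + 1) → ℝ} {C : ℝ≥0} (hg : LipschitzWith C g) :
    ∫ x in convexHull ℝ (range b), lineDeriv ℝ g x (b i - b j) =
      ∑ k, inner ℝ (outNormal b k) (b i - b j) *
        ∫ x in oppFacet b k, g x ∂(Measure.euclideanHausdorffMeasure m) := by
  classical
  haveI : Nontrivial ι := ⟨i, j, hij⟩
  have hcard : Fintype.card ι = m + 2 := by rw [b.card_eq_finrank_add_one]; simp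
  obtain ⟨e, he0, he1⟩ : ∃ e : Fin (m + 2) ≃ ι, e 0 = j ∧ e 1 = i := by
    let e₀ := (Fintype.equivFinOfCardEq hcard).symm
    let e₁ := (Equiv.swap 0 (e₀.symm j)).trans e₀
    have h0 : e₁ 0 = j := by simp [e₁]
    refine ⟨(Equiv.swap 1 (e₁.symm i)).trans e₁, ?_, by simp⟩
    have hne : e₁.symm i ≠ 0 := fun h => hij (by rw [← h0, ← h]; simp)
    simp only [Equiv.trans_apply]
    rw [Equiv.swap_apply_of_ne_of_ne (by simp) (Ne.symm hne), h0]
  set v : Fin (m + 2) → Euc (m + 1) := b ∘ e with hv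
  have hvi : AffineIndependent ℝ v := b.ind.comp_embedding e.toEmbedding
  have hrange : range v = range b := by simp_all
  have hv0 : v 0 = b j := by simp_all
  have hv1 : v 1 = b i := by simp_all
  have hj : ∀ k : Fin m, e k.succ.succ ≠ j := by aesop
  have hi : ∀ k : Fin m, e k.succ.succ ≠ i := fun k h => by
    rw [← he1] at h
    exact Fin.succ_ne_zero _ (Fin.succ_injective _ (e.injective h))
  have himage : ∀ k : Fin (m + 2), v '' {k}ᶜ = b '' {e k}ᶜ := fun k => by
    rw [hv, image_comp]
    congr 1
    rw [image_compl_eq e.bijective, image_singleton]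
  -- the facet opposite to `b i`
  have hFi := abs_inner_mul_integral_facet hvi (norm_outNormal b i) (fun k => by
    rw [hv0, inner_outNormal, linear_coord_sub, hv, Function.comp_apply,
      b.coord_apply_ne (hi k).symm, b.coord_apply_ne hij]
    simp) g
  -- the facet opposite to `b j`
  have hFj := abs_inner_mul_integral_facet (v := v ∘ Equiv.swap 0 1)
    (hvi.comp_embedding (Equiv.swap 0 1).toEmbedding) (norm_outNormal b j) (fun k => by
    have h1 : Equiv.swap (0 : Fin (m + 2)) 1 k.succ.succ = k.succ.succ :=
      by rfl
    simp only [Function.comp_apply, h1, Equiv.swap_apply_left]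
    rw [hv1, inner_outNormal, linear_coord_sub, hv, Function.comp_apply,
      b.coord_apply_ne (hj k).symm, b.coord_apply_ne hij.symm]
    simp) g
  have hsw : ∀ k : Fin m, Equiv.swap (0 : Fin (m + 2)) 1 k.succ.succ = k.succ.succ := by bound
  have hdet := abs_det_swap hvi
  have hswimg : (v ∘ Equiv.swap 0 1) '' {1}ᶜ = v '' {0}ᶜ := by
    rw [image_comp]
    congr 1
    rw [image_compl_eq (Equiv.bijective _), image_singleton, Equiv.swap_apply_right]
  simp only [Function.comp_apply, hsw, Equiv.swap_apply_left, Equiv.swap_apply_right] at hFj hdet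
  rw [show (fun a => v (Equiv.swap 0 1 a)) = v ∘ Equiv.swap 0 1 from rfl, hswimg] at hFj
  rw [hdet, himage, he0] at hFj
  rw [himage, he1] at hFi
  rw [Finset.sum_eq_add i j hij _ (by simp) (by simp)]
  · rw [← hrange, ← hv0, ← hv1, integral_lineDeriv_edge hvi hg, mul_sub, ← hFi, ← hFj]
    have hci : inner ℝ (outNormal b i) (v 1 - v 0) = -‖baryGrad b i‖⁻¹ := by
      rw [hv0, hv1, inner_outNormal, linear_coord_sub, b.coord_apply_eq, b.coord_apply_ne hij]
      simp
    have hcj : inner ℝ (outNormal b j) (v 0 - v 1) = -‖baryGrad b j‖⁻¹ := by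
      rw [hv0, hv1, inner_outNormal, linear_coord_sub, b.coord_apply_eq, b.coord_apply_ne hij.symm]
      simp
    have hcj' : inner ℝ (outNormal b j) (v 1 - v 0) = ‖baryGrad b j‖⁻¹ := by
      rw [← neg_sub, inner_neg_right, hcj, neg_neg]
    rw [hci, hcj, hcj', abs_neg, abs_neg, abs_of_nonneg (by positivity), abs_of_nonneg
      (by positivity)]
    simp only [oppFacet]
    ring
  · rintro k - ⟨hki, hkj⟩
    rw [inner_outNormal, linear_coord_sub, b.coord_apply_ne hki, b.coord_apply_ne hkj]
    simp

end Green

section GreenGeneral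

variable {n : ℕ}

/-- The surface measure on `(n-1)`-dimensional subsets of `ℝⁿ`. -/
noncomputable abbrev surf (n : ℕ) : Measure (Euc n) := Measure.euclideanHausdorffMeasure (n - 1)

lemma LocallyLipschitz.mul_real {E : Type*} [PseudoEMetricSpace E] {f g : E → ℝ}
    (hf : LocallyLipschitz f) (hg : LocallyLipschitz g) : LocallyLipschitz fun x => f x * g x := by
  have h : LocallyLipschitz fun q : ℝ × ℝ => q.1 * q.2 :=
    (contDiff_fst.mul contDiff_snd : ContDiff ℝ 1 fun q : ℝ × ℝ => q.1 * q.2).locallyLipschitz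
  exact h.comp (hf.prodMk hg)

lemma LocallyLipschitz.add_real {E : Type*} [PseudoEMetricSpace E] {f g : E → ℝ}
    (hf : LocallyLipschitz f) (hg : LocallyLipschitz g) : LocallyLipschitz fun x => f x + g x := by
  have h : LocallyLipschitz fun q : ℝ × ℝ => q.1 + q.2 :=
    (contDiff_fst.add contDiff_snd : ContDiff ℝ 1 fun q : ℝ × ℝ => q.1 + q.2).locallyLipschitz
  exact h.comp (hf.prodMk hg)

lemma LocallyLipschitz.sum_real {E ι : Type*} [PseudoEMetricSpace E] (s : Finset ι)
    {f : ι → E → ℝ} (hf : ∀ i ∈ s, LocallyLipschitz (f i)) :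
    LocallyLipschitz fun x => ∑ i ∈ s, f i x := by
  classical
  induction s using Finset.induction_on with
  | empty => simpa using LocallyLipschitz.const (0 : ℝ)
  | insert i s hi ih =>
    simp only [Finset.sum_insert hi]
    exact (hf i (Finset.mem_insert_self _ _)).add_real
      (ih fun j hj => hf j (Finset.mem_insert_of_mem hj))

/-- A locally Lipschitz function agrees with a globally Lipschitz one near a given bounded set. -/
lemma LocallyLipschitz.exists_lipschitz {E : Type*} [NormedAddCommGroup E] [NormedSpace ℝ E]
    [FiniteDimensional ℝ E] {g : E → ℝ} (hg : LocallyLipschitz g)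
    {S : Set E} (hS : Bornology.IsBounded S) :
    ∃ (C : ℝ≥0) (g' : E → ℝ), LipschitzWith C g' ∧ ∀ x ∈ S, g =ᶠ[nhds x] g' := by
  obtain ⟨R, hR⟩ := hS.subset_ball 0
  obtain ⟨C, hC⟩ := (hg.locallyLipschitzOn (s := closedBall (0 : E) R)
    ).exists_lipschitzOnWith_of_compact (isCompact_closedBall _ _)
  obtain ⟨g', hg', heq⟩ := hC.extend_real
  refine ⟨C, g', hg', fun x hx => ?_⟩
  filter_upwards [Metric.isOpen_ball.mem_nhds (hR hx)] with y hy
  exact heq (Metric.ball_subset_closedBall hy)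

lemma LocallyLipschitz.ae_differentiableAt_real {E : Type*} [NormedAddCommGroup E]
    [NormedSpace ℝ E] [FiniteDimensional ℝ E] [MeasurableSpace E] [BorelSpace E] {μ : Measure E}
    [μ.IsAddHaarMeasure] {g : E → ℝ} (hg : LocallyLipschitz g) :
    ∀ᵐ x ∂μ, DifferentiableAt ℝ g x := by
  have h : ∀ k : ℕ, ∀ᵐ x ∂μ, x ∈ Metric.ball (0 : E) k → DifferentiableAt ℝ g x := fun k => by
    obtain ⟨C, g', hg', heq⟩ := hg.exists_lipschitz (Metric.isBounded_ball (x := (0 : E)) (r := k))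
    filter_upwards [hg'.ae_differentiableAt (μ := μ)] with x hx hxk
    exact (heq x hxk).differentiableAt_iff.2 hx
  filter_upwards [ae_all_iff.2 h] with x hx
  obtain ⟨k, hk⟩ := exists_nat_gt ‖x‖
  exact hx k (by simpa using hk)

lemma LocallyLipschitz.integrableOn_lineDeriv {g : Euc n → ℝ} (hg : LocallyLipschitz g)
    {S : Set (Euc n)} (hS : Bornology.IsBounded S) (hSm : MeasurableSet S) t :
    IntegrableOn (fun x => lineDeriv ℝ g x t) S := by
  obtain ⟨C, g', hg', heq⟩ := hg.exists_lipschitz hS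
  refine Measure.integrableOn_of_bounded (M := C * ‖t‖) hS.measure_lt_top.ne
    (measurable_lineDeriv hg.continuous).aestronglyMeasurable ?_
  refine ae_restrict_of_forall_mem hSm fun x hx => ?_
  rw [(heq x hx).lineDeriv_eq]
  exact norm_lineDeriv_le_of_lipschitz ℝ hg'

variable {ι : Type*} [Fintype ι]

lemma sum_linear_coord_smul (b : AffineBasis ι ℝ (Euc n)) (j : ι) t :
    ∑ i, (b.coord i).linear t • (b i - b j) = t := by
  have hl : ∀ i, (b.coord i).linear t = b.coord i t - b.coord i 0 := fun i => by
    rw [← linear_coord_sub, sub_zero]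
  have h1 := b.linear_combination_coord_eq_self t
  have h2 := b.linear_combination_coord_eq_self 0
  have h3 := b.sum_coord_apply_eq_one t
  have h4 := b.sum_coord_apply_eq_one 0
  simp only [hl, smul_sub, sum_sub_distrib, ← Finset.sum_smul, h3, h4, sub_smul, h1, h2]
  simp

/-- **Green's formula** on a simplex for locally Lipschitz functions. -/
theorem green (hn : 0 < n) (b : AffineBasis ι ℝ (Euc n)) {g : Euc n → ℝ} (hg : LocallyLipschitz g)
    t : ∫ x in convexHull ℝ (range b), lineDeriv ℝ g x t =
      ∑ k, inner ℝ (outNormal b k) t * ∫ x in oppFacet b k, g x ∂(surf n) := by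
  have hcpt : IsCompact (convexHull ℝ (range b)) := Set.Finite.isCompact_convexHull (𝕜 := ℝ) (finite_range b)
  obtain ⟨m, rfl⟩ : ∃ m, n = m + 1 := ⟨n - 1, by omega⟩
  obtain ⟨C, g', hg', heq⟩ := hg.exists_lipschitz hcpt.isBounded
  have hsub : ∀ k, oppFacet b k ⊆ convexHull ℝ (range b) := fun k =>
    convexHull_mono (image_subset_range _ _)
  have h1 : ∀ x ∈ convexHull ℝ (range b), lineDeriv ℝ g x t = lineDeriv ℝ g' x t := fun x hx =>
    (heq x hx).lineDeriv_eq
  rw [setIntegral_congr_fun hcpt.measurableSet h1]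
  have h2 : ∀ k, ∫ x in oppFacet b k, g x ∂(surf (m + 1)) =
      ∫ x in oppFacet b k, g' x ∂(surf (m + 1)) := fun k => by
    refine setIntegral_congr_fun ?_ fun x hx => (heq x (hsub k hx)).eq_of_nhds
    exact (Set.Finite.isCompact_convexHull (𝕜 := ℝ)
      ((finite_range b).subset (image_subset_range _ _))).measurableSet
  simp only [h2]
  obtain ⟨j⟩ : Nonempty ι := b.nonempty
  have hint : ∀ s, IntegrableOn (fun x => lineDeriv ℝ g' x s) (convexHull ℝ (range b)) := fun s =>
    hg'.locallyLipschitz.integrableOn_lineDeriv hcpt.isBounded hcpt.measurableSet s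
  have h3 : ∫ x in convexHull ℝ (range b), lineDeriv ℝ g' x t = ∑ i, (b.coord i).linear t *
        ∫ x in convexHull ℝ (range b), lineDeriv ℝ g' x (b i - b j) := by
    simp only [← integral_const_mul]
    rw [← integral_finset_sum _ fun i _ => (hint _).const_mul _]
    refine integral_congr_ae ?_
    filter_upwards [ae_restrict_of_ae hg'.ae_differentiableAt] with x hx
    simp only [hx.lineDeriv_eq_fderiv]
    conv_lhs => rw [← sum_linear_coord_smul b j t]
    simp [map_sum]
  have h4 : ∀ i, ∫ x in convexHull ℝ (range b), lineDeriv ℝ g' x (b i - b j) =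
      ∑ k, inner ℝ (outNormal b k) (b i - b j) * ∫ x in oppFacet b k, g' x ∂(surf (m + 1)) := by
    intro i
    by_cases hij : i = j
    · subst hij
      simp [lineDeriv]
    · exact green_edge b hij hg'
  rw [h3]
  simp only [h4, mul_sum]
  rw [sum_comm]
  refine sum_congr rfl fun k _ => ?_
  conv_rhs => rw [← sum_linear_coord_smul b j t]
  rw [inner_sum, sum_mul]
  refine sum_congr rfl fun i _ => ?_
  rw [real_inner_smul_right]
  ring

lemma convexHull_eq_nonneg (b : AffineBasis ι ℝ (Euc n)) :
    convexHull ℝ (range b) = {x | ∀ i, 0 ≤ b.coord i x} := b.convexHull_eq_nonneg_coord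

lemma mem_oppFacet_iff (b : AffineBasis ι ℝ (Euc n)) {i : ι} {x : Euc n} :
    x ∈ oppFacet b i ↔ x ∈ convexHull ℝ (range b) ∧ b.coord i x = 0 := by
  classical
  constructor
  · intro hx
    refine ⟨convexHull_mono (image_subset_range _ _) hx, ?_⟩
    have : convexHull ℝ (b '' {i}ᶜ) ⊆ {x | b.coord i x = 0} := by
      refine convexHull_min ?_ ?_
      · rintro _ ⟨j, hj, rfl⟩
        exact b.coord_apply_ne (Ne.symm hj)
      · exact (convex_singleton (0 : ℝ)).affine_preimage (b.coord i)
    exact this hx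
  · rintro ⟨hx, h0⟩
    rw [convexHull_eq_nonneg] at hx
    have h1 := b.sum_coord_apply_eq_one x
    have h2 := b.linear_combination_coord_eq_self x
    rw [← Finset.add_sum_erase _ _ (Finset.mem_univ i), h0, zero_add] at h1
    rw [← Finset.add_sum_erase _ _ (Finset.mem_univ i), h0, zero_smul, zero_add] at h2
    rw [← h2]
    refine (convex_convexHull ℝ _).sum_mem (fun j _ => hx j) h1 fun j hj => ?_
    exact subset_convexHull ℝ _ ⟨j, Finset.ne_of_mem_erase hj, rfl⟩

end GreenGeneral

/-! ### Simplices given by their vertex sets -/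

section Simplex

variable {n : ℕ}

/-- `K` is the vertex set of an `n`-dimensional simplex in `ℝⁿ`. -/
def IsNSimplex (K : Finset (Euc n)) : Prop := AffineIndependent ℝ ((↑) : K → Euc n) ∧ K.card = n + 1

/-- The vertices of an `n`-dimensional simplex, as an affine basis. -/
noncomputable def IsNSimplex.basis {K : Finset (Euc n)} (hK : IsNSimplex K) :
    AffineBasis K ℝ (Euc n) := ⟨(↑), hK.1, by
    rw [hK.1.affineSpan_eq_top_iff_card_eq_finrank_add_one]
    simp [hK.2]⟩

/-- The simplex with vertex set `K`. -/
abbrev hull (K : Finset (Euc n)) : Set (Euc n) := convexHull ℝ (K : Set (Euc n))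

lemma isCompact_hull (K : Finset (Euc n)) : IsCompact (hull K) :=
  Set.Finite.isCompact_convexHull (𝕜 := ℝ) K.finite_toSet

lemma measurableSet_hull (K : Finset (Euc n)) : MeasurableSet (hull K) :=
  (isCompact_hull K).measurableSet

lemma hull_mono {K L : Finset (Euc n)} (h : K ⊆ L) : hull K ⊆ hull L :=
  convexHull_mono (by exact_mod_cast h)

variable {K : Finset (Euc n)}

lemma IsNSimplex.range_basis (hK : IsNSimplex K) : range hK.basis = (K : Set (Euc n)) :=
  Subtype.range_coe

lemma IsNSimplex.basis_apply (hK : IsNSimplex K) (z : K) : hK.basis z = z := rfl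

lemma IsNSimplex.hull_eq (hK : IsNSimplex K) : hull K = convexHull ℝ (range hK.basis) := by
  rw [hK.range_basis]

open Classical in
lemma IsNSimplex.oppFacet_eq (hK : IsNSimplex K) (z : K) :
    oppFacet hK.basis z = hull (K.erase z) := by
  rw [oppFacet, hull]
  congr 1
  ext x
  simp only [mem_image, mem_compl_iff, mem_singleton_iff, Finset.coe_erase, mem_diff,
    SetLike.mem_coe, hK.basis_apply]
  constructor
  · rintro ⟨y, hy, rfl⟩
    exact ⟨y.2, fun h => hy (Subtype.ext h)⟩
  · rintro ⟨hx, hxz⟩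
    exact ⟨⟨x, hx⟩, fun h => hxz (congrArg Subtype.val h), rfl⟩

open Classical in
/-- The outward unit normal of the simplex `K` on its facet `f`. -/
noncomputable def facetNormal (K f : Finset (Euc n)) : Euc n :=
  if h : IsNSimplex K ∧ ∃ z : K, f = K.erase z then outNormal h.1.basis h.2.choose else 0

open Classical in
lemma facetNormal_erase (hK : IsNSimplex K) (z : K) :
    facetNormal K (K.erase z) = outNormal hK.basis z := by
  have h : IsNSimplex K ∧ ∃ z' : K, K.erase z = K.erase z' := ⟨hK, z, rfl⟩
  rw [facetNormal, dif_pos h]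
  congr 1
  have h2 := h.2.choose_spec
  by_contra hne
  have : (z : Euc n) ∈ K.erase (h.2.choose : Euc n) :=
    mem_erase.2 ⟨fun h3 => hne (Subtype.ext h3).symm, z.2⟩
  rw [← h2] at this
  exact notMem_erase _ _ this

open Classical in
lemma exists_eq_erase {f : Finset (Euc n)} (hK : IsNSimplex K) (hf : f ∈ K.powersetCard n) :
    ∃ z : K, f = K.erase z := by
  rw [mem_powersetCard] at hf
  have hc : (K \ f).card = 1 := by rw [Finset.card_sdiff_of_subset hf.1, hK.2, hf.2]; omega
  obtain ⟨z, hz⟩ := Finset.card_eq_one.1 hc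
  have hzK : z ∈ K \ f := by rw [hz]; simp
  refine ⟨⟨z, (Finset.mem_sdiff.1 hzK).1⟩, ?_⟩
  rw [Finset.erase_eq, ← hz, Finset.sdiff_sdiff_eq_self hf.1]

open Classical in
lemma erase_mem_powersetCard (hK : IsNSimplex K) (z : K) : K.erase z ∈ K.powersetCard n := by
  rw [mem_powersetCard]
  exact ⟨erase_subset _ _, by rw [Finset.card_erase_of_mem z.2, hK.2]; rfl⟩

open Classical in
lemma sum_facets (hK : IsNSimplex K) (Θ : Finset (Euc n) → ℝ) :
    ∑ f ∈ K.powersetCard n, Θ f = ∑ z : K, Θ (K.erase z) := by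
  symm
  refine Finset.sum_bij (fun z _ => K.erase z) (fun z _ => erase_mem_powersetCard hK z) ?_ ?_ ?_
  · intro z _ z' _ h
    by_contra hne
    have : (z : Euc n) ∈ K.erase (z' : Euc n) :=
      mem_erase.2 ⟨fun h3 => hne (Subtype.ext h3), z.2⟩
    rw [← h] at this
    exact notMem_erase _ _ this
  · intro f hf
    obtain ⟨z, rfl⟩ := exists_eq_erase hK hf
    exact ⟨z, Finset.mem_univ _, rfl⟩
  · intros; rfl

/-- Green's formula on a simplex, as a sum over the facets. -/
lemma IsNSimplex.green (hK : IsNSimplex K) (hn : 0 < n) {g : Euc n → ℝ} (hg : LocallyLipschitz g)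
    (t : Euc n) : ∫ x in hull K, lineDeriv ℝ g x t =
      ∑ f ∈ K.powersetCard n, inner ℝ (facetNormal K f) t * ∫ x in hull f, g x ∂(surf n) := by
  classical
  rw [hK.hull_eq, _root_.green hn hK.basis hg, sum_facets hK]
  refine sum_congr rfl fun z _ => ?_
  rw [facetNormal_erase hK, hK.oppFacet_eq]

lemma IsNSimplex.nontrivial (hK : IsNSimplex K) (hn : 0 < n) : Nontrivial K := by
  rw [← Fintype.one_lt_card_iff_nontrivial, Fintype.card_coe, hK.2]
  omega

lemma norm_facetNormal (hK : IsNSimplex K) (hn : 0 < n) {f : Finset (Euc n)}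
    (hf : f ∈ K.powersetCard n) : ‖facetNormal K f‖ = 1 := by
  classical
  obtain ⟨z, rfl⟩ := exists_eq_erase hK hf
  haveI := hK.nontrivial hn
  rw [facetNormal_erase hK, norm_outNormal]

lemma IsNSimplex.interior_hull (hK : IsNSimplex K) :
    interior (hull K) = {x | ∀ z, 0 < hK.basis.coord z x} := by
  rw [hK.hull_eq, AffineBasis.interior_convexHull]

lemma IsNSimplex.interior_nonempty (hK : IsNSimplex K) : (interior (hull K)).Nonempty := by
  rw [hull, interior_convexHull_nonempty_iff_affineSpan_eq_top, ← hK.range_basis]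
  exact hK.basis.tot

lemma convex_hull (K : Finset (Euc n)) : Convex ℝ (hull K) := convex_convexHull ℝ _

lemma volume_frontier_hull (K : Finset (Euc n)) : volume (frontier (hull K)) = 0 :=
  (convex_hull K).addHaar_frontier _

lemma interior_hull_ae_eq (K : Finset (Euc n)) : interior (hull K) =ᵐ[volume] hull K :=
  interior_ae_eq_of_null_frontier (volume_frontier_hull K)

lemma IsNSimplex.closure_interior (hK : IsNSimplex K) : closure (interior (hull K)) = hull K := by
  rw [(convex_hull K).closure_interior_eq_closure_of_nonempty_interior hK.interior_nonempty,
    (isCompact_hull K).isClosed.closure_eq]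

lemma IsNSimplex.volume_pos (hK : IsNSimplex K) : 0 < (volume : Measure (Euc n)).real (hull K) :=
  ENNReal.toReal_pos ((isOpen_interior.measure_pos _ hK.interior_nonempty).trans_le
    (measure_mono interior_subset)).ne' (isCompact_hull K).measure_lt_top.ne

/-- A facet is an affine image of the reference simplex. -/
lemma facet_param {f : Finset (Euc n)} (hf : AffineIndependent ℝ ((↑) : f → Euc n))
    (hn : 0 < n) (hc : f.card = n) :
    ∃ (p : Euc n) (L : Euc (n - 1) →ₗ[ℝ] Euc n), Function.Injective L ∧
      hull f = (fun y => p + L y) '' refSimplex (n - 1) := by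
  have hc' : Fintype.card f = (n - 1) + 1 := by rw [Fintype.card_coe, hc]; omega
  let e := (Fintype.equivFinOfCardEq hc').symm
  let v : Fin (n - 1 + 1) → Euc n := fun i => e i
  have hv : AffineIndependent ℝ v := hf.comp_embedding e.toEmbedding
  refine ⟨v 0, colMap fun j => v j.succ - v 0,
    colMap_injective (linearIndependent_sub_of_affineIndependent hv), ?_⟩
  rw [← convexHull_eq_image]
  have : range v = (f : Set (Euc n)) := by
    have : v = (fun x : f => (x : Euc n)) ∘ e := rfl
    rw [this, e.surjective.range_comp]
    exact Subtype.range_coe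
  rw [this]

lemma surf_hull_lt_top {f : Finset (Euc n)} (hf : AffineIndependent ℝ ((↑) : f → Euc n))
    (hn : 0 < n) (hc : f.card = n) : surf n (hull f) < (⊤ : ℝ≥0∞) := by
  obtain ⟨p, L, hL, himg⟩ := facet_param hf hn hc
  have h := congrArg (fun μ => μ univ)
    (hausdorff_restrict_image p L hL (measurableSet_refSimplex (m := n - 1)))
  simp only [Measure.restrict_apply MeasurableSet.univ, univ_inter, Measure.smul_apply] at h
  rw [himg, surf, h]
  have hc : Continuous fun y => p + L y :=
    continuous_const.add (LinearMap.continuous_of_finiteDimensional L)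
  rw [Measure.map_apply hc.measurable MeasurableSet.univ, preimage_univ,
    Measure.restrict_apply MeasurableSet.univ, univ_inter, smul_eq_mul]
  exact ENNReal.mul_lt_top ENNReal.ofReal_lt_top isCompact_refSimplex.measure_lt_top

/-- Relatively open nonempty parts of a facet have positive surface measure. -/
lemma surf_hull_inter_pos {f : Finset (Euc n)} (hf : AffineIndependent ℝ ((↑) : f → Euc n))
    (hn : 0 < n) (hc : f.card = n) {U : Set (Euc n)} (hU : IsOpen U) (hne : (hull f ∩ U).Nonempty) :
    0 < surf n (hull f ∩ U) := by
  obtain ⟨p, L, hL, himg⟩ := facet_param hf hn hc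
  have h := congrArg (fun μ => μ U)
    (hausdorff_restrict_image p L hL (measurableSet_refSimplex (m := n - 1)))
  simp only [Measure.restrict_apply hU.measurableSet, Measure.smul_apply] at h
  have hc : Continuous fun y => p + L y :=
    continuous_const.add (LinearMap.continuous_of_finiteDimensional L)
  rw [inter_comm, himg, surf, h, Measure.map_apply hc.measurable hU.measurableSet,
    Measure.restrict_apply (hc.measurable hU.measurableSet), smul_eq_mul]
  refine ENNReal.mul_pos ?_ ?_
  · have : L.normDet ≠ 0 := by
      rw [Ne, LinearMap.normDet_eq_zero_iff_ker_ne_bot, not_not]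
      exact LinearMap.ker_eq_bot.2 hL
    simpa using lt_of_le_of_ne L.normDet_nonneg this.symm
  · obtain ⟨x, hx, hxU⟩ := hne
    rw [himg] at hx
    obtain ⟨y, hy, rfl⟩ := hx
    have hcl : y ∈ closure (interior (refSimplex (n - 1))) := by
      have hconv : Convex ℝ (refSimplex (n - 1)) := by
        intro a ha b hb r s hr hs hrs
        refine ⟨fun j => ?_, ?_⟩
        · have := ha.1 j
          have := hb.1 j
          simp
          positivity
        · have h1 := mul_le_mul_of_nonneg_left ha.2 hr
          have h2 := mul_le_mul_of_nonneg_left hb.2 hs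
          simp [sum_add_distrib, ← mul_sum]
          linarith
      rw [hconv.closure_interior_eq_closure_of_nonempty_interior interior_refSimplex_nonempty]
      exact subset_closure hy
    obtain ⟨z, hz1, hz2⟩ := mem_closure_iff.1 hcl _ (hU.preimage hc) hxU
    exact ((((hU.preimage hc).inter isOpen_interior).measure_pos volume ⟨z, hz1, hz2⟩).trans_le
      (measure_mono (inter_subset_inter_right _ interior_subset))).ne'

end Simplex

section RelFace

variable {n : ℕ} {K f : Finset (Euc n)}

lemma affine_sum {ι : Type*} (l : Euc n →ᵃ[ℝ] ℝ) (s : Finset ι) (w : ι → ℝ) (p : ι → Euc n)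
    (hw : ∑ v ∈ s, w v = 1) : l (∑ v ∈ s, w v • p v) = ∑ v ∈ s, w v * l (p v) := by
  have h : ∀ x, l x = l.linear x + l 0 := fun x => congrFun l.decomp x
  rw [h, map_sum]
  simp only [map_smul, smul_eq_mul, h (p _), mul_add, sum_add_distrib, ← sum_mul, hw,
    one_mul]

open Classical in
lemma coord_combo (hK : IsNSimplex K) (hf : f ⊆ K) {w : Euc n → ℝ} (hw : ∑ v ∈ f, w v = 1) (z : K) :
    hK.basis.coord z (∑ v ∈ f, w v • v) = if (z : Euc n) ∈ f then w z else 0 := by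
  rw [affine_sum _ _ _ _ hw]
  have : ∀ v ∈ f, w v * hK.basis.coord z v = if v = z then w z else 0 := fun v hv => by
    split_ifs with h
    · subst h
      have := hK.basis.coord_apply_eq z
      rw [hK.basis_apply] at this
      rw [this, mul_one]
    · have hne : z ≠ ⟨v, hf hv⟩ := fun h' => h (by rw [h'])
      have := hK.basis.coord_apply_ne hne
      rw [hK.basis_apply] at this
      rw [this, mul_zero]
  rw [sum_congr rfl this, Finset.sum_ite_eq']

lemma coord_eq_zero_of_mem_hull (hK : IsNSimplex K) (hf : f ⊆ K) {y : Euc n} (hy : y ∈ hull f)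
    (z : K) (hz : (z : Euc n) ∉ f) : hK.basis.coord z y = 0 := by
  classical
  obtain ⟨w, -, h1, rfl⟩ := Finset.mem_convexHull'.1 hy
  rw [coord_combo hK hf h1, if_neg hz]

lemma IsNSimplex.mem_hull_iff (hK : IsNSimplex K) {y : Euc n} :
    y ∈ hull K ↔ ∀ z, 0 ≤ hK.basis.coord z y := by rw [hK.hull_eq, convexHull_eq_nonneg]; rfl

/-- The relative interior of the simplex with vertex set `f`. -/
def relFace (f : Finset (Euc n)) : Set (Euc n) :=
  {y | ∃ w : Euc n → ℝ, (∀ v ∈ f, 0 < w v) ∧ ∑ v ∈ f, w v = 1 ∧ ∑ v ∈ f, w v • v = y}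

lemma relFace_subset : relFace f ⊆ hull f := by
  rintro y ⟨w, h0, h1, h2⟩
  exact Finset.mem_convexHull'.2 ⟨w, fun v hv => (h0 v hv).le, h1, h2⟩

lemma relFace_coord_pos (hK : IsNSimplex K) (hf : f ⊆ K) {y : Euc n} (hy : y ∈ relFace f) (z : K)
    (hz : (z : Euc n) ∈ f) : 0 < hK.basis.coord z y := by
  classical
  obtain ⟨w, h0, h1, rfl⟩ := hy
  rw [coord_combo hK hf h1, if_pos hz]
  exact h0 _ hz

lemma subset_of_relFace (hK : IsNSimplex K) (hf : f ⊆ K) {g : Finset (Euc n)} (hg : g ⊆ K)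
    {y : Euc n} (hy : y ∈ relFace f) (hyg : y ∈ hull g) : f ⊆ g := by
  intro v hv
  by_contra hvg
  have h1 := relFace_coord_pos hK hf hy ⟨v, hf hv⟩ hv
  rw [coord_eq_zero_of_mem_hull hK hg hyg ⟨v, hf hv⟩ hvg] at h1
  exact lt_irrefl _ h1

lemma hull_subset_closure_relFace (hf : f.Nonempty) : hull f ⊆ closure (relFace f) := by
  intro x hx
  obtain ⟨w, h0, h1, rfl⟩ := Finset.mem_convexHull'.1 hx
  have hc : (0 : ℝ) < f.card := by exact_mod_cast hf.card_pos
  refine mem_closure_of_tendsto (b := nhdsWithin (0 : ℝ) (Ioi 0))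
    (f := fun ε : ℝ => ∑ v ∈ f, ((1 - ε) * w v + ε * (f.card : ℝ)⁻¹) • v) ?_ ?_
  · have hcont : Continuous fun ε : ℝ => ∑ v ∈ f, ((1 - ε) * w v + ε * (f.card : ℝ)⁻¹) • v := by
      fun_prop
    have := hcont.tendsto 0
    simp only [sub_zero, one_mul, zero_mul, add_zero] at this
    exact this.mono_left nhdsWithin_le_nhds
  · have h2 : ∀ᶠ ε : ℝ in nhdsWithin (0 : ℝ) (Ioi 0), ε < 1 :=
      (eventually_lt_nhds one_pos).filter_mono nhdsWithin_le_nhds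
    filter_upwards [h2, self_mem_nhdsWithin] with ε hε1 hε0
    refine ⟨fun v => (1 - ε) * w v + ε * (f.card : ℝ)⁻¹, fun v hv => ?_, ?_, rfl⟩
    · have h3 : 0 ≤ (1 - ε) * w v := mul_nonneg (by linarith) (h0 v hv)
      have h4 : 0 < ε * (f.card : ℝ)⁻¹ := mul_pos hε0 (inv_pos.2 hc)
      linarith
    · rw [sum_add_distrib, ← mul_sum, h1, sum_const, nsmul_eq_mul]
      field_simp
      ring

lemma eq_on_hull_of_relFace {X : Type*} [TopologicalSpace X] [T2Space X] (hf : f.Nonempty)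
    {φ ψ : Euc n → X} (hφ : Continuous φ) (hψ : Continuous ψ) (h : ∀ y ∈ relFace f, φ y = ψ y) :
    ∀ y ∈ hull f, φ y = ψ y := fun _ hy =>
  closure_minimal h (isClosed_eq hφ hψ) (hull_subset_closure_relFace hf hy)

open Classical in
lemma coord_eq_neg_inner (hK : IsNSimplex K) (hn : 0 < n) (z : K) x {y : Euc n}
    (hy : y ∈ hull (K.erase z)) : hK.basis.coord z x =
      -(‖baryGrad hK.basis z‖ * inner ℝ (facetNormal K (K.erase z)) (x - y)) := by
  haveI := hK.nontrivial hn
  have h0 := norm_ne_zero_iff.2 (baryGrad_ne_zero hK.basis z)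
  have hyz := coord_eq_zero_of_mem_hull hK (erase_subset _ _) hy z (notMem_erase _ _)
  rw [facetNormal_erase hK, inner_outNormal, linear_coord_sub, hyz]
  field_simp
  ring

lemma inner_facetNormal_eq_zero (hK : IsNSimplex K) (hn : 0 < n) (hf : f ∈ K.powersetCard n)
    {x y : Euc n} (hx : x ∈ hull f) (hy : y ∈ hull f) : inner ℝ (facetNormal K f) (x - y) = 0 := by
  classical
  obtain ⟨z, rfl⟩ := exists_eq_erase hK hf
  haveI := hK.nontrivial hn
  have h0 := norm_ne_zero_iff.2 (baryGrad_ne_zero hK.basis z)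
  have h1 := coord_eq_neg_inner hK hn z x hy
  rw [coord_eq_zero_of_mem_hull hK (erase_subset _ _) hx z (notMem_erase _ _)] at h1
  simpa [h0] using h1

lemma inner_facetNormal_nonpos (hK : IsNSimplex K) (hn : 0 < n) (hf : f ∈ K.powersetCard n)
    {x y : Euc n} (hx : x ∈ hull K) (hy : y ∈ hull f) : inner ℝ (facetNormal K f) (x - y) ≤ 0 := by
  classical
  obtain ⟨z, rfl⟩ := exists_eq_erase hK hf
  haveI := hK.nontrivial hn
  have h0 := norm_pos_iff.2 (baryGrad_ne_zero hK.basis z)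
  have h1 := coord_eq_neg_inner hK hn z x hy
  have h2 := hK.mem_hull_iff.1 hx z
  nlinarith

lemma inner_facetNormal_vertex_neg (hK : IsNSimplex K) (hn : 0 < n) (hf : f ∈ K.powersetCard n)
    {y : Euc n} (hy : y ∈ hull f) : ∃ z ∈ K, inner ℝ (facetNormal K f) (z - y) < 0 := by
  classical
  obtain ⟨z, rfl⟩ := exists_eq_erase hK hf
  haveI := hK.nontrivial hn
  refine ⟨z, z.2, ?_⟩
  have h0 := norm_pos_iff.2 (baryGrad_ne_zero hK.basis z)
  have h1 := coord_eq_neg_inner hK hn z z hy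
  have h2 := hK.basis.coord_apply_eq z
  rw [hK.basis_apply] at h2
  nlinarith

/-- Near a relative interior point of a facet, the simplex is a half space. -/
lemma eventually_mem_hull (hK : IsNSimplex K) (hn : 0 < n) (hf : f ∈ K.powersetCard n)
    {y : Euc n} (hy : y ∈ relFace f) : ∀ᶠ x in nhds y,
      (inner ℝ (facetNormal K f) (x - y) ≤ 0 → x ∈ hull K) ∧
      (inner ℝ (facetNormal K f) (x - y) < 0 → x ∈ interior (hull K)) := by
  classical
  obtain ⟨z, rfl⟩ := exists_eq_erase hK hf
  haveI := hK.nontrivial hn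
  have h0 := norm_pos_iff.2 (baryGrad_ne_zero hK.basis z)
  have h1 : ∀ v : K, v ≠ z → ∀ᶠ x in nhds y, 0 < hK.basis.coord v x := fun v hv => by
    have hvf : (v : Euc n) ∈ K.erase z.1 :=
      mem_erase.2 ⟨fun h => hv (Subtype.ext h), v.2⟩
    have hpos := relFace_coord_pos hK (erase_subset _ _) hy v hvf
    have hc : Continuous (hK.basis.coord v) := AffineMap.continuous_of_finiteDimensional _
    exact hc.continuousAt.eventually (lt_mem_nhds hpos)
  have h2 : ∀ᶠ x in nhds y, ∀ v : K, v ≠ z → 0 < hK.basis.coord v x := by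
    rw [Filter.eventually_all]
    intro v
    by_cases hv : v = z
    · exact .of_forall fun x h => absurd hv h
    · filter_upwards [h1 v hv] with x hx _ using hx
  filter_upwards [h2] with x hx
  have h3 := coord_eq_neg_inner hK hn z x (relFace_subset hy)
  rw [hK.mem_hull_iff, hK.interior_hull]
  refine ⟨fun h v => ?_, fun h v => ?_⟩
  · rcases eq_or_ne v z with rfl | hv
    · nlinarith
    · exact (hx v hv).le
  · rcases eq_or_ne v z with rfl | hv
    · nlinarith
    · exact hx v hv

lemma unit_normal_unique (hK : IsNSimplex K) (hn : 0 < n) (hf : f ∈ K.powersetCard n) {ν : Euc n}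
    (hν : ‖ν‖ = 1) (h : ∀ x ∈ f, ∀ y ∈ f, inner ℝ ν (y - x) = 0) :
    ν = facetNormal K f ∨ ν = -facetNormal K f := by
  classical
  have hcard := (mem_powersetCard.1 hf)
  obtain ⟨z, rfl⟩ := exists_eq_erase hK hf
  haveI := hK.nontrivial hn
  obtain ⟨j, hj⟩ : (K.erase z).Nonempty := by rw [← Finset.card_pos, hcard.2]; exact hn
  have hjK : j ∈ K := Finset.mem_of_mem_erase hj
  set c : ℝ := inner ℝ ν (z - j) with hc
  have h1 : ν = c • baryGrad hK.basis z := by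
    refine ext_inner_right ℝ fun t => ?_
    rw [real_inner_smul_left, inner_baryGrad]
    conv_lhs => rw [← sum_linear_coord_smul hK.basis ⟨j, hjK⟩ t]
    rw [inner_sum, sum_eq_single z]
    · rw [real_inner_smul_right, mul_comm]; rfl
    · intro v _ hv
      rw [real_inner_smul_right]
      have := h j hj v (mem_erase.2 ⟨fun h => hv (Subtype.ext h), v.2⟩)
      simp only [hK.basis_apply]
      rw [this, mul_zero]
    · simp
  have hg := norm_pos_iff.2 (baryGrad_ne_zero hK.basis z)
  have h2 : |c| = ‖baryGrad hK.basis z‖⁻¹ := by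
    have h3 := hν
    rw [h1, norm_smul, Real.norm_eq_abs] at h3
    exact eq_inv_of_mul_eq_one_left h3
  rw [facetNormal_erase hK, outNormal, neg_neg, h1]
  rcases abs_eq_abs.1 (h2.trans (abs_of_pos (inv_pos.2 hg)).symm) with h3 | h3
  · right; rw [h3]
  · left; rw [h3, neg_smul]

end RelFace

namespace Triangulation

variable {n : ℕ} {Ω : Set (Euc n)} (𝒯 : Triangulation Ω)

lemma mem_cells {K : Finset (Euc n)} : K ∈ 𝒯.cells ↔ K ∈ 𝒯.complex.faces ∧ K.card = n + 1 := by
  simp [cells]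

lemma cell_simplex {K : Finset (Euc n)} (hK : K ∈ 𝒯.cells) : IsNSimplex K :=
  ⟨𝒯.complex.indep (𝒯.mem_cells.1 hK).1, (𝒯.mem_cells.1 hK).2⟩

lemma hull_cell_subset {K : Finset (Euc n)} (hK : K ∈ 𝒯.cells) : hull K ⊆ closure Ω := by
  rw [← 𝒯.space_eq]
  exact 𝒯.complex.convexHull_subset_space (𝒯.mem_cells.1 hK).1

lemma interior_cell_subset (hΩ : interior (closure Ω) = Ω) {K : Finset (Euc n)}
    (hK : K ∈ 𝒯.cells) : interior (hull K) ⊆ Ω := by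
  rw [← hΩ]
  exact interior_mono (𝒯.hull_cell_subset hK)

open Classical in
lemma hull_inter {K L : Finset (Euc n)} (hK : K ∈ 𝒯.cells) (hL : L ∈ 𝒯.cells) :
    hull K ∩ hull L ⊆ hull (K ∩ L) := by
  have := 𝒯.complex.inter_subset_convexHull (𝒯.mem_cells.1 hK).1 (𝒯.mem_cells.1 hL).1
  rwa [← Finset.coe_inter] at this

lemma interior_inter_hull {K L : Finset (Euc n)} (hK : K ∈ 𝒯.cells) (hL : L ∈ 𝒯.cells)
    (hne : K ≠ L) : Disjoint (interior (hull K)) (hull L) := by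
  classical
  rw [Set.disjoint_left]
  intro x hxK hxL
  have hx := 𝒯.hull_inter hK hL ⟨interior_subset hxK, hxL⟩
  have hKs := 𝒯.cell_simplex hK
  have hsub : ¬ K ⊆ L := fun h => hne (Finset.eq_of_subset_of_card_le h
    (by rw [(𝒯.mem_cells.1 hK).2, (𝒯.mem_cells.1 hL).2]))
  obtain ⟨v, hvK, hvL⟩ := Finset.not_subset.1 hsub
  rw [hKs.interior_hull] at hxK
  have h1 := hxK ⟨v, hvK⟩
  rw [coord_eq_zero_of_mem_hull hKs Finset.inter_subset_left hx ⟨v, hvK⟩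
    (fun h => hvL (Finset.mem_inter.1 h).2)] at h1
  exact lt_irrefl _ h1

lemma disjoint_interior {K L : Finset (Euc n)} (hK : K ∈ 𝒯.cells) (hL : L ∈ 𝒯.cells)
    (hne : K ≠ L) : Disjoint (interior (hull K)) (interior (hull L)) :=
  (𝒯.interior_inter_hull hK hL hne).mono_right interior_subset

/-- Up to a null set, `Ω` is the disjoint union of the cells. -/
lemma restrict_eq_sum (hΩ : interior (closure Ω) = Ω) :
    (volume.restrict Ω : Measure (Euc n)) = ∑ K ∈ 𝒯.cells, volume.restrict (hull K) := by
  have h1 : Ω =ᵐ[volume] ⋃ K ∈ 𝒯.cells, interior (hull K) := by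
    refine Filter.EventuallyLE.antisymm ?_ (HasSubset.Subset.eventuallyLE
      (iUnion₂_subset fun K hK => 𝒯.interior_cell_subset hΩ hK))
    have hnull : ∀ g ∈ 𝒯.complex.faces, ∀ᵐ x ∂(volume : Measure (Euc n)),
        x ∈ hull g → x ∈ ⋃ K ∈ 𝒯.cells, interior (hull K) := by
      intro g hg
      by_cases hc : g.card = n + 1
      · filter_upwards [(interior_hull_ae_eq g).symm.le] with x hx hxg
        exact mem_iUnion₂.2 ⟨g, 𝒯.mem_cells.2 ⟨hg, hc⟩, hx hxg⟩
      · have hne : affineSpan ℝ (g : Set (Euc n)) ≠ ⊤ := by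
          intro h
          have hi := 𝒯.complex.indep hg
          have := hi.affineSpan_eq_top_iff_card_eq_finrank_add_one.1 (by
            have h2 : range ((↑) : g → Euc n) = (g : Set (Euc n)) := Subtype.range_coe
            rw [h2]; exact h)
          rw [Fintype.card_coe, finrank_euclideanSpace_fin] at this
          exact hc this
        have hz := Measure.addHaar_affineSubspace (volume : Measure (Euc n)) _ hne
        have h3 : ∀ᵐ x ∂(volume : Measure (Euc n)), x ∉ (affineSpan ℝ (g : Set (Euc n)) : Set _) :=
          measure_eq_zero_iff_ae_notMem.1 hz
        filter_upwards [h3] with x hx hxg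
        exact absurd (convexHull_subset_affineSpan _ hxg) hx
    filter_upwards [(ae_ball_iff 𝒯.finite.countable).2 hnull] with x hx hxΩ
    have : x ∈ 𝒯.complex.space := by rw [𝒯.space_eq]; exact subset_closure hxΩ
    obtain ⟨g, hg, hxg⟩ := 𝒯.complex.mem_space_iff.1 this
    exact hx g hg hxg
  rw [Measure.restrict_congr_set h1, Measure.restrict_biUnion_finset
    (fun K hK L hL hne => 𝒯.disjoint_interior hK hL hne) (fun K => isOpen_interior.measurableSet),
    Measure.sum_fintype]
  rw [sum_coe_sort 𝒯.cells fun K => volume.restrict (interior (hull K))]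
  exact sum_congr rfl fun K _ => Measure.restrict_congr_set (interior_hull_ae_eq K)

lemma setIntegral_eq_sum (hΩ : interior (closure Ω) = Ω) {G : Euc n → ℝ}
    (hG : ∀ K ∈ 𝒯.cells, IntegrableOn G (hull K)) :
    ∫ x in Ω, G x = ∑ K ∈ 𝒯.cells, ∫ x in hull K, G x := by
  rw [𝒯.restrict_eq_sum hΩ, integral_finset_sum_measure hG]

lemma mem_faces_of_facet (hn : 0 < n) {K f : Finset (Euc n)} (hK : K ∈ 𝒯.cells)
    (hf : f ∈ K.powersetCard n) : f ∈ 𝒯.complex.faces := by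
  rw [mem_powersetCard] at hf
  exact 𝒯.complex.down_closed (𝒯.mem_cells.1 hK).1 hf.1 (by rw [← Finset.card_pos]; omega)

/-- A relative interior point of a face lies only in those faces that contain it. -/
lemma face_subset_of_relFace (hn : 0 < n) {K f g : Finset (Euc n)} (hK : K ∈ 𝒯.cells)
    (hf : f ∈ K.powersetCard n) (hg : g ∈ 𝒯.complex.faces) {y : Euc n} (hy : y ∈ relFace f)
    (hyg : y ∈ hull g) : f ⊆ g := by
  classical
  have h := 𝒯.complex.inter_subset_convexHull (𝒯.mem_faces_of_facet hn hK hf) hg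
    ⟨relFace_subset hy, hyg⟩
  rw [← Finset.coe_inter] at h
  have hfK := (mem_powersetCard.1 hf).1
  exact (subset_of_relFace (𝒯.cell_simplex hK) hfK (Finset.inter_subset_left.trans hfK) hy h).trans
    Finset.inter_subset_right

lemma facet_nonempty (hn : 0 < n) {K f : Finset (Euc n)} (hf : f ∈ K.powersetCard n) :
    f.Nonempty := by
  rw [mem_powersetCard] at hf
  rw [← Finset.card_pos]; omega

lemma relFace_nonempty (hn : 0 < n) {K f : Finset (Euc n)} (hf : f ∈ K.powersetCard n) :
    (relFace f).Nonempty := by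
  have hne := facet_nonempty hn hf
  have : (hull f).Nonempty := (Finset.coe_nonempty.2 hne).mono (subset_convexHull ℝ _)
  exact closure_nonempty_iff.1 (this.mono (hull_subset_closure_relFace hne))

lemma facetNormal_opposite (hn : 0 < n) {K L f : Finset (Euc n)} (hK : K ∈ 𝒯.cells)
    (hL : L ∈ 𝒯.cells) (hne : K ≠ L) (hfK : f ∈ K.powersetCard n) (hfL : f ∈ L.powersetCard n) :
    facetNormal L f = -facetNormal K f := by
  have hKs := 𝒯.cell_simplex hK
  have hLs := 𝒯.cell_simplex hL
  have hu := unit_normal_unique hKs hn hfK (norm_facetNormal hLs hn hfL) fun x hx y hy =>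
    inner_facetNormal_eq_zero hLs hn hfL (subset_convexHull ℝ _ hy) (subset_convexHull ℝ _ hx)
  refine hu.resolve_left fun heq => ?_
  obtain ⟨y, hy⟩ := relFace_nonempty hn hfK
  have h1 := eventually_mem_hull hKs hn hfK hy
  have h2 := eventually_mem_hull hLs hn hfL hy
  have ht : Filter.Tendsto (fun ε : ℝ => y - ε • facetNormal K f) (nhdsWithin 0 (Ioi 0))
      (nhds y) := by
    have hc : Continuous fun ε : ℝ => y - ε • facetNormal K f := by fun_prop
    have := hc.tendsto 0
    simp only [zero_smul, sub_zero] at this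
    exact this.mono_left nhdsWithin_le_nhds
  obtain ⟨ε, ⟨⟨-, hε1⟩, -, hε2⟩, hε0⟩ :=
    ((ht.eventually (h1.and h2)).and self_mem_nhdsWithin).exists
  have hneg : inner ℝ (facetNormal K f) (y - ε • facetNormal K f - y) < 0 := by
    rw [show y - ε • facetNormal K f - y = -(ε • facetNormal K f) by abel, inner_neg_right,
      real_inner_smul_right, real_inner_self_eq_norm_sq, norm_facetNormal hKs hn hfK]
    have : (0 : ℝ) < ε := hε0
    linarith
  exact Set.disjoint_left.1 (𝒯.disjoint_interior hK hL hne) (hε1 hneg)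
    (hε2 (by rw [heq]; exact hneg))

lemma mem_interiorFacets {f : Finset (Euc n)} : f ∈ 𝒯.interiorFacets ↔
    f ∈ 𝒯.complex.faces ∧ f.card = n ∧ ∃ K ∈ 𝒯.cells, ∃ L ∈ 𝒯.cells, K ≠ L ∧ f ⊆ K ∧ f ⊆ L := by
  simp [interiorFacets]

namespace Orientation

variable {𝒯} (o : 𝒯.Orientation) {f : Finset (Euc n)}

lemma mem_plus (hf : f ∈ 𝒯.interiorFacets) : f ∈ (o.plus f).powersetCard n :=
  mem_powersetCard.2 ⟨(o.plus_mem f hf).2, (𝒯.mem_interiorFacets.1 hf).2.1⟩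

lemma mem_minus (hf : f ∈ 𝒯.interiorFacets) : f ∈ (o.minus f).powersetCard n :=
  mem_powersetCard.2 ⟨(o.minus_mem f hf).2, (𝒯.mem_interiorFacets.1 hf).2.1⟩

lemma facetNormal_plus (hn : 0 < n) (hf : f ∈ 𝒯.interiorFacets) :
    facetNormal (o.plus f) f = o.normal f := by
  have hKs := 𝒯.cell_simplex (o.plus_mem f hf).1
  have hfK := o.mem_plus hf
  rcases unit_normal_unique hKs hn hfK (o.norm_normal f hf) (o.normal_orthogonal f hf) with h | h
  · exact h.symm
  · exfalso
    obtain ⟨x, hx⟩ := facet_nonempty hn hfK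
    obtain ⟨z, hz, hlt⟩ := inner_facetNormal_vertex_neg hKs hn hfK (subset_convexHull ℝ _ hx)
    have := o.normal_outward f hf x hx z hz
    rw [h, inner_neg_left] at this
    linarith

lemma facetNormal_minus (hn : 0 < n) (hf : f ∈ 𝒯.interiorFacets) :
    facetNormal (o.minus f) f = -o.normal f := by
  rw [← o.facetNormal_plus hn hf]
  exact 𝒯.facetNormal_opposite hn (o.plus_mem f hf).1 (o.minus_mem f hf).1 (o.plus_ne_minus f hf)
    (o.mem_plus hf) (o.mem_minus hf)

lemma eq_plus_or_minus (hn : 0 < n) (hf : f ∈ 𝒯.interiorFacets) {K : Finset (Euc n)}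
    (hK : K ∈ 𝒯.cells) (hfK : f ⊆ K) : K = o.plus f ∨ K = o.minus f := by
  by_contra! h
  have hfK' : f ∈ K.powersetCard n :=
    mem_powersetCard.2 ⟨hfK, (𝒯.mem_interiorFacets.1 hf).2.1⟩
  have h1 := 𝒯.facetNormal_opposite hn hK (o.plus_mem f hf).1 h.1 hfK' (o.mem_plus hf)
  have h2 := 𝒯.facetNormal_opposite hn hK (o.minus_mem f hf).1 h.2 hfK' (o.mem_minus hf)
  rw [o.facetNormal_plus hn hf] at h1
  rw [o.facetNormal_minus hn hf] at h2
  have h3 : o.normal f = 0 := by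
    have : o.normal f = -o.normal f := by rw [h2, ← h1]
    have h4 : (2 : ℝ) • o.normal f = 0 := by
      rw [two_smul]; nth_rewrite 1 [this]; exact neg_add_cancel _
    exact (smul_eq_zero.1 h4).resolve_left two_ne_zero
  have := o.norm_normal f hf
  rw [h3] at this
  simp at this

open Classical in
/-- A sum over all pairs of a cell and a facet of it, rearranged as a sum over facets. -/
lemma sum_cells_facets (hn : 0 < n) (Θ : Finset (Euc n) → Finset (Euc n) → ℝ)
    (hΘ : ∀ K ∈ 𝒯.cells, ∀ f ∈ K.powersetCard n, f ∉ 𝒯.interiorFacets → Θ K f = 0) :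
    ∑ K ∈ 𝒯.cells, ∑ f ∈ K.powersetCard n, Θ K f =
      ∑ f ∈ 𝒯.interiorFacets, (Θ (o.plus f) f + Θ (o.minus f) f) := by
  have h1 : ∀ K ∈ 𝒯.cells, ∑ f ∈ K.powersetCard n, Θ K f =
      ∑ f ∈ 𝒯.interiorFacets, if f ⊆ K then Θ K f else 0 := by
    intro K hK
    rw [← Finset.sum_filter]
    symm
    refine Finset.sum_subset (fun f hf => ?_) fun f hf hnf => ?_
    · rw [mem_filter] at hf
      exact mem_powersetCard.2 ⟨hf.2, (𝒯.mem_interiorFacets.1 hf.1).2.1⟩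
    · refine hΘ K hK f hf fun hfi => hnf (mem_filter.2 ⟨hfi, ?_⟩)
      exact (mem_powersetCard.1 hf).1
  rw [sum_congr rfl h1, sum_comm]
  refine sum_congr rfl fun f hf => ?_
  rw [← Finset.sum_filter]
  have : 𝒯.cells.filter (fun K => f ⊆ K) = {o.plus f, o.minus f} := by
    ext K
    simp only [mem_filter, Finset.mem_insert, Finset.mem_singleton]
    constructor
    · rintro ⟨hK, hfK⟩
      exact o.eq_plus_or_minus hn hf hK hfK
    · rintro (rfl | rfl)
      exacts [o.plus_mem f hf, o.minus_mem f hf]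
  rw [this, Finset.sum_pair (o.plus_ne_minus f hf)]

end Orientation

lemma relFace_subset_interior (hn : 0 < n) (hΩ : interior (closure Ω) = Ω) {f : Finset (Euc n)}
    (hf : f ∈ 𝒯.interiorFacets) : relFace f ⊆ Ω := by
  intro y hy
  obtain ⟨-, hc, K, hK, L, hL, hne, hfK, hfL⟩ := 𝒯.mem_interiorFacets.1 hf
  have hfK' := mem_powersetCard.2 ⟨hfK, hc⟩
  have hfL' := mem_powersetCard.2 ⟨hfL, hc⟩
  rw [← hΩ, mem_interior_iff_mem_nhds]
  filter_upwards [eventually_mem_hull (𝒯.cell_simplex hK) hn hfK' hy,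
    eventually_mem_hull (𝒯.cell_simplex hL) hn hfL' hy] with x h1 h2
  rw [𝒯.facetNormal_opposite hn hK hL hne hfK' hfL', inner_neg_left] at h2
  rcases le_total (inner ℝ (facetNormal K f) (x - y)) 0 with h | h
  · exact 𝒯.hull_cell_subset hK (h1.1 h)
  · exact 𝒯.hull_cell_subset hL (h2.1 (by linarith))

lemma diam_le_meshSize {K : Finset (Euc n)} (hK : K ∈ 𝒯.cells) :
    diam (hull K) ≤ 𝒯.meshSize :=
  le_csSup ((𝒯.cells.finite_toSet.image _).bddAbove) ⟨K, hK, rfl⟩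

lemma diam_pos (hn : 0 < n) {K : Finset (Euc n)} (hK : K ∈ 𝒯.cells) : 0 < diam (hull K) := by
  have hKs := 𝒯.cell_simplex hK
  refine Metric.diam_pos ?_ (isCompact_hull K).isBounded
  have : (K : Set (Euc n)).Nontrivial := by
    refine Finset.one_lt_card_iff_nontrivial.1 ?_
    rw [hKs.2]; omega
  exact this.mono (subset_convexHull ℝ _)

lemma cells_nonempty (hΩo : IsOpen Ω) (hΩne : Ω.Nonempty) (hΩ : interior (closure Ω) = Ω) :
    𝒯.cells.Nonempty := by
  by_contra h
  have h1 := 𝒯.restrict_eq_sum hΩ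
  rw [Finset.not_nonempty_iff_eq_empty.1 h, Finset.sum_empty, Measure.restrict_eq_zero] at h1
  exact (hΩo.measure_pos volume hΩne).ne' h1

lemma meshSize_pos (hn : 0 < n) (hΩo : IsOpen Ω) (hΩne : Ω.Nonempty)
    (hΩ : interior (closure Ω) = Ω) : 0 < 𝒯.meshSize := by
  obtain ⟨K, hK⟩ := 𝒯.cells_nonempty hΩo hΩne hΩ
  exact (𝒯.diam_pos hn hK).trans_le (𝒯.diam_le_meshSize hK)

lemma meshSize_le_diam (hΩb : Bornology.IsBounded Ω) : 𝒯.meshSize ≤ diam Ω := by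
  rw [← Metric.diam_closure]
  refine Real.sSup_le ?_ diam_nonneg
  rintro _ ⟨K, hK, rfl⟩
  exact Metric.diam_mono (𝒯.hull_cell_subset hK) hΩb.closure

end Triangulation

section Fields

variable {n : ℕ} {K : Finset (Euc n)}

/-- The `i`-th standard basis vector of `ℝⁿ`. -/
noncomputable abbrev stdVec (i : Fin n) : Euc n := EuclideanSpace.single i (1 : ℝ)

lemma sum_smul_stdVec (t : Euc n) : ∑ i, t i • stdVec i = t := by
  ext j
  simp [Finset.sum_apply, Pi.single_apply]

lemma fderiv_eq_sum_lineDeriv {φ : Euc n → ℝ} {x : Euc n} (h : DifferentiableAt ℝ φ x) (t : Euc n) :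
    fderiv ℝ φ x t = ∑ i, lineDeriv ℝ φ x (stdVec i) * t i := by
  conv_lhs => rw [← sum_smul_stdVec t]
  simp only [map_sum, map_smul, smul_eq_mul, h.lineDeriv_eq_fderiv]
  exact sum_congr rfl fun i _ => mul_comm _ _

/-- `∇ V x i j` is the derivative at `x` of the component `i` of `V` in the direction `j`. -/
notation:max "∇" V:max x:max i:max j:max => lineDeriv ℝ (fun y => V y i) x (stdVec j)

/-- The pointwise divergence of a vector field. -/
noncomputable def divPt (U : Euc n → Fin n → ℝ) (x : Euc n) : ℝ :=
  ∑ i, ∇ U x i i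

/-- The outward normal component of the field `U` on the facet `f` of the simplex `K`. -/
noncomputable def flux (U : Euc n → Fin n → ℝ) (K f : Finset (Euc n)) (x : Euc n) : ℝ :=
  ∑ i, facetNormal K f i * U x i

lemma integral_mul_divPt_eq_zero {K : Finset (Euc n)} {U : Euc n → Fin n → ℝ}
    (h : ∀ᵐ x ∂(volume.restrict (hull K)), divPt U x = 0) (φ : Euc n → ℝ) :
    ∫ x in hull K, φ x * divPt U x = 0 := integral_eq_zero_of_ae (h.mono fun x hx => by simp [hx])

@[fun_prop]
lemma continuous_flux {U : Euc n → Fin n → ℝ} (hU : ∀ i, Continuous fun x => U x i)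
    (K f : Finset (Euc n)) : Continuous (flux U K f) :=
  continuous_finsetSum _ fun i _ => continuous_const.mul (hU i)

lemma integrableOn_lineDeriv_mul {φ g : Euc n → ℝ} (hφ : LocallyLipschitz φ) (hg : Continuous g)
    K t : IntegrableOn (fun x => lineDeriv ℝ φ x t * g x) (hull K) :=
  (hφ.integrableOn_lineDeriv (isCompact_hull K).isBounded (measurableSet_hull K) t).mul_continuousOn
    hg.continuousOn (isCompact_hull K)

lemma integrableOn_mul_divPt {φ : Euc n → ℝ} {U : Euc n → Fin n → ℝ}
    (hφ : Continuous φ) (hU : ∀ i, LocallyLipschitz fun x => U x i) K :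
    IntegrableOn (fun x => φ x * divPt U x) (hull K) := by
  simp only [divPt, mul_sum]
  refine integrable_finset_sum _ fun i _ => ?_
  have := integrableOn_lineDeriv_mul (hU i) hφ K (stdVec i)
  simp only [mul_comm] at this
  exact this

lemma integrableOn_facet {f : Finset (Euc n)} (hK : IsNSimplex K) (hn : 0 < n)
    (hf : f ∈ K.powersetCard n) {g : Euc n → ℝ} (hg : Continuous g) :
    IntegrableOn g (hull f) (surf n) := by
  have hf' := mem_powersetCard.1 hf
  have hfin : surf n (hull f) < ⊤ := surf_hull_lt_top (hK.1.mono hf'.1) hn hf'.2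
  haveI : IsFiniteMeasure ((surf n).restrict (hull f)) := ⟨by simpa using hfin⟩
  obtain ⟨C, hC⟩ := (isCompact_hull f).exists_bound_of_continuousOn hg.continuousOn
  exact Measure.integrableOn_of_bounded hfin.ne hg.aestronglyMeasurable
    (ae_restrict_of_forall_mem (measurableSet_hull f) hC)

/-- **Green's formula** for a scalar function and a vector field on a simplex. -/
lemma IsNSimplex.green_field (hK : IsNSimplex K) (hn : 0 < n) {φ : Euc n → ℝ}
    {U : Euc n → Fin n → ℝ} (hφ : LocallyLipschitz φ) (hU : ∀ i, LocallyLipschitz fun x => U x i) :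
    ∑ f ∈ K.powersetCard n, ∫ x in hull f, φ x * flux U K f x ∂(surf n) =
      (∫ x in hull K, ∑ i, lineDeriv ℝ φ x (stdVec i) * U x i) +
        ∫ x in hull K, φ x * divPt U x := by
  have h1 : ∀ i, ∫ x in hull K, lineDeriv ℝ (fun y => φ y * U y i) x (stdVec i) =
      (∫ x in hull K, lineDeriv ℝ φ x (stdVec i) * U x i) +
        ∫ x in hull K, ∇ U x i i * φ x := by
    intro i
    rw [← integral_add (integrableOn_lineDeriv_mul hφ (hU i).continuous K _)
      (integrableOn_lineDeriv_mul (hU i) hφ.continuous K _)]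
    refine integral_congr_ae ?_
    filter_upwards [ae_restrict_of_ae hφ.ae_differentiableAt_real,
      ae_restrict_of_ae (hU i).ae_differentiableAt_real] with x hx1 hx2
    rw [(hx1.fun_mul hx2).lineDeriv_eq_fderiv, hx1.lineDeriv_eq_fderiv, hx2.lineDeriv_eq_fderiv,
      fderiv_fun_mul hx1 hx2]
    simp
    ring
  have h2 : ∀ i, ∫ x in hull K, lineDeriv ℝ (fun y => φ y * U y i) x (stdVec i) =
      ∑ f ∈ K.powersetCard n, ∫ x in hull f, φ x * (facetNormal K f i * U x i) ∂(surf n) := by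
    intro i
    rw [hK.green hn (hφ.mul_real (hU i))]
    refine sum_congr rfl fun f _ => ?_
    rw [← integral_const_mul]
    refine integral_congr_ae (.of_forall fun x => ?_)
    simp [EuclideanSpace.inner_single_right]
    ring
  have h3 : ∀ f ∈ K.powersetCard n, ∫ x in hull f, φ x * flux U K f x ∂(surf n) =
      ∑ i, ∫ x in hull f, φ x * (facetNormal K f i * U x i) ∂(surf n) := by
    intro f hf
    simp only [flux, mul_sum]
    exact integral_finset_sum _ fun i _ => integrableOn_facet hK hn hf
      (hφ.continuous.mul (continuous_const.mul (hU i).continuous))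
  rw [sum_congr rfl h3, sum_comm]
  simp only [← h2, h1, sum_add_distrib]
  congr 1
  · exact (integral_finset_sum _ fun i _ =>
      integrableOn_lineDeriv_mul hφ (hU i).continuous K _).symm
  · rw [← integral_finset_sum _ fun i _ => integrableOn_lineDeriv_mul (hU i) hφ.continuous K _]
    refine integral_congr_ae (.of_forall fun x => ?_)
    simp [divPt, mul_sum, mul_comm]

end Fields

namespace Triangulation

variable {n : ℕ} {Ω : Set (Euc n)} (𝒯 : Triangulation Ω)

open Classical in
/-- The jump of the normal component at the facet `f`; for a facet on the boundary it is the normal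
component itself. -/
noncomputable def normalJump (U : Finset (Euc n) → Euc n → Fin n → ℝ) (f : Finset (Euc n))
    (x : Euc n) : ℝ := ∑ K ∈ 𝒯.cells.filter (fun K => f ⊆ K), flux (U K) K f x

/-- A broken field is divergence free on each cell, its normal components fit together at the
interior facets, and vanish at the boundary facets. -/
structure DivFree (U : Finset (Euc n) → Euc n → Fin n → ℝ) : Prop where
  lip : ∀ K ∈ 𝒯.cells, ∀ i, LocallyLipschitz fun x => U K x i
  div : ∀ K ∈ 𝒯.cells, ∀ᵐ x ∂(volume.restrict (hull K)), divPt (U K) x = 0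
  jump : ∀ K ∈ 𝒯.cells, ∀ f ∈ K.powersetCard n, ∀ x ∈ hull f, 𝒯.normalJump U f x = 0

open Classical in
lemma sum_facets_comm (Θ : Finset (Euc n) → Finset (Euc n) → ℝ) :
    ∑ K ∈ 𝒯.cells, ∑ f ∈ K.powersetCard n, Θ K f =
      ∑ f ∈ 𝒯.cells.biUnion (fun K => K.powersetCard n),
        ∑ K ∈ 𝒯.cells.filter (fun K => f ⊆ K), Θ K f := by
  refine Finset.sum_comm' fun K f => ?_
  simp only [Finset.mem_biUnion, mem_filter, mem_powersetCard]
  constructor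
  · rintro ⟨hK, hf, hc⟩
    exact ⟨⟨hK, hf⟩, K, hK, hf, hc⟩
  · rintro ⟨⟨hK, hf⟩, L, -, -, hc⟩
    exact ⟨hK, hf, hc⟩

variable {𝒯} {U : Finset (Euc n) → Euc n → Fin n → ℝ}

open Classical in
lemma sum_integral_mul_flux (hn : 0 < n) (hU : ∀ K ∈ 𝒯.cells, ∀ i, LocallyLipschitz fun x => U K x i)
    {φ : Finset (Euc n) → Euc n → ℝ} (hφ : ∀ f, Continuous (φ f)) :
    ∑ K ∈ 𝒯.cells, ∑ f ∈ K.powersetCard n, ∫ x in hull f, φ f x * flux (U K) K f x ∂(surf n) =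
      ∑ f ∈ 𝒯.cells.biUnion (fun K => K.powersetCard n),
        ∫ x in hull f, φ f x * 𝒯.normalJump U f x ∂(surf n) := by
  rw [sum_facets_comm]
  refine sum_congr rfl fun f hf => ?_
  obtain ⟨K, hK, hfK⟩ := Finset.mem_biUnion.1 hf
  simp only [normalJump, mul_sum]
  refine (integral_finset_sum _ fun L hL => ?_).symm
  rw [mem_filter] at hL
  exact integrableOn_facet (𝒯.cell_simplex hK) hn hfK
    ((hφ f).mul (continuous_flux (fun i => (hU L hL.1 i).continuous) _ _))

/-- Multipliers on the facets do not see fields with matching normal components. -/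
lemma DivFree.sum_integral_mul_flux_eq_zero (hU : 𝒯.DivFree U) (hn : 0 < n)
    {φ : Finset (Euc n) → Euc n → ℝ} (hφ : ∀ f, Continuous (φ f)) :
    ∑ K ∈ 𝒯.cells, ∑ f ∈ K.powersetCard n,
      ∫ x in hull f, φ f x * flux (U K) K f x ∂(surf n) = 0 := by
  classical
  rw [sum_integral_mul_flux hn hU.lip hφ]
  refine sum_eq_zero fun f hf => ?_
  obtain ⟨K, hK, hfK⟩ := Finset.mem_biUnion.1 hf
  rw [setIntegral_congr_fun (g := fun _ => 0) (measurableSet_hull f)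
    fun x hx => by simp [hU.jump K hK f hfK x hx]]
  simp

lemma DivFree.flux_eq_zero (hU : 𝒯.DivFree U) {K f : Finset (Euc n)} (hK : K ∈ 𝒯.cells)
    (hn : 0 < n) (hf : f ∈ K.powersetCard n) (hfi : f ∉ 𝒯.interiorFacets) {x : Euc n}
    (hx : x ∈ hull f) : flux (U K) K f x = 0 := by
  classical
  have h := hU.jump K hK f hf x hx
  have hf' := mem_powersetCard.1 hf
  rw [normalJump, sum_eq_single K] at h
  · exact h
  · intro L hL hne
    rw [mem_filter] at hL
    exact absurd (𝒯.mem_interiorFacets.2 ⟨𝒯.mem_faces_of_facet hn hK hf, hf'.2, L, hL.1, K, hK, hne,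
      hL.2, hf'.1⟩) hfi
  · intro h'
    exact absurd (mem_filter.2 ⟨hK, hf'.1⟩) h'

lemma DivFree.normal_eq (hU : 𝒯.DivFree U) (hn : 0 < n) (o : 𝒯.Orientation) {f : Finset (Euc n)}
    (hf : f ∈ 𝒯.interiorFacets) {x : Euc n} (hx : x ∈ hull f) :
    ∑ i, o.normal f i * U (o.plus f) x i = ∑ i, o.normal f i * U (o.minus f) x i := by
  classical
  have h := hU.jump _ (o.plus_mem f hf).1 f (o.mem_plus hf) x hx
  have : 𝒯.cells.filter (fun K => f ⊆ K) = {o.plus f, o.minus f} := by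
    ext K
    simp only [mem_filter, Finset.mem_insert, Finset.mem_singleton]
    constructor
    · rintro ⟨hK, hfK⟩
      exact o.eq_plus_or_minus hn hf hK hfK
    · rintro (rfl | rfl)
      exacts [o.plus_mem f hf, o.minus_mem f hf]
  rw [normalJump, this, Finset.sum_pair (o.plus_ne_minus f hf), flux, flux,
    o.facetNormal_plus hn hf, o.facetNormal_minus hn hf] at h
  simp only [PiLp.neg_apply, neg_mul, sum_neg_distrib] at h
  linarith

/-- A vector field on `Ω` is represented by the broken field `U`. -/
def Represents (𝒯 : Triangulation Ω) (U : Finset (Euc n) → Euc n → Fin n → ℝ) (w : Euc n → Euc n) :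
    Prop := ∀ K ∈ 𝒯.cells, ∀ x ∈ interior (hull K), ∀ i, w x i = U K x i

lemma Represents.ae {w : Euc n → Euc n} (h : 𝒯.Represents U w) {K : Finset (Euc n)}
    (hK : K ∈ 𝒯.cells) : ∀ᵐ x ∂(volume.restrict (hull K)), ∀ i, w x i = U K x i := by
  rw [← Measure.restrict_congr_set (interior_hull_ae_eq K)]
  exact ae_restrict_of_forall_mem isOpen_interior.measurableSet (h K hK)

lemma integral_fderiv_eq (hΩ : interior (closure Ω) = Ω) {w : Euc n → Euc n}
    (hw : 𝒯.Represents U w) (hU : ∀ K ∈ 𝒯.cells, ∀ i, LocallyLipschitz fun x => U K x i)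
    {φ : Euc n → ℝ} (hφ : ContDiff ℝ ∞ φ) : ∫ x in Ω, fderiv ℝ φ x (w x) =
      ∑ K ∈ 𝒯.cells, ∫ x in hull K, ∑ i, lineDeriv ℝ φ x (stdVec i) * U K x i := by
  have hφ' : LocallyLipschitz φ := (hφ.of_le (by simp)).locallyLipschitz
  have h1 : ∀ K ∈ 𝒯.cells, (fun x => fderiv ℝ φ x (w x)) =ᵐ[volume.restrict (hull K)]
      fun x => ∑ i, lineDeriv ℝ φ x (stdVec i) * U K x i := fun K hK => by
    filter_upwards [hw.ae hK] with x hx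
    rw [fderiv_eq_sum_lineDeriv (hφ.differentiable (by simp) x)]
    simp only [hx]
  rw [𝒯.setIntegral_eq_sum hΩ]
  · exact sum_congr rfl fun K hK => integral_congr_ae (h1 K hK)
  · intro K hK
    refine Integrable.congr ?_ (h1 K hK).symm
    exact integrable_finset_sum _ fun i _ =>
      integrableOn_lineDeriv_mul hφ' (hU K hK i).continuous K _

/-- Solenoidal fields that are piecewise Lipschitz are divergence free on the cells, with matching
normal components. -/
lemma divFree_of_isSolenoidal (hn : 0 < n) (hΩ : interior (closure Ω) = Ω) {w : Euc n → Euc n}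
    (hs : IsSolenoidal Ω w) (hw : 𝒯.Represents U w)
    (hU : ∀ K ∈ 𝒯.cells, ∀ i, LocallyLipschitz fun x => U K x i) : 𝒯.DivFree U := by
  classical
  have hdiv : ∀ K ∈ 𝒯.cells, ∀ᵐ x ∂(volume.restrict (hull K)), divPt (U K) x = 0 := by
    intro K hK
    have hKs := 𝒯.cell_simplex hK
    have hint : LocallyIntegrableOn (divPt (U K)) (interior (hull K)) := by
      have := integrableOn_mul_divPt (φ := fun _ => 1) continuous_const (hU K hK) K
      simp only [one_mul] at this
      exact (this.mono_set interior_subset).locallyIntegrableOn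
    have h := isOpen_interior.ae_eq_zero_of_integral_contDiff_smul_eq_zero hint ?_
    · rw [← Measure.restrict_congr_set (interior_hull_ae_eq K)]
      rw [ae_restrict_iff' isOpen_interior.measurableSet]
      exact h
    · intro φ hφ hc hsup
      have h0 := hs.2 φ ⟨hφ, hc, subset_univ _⟩
      rw [integral_fderiv_eq hΩ hw hU hφ] at h0
      have hφ' : LocallyLipschitz φ := (hφ.of_le (by simp)).locallyLipschitz
      rw [sum_eq_single K] at h0
      · have h1 := hKs.green_field hn hφ' (hU K hK)
        rw [h0, zero_add] at h1
        have h2 : ∀ f ∈ K.powersetCard n, ∫ x in hull f, φ x * flux (U K) K f x ∂(surf n) = 0 := by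
          intro f hf
          rw [setIntegral_congr_fun (g := fun _ => 0) (measurableSet_hull f)]
          · simp
          · intro x hx
            have : x ∉ tsupport φ := fun hxs => by
              have h3 := hsup hxs
              rw [hKs.interior_hull] at h3
              obtain ⟨z, hz⟩ := exists_eq_erase hKs hf
              have h4 := coord_eq_zero_of_mem_hull hKs (mem_powersetCard.1 hf).1 hx z
                (by rw [hz]; exact notMem_erase _ _)
              exact (h3 z).ne' h4
            simp [image_eq_zero_of_notMem_tsupport this]
        rw [sum_eq_zero h2] at h1
        have h5 : ∫ x, φ x • divPt (U K) x = ∫ x in hull K, φ x * divPt (U K) x := by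
          rw [setIntegral_eq_integral_of_forall_compl_eq_zero]
          · rfl
          · intro x hx
            have : x ∉ tsupport φ := fun hxs => hx (interior_subset (hsup hxs))
            simp [image_eq_zero_of_notMem_tsupport this]
        rw [h5, ← h1]
      · intro L hL hne
        rw [setIntegral_congr_fun (g := fun _ => 0) (measurableSet_hull L)]
        · simp
        · intro x hx
          have hxn : x ∉ tsupport φ := fun hxs =>
            Set.disjoint_left.1 (𝒯.interior_inter_hull hK hL (Ne.symm hne)) (hsup hxs) hx
          have : φ =ᶠ[nhds x] fun _ => 0 := notMem_tsupport_iff_eventuallyEq.1 hxn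
          have h3 : ∀ t, lineDeriv ℝ φ x t = 0 := fun t => by
            rw [this.lineDeriv_eq]; simp [lineDeriv]
          simp [h3]
      · exact fun h => absurd hK h
  refine ⟨hU, hdiv, ?_⟩
  -- the boundary terms of Green's formula vanish when tested with smooth functions
  have hbd : ∀ φ : Euc n → ℝ, ContDiff ℝ ∞ φ → HasCompactSupport φ →
      ∑ f ∈ 𝒯.cells.biUnion (fun K => K.powersetCard n),
        ∫ x in hull f, φ x * 𝒯.normalJump U f x ∂(surf n) = 0 := by
    intro φ hφ hc
    have hφ' : LocallyLipschitz φ := (hφ.of_le (by simp)).locallyLipschitz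
    rw [← sum_integral_mul_flux hn hU (φ := fun _ => φ) fun _ => hφ.continuous]
    have h0 := hs.2 φ ⟨hφ, hc, subset_univ _⟩
    rw [integral_fderiv_eq hΩ hw hU hφ] at h0
    rw [← h0]
    refine sum_congr rfl fun K hK => ?_
    rw [(𝒯.cell_simplex hK).green_field hn hφ' (hU K hK), add_eq_left]
    refine integral_eq_zero_of_ae ?_
    filter_upwards [hdiv K hK] with x hx
    simp [hx]
  have hcont : ∀ f, Continuous (𝒯.normalJump U f) := fun f =>
    continuous_finsetSum _ fun L hL => continuous_flux
      (fun i => (hU L (mem_filter.1 hL).1 i).continuous) _ _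
  intro K hK f hf
  refine eq_on_hull_of_relFace (facet_nonempty hn hf) (hcont f) continuous_const ?_
  intro y hy
  by_contra hJ
  have hf' := mem_powersetCard.1 hf
  have hnhds : ∀ᶠ x in nhds y, (∀ g ∈ (𝒯.cells.biUnion fun K => K.powersetCard n).erase f,
      x ∉ hull g) ∧ 0 < 𝒯.normalJump U f y * 𝒯.normalJump U f x := by
    refine Filter.Eventually.and ?_ ?_
    · rw [Finset.eventually_all]
      intro g hg
      refine (isCompact_hull g).isClosed.isOpen_compl.mem_nhds fun hyg => ?_
      rw [mem_erase, Finset.mem_biUnion] at hg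
      obtain ⟨hgf, L, hL, hgL⟩ := hg
      have h1 := 𝒯.face_subset_of_relFace hn hK hf (𝒯.mem_faces_of_facet hn hL hgL) hy hyg
      exact hgf (Finset.eq_of_subset_of_card_le h1
        (by rw [hf'.2, (mem_powersetCard.1 hgL).2])).symm
    · have h1 : Continuous fun x => 𝒯.normalJump U f y * 𝒯.normalJump U f x :=
        continuous_const.mul (hcont f)
      exact h1.continuousAt.eventually (lt_mem_nhds (mul_self_pos.2 hJ))
  obtain ⟨r, hr, hball⟩ := Metric.eventually_nhds_iff_ball.1 hnhds
  let φ : ContDiffBump y := ⟨r / 2, r, by positivity, by linarith⟩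
  have h0 := hbd φ φ.contDiff φ.hasCompactSupport
  have hmem : f ∈ 𝒯.cells.biUnion fun K => K.powersetCard n := Finset.mem_biUnion.2 ⟨K, hK, hf⟩
  have hout : ∀ x, x ∉ Metric.ball y r → φ x = 0 := fun x hx =>
    φ.zero_of_le_dist (by simpa using hx)
  rw [← Finset.add_sum_erase _ _ hmem, sum_eq_zero, add_zero] at h0
  · have hpos : 0 < ∫ x in hull f, 𝒯.normalJump U f y * (φ x * 𝒯.normalJump U f x) ∂(surf n) := by
      have hcont2 : Continuous fun x => 𝒯.normalJump U f y * (φ x * 𝒯.normalJump U f x) :=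
        continuous_const.mul (φ.continuous.mul (hcont f))
      have hnn : ∀ x, 0 ≤ 𝒯.normalJump U f y * (φ x * 𝒯.normalJump U f x) := by
        intro x
        by_cases hx : x ∈ Metric.ball y r
        · have := (hball x hx).2
          have := φ.nonneg (x := x)
          rw [mul_left_comm]
          positivity
        · simp [hout x hx]
      rw [integral_pos_iff_support_of_nonneg hnn
        (integrableOn_facet (𝒯.cell_simplex hK) hn hf hcont2),
        Measure.restrict_apply' (measurableSet_hull f)]
      refine (surf_hull_inter_pos ((𝒯.cell_simplex hK).1.mono hf'.1) hn hf'.2 Metric.isOpen_ball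
        ⟨y, relFace_subset hy, Metric.mem_ball_self hr⟩).trans_le (measure_mono ?_)
      rintro x ⟨hx1, hx2⟩
      refine ⟨?_, hx1⟩
      have h2 := (hball x hx2).2
      have h3 : 0 < φ x := φ.pos_of_mem_ball hx2
      rw [Function.mem_support, mul_left_comm]
      positivity
    rw [integral_const_mul, h0, mul_zero] at hpos
    exact lt_irrefl _ hpos
  · intro g hg
    rw [setIntegral_congr_fun (g := fun _ => 0) (measurableSet_hull g)]
    · simp
    · intro x hx
      have : x ∉ Metric.ball y r := fun hxb => (hball x hxb).1 g hg hx
      simp [hout x this]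

variable (𝒯) in
lemma glue_eq {K : Finset (Euc n)} (hK : K ∈ 𝒯.cells) (v : BrokenField n) {x : Euc n}
    (hx : x ∈ interior (hull K)) : 𝒯.glue v x = WithLp.toLp 2 (trace v K x) := by
  rw [glue, sum_eq_single K]
  · exact indicator_of_mem hx _
  · intro L hL hne
    exact indicator_of_notMem (fun hxL =>
      Set.disjoint_left.1 (𝒯.disjoint_interior hK hL hne.symm) hx hxL) _
  · exact fun h => absurd hK h

variable (𝒯) in
lemma represents_glue (v : BrokenField n) : 𝒯.Represents (fun K => trace v K) (𝒯.glue v) :=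
  fun K hK x hx i => by rw [𝒯.glue_eq hK v hx]

lemma trace_mem_polySpace {v : BrokenField n} {K : Finset (Euc n)} {i : Fin n} {s : ℕ}
    (h : (v K i).totalDegree ≤ s) : (fun x => trace v K x i) ∈ polySpace n s := eval_mem_polySpace h

lemma trace_locallyLipschitz (v : BrokenField n) K (i : Fin n) :
    LocallyLipschitz fun x => trace v K x i :=
  polySpace_locallyLipschitz (trace_mem_polySpace le_rfl)

lemma continuous_trace (v : BrokenField n) K :
    Continuous fun x => (WithLp.toLp 2 (trace v K x) : Euc n) := (PiLp.continuous_toLp 2 _).comp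
    (continuous_pi fun i => (trace_locallyLipschitz v K i).continuous)

variable (𝒯) in
lemma memLp_glue (v : BrokenField n) (p : ℝ≥0∞) : MemLp (𝒯.glue v) p (volume.restrict Ω) := by
  have h : ∀ K ∈ 𝒯.cells, MemLp ((interior (hull K)).indicator
      fun y => (WithLp.toLp 2 (trace v K y) : Euc n)) p (volume.restrict Ω) := by
    intro K _
    rw [memLp_indicator_iff_restrict isOpen_interior.measurableSet,
      Measure.restrict_restrict isOpen_interior.measurableSet]
    obtain ⟨C, hC⟩ := (isCompact_hull K).exists_bound_of_continuousOn
      (continuous_trace v K).continuousOn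
    have hfin : volume (interior (hull K) ∩ Ω) < ⊤ :=
      (measure_mono (inter_subset_left.trans interior_subset)).trans_lt
        (isCompact_hull K).measure_lt_top
    haveI : IsFiniteMeasure (volume.restrict (interior (hull K) ∩ Ω)) := ⟨by simpa using hfin⟩
    refine MemLp.of_bound (continuous_trace v K).aestronglyMeasurable C ?_
    refine ae_mono (Measure.restrict_mono (inter_subset_left.trans interior_subset) le_rfl)
      (ae_restrict_of_forall_mem (measurableSet_hull K) hC)
  exact memLp_finset_sum _ h

/-- Broken polynomial fields with the local conditions are solenoidal. -/
lemma DivFree.isSolenoidal_glue (hn : 0 < n) (hΩ : interior (closure Ω) = Ω) {v : BrokenField n}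
    (h : 𝒯.DivFree fun K => trace v K) : IsSolenoidal Ω (𝒯.glue v) := by
  refine ⟨memLp_glue 𝒯 v 2, fun φ hφ => ?_⟩
  have hφ' : LocallyLipschitz φ := (hφ.smooth.of_le (by simp)).locallyLipschitz
  rw [integral_fderiv_eq hΩ (𝒯.represents_glue v) h.lip hφ.smooth,
    ← h.sum_integral_mul_flux_eq_zero hn (φ := fun _ => φ) fun _ => hφ'.continuous]
  refine sum_congr rfl fun K hK => ?_
  rw [(𝒯.cell_simplex hK).green_field hn hφ' (h.lip K hK), eq_comm, add_eq_left]
  refine integral_eq_zero_of_ae ?_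
  filter_upwards [h.div K hK] with x hx
  simp [hx]

lemma divFree_of_mem (hn : 0 < n) (hΩ : interior (closure Ω) = Ω) {F : ElementFamily} {s : ℕ}
    {v : BrokenField n} (h : v ∈ 𝒯.divFreeSpace F s) : 𝒯.DivFree fun K => trace v K :=
  divFree_of_isSolenoidal hn hΩ h.2 (𝒯.represents_glue v) fun K _ i => trace_locallyLipschitz v K i

lemma mem_divFreeSpace (hn : 0 < n) (hΩ : interior (closure Ω) = Ω) (F : ElementFamily) {s : ℕ}
    {v : BrokenField n} (hd : ∀ K ∈ 𝒯.cells, ∀ i, (v K i).totalDegree ≤ s)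
    (h : 𝒯.DivFree fun K => trace v K) : v ∈ 𝒯.divFreeSpace F s := by
  have hsol := h.isSolenoidal_glue hn hΩ
  refine ⟨⟨⟨hsol.1, fun _ => 0, by simp, fun φ hφ => ?_⟩, fun K hK => ?_⟩, hsol⟩
  · simpa using hsol.2 φ ⟨hφ.smooth, hφ.compact, subset_univ _⟩
  · cases F
    · exact ⟨v K, 0, hd K hK, by simp, by simp⟩
    · exact hd K hK

/-- Both families consist of fields of degree at most `s + 1`. -/
lemma totalDegree_le_of_mem {F : ElementFamily} {s : ℕ} {v : BrokenField n}
    (h : v ∈ 𝒯.divFreeSpace F s) {K : Finset (Euc n)} (hK : K ∈ 𝒯.cells) (i : Fin n) :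
    (v K i).totalDegree ≤ s + 1 := by
  have := h.1.2 K hK
  cases F
  · obtain ⟨q, r, hq, hr, hv⟩ := this
    rw [hv i]
    refine (MvPolynomial.totalDegree_add _ _).trans (max_le ((hq i).trans (Nat.le_succ s)) ?_)
    refine (MvPolynomial.totalDegree_mul _ _).trans ?_
    rw [MvPolynomial.totalDegree_X]
    omega
  · exact (this i).trans (Nat.le_succ s)

end Triangulation

section PolyBounds

variable {n s : ℕ}

instance : CoeFun (polySpace n s) fun _ => Euc n → ℝ := ⟨Subtype.val⟩

@[fun_prop]
lemma continuous_poly (p : polySpace n s) : Continuous p := polySpace_continuous p.2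

lemma polySpace_eq_zero {p : Euc n → ℝ} (hp : p ∈ polySpace n s) {U : Set (Euc n)} (hU : IsOpen U)
    (hne : U.Nonempty) (h : ∀ x ∈ U, p x = 0) x : p x = 0 := by
  obtain ⟨q, -, hq⟩ := hp
  obtain ⟨c, hc⟩ := hne
  have ha : AnalyticOnNhd ℝ p univ := by
    rw [show p = _ from funext hq]
    have := AnalyticOnNhd.eval_continuousLinearMap' (𝕜 := ℝ)
      (fun i => (EuclideanSpace.proj i : Euc n →L[ℝ] ℝ)) q
    exact this
  exact ha.eqOn_zero_of_preconnected_of_eventuallyEq_zero isPreconnected_univ (mem_univ c)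
    (Filter.eventually_of_mem (hU.mem_nhds hc) h) (mem_univ x)

lemma integrableOn_of_continuous {X : Type*} [MeasurableSpace X] [TopologicalSpace X]
    [OpensMeasurableSpace X] [T2Space X] {μ : Measure X} [IsFiniteMeasureOnCompacts μ] {g : X → ℝ}
    (hg : Continuous g) {S : Set X} (hS : IsCompact S) : IntegrableOn g S μ :=
  hg.continuousOn.integrableOn_compact' hS hS.measurableSet

lemma integrable_hull (K : Finset (Euc n)) (g : Euc n → ℝ) (hg : Continuous g) :
    Integrable g (volume.restrict (hull K)) := integrableOn_of_continuous hg (isCompact_hull K)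

/-- A Cauchy-Schwarz type bound for finite dimensional function spaces: a linear functional that
vanishes with the `L²` norm is bounded by it. -/
lemma exists_bound_of_l2 {E : Type*} [AddCommGroup E] [Module ℝ E] [FiniteDimensional ℝ E]
    {β : LinearMap.BilinForm ℝ E} (hs : ∀ x y, β x y = β y x) (hp : ∀ x, 0 ≤ β x x)
    {ι : Type*} (ℓ : ι → E →ₗ[ℝ] ℝ) (hker : ∀ x, β x x = 0 → ∀ i, ℓ i x = 0)
    (hbd : ∀ x, ∃ M, ∀ i, (ℓ i x) ^ 2 ≤ M) : ∃ C : ℝ, 0 < C ∧ ∀ x i, (ℓ i x) ^ 2 ≤ C * β x x := by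
  obtain ⟨κ, _, b, hb1, hb2, hb3⟩ := exists_orthonormal_family hs hp
  choose M hM using hbd
  refine ⟨∑ k, |M (b k)| + 1, by positivity, fun x i => ?_⟩
  have h1 := hker _ (hb3 x) i
  have h2 := bilin_eq_zero_of_self_eq_zero hs hp (hb3 x) x
  rw [map_sub, sub_eq_zero, map_sum] at h1
  rw [map_sub, LinearMap.sub_apply, sub_eq_zero] at h2
  rw [h1, h2, hs, map_sum]
  simp only [map_smul, smul_eq_mul, ← sq]
  refine (Finset.sum_mul_sq_le_sq_mul_sq _ _ _).trans ?_
  rw [mul_comm]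
  gcongr
  exact (sum_le_sum fun k _ => (hM (b k) i).trans (le_abs_self _)).trans (by linarith)

/-- The same for functionals of a representation of elements of the dual space: if `L m = 0` implies
that the functional vanishes at `m`, then it is bounded by the norm of `z` whenever `L m` is the
inner product with `z`. -/
lemma exists_bound_of_dual {E M : Type*} [AddCommGroup E] [Module ℝ E] [FiniteDimensional ℝ E]
    [AddCommGroup M] [Module ℝ M] {β : LinearMap.BilinForm ℝ E} (hs : ∀ x y, β x y = β y x)
    (hp : ∀ x, 0 ≤ β x x) (L : M →ₗ[ℝ] E →ₗ[ℝ] ℝ) {ι : Type*} (ℓ : ι → M →ₗ[ℝ] ℝ)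
    (hker : ∀ m, L m = 0 → ∀ i, ℓ i m = 0) (hbd : ∀ m, ∃ B, ∀ i, (ℓ i m) ^ 2 ≤ B) :
    ∃ C : ℝ, 0 < C ∧ ∀ m z, L m = β z → ∀ i, (ℓ i m) ^ 2 ≤ C * β z z := by
  let W := (LinearMap.range L).comap β
  let r : W →ₗ[ℝ] LinearMap.range L := LinearMap.restrict β fun _ hx => hx
  have hle : ∀ i, LinearMap.ker L ≤ LinearMap.ker (ℓ i) := fun i m hm => hker m hm i
  let ℓ' : ι → W →ₗ[ℝ] ℝ := fun i => (LinearMap.ker L).liftQ (ℓ i) (hle i) ∘ₗ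
    L.quotKerEquivRange.symm.toLinearMap ∘ₗ r
  have hkey : ∀ (w : W) m, L m = β w → ∀ i, ℓ' i w = ℓ i m := fun w m hm i => by
    have : r w = ⟨L m, m, rfl⟩ := Subtype.ext hm.symm
    change (LinearMap.ker L).liftQ (ℓ i) (hle i) (L.quotKerEquivRange.symm _) = _
    rw [this, L.quotKerEquivRange_symm_apply_image m ⟨m, rfl⟩]
    exact Submodule.liftQ_apply ..
  obtain ⟨C, hC, h⟩ := exists_bound_of_l2 (β := β.compl₁₂ W.subtype W.subtype) (fun x y => hs x y)
    (fun x => hp x) ℓ' (fun w hw i => by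
      rw [hkey w 0 (by ext v; rw [map_zero]; exact (bilin_eq_zero_of_self_eq_zero hs hp hw v).symm),
        map_zero]) fun w => by
      obtain ⟨m, hm⟩ := w.2
      simpa only [hkey w m hm] using hbd m
  exact ⟨C, hC, fun m z hm i => hkey ⟨z, m, hm⟩ m hm i ▸ h ⟨z, m, hm⟩ i⟩

/-- Integration of products of polynomials. -/
noncomputable def pairForm (s : ℕ) (μ : Measure (Euc n)) (hμ : ∀ g : Euc n → ℝ, Continuous g →
    Integrable g μ) : LinearMap.BilinForm ℝ (polySpace n s) :=
  LinearMap.mk₂ ℝ (fun p q => ∫ x, p x * q x ∂μ)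
    (fun p p' q => by
      rw [← integral_add (hμ _ (by fun_prop)) (hμ _ (by fun_prop))]; simp [add_mul])
    (fun c p q => by rw [smul_eq_mul, ← integral_const_mul]; simp [mul_assoc])
    (fun p q q' => by
      rw [← integral_add (hμ _ (by fun_prop)) (hμ _ (by fun_prop))]; simp [mul_add])
    (fun c p q => by rw [smul_eq_mul, ← integral_const_mul]; simp [mul_left_comm])

lemma pairForm_apply (μ : Measure (Euc n)) (hμ) (p q : polySpace n s) :
    pairForm s μ hμ p q = ∫ x, p x * q x ∂μ := rfl

lemma eq_zero_of_setIntegral {X : Type*} [MeasurableSpace X] [TopologicalSpace X]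
    [OpensMeasurableSpace X] [T2Space X] {μ : Measure X} [IsFiniteMeasureOnCompacts μ]
    [μ.IsOpenPosMeasure] {g : X → ℝ} (hg : Continuous g) {S : Set X} (hS : IsCompact S)
    (h0 : ∀ x ∈ S, 0 ≤ g x) (h : ∫ x in S, g x ∂μ = 0) : ∀ x ∈ interior S, g x = 0 :=
  Measure.eqOn_open_of_ae_eq (ae_mono (Measure.restrict_mono interior_subset le_rfl)
    ((integral_eq_zero_iff_of_nonneg_ae (ae_restrict_of_forall_mem hS.measurableSet h0)
      (integrableOn_of_continuous hg hS)).1 h)) isOpen_interior hg.continuousOn continuousOn_const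

lemma eq_zero_of_integral_sq {X : Type*} [MeasurableSpace X] [TopologicalSpace X]
    [OpensMeasurableSpace X] [T2Space X] {μ : Measure X} [IsFiniteMeasureOnCompacts μ]
    [μ.IsOpenPosMeasure] {g : X → ℝ} (hg : Continuous g) {S : Set X} (hS : IsCompact S)
    (h : ∫ x in S, g x * g x ∂μ = 0) (x : X) (hx : x ∈ interior S) : g x = 0 :=
  mul_self_eq_zero.1 (eq_zero_of_setIntegral (hg.mul hg) hS (fun _ _ => mul_self_nonneg _) h x hx)

/-- The directional derivative as a linear map on polynomials. -/
noncomputable def polyD (s : ℕ) (t : Euc n) : polySpace n s →ₗ[ℝ] polySpace n s where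
  toFun p := ⟨fun x => fderiv ℝ p x t, polySpace_mono (by omega) (polySpace_fderiv p.2 t)⟩
  map_add' p q := by
    ext x
    simp only [Submodule.coe_add]
    rw [fderiv_add (polySpace_differentiable p.2 x) (polySpace_differentiable q.2 x)]
    rfl
  map_smul' c p := by
    ext x
    simp only [Submodule.coe_smul]
    rw [fderiv_const_smul (polySpace_differentiable p.2 x)]
    rfl

/-- Evaluation at a point as a linear functional on polynomials. -/
noncomputable def polyEval (s : ℕ) (y : Euc n) : polySpace n s →ₗ[ℝ] ℝ :=
  LinearMap.proj y ∘ₗ (polySpace n s).subtype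

lemma exists_sq_bound {X : Type*} [TopologicalSpace X] {S : Set X} (hS : IsCompact S) {g : X → ℝ}
    (hg : Continuous g) : ∃ M, ∀ y : S, g y ^ 2 ≤ M := by
  obtain ⟨M, hM⟩ := hS.exists_bound_of_continuousOn (hg.pow 2).continuousOn
  exact ⟨M, fun y => (Real.le_norm_self _).trans (hM y y.2)⟩

@[fun_prop]
lemma continuous_fderiv_poly (p : polySpace n s) : Continuous (fderiv ℝ p) :=
  (polySpace_contDiff p.2).continuous_fderiv (by simp)

lemma isCompact_prod_ball (K : Finset (Euc n)) :
    IsCompact (hull K ×ˢ closedBall (0 : Euc n) 1) :=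
  (isCompact_hull K).prod (isCompact_closedBall _ _)

/-- A bound for directional derivatives in unit directions holds in all directions. -/
lemma sq_le_of_unit {ℓ : Euc n →L[ℝ] ℝ} {B : ℝ}
    (h : ∀ t ∈ closedBall 0 1, ℓ t ^ 2 ≤ B) t : ℓ t ^ 2 ≤ B * ‖t‖ ^ 2 := by
  rcases eq_or_ne t 0 with rfl | ht
  · simp
  have h1 := h (‖t‖⁻¹ • t) (by simp [norm_smul, inv_mul_cancel₀ (norm_ne_zero_iff.2 ht)])
  rwa [map_smul, smul_eq_mul, mul_pow, inv_pow, inv_mul_le_iff₀ (by positivity), mul_comm] at h1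

/-- Bounds for polynomials on a fixed simplex. -/
lemma IsNSimplex.exists_sup_bound {K : Finset (Euc n)} (hK : IsNSimplex K) (s : ℕ) :
    ∃ C : ℝ, 0 < C ∧ ∀ p : polySpace n s, ∀ y ∈ hull K,
      (p : Euc n → ℝ) y ^ 2 ≤ C * pairForm s _ (integrable_hull K) p p ∧
      ∀ t, (fderiv ℝ (p : Euc n → ℝ) y t) ^ 2 ≤
        C * pairForm s _ (integrable_hull K) p p * ‖t‖ ^ 2 := by
  have hsym : ∀ p q, pairForm s _ (integrable_hull K) p q = pairForm s _ (integrable_hull K) q p :=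
    fun p q => by simp only [pairForm_apply, mul_comm]
  have hnn : ∀ p, 0 ≤ pairForm s _ (integrable_hull K) p p := fun p =>
    integral_nonneg fun x => mul_self_nonneg _
  have hz : ∀ p, pairForm s _ (integrable_hull K) p p = 0 → p = 0 := fun p hp =>
    Subtype.ext (funext (polySpace_eq_zero p.2 isOpen_interior hK.interior_nonempty
      (eq_zero_of_integral_sq (continuous_poly p) (isCompact_hull K) hp)))
  obtain ⟨C₁, hC₁, h₁⟩ := exists_bound_of_l2 hsym hnn (fun y : hull K => polyEval s (y : Euc n))
    (fun p hp y => by rw [hz p hp, map_zero])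
    fun p => exists_sq_bound (isCompact_hull K) (continuous_poly p)
  obtain ⟨C₂, hC₂, h₂⟩ := exists_bound_of_l2 hsym hnn
    (fun q : ↥(hull K ×ˢ closedBall (0 : Euc n) 1) => polyEval s q.1.1 ∘ₗ polyD s q.1.2)
    (fun p hp y => by rw [hz p hp, map_zero])
    fun p => exists_sq_bound (isCompact_prod_ball K)
      (g := fun q => fderiv ℝ (p : Euc n → ℝ) q.1 q.2) (by fun_prop)
  refine ⟨C₁ + C₂, by positivity, fun p y hy => ⟨(h₁ p ⟨y, hy⟩).trans ?_, sq_le_of_unit fun t ht =>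
    (h₂ p ⟨(y, t), hy, ht⟩).trans ?_⟩⟩
  all_goals
    have := mul_nonneg hC₁.le (hnn p)
    have := mul_nonneg hC₂.le (hnn p)
    linarith

end PolyBounds

/-- The simplex `K` has positive diameter and contains the ball around `c` of radius
`σ * diam K`. -/
structure ShapeReg (σ : ℝ) (K : Finset (Euc n)) (c : Euc n) : Prop where
  simplex : IsNSimplex K
  sigma_pos : 0 < σ
  diam_pos : 0 < diam (hull K)
  ball : closedBall c (σ * diam (hull K)) ⊆ hull K

namespace ShapeReg

variable {n s : ℕ} {σ : ℝ} {K : Finset (Euc n)} {c : Euc n}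

lemma hull_subset (h : ShapeReg σ K c) : hull K ⊆ closedBall c (diam (hull K)) := by
  intro y hy
  have hc : c ∈ hull K := h.ball (Metric.mem_closedBall_self
    (mul_nonneg h.sigma_pos.le h.diam_pos.le))
  exact Metric.dist_le_diam_of_mem (isCompact_hull K).isBounded hy hc

lemma volume_le (h : ShapeReg σ K c) : (volume : Measure (Euc n)).real (hull K) ≤
    diam (hull K) ^ n * (volume : Measure (Euc n)).real (closedBall 0 1) := by
  have h1 := measureReal_mono (μ := volume) h.hull_subset
    (isCompact_closedBall _ _).measure_lt_top.ne
  refine h1.trans_eq ?_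
  rw [Measure.addHaar_real_closedBall' _ _ h.diam_pos.le, finrank_euclideanSpace_fin]

lemma coord_le_one (h : ShapeReg σ K c) {y : Euc n} (hy : y ∈ hull K) (z : K) :
    h.simplex.basis.coord z y ≤ 1 := by
  have h1 := h.simplex.basis.sum_coord_apply_eq_one y
  have h2 := h.simplex.mem_hull_iff.1 hy
  rw [← h1]
  exact single_le_sum (f := fun i => h.simplex.basis.coord i y) (fun i _ => h2 i)
    (Finset.mem_univ z)

lemma norm_baryGrad_le (h : ShapeReg σ K c) (hn : 0 < n) (z : K) :
    ‖baryGrad h.simplex.basis z‖ * (σ * diam (hull K)) ≤ h.simplex.basis.coord z c := by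
  haveI := h.simplex.nontrivial hn
  have hg := norm_pos_iff.2 (baryGrad_ne_zero h.simplex.basis z)
  set N := outNormal h.simplex.basis z with hN
  have hN1 : ‖N‖ = 1 := norm_outNormal _ _
  set ρ := σ * diam (hull K) with hρ
  have hρ0 : 0 ≤ ρ := mul_nonneg h.sigma_pos.le h.diam_pos.le
  have hmem : c + ρ • N ∈ hull K := by
    refine h.ball ?_
    rw [mem_closedBall_iff_norm, add_sub_cancel_left, norm_smul, hN1, mul_one,
      Real.norm_of_nonneg hρ0]
  have h1 := h.simplex.mem_hull_iff.1 hmem z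
  have h2 := linear_coord_sub h.simplex.basis z (c + ρ • N) c
  have h3 := inner_outNormal h.simplex.basis z N
  rw [← hN, real_inner_self_eq_norm_sq, hN1] at h3
  rw [add_sub_cancel_left, map_smul, smul_eq_mul] at h2
  have h4 : (h.simplex.basis.coord z).linear N = -‖baryGrad h.simplex.basis z‖ := by
    field_simp at h3
    linarith
  rw [h4] at h2
  nlinarith

end ShapeReg

open Classical in
/-- The surface measure of a facet is `n` times the volume over the height. -/
lemma IsNSimplex.surf_facet {K : Finset (Euc n)} (h : IsNSimplex K) (hn : 0 < n) (z : K) : (surf n).real (hull (K.erase z)) =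
      n * (volume : Measure (Euc n)).real (hull K) * ‖baryGrad h.basis z‖ := by
  haveI := h.nontrivial hn
  have hg := norm_pos_iff.2 (baryGrad_ne_zero h.basis z)
  have hlip : ∀ i, LocallyLipschitz fun x : Euc n => (x - z) i := fun i => by
    have : (fun x : Euc n => (x - z) i) ∈ polySpace n 1 := by
      have h2 : (fun x : Euc n => (x - z) i) = (fun x : Euc n => x i) - fun _ => (z : Euc n) i := by
        ext; simp
      rw [h2]
      exact Submodule.sub_mem _ (polySpace_coord i) (polySpace_const _)
    exact polySpace_locallyLipschitz this
  have hgreen := h.green_field hn (φ := fun _ => 1) (U := fun x i => (x - z) i)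
    (LocallyLipschitz.const 1) hlip
  have hflux : ∀ f x, flux (fun x i => (x - z) i) K f x =
      inner ℝ (facetNormal K f) (x - z) := fun f x => by simp [flux, PiLp.inner_apply, mul_comm]
  have hdiv : ∀ x, divPt (fun (x : Euc n) i => (x - z) i) x = n := fun x => by
    have : ∀ i, lineDeriv ℝ (fun y : Euc n => (y - z) i) x (stdVec i) = 1 := fun i => by
      have h1 : HasDerivAt (fun t : ℝ => (x + t • stdVec i - z) i) 1 0 := by
        have : (fun t : ℝ => (x + t • stdVec i - z) i) = fun t => (x i - (z : Euc n) i) + t := by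
          ext t; simp; ring
        rw [this]
        exact (hasDerivAt_id 0).const_add _
      exact h1.deriv
    simp only [divPt, this]
    simp
  have hconst : ∀ x t : Euc n, lineDeriv ℝ (fun _ : Euc n => (1 : ℝ)) x t = 0 := fun x t => by
    simp [lineDeriv]
  simp only [hflux, hdiv, one_mul, hconst, zero_mul, Finset.sum_const_zero,
    integral_zero, zero_add] at hgreen
  rw [sum_eq_single (K.erase z.1)] at hgreen
  · have h1 : ∀ x ∈ hull (K.erase z.1), inner ℝ (facetNormal K (K.erase z)) (x - z) =
        ‖baryGrad h.basis z‖⁻¹ := fun x hx => by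
      have h2 := coord_eq_neg_inner h hn z z hx
      have h3 := h.basis.coord_apply_eq z
      rw [h.basis_apply] at h3
      rw [h3, ← neg_sub, inner_neg_right] at h2
      refine eq_inv_of_mul_eq_one_left ?_
      linarith
    rw [setIntegral_congr_fun (measurableSet_hull _) h1] at hgreen
    simp only [integral_const, smul_eq_mul, measureReal_restrict_apply MeasurableSet.univ,
      univ_inter] at hgreen
    field_simp at hgreen
    linarith
  · intro f hf hne
    have hz : (z : Euc n) ∈ hull f := by
      obtain ⟨w, rfl⟩ := exists_eq_erase h hf
      refine subset_convexHull ℝ _ (Finset.mem_coe.2 (mem_erase.2 ⟨fun h' => hne ?_, z.2⟩))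
      rw [h']
    rw [setIntegral_congr_fun (g := fun _ => 0) (measurableSet_hull f)]
    · simp
    · intro x hx
      exact inner_facetNormal_eq_zero h hn hf hx hz
  · exact fun h' => absurd (erase_mem_powersetCard h z) h'


variable {n s : ℕ}

lemma norm_sub_le_diam {K : Finset (Euc n)} (x y : K) : ‖(x : Euc n) - y‖ ≤ diam (hull K) := by
  rw [← dist_eq_norm]
  exact Metric.dist_le_diam_of_mem (isCompact_hull K).isBounded (subset_convexHull ℝ _ x.2)
    (subset_convexHull ℝ _ y.2)

lemma IsNSimplex.norm_le {K : Finset (Euc n)} (hK : IsNSimplex K) (t : Euc n) :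
    ‖t‖ ≤ diam (hull K) * ∑ z, |(hK.basis.coord z).linear t| := by
  obtain ⟨k⟩ : Nonempty K := hK.basis.nonempty
  conv_lhs => rw [← sum_linear_coord_smul hK.basis k t]
  rw [mul_sum]
  refine norm_sum_le_of_le _ fun z _ => ?_
  rw [norm_smul, mul_comm]
  exact mul_le_mul_of_nonneg_right (norm_sub_le_diam z k) (abs_nonneg _)

open Classical in
/-- Any two simplices are affinely equivalent. Volume integrals are multiplied by the determinant
`D`, and surface integrals also by the quotient of the lengths of the gradients of the barycentric
coordinates. -/
lemma IsNSimplex.exists_transport {K L : Finset (Euc n)} (hK : IsNSimplex K) (hL : IsNSimplex L)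
    (hn : 0 < n) : ∃ (p : Euc n) (B : Euc n ≃ₗ[ℝ] Euc n) (e : K ≃ L) (D : ℝ), 0 < D ∧ (∀ z : K, p + B z = e z) ∧
      (∀ z y, hL.basis.coord (e z) (p + B y) = hK.basis.coord z y) ∧
      (∀ g : Euc n → ℝ, ∫ x in hull L, g x = D * ∫ y in hull K, g (p + B y)) ∧
      (∀ z, hull (L.erase (e z)) = (fun y => p + B y) '' hull (K.erase z)) ∧
      ∀ (z : K) (g : Euc n → ℝ), ‖baryGrad hK.basis z‖ * ∫ x in hull (L.erase (e z)), g x ∂(surf n) =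
        D * ‖baryGrad hL.basis (e z)‖ * ∫ y in hull (K.erase z), g (p + B y) ∂(surf n) := by
  obtain ⟨k⟩ : Nonempty K := hK.basis.nonempty
  let e : K ≃ L := Finset.equivOfCardEq (hK.2.trans hL.2.symm)
  let B : Euc n ≃ₗ[ℝ] Euc n := (hK.basis.basisOf k).equiv (hL.basis.basisOf (e k))
    (e.subtypeEquiv fun _ => e.injective.ne_iff.symm)
  set p : Euc n := e k - B k with hp
  let A : Euc n →ᵃ[ℝ] Euc n := AffineMap.const ℝ _ p + B.toLinearMap.toAffineMap
  have hA : ⇑A = fun y => p + B y := rfl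
  have hv : ∀ z : K, p + B z = e z := fun z => by
    rcases eq_or_ne z k with rfl | hz
    · exact sub_add_cancel ..
    · have h := (hK.basis.basisOf k).equiv_apply ⟨z, hz⟩ (hL.basis.basisOf (e k))
        (e.subtypeEquiv fun _ => e.injective.ne_iff.symm)
      rw [AffineBasis.basisOf_apply, AffineBasis.basisOf_apply] at h
      change B (z.1 - k) = (e z : Euc n) - e k at h
      rw [map_sub] at h
      rw [hp, sub_add_eq_add_sub, add_sub_assoc, h, add_sub_cancel]
  have himg : ∀ t : Set (Euc n), (fun y => p + B y) '' convexHull ℝ t =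
    convexHull ℝ ((fun y => p + B y) '' t) := fun t => hA ▸ A.image_convexHull t
  have hinj : Function.Injective fun y => p + B y := (add_right_injective p).comp B.injective
  have hKL : (fun y => p + B y) '' K = L := by
    ext x
    constructor
    · rintro ⟨y, hy, rfl⟩
      exact mem_of_eq_of_mem (hv ⟨y, hy⟩) (e ⟨y, hy⟩).2
    · exact fun hx => ⟨e.symm ⟨x, hx⟩, (e.symm ⟨x, hx⟩).2, by simp [hv]⟩
  have hvol : ∀ g : Euc n → ℝ, ∫ x in hull L, g x =
      |LinearMap.det B.toLinearMap| * ∫ y in hull K, g (p + B y) := fun g => by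
    rw [hull, ← hKL, ← himg]
    exact setIntegral_affine_image p B.toLinearMap B.injective (measurableSet_hull K) g
  have hD : 0 < |LinearMap.det B.toLinearMap| := abs_pos.2 B.isUnit_det'.ne_zero
  have hf : ∀ z, hull (L.erase (e z)) = (fun y => p + B y) '' hull (K.erase z) := fun z => by
    rw [himg, hull, Finset.coe_erase, Finset.coe_erase, image_diff hinj, hKL, image_singleton, hv]
  refine ⟨p, B, e, _, hD, hv, fun z y => ?_, hvol, hf, fun z g => ?_⟩
  · conv_lhs => rw [← hK.basis.linear_combination_coord_eq_self y]
    have h := affine_sum ((hL.basis.coord (e z)).comp A) Finset.univ (fun w => hK.basis.coord w y)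
      hK.basis (hK.basis.sum_coord_apply_eq_one y)
    have h1 : ∀ w, (hL.basis.coord (e z)).comp A (hK.basis w) = if z = w then 1 else 0 := fun w => by
      change hL.basis.coord (e z) (p + B w) = _
      rw [hv]
      exact (hL.basis.coord_apply _ (e w)).trans (by simp)
    simp only [h1, mul_ite, mul_one, mul_zero, Finset.sum_ite_eq, Finset.mem_univ, if_true] at h
    exact h
  · have hz := mem_powersetCard.1 (erase_mem_powersetCard hK z)
    obtain ⟨q, M, hM, hqM⟩ := facet_param (hK.1.mono hz.1) hn hz.2
    have h1 : ∀ g : Euc n → ℝ, ∫ y in hull (K.erase z), g y ∂(surf n) =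
        M.normDet * ∫ y in refSimplex (n - 1), g (q + M y) := fun g => by
      rw [hqM]; exact integral_hausdorff_image q M hM measurableSet_refSimplex g
    have h2 : ∀ g : Euc n → ℝ, ∫ y in hull (L.erase (e z)), g y ∂(surf n) =
        (B.toLinearMap ∘ₗ M).normDet * ∫ y in refSimplex (n - 1), g (p + B (q + M y)) := fun g => by
      have := integral_hausdorff_image (p + B q) (B.toLinearMap ∘ₗ M) (B.injective.comp hM)
        measurableSet_refSimplex g
      rw [hf, hqM, image_image]
      simpa [add_assoc] using this
    have h3 := h1 fun _ => 1
    have h4 := h2 fun _ => 1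
    have h5 := hvol fun _ => 1
    simp only [integral_const, measureReal_restrict_apply MeasurableSet.univ, univ_inter, smul_eq_mul,
      mul_one] at h3 h4 h5
    rw [hK.surf_facet hn] at h3
    rw [hL.surf_facet hn, h5] at h4
    rw [h1, h2]
    refine mul_left_cancel₀ (mul_pos (Nat.cast_pos.2 hn) hK.volume_pos).ne' ?_
    linear_combination (∫ y in refSimplex (n - 1), g (p + B (q + M y))) *
      ((B.toLinearMap ∘ₗ M).normDet * h3 - M.normDet * h4)

lemma polySpace_transport {p : Euc n → ℝ} (hp : p ∈ polySpace n s) q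
    (B : Euc n →ₗ[ℝ] Euc n) : (fun y => p (q + B y)) ∈ polySpace n s :=
  polySpace_comp hp (A := fun y => q + B y) fun j => polySpace_affine
    ((EuclideanSpace.proj j : Euc n →L[ℝ] ℝ).toLinearMap.toAffineMap.comp
      (AffineMap.const ℝ _ q + B.toAffineMap))

lemma fderiv_transport {p : Euc n → ℝ} (hp : p ∈ polySpace n s) q
    (B : Euc n →ₗ[ℝ] Euc n) (y t : Euc n) :
    fderiv ℝ (fun y => p (q + B y)) y t = fderiv ℝ p (q + B y) (B t) := by
  have h := (polySpace_differentiable hp (q + B y)).hasFDerivAt.comp y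
    ((LinearMap.toContinuousLinearMap B).hasFDerivAt.const_add q)
  exact DFunLike.congr_fun h.fderiv t

lemma ShapeReg.norm_baryGrad_mul_le {σ : ℝ} {K : Finset (Euc n)} {c : Euc n} (h : ShapeReg σ K c)
    (hn : 0 < n) (z : K) : ‖baryGrad h.simplex.basis z‖ * (σ * diam (hull K)) ≤ 1 :=
  (h.norm_baryGrad_le hn z).trans (h.coord_le_one
    (h.ball (Metric.mem_closedBall_self (mul_pos h.sigma_pos h.diam_pos).le)) z)

/-- The inverse of the linear part of a map onto a shape regular simplex. -/
lemma ShapeReg.norm_symm_le {σ : ℝ} {K₀ K : Finset (Euc n)} {c : Euc n} (h : ShapeReg σ K c)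
    (h₀ : IsNSimplex K₀) (hn : 0 < n) {q : Euc n} {B : Euc n ≃ₗ[ℝ] Euc n} {e : K₀ ≃ K}
    (hco : ∀ z y, h.simplex.basis.coord (e z) (q + B y) = h₀.basis.coord z y) (t : Euc n) :
    ‖B.symm t‖ * diam (hull K) ≤ diam (hull K₀) * (n + 1) / σ * ‖t‖ := by
  have hd := h.diam_pos
  have hσ := h.sigma_pos
  have h1 : ∀ z, |(h₀.basis.coord z).linear (B.symm t)| ≤ ‖t‖ / (σ * diam (hull K)) :=
      fun z => by
    have h2 := linear_coord_sub h₀.basis z (B.symm t) 0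
    rw [sub_zero, ← hco, ← hco, ← linear_coord_sub, add_sub_add_left_eq_sub, map_zero, sub_zero,
      B.apply_symm_apply] at h2
    rw [h2, ← inner_baryGrad, le_div_iff₀ (by positivity)]
    have h4 := abs_real_inner_le_norm (baryGrad h.simplex.basis (e z)) t
    calc _ ≤ ‖baryGrad h.simplex.basis (e z)‖ * ‖t‖ * (σ * diam (hull K)) := by gcongr
      _ = ‖baryGrad h.simplex.basis (e z)‖ * (σ * diam (hull K)) * ‖t‖ := by ring
      _ ≤ _ := mul_le_of_le_one_left (norm_nonneg _) (h.norm_baryGrad_mul_le hn (e z))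
  have h2 := (h₀.norm_le (B.symm t)).trans (mul_le_mul_of_nonneg_left
    (sum_le_sum fun z _ => h1 z) diam_nonneg)
  rw [sum_const, card_univ, Fintype.card_coe, h₀.2, nsmul_eq_mul] at h2
  refine (mul_le_mul_of_nonneg_right h2 hd.le).trans_eq ?_
  push_cast
  field_simp

/-- Pointwise bounds for polynomials on shape regular simplices in terms of the volume. -/
lemma exists_pointwise_inverse (n s : ℕ) (hn : 0 < n) {σ : ℝ} (hσ : 0 < σ) : ∃ C : ℝ, 0 < C ∧
    ∀ (K : Finset (Euc n)) (c : Euc n), ShapeReg σ K c → ∀ p ∈ polySpace n s, ∀ y ∈ hull K,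
      (volume : Measure (Euc n)).real (hull K) * p y ^ 2 ≤ C * ∫ x in hull K, p x * p x ∧
      ∀ t : Euc n, volume.real (hull K) * diam (hull K) ^ 2 *
        (fderiv ℝ p y t) ^ 2 ≤ C * ‖t‖ ^ 2 * ∫ x in hull K, p x * p x := by
  by_cases hex : ∃ K₀ : Finset (Euc n), IsNSimplex K₀
  swap
  · exact ⟨1, one_pos, fun K c hK => absurd ⟨K, hK.simplex⟩ hex⟩
  obtain ⟨K₀, h₀⟩ := hex
  obtain ⟨C, hC, hsup⟩ := h₀.exists_sup_bound s
  set V₀ := volume.real (hull K₀) with hV₀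
  have hV0 : 0 < V₀ := h₀.volume_pos
  set m := diam (hull K₀) * (n + 1) / σ with hm
  refine ⟨V₀ * C + V₀ * C * m ^ 2, by positivity, fun K c hK p hp y hy => ?_⟩
  obtain ⟨q, B, e, D, hD, -, hco, hvol, -, -⟩ := h₀.exists_transport hK.simplex hn
  have hB : ∀ z, q + B (B.symm (z - q)) = z := fun z => by simp
  have hV : volume.real (hull K) = D * V₀ := by
    simpa [measureReal_restrict_apply MeasurableSet.univ] using hvol fun _ => 1
  have hy0 : B.symm (y - q) ∈ hull K₀ := h₀.mem_hull_iff.2 fun z => by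
    rw [← hco, hB]; exact hK.simplex.mem_hull_iff.1 hy _
  have hmem : (fun z => p (q + B z)) ∈ polySpace n s := polySpace_transport hp q B
  obtain ⟨h1, h2⟩ := hsup ⟨_, hmem⟩ _ hy0
  have hI : ∫ x in hull K, p x * p x =
      D * pairForm s _ (integrable_hull K₀) ⟨_, hmem⟩ ⟨_, hmem⟩ := hvol fun x => p x * p x
  have hI0 : 0 ≤ pairForm s _ (integrable_hull K₀) ⟨_, hmem⟩ ⟨_, hmem⟩ :=
    integral_nonneg fun x => mul_self_nonneg _
  rw [hI, hV]
  set I := pairForm s _ (integrable_hull K₀) ⟨_, hmem⟩ ⟨_, hmem⟩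
  have hd := hK.diam_pos
  refine ⟨?_, fun t => ?_⟩
  · simp only [hB] at h1
    have := mul_le_mul_of_nonneg_left h1 (mul_pos hD hV0).le
    have : 0 ≤ V₀ * C * m ^ 2 * (D * I) := by positivity
    linarith
  · have h3 : ‖B.symm t‖ * diam (hull K) ≤ m * ‖t‖ := hK.norm_symm_le h₀ hn hco t
    have h4 := h2 (B.symm t)
    have h6 := fderiv_transport hp q B (B.symm (y - q)) (B.symm t)
    simp only [LinearEquiv.coe_coe, B.apply_symm_apply, add_sub_cancel] at h6
    rw [h6] at h4
    have h5 := pow_le_pow_left₀ (by positivity) h3 2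
    calc D * V₀ * diam (hull K) ^ 2 * fderiv ℝ p y t ^ 2
        ≤ D * V₀ * diam (hull K) ^ 2 * (C * I * ‖B.symm t‖ ^ 2) :=
          mul_le_mul_of_nonneg_left h4 (by positivity)
      _ = D * V₀ * C * I * (‖B.symm t‖ * diam (hull K)) ^ 2 := by ring
      _ ≤ D * V₀ * C * I * (m * ‖t‖) ^ 2 := by gcongr
      _ = (V₀ * C * m ^ 2) * ‖t‖ ^ 2 * (D * I) := by ring
      _ ≤ _ := by gcongr; linarith [mul_pos hV0 hC]

/-- The integral over a simplex or a facet is at most the supremum times the measure. -/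
lemma setIntegral_le {X : Type*} [MeasurableSpace X] {μ : Measure X} {S : Set X} (hS : μ S < ⊤)
    {g : X → ℝ} {M : ℝ} (h0 : ∀ x ∈ S, 0 ≤ g x) (h : ∀ x ∈ S, g x ≤ M) :
    ∫ x in S, g x ∂μ ≤ M * μ.real S :=
  (Real.le_norm_self _).trans (norm_setIntegral_le_of_norm_le_const hS fun x hx => by
    rw [Real.norm_of_nonneg (h0 x hx)]; exact h x hx)

/-- Inverse and trace estimates for polynomial fields on shape regular simplices. -/
lemma exists_inverse_estimates (n s : ℕ) (hn : 0 < n) {σ κ : ℝ} (hσ : 0 < σ) (hκ : 0 < κ) :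
    ∃ C : ℝ, 1 ≤ C ∧ ∀ {K : Finset (Euc n)} {c : Euc n} {h : ℝ}, ShapeReg σ K c → 0 < h →
      κ * h ≤ diam (hull K) → ∀ {v : Euc n → Fin n → ℝ}, (∀ i, (fun x => v x i) ∈ polySpace n s) →
      (∀ y ∈ hull K, ∀ i, h ^ n * v y i ^ 2 ≤ C * ∫ x in hull K, ∑ i, v x i ^ 2) ∧
      (∀ y ∈ hull K, ∀ i j, h ^ (n + 2) * ∇ v y i j ^ 2 ≤
        C * ∫ x in hull K, ∑ i, v x i ^ 2) ∧
      (h ^ 2 * ∫ x in hull K, ∑ i, ∑ j, ∇ v x i j ^ 2) ≤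
        C * (∫ x in hull K, ∑ i, v x i ^ 2) ∧
      h * ∑ f ∈ K.powersetCard n, ∫ x in hull f, ∑ i, v x i ^ 2 ∂(surf n) ≤
        C * ∫ x in hull K, ∑ i, v x i ^ 2 := by
  classical
  obtain ⟨C, hC, hp⟩ := exists_pointwise_inverse n s hn hσ
  set V₁ := (volume : Measure (Euc n)).real (closedBall 0 1) with hV₁
  have hV1 : 0 < V₁ := ENNReal.toReal_pos (Metric.measure_closedBall_pos _ _ one_pos).ne'
    (isCompact_closedBall _ _).measure_lt_top.ne
  have c1 : 0 ≤ C / ((κ * σ) ^ n * V₁) := by positivity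
  have c2 : 0 ≤ C / ((κ * σ) ^ n * V₁ * κ ^ 2) := by positivity
  have c3 : 0 ≤ n * (n * C) / κ ^ 2 := by positivity
  have c4 : 0 ≤ (n + 1) * (n * (n * C) / (κ * σ)) := by positivity
  refine ⟨1 + C / ((κ * σ) ^ n * V₁) + C / ((κ * σ) ^ n * V₁ * κ ^ 2) + n * (n * C) / κ ^ 2 +
    (n + 1) * (n * (n * C) / (κ * σ)), by linarith, fun {K c h} hK hh hd v hv => ?_⟩
  have hd0 := hK.diam_pos
  have hV0 := hK.simplex.volume_pos
  have hvc : ∀ i, Continuous fun x => v x i := fun i => polySpace_continuous (hv i)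
  set d := diam (hull K)
  set V := (volume : Measure (Euc n)).real (hull K) with hV
  set S := ∫ x in hull K, ∑ i, v x i ^ 2
  have hS0 : 0 ≤ S := integral_nonneg fun x => sum_nonneg fun _ _ => sq_nonneg _
  have hS : ∀ i, ∫ x in hull K, v x i * v x i ≤ S := fun i =>
    integral_mono (integrable_hull K _ (by fun_prop)) (integrable_hull K _ (by fun_prop)) fun x => by
      simpa only [sq] using single_le_sum (f := fun i => v x i ^ 2) (fun _ _ => sq_nonneg _)
        (Finset.mem_univ i)
  have hVd : (κ * σ) ^ n * V₁ * h ^ n ≤ V := by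
    have h1 := measureReal_mono (μ := volume) hK.ball (isCompact_hull K).measure_lt_top.ne
    rw [Measure.addHaar_real_closedBall' _ _ (mul_pos hσ hd0).le, finrank_euclideanSpace_fin] at h1
    refine le_trans (le_of_eq_of_le ?_ (mul_le_mul_of_nonneg_right (pow_le_pow_left₀ (by positivity)
      (mul_le_mul_of_nonneg_left hd hσ.le) n) hV1.le)) h1
    ring
  have h1 : ∀ y ∈ hull K, ∀ i, V * v y i ^ 2 ≤ C * S := fun y hy i =>
    ((hp K c hK _ (hv i) y hy).1).trans (mul_le_mul_of_nonneg_left (hS i) hC.le)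
  have h2 : ∀ y ∈ hull K, ∀ i j, V * d ^ 2 * ∇ v y i j ^ 2 ≤ C * S := by
    intro y hy i j
    rw [(polySpace_differentiable (hv i) y).lineDeriv_eq_fderiv]
    refine ((hp K c hK _ (hv i) y hy).2 (stdVec j)).trans ?_
    rw [show ‖(stdVec j : Euc n)‖ = 1 by simp [stdVec], one_pow, mul_one]
    exact mul_le_mul_of_nonneg_left (hS i) hC.le
  have fin : ∀ {a b : ℝ}, a ≤ b * S → b ≤ 1 + C / ((κ * σ) ^ n * V₁) +
      C / ((κ * σ) ^ n * V₁ * κ ^ 2) + n * (n * C) / κ ^ 2 + (n + 1) * (n * (n * C) / (κ * σ)) →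
      a ≤ _ * S := fun h1 h2 => h1.trans (mul_le_mul_of_nonneg_right h2 hS0)
  refine ⟨fun y hy i => fin (b := C / ((κ * σ) ^ n * V₁)) ?_ (by linarith), fun y hy i j =>
    fin (b := C / ((κ * σ) ^ n * V₁ * κ ^ 2)) ?_ (by linarith),
    fin (b := n * (n * C) / κ ^ 2) ?_ (by linarith),
    fin (b := (n + 1) * (n * (n * C) / (κ * σ))) ?_ (by linarith)⟩
  · rw [div_mul_eq_mul_div, le_div_iff₀ (by positivity)]
    refine le_trans ?_ (h1 y hy i)
    rw [mul_right_comm, mul_comm (h ^ n)]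
    exact mul_le_mul_of_nonneg_right hVd (sq_nonneg _)
  · rw [div_mul_eq_mul_div, le_div_iff₀ (by positivity)]
    refine le_of_eq_of_le ?_ ((mul_le_mul_of_nonneg_right (mul_le_mul hVd (pow_le_pow_left₀
      (by positivity) hd 2) (by positivity) hV0.le) (sq_nonneg _)).trans (h2 y hy i j))
    ring
  · have h3 : ∫ x in hull K, ∑ i, ∑ j, ∇ v x i j ^ 2 ≤
        n * (n * (C * S / (V * d ^ 2))) * V := by
      refine setIntegral_le (isCompact_hull K).measure_lt_top
        (fun _ _ => sum_nonneg fun _ _ => sum_nonneg fun _ _ => sq_nonneg _) fun x hx => ?_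
      refine (sum_le_sum fun i _ => sum_le_sum fun j _ =>
        (le_div_iff₀' (by positivity)).2 (h2 x hx i j)).trans_eq ?_
      simp only [sum_const, card_univ, Fintype.card_fin, nsmul_eq_mul]
    calc _ ≤ h ^ 2 * (n * (n * (C * S / (V * d ^ 2))) * V) := by gcongr
      _ = h ^ 2 * κ ^ 2 * (n * (n * C) * S / (κ ^ 2 * d ^ 2)) := by field_simp
      _ ≤ d ^ 2 * (n * (n * C) * S / (κ ^ 2 * d ^ 2)) := by
        gcongr
        rw [← mul_pow, mul_comm]
        gcongr
      _ = _ := by field_simp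
  · have h3 : ∀ z : K, h * ∫ x in hull (K.erase z), ∑ i, v x i ^ 2 ∂(surf n) ≤
        n * (n * C) / (κ * σ) * S := fun z => by
      have h4 := setIntegral_le (g := fun x => ∑ i, v x i ^ 2) (M := n * (C * S / V))
        (surf_hull_lt_top (hK.simplex.1.mono (erase_subset _ _)) hn
          (mem_powersetCard.1 (erase_mem_powersetCard hK.simplex z)).2)
        (fun _ _ => sum_nonneg fun _ _ => sq_nonneg _) fun x hx => by
          refine (sum_le_sum fun i _ => (le_div_iff₀' hV0).2
            (h1 x (hull_mono (erase_subset _ _) hx) i)).trans_eq ?_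
          simp only [sum_const, card_univ, Fintype.card_fin, nsmul_eq_mul]
      rw [hK.simplex.surf_facet hn] at h4
      have h5 : ‖baryGrad hK.simplex.basis z‖ * (σ * (κ * h)) ≤ 1 := le_trans (by gcongr)
        (hK.norm_baryGrad_mul_le hn z)
      calc _ ≤ h * (n * (C * S / V) * (n * V * ‖baryGrad hK.simplex.basis z‖)) := by gcongr
        _ = ‖baryGrad hK.simplex.basis z‖ * (σ * (κ * h)) * (n * (n * C) / (κ * σ) * S) := by field_simp
        _ ≤ _ := mul_le_of_le_one_left (by positivity) h5
    rw [sum_facets hK.simplex, mul_sum]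
    refine (sum_le_sum fun z _ => h3 z).trans_eq ?_
    rw [sum_const, card_univ, Fintype.card_coe, hK.simplex.2, nsmul_eq_mul]
    push_cast
    ring

section Multiplier

variable {n s : ℕ}

open Classical in
/-- The surface measure on a facet (and zero on sets that are not facets). -/
noncomputable def faceMeas (f : Finset (Euc n)) : Measure (Euc n) :=
  if surf n (hull f) < ⊤ then (surf n).restrict (hull f) else 0

lemma faceMeas_eq {K f : Finset (Euc n)} (hK : IsNSimplex K) (hn : 0 < n)
    (hf : f ∈ K.powersetCard n) : faceMeas f = (surf n).restrict (hull f) := by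
  have hf' := mem_powersetCard.1 hf
  rw [faceMeas, if_pos (surf_hull_lt_top (hK.1.mono hf'.1) hn hf'.2)]

lemma integrable_faceMeas (f : Finset (Euc n)) (g : Euc n → ℝ) (hg : Continuous g) :
    Integrable g (faceMeas f) := by
  rw [faceMeas]
  split_ifs with h
  · obtain ⟨C, hC⟩ := (isCompact_hull f).exists_bound_of_continuousOn hg.continuousOn
    exact Measure.integrableOn_of_bounded h.ne hg.aestronglyMeasurable
      (ae_restrict_of_forall_mem (measurableSet_hull f) hC)
  simp

lemma facet_eq_zero_of_integral_sq {K f : Finset (Euc n)} (hK : IsNSimplex K) (hn : 0 < n)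
    (hf : f ∈ K.powersetCard n) {g : Euc n → ℝ} (hg : Continuous g)
    (h : ∫ x in hull f, g x * g x ∂(surf n) = 0) : ∀ x ∈ hull f, g x = 0 := by
  have hf' := mem_powersetCard.1 hf
  intro x hx
  by_contra hne
  have hU : IsOpen {y | g y ≠ 0} := isOpen_ne_fun hg continuous_const
  have h1 := surf_hull_inter_pos (hK.1.mono hf'.1) hn hf'.2 hU ⟨x, hx, hne⟩
  have h2 := (integral_eq_zero_iff_of_nonneg (fun x => mul_self_nonneg (g x))
    (integrableOn_facet hK hn hf (hg.mul hg))).1 h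
  have h3 : ∀ᵐ y ∂((surf n).restrict (hull f)), y ∉ {y | g y ≠ 0} := by
    filter_upwards [h2] with y hy
    simp_all
  rw [← measure_eq_zero_iff_ae_notMem, Measure.restrict_apply hU.measurableSet, inter_comm] at h3
  simp_all

/-- Polynomials of degree at most `s - 1` as polynomials of degree at most `s`. -/
noncomputable def polyIncl (n s : ℕ) : polySpace n (s - 1) →ₗ[ℝ] polySpace n s :=
  Submodule.inclusion fun _ h => polySpace_mono (Nat.sub_le s 1) h

/-- The `L²` inner product of polynomial fields on a simplex. -/
noncomputable def cellInner (s : ℕ) (K : Finset (Euc n)) :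
    LinearMap.BilinForm ℝ (Fin n → polySpace n s) :=
  LinearMap.mk₂ ℝ (fun v w => ∑ i, pairForm s _ (integrable_hull K) (v i) (w i))
    (fun v v' w => by simp [sum_add_distrib]) (fun c v w => by simp [mul_sum])
    (fun v w w' => by simp [sum_add_distrib]) (fun c v w => by simp [mul_sum])

/-- The pairing of polynomial fields on a simplex with a multiplier `φ` for the divergence and
multipliers `ψ` for the normal components on the facets. -/
noncomputable def cellForm (s : ℕ) (K : Finset (Euc n)) :
    (polySpace n (s - 1) × (Finset (Euc n) → polySpace n s)) →ₗ[ℝ]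
      (Fin n → polySpace n s) →ₗ[ℝ] ℝ :=
  LinearMap.mk₂ ℝ (fun m v =>
      ∑ i, pairForm s _ (integrable_hull K) (polyD s (stdVec i) (polyIncl n s m.1)) (v i) +
      ∑ f ∈ K.powersetCard n, ∑ i, facetNormal K f i *
        pairForm s _ (integrable_faceMeas f) (m.2 f) (v i))
    (fun m m' v => by
      simp only [Prod.fst_add, Prod.snd_add, Pi.add_apply, map_add, LinearMap.add_apply, mul_add,
        sum_add_distrib]
      ring)
    (fun c m v => by
      simp only [Prod.smul_fst, Prod.smul_snd, Pi.smul_apply, map_smul, LinearMap.smul_apply,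
        smul_eq_mul, mul_sum, mul_add, mul_left_comm c])
    (fun m v v' => by
      simp only [Pi.add_apply, map_add, mul_add, sum_add_distrib]
      ring)
    (fun c m v => by
      simp only [Pi.smul_apply, map_smul, smul_eq_mul, mul_sum, mul_add, mul_left_comm c])

lemma cellInner_apply K (v w : Fin n → polySpace n s) : cellInner s K v w =
    ∫ x in hull K, ∑ i, v i x * w i x := by
  rw [integral_finset_sum _ fun i _ => integrable_hull K _ (by fun_prop)]
  rfl

lemma cellInner_self_nonneg K (v : Fin n → polySpace n s) :
    0 ≤ cellInner s K v v := by
  rw [cellInner_apply]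
  exact integral_nonneg fun x => sum_nonneg fun i _ => mul_self_nonneg _

lemma cellForm_apply {K : Finset (Euc n)} (hK : IsNSimplex K) (hn : 0 < n)
    (φ : polySpace n (s - 1)) (ψ : Finset (Euc n) → polySpace n s) (v : Fin n → polySpace n s) :
    cellForm s K (φ, ψ) v =
      (∫ x in hull K, ∑ i, fderiv ℝ φ.1 x (stdVec i) * (v i).1 x) +
      ∑ f ∈ K.powersetCard n, ∫ x in hull f,
        (ψ f).1 x * flux (fun x i => (v i).1 x) K f x ∂(surf n) := by
  refine congrArg₂ _ (integral_finset_sum _ fun i _ => integrable_hull K _ (by fun_prop)).symm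
    (sum_congr rfl fun f hf => ?_)
  rw [← faceMeas_eq hK hn hf]
  simp only [flux, mul_sum]
  rw [integral_finset_sum _ fun i _ => integrable_faceMeas f _ (by fun_prop)]
  simp only [pairForm_apply, ← integral_const_mul, mul_left_comm]

/-- Fields of the form `a τ` with a scalar polynomial `a` and a vector `τ`. -/
lemma cellForm_smul (K : Finset (Euc n)) (φ : polySpace n (s - 1))
    (ψ : Finset (Euc n) → polySpace n s) (τ : Euc n) (a : polySpace n s) :
    cellForm s K (φ, ψ) (fun i => τ i • a) =
      pairForm s _ (integrable_hull K) (polyD s τ (polyIncl n s φ)) a +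
      ∑ f ∈ K.powersetCard n, inner ℝ (facetNormal K f) τ *
        pairForm s _ (integrable_faceMeas f) (ψ f) a := by
  refine congrArg₂ _ ?_ (sum_congr rfl fun f _ => ?_)
  · have : polyD s τ (polyIncl n s φ) = ∑ i, τ i • polyD s (stdVec i) (polyIncl n s φ) := by
      ext x
      change fderiv ℝ φ.1 x τ = _
      conv_lhs => rw [← sum_smul_stdVec τ]
      simp [polyD, polyIncl]
    simp_all
  · rw [PiLp.inner_apply, sum_mul]
    exact sum_congr rfl fun i _ => by
      rw [map_smul, smul_eq_mul, ← mul_assoc]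
      simp [mul_comm]

/-- Every polynomial of degree at most `s` is a combination of the barycentric coordinates with
coefficients of degree at most `s - 1`. -/
lemma exists_decomposition {K : Finset (Euc n)} (hK : IsNSimplex K) (hs : 1 ≤ s) {p : Euc n → ℝ}
    (hp : p ∈ polySpace n s) : ∃ h : K → Euc n → ℝ, (∀ j, h j ∈ polySpace n (s - 1)) ∧
      ∀ y, p y = ∑ j, hK.basis.coord j y * h j y := by
  classical
  obtain ⟨q, hq, hpq⟩ := hp
  have hmon : ∀ d ∈ q.support, ∃ h : K → Euc n → ℝ, (∀ j, h j ∈ polySpace n (s - 1)) ∧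
      ∀ y : Euc n, eval (fun j => y j) (MvPolynomial.monomial d (q.coeff d)) =
        ∑ j, hK.basis.coord j y * h j y := by
    intro d hd
    by_cases h0 : d = 0
    · refine ⟨fun _ _ => q.coeff d, fun _ => polySpace_const _, fun y => ?_⟩
      rw [← sum_mul, hK.basis.sum_coord_apply_eq_one, h0]
      simp
    · obtain ⟨k, hk⟩ := Finsupp.ne_iff.1 h0
      set e := d - Finsupp.single k 1 with he
      have hde : d = e + Finsupp.single k 1 :=
        (tsub_add_cancel_of_le (Finsupp.single_le_iff.2 (Nat.one_le_iff_ne_zero.2 hk))).symm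
      have hdeg : (d.sum fun _ i => i) = (e.sum fun _ i => i) + 1 := by
        rw [hde, Finsupp.sum_add_index' (fun _ => rfl) (fun _ _ _ => rfl),
          Finsupp.sum_single_index rfl]
      have hle := (MvPolynomial.le_totalDegree hd).trans hq
      refine ⟨fun j y => (j : Euc n) k * eval (fun j => y j)
        (MvPolynomial.monomial e (q.coeff d)), fun j => Submodule.smul_mem _ _ (eval_mem_polySpace
          ((MvPolynomial.totalDegree_monomial_le _ _).trans
            (by change (e.sum fun _ i => i) ≤ s - 1; omega))), fun y => ?_⟩
      have h1 : y k = ∑ j, hK.basis.coord j y * j.1 k := by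
        conv_lhs => rw [← hK.basis.linear_combination_coord_eq_self y]
        simp [IsNSimplex.basis_apply]
      rw [hde, add_comm, ← one_mul (MvPolynomial.coeff _ q), ← MvPolynomial.monomial_mul, map_mul,
        ← MvPolynomial.X, MvPolynomial.eval_X, h1, sum_mul, one_mul, add_comm, ← hde]
      simp only [mul_assoc]
  choose! h h1 h2 using hmon
  refine ⟨fun j y => ∑ d ∈ q.support, h d j y, fun j => polySpace_sum _ fun d hd => h1 d hd j,
    fun y => ?_⟩
  rw [hpq, q.as_sum, map_sum, ← q.as_sum, sum_congr rfl fun d hd => h2 d hd y,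
    sum_comm]
  simp only [mul_sum]

open Classical in
/-- Multipliers that pair to zero with all fields are trivial. The gradient of `φ` is tested with the
fields `λ_p λ_q (∂_{p - q} φ) (p - q)`, whose normal components vanish, and `ψ` on the facet opposite
to `w` is tested with `λ_j h (j - w)`, whose normal components vanish on the other facets. -/
lemma IsNSimplex.cellForm_injective {K : Finset (Euc n)} (hK : IsNSimplex K) (hn : 0 < n)
    (hs : 2 ≤ s) {φ : polySpace n (s - 1)} {ψ : Finset (Euc n) → polySpace n s}
    (h : cellForm s K (φ, ψ) = 0) : (∀ x t, fderiv ℝ (φ : Euc n → ℝ) x t = 0) ∧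
      ∀ f ∈ K.powersetCard n, ∀ x ∈ hull f, (ψ f : Euc n → ℝ) x = 0 := by
  have hlam : ∀ j, (fun x => hK.basis.coord j x) ∈ polySpace n 1 := fun j => polySpace_affine _
  have hmem : ∀ j k : K, j ≠ k → (j : Euc n) ∈ hull (K.erase k.1) := fun j k hj =>
    subset_convexHull ℝ _ (Finset.mem_coe.2 (mem_erase.2 ⟨fun h => hj (Subtype.ext h), j.2⟩))
  -- on the facet opposite to `k`, a field `a (p - q)` has a nonzero normal component only if `k` is
  -- `p` or `q`
  have hterm : ∀ (k p q : K) (a : polySpace n s),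
      (k = p ∨ k = q → ∀ x ∈ hull (K.erase k.1), a.1 x = 0) →
      inner ℝ (facetNormal K (K.erase k)) (p.1 - q) *
        pairForm s _ (integrable_faceMeas (K.erase k.1)) (ψ (K.erase k)) a = 0 := by
    intro k p q a ha
    by_cases hk : k = p ∨ k = q
    · rw [pairForm_apply, faceMeas_eq hK hn (erase_mem_powersetCard hK k),
        setIntegral_congr_fun (g := fun _ => 0) (measurableSet_hull _) fun x hx => by
          simp [ha hk x hx]]
      simp
    · rw [not_or] at hk
      rw [inner_facetNormal_eq_zero hK hn (erase_mem_powersetCard hK k) (hmem p k (Ne.symm hk.1))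
        (hmem q k (Ne.symm hk.2)), zero_mul]
  have hc0 : ∀ k : K, ∀ x ∈ hull (K.erase k.1), hK.basis.coord k x = 0 := fun k x hx =>
    coord_eq_zero_of_mem_hull hK (erase_subset _ _) hx k (notMem_erase _ _)
  have hD : ∀ (p q : K) x, fderiv ℝ φ.1 x (p.1 - q) = 0 := by
    intro p q
    have hd := polySpace_fderiv φ.2 (p.1 - q)
    have hm : (fun x => hK.basis.coord p x * hK.basis.coord q x *
        fderiv ℝ φ.1 x (p.1 - q)) ∈ polySpace n s :=
      polySpace_mono (by omega) (polySpace_mul (polySpace_mul (hlam p) (hlam q)) hd)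
    have h1 := cellForm_smul K φ ψ (p.1 - q) ⟨_, hm⟩
    rw [h, LinearMap.zero_apply, sum_facets hK, sum_eq_zero fun k _ => hterm k p q _ (by
      rintro (rfl | rfl) x hx <;> simp [hc0 _ x hx]), add_zero, pairForm_apply] at h1
    have hcd := polySpace_continuous hd
    have hcl := fun j => polySpace_continuous (hlam j)
    refine polySpace_eq_zero hd isOpen_interior hK.interior_nonempty fun x hx => ?_
    have h2 := eq_zero_of_setIntegral (g := fun x => fderiv ℝ φ.1 x (p.1 - q) *
      (hK.basis.coord p x * hK.basis.coord q x * fderiv ℝ φ.1 x (p.1 - q)))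
      (hcd.mul (((hcl p).mul (hcl q)).mul hcd)) (isCompact_hull K) (fun x hx => by
        have := mul_nonneg (mul_nonneg (hK.mem_hull_iff.1 hx p) (hK.mem_hull_iff.1 hx q))
          (mul_self_nonneg (fderiv ℝ φ.1 x (p.1 - q)))
        linarith) h1.symm x hx
    rw [hK.interior_hull] at hx
    simpa [(hx p).ne', (hx q).ne'] using h2
  have hφ : ∀ x t, fderiv ℝ φ.1 x t = 0 := fun x t => by
    obtain ⟨k⟩ : Nonempty K := hK.basis.nonempty
    rw [← sum_linear_coord_smul hK.basis k t, map_sum]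
    exact sum_eq_zero fun j _ => by
      rw [map_smul, hK.basis_apply, hK.basis_apply, hD, smul_zero]
  refine ⟨hφ, fun f hf => ?_⟩
  obtain ⟨w, rfl⟩ := exists_eq_erase hK hf
  have hD0 : ∀ τ, polyD s τ (polyIncl n s φ) = 0 := by bound
  have hpair : ∀ (j : K) (a : Euc n → ℝ) (ha : (fun x => hK.basis.coord j x * a x) ∈ polySpace n s), pairForm s _ (integrable_faceMeas (K.erase (w : Euc n))) (ψ (K.erase w))
        ⟨_, ha⟩ = 0 := by
    intro j a ha
    rcases eq_or_ne j w with rfl | hj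
    · rw [pairForm_apply, faceMeas_eq hK hn hf,
        setIntegral_congr_fun (g := fun _ => 0) (measurableSet_hull _) fun x hx => by
          simp [hc0 _ x hx]]
      simp
    · have h1 := cellForm_smul K φ ψ (j.1 - w) ⟨_, ha⟩
      rw [h, LinearMap.zero_apply, sum_facets hK, hD0, map_zero, LinearMap.zero_apply, zero_add,
        sum_eq_single w (fun k _ hk => hterm k j w _ fun hk' x hx => by
          rcases hk' with rfl | rfl
          · simp [hc0 _ x hx]
          · exact absurd rfl hk) (by simp)] at h1
      refine (mul_eq_zero.1 h1.symm).resolve_left fun h0 => ?_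
      have h2 := coord_eq_neg_inner hK hn w w (hmem j w hj)
      have h3 := hK.basis.coord_apply_eq w
      rw [hK.basis_apply, h2, ← neg_sub, inner_neg_right, h0] at h3
      simp at h3
  obtain ⟨a, ha1, ha2⟩ := exists_decomposition hK (by omega : 1 ≤ s) (ψ (K.erase w)).2
  have hla : ∀ j, (fun x => hK.basis.coord j x * a j x) ∈ polySpace n s := fun j =>
    polySpace_mono (by omega) (polySpace_mul (hlam j) (ha1 j))
  have h1 : pairForm s _ (integrable_faceMeas (K.erase w.1)) (ψ (K.erase w))
      (ψ (K.erase w)) = 0 := by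
    have : ψ (K.erase w) = ∑ j, ⟨_, hla j⟩ := by
      ext x
      rw [ha2]
      simp
    conv_lhs => rw [this, map_sum, ← this]
    exact sum_eq_zero fun j _ => hpair j _ (hla j)
  rw [pairForm_apply, faceMeas_eq hK hn hf] at h1
  exact facet_eq_zero_of_integral_sq hK hn hf (continuous_poly _) h1

lemma sq_dot_le (y : Fin n → ℝ) {t : Euc n} {d : ℝ} (ht : ‖t‖ ≤ d) :
    (∑ i, y i * t i) ^ 2 ≤ d ^ 2 * ∑ i, y i ^ 2 := by
  refine (Finset.sum_mul_sq_le_sq_mul_sq _ _ _).trans ?_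
  have h0 : 0 ≤ ∑ i, y i ^ 2 := by positivity
  have h1 : ∑ i, t i ^ 2 ≤ d ^ 2 := by
    rw [← EuclideanSpace.real_norm_sq_eq]
    gcongr
  nlinarith

open Classical in
/-- Bounds for the multipliers on a fixed simplex. -/
lemma IsNSimplex.exists_multiplier_bound {K : Finset (Euc n)} (hK : IsNSimplex K) (hn : 0 < n)
    (hs : 2 ≤ s) : ∃ C : ℝ, 0 < C ∧ ∀ (φ : polySpace n (s - 1)) (ψ : Finset (Euc n) → polySpace n s)
      (z : Fin n → polySpace n s), cellForm s K (φ, ψ) = cellInner s K z →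
      (∀ y ∈ hull K, ∀ t, fderiv ℝ φ.1 y t ^ 2 ≤ C * cellInner s K z z * ‖t‖ ^ 2) ∧
      ∀ f ∈ K.powersetCard n, ∀ y ∈ hull f, (ψ f).1 y ^ 2 ≤ C * cellInner s K z z := by
  have hsym : ∀ v w, cellInner s K v w = cellInner s K w v := fun v w => by
    simp only [cellInner_apply, mul_comm]
  have hnn := cellInner_self_nonneg (s := s) K
  obtain ⟨C₁, hC₁, h₁⟩ := exists_bound_of_dual hsym hnn (cellForm s K)
    (fun q : ↥(hull K ×ˢ closedBall (0 : Euc n) 1) =>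
      polyEval (s - 1) q.1.1 ∘ₗ polyD (s - 1) q.1.2 ∘ₗ LinearMap.fst ℝ _ _)
    (fun m hm q => (hK.cellForm_injective hn hs hm).1 _ _) fun m => exists_sq_bound
      (isCompact_prod_ball K) (g := fun q => fderiv ℝ (m.1 : Euc n → ℝ) q.1 q.2) (by fun_prop)
  have h₂ := fun f : K.powersetCard n => exists_bound_of_dual hsym hnn (cellForm s K)
    (fun y : hull (f : Finset (Euc n)) =>
      polyEval s (y : Euc n) ∘ₗ LinearMap.proj (R := ℝ) (φ := fun _ : Finset (Euc n) => polySpace n s)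
        (f : Finset (Euc n)) ∘ₗ LinearMap.snd ℝ _ _)
    (fun m hm y => (hK.cellForm_injective hn hs hm).2 _ f.2 _ y.2)
    fun m => exists_sq_bound (isCompact_hull _) (continuous_poly (m.2 f))
  choose C₂ hC₂ h₂ using h₂
  have hC : 0 ≤ ∑ f, C₂ f := sum_nonneg fun f _ => (hC₂ f).le
  refine ⟨C₁ + ∑ f, C₂ f, by positivity, fun φ ψ z h => ⟨fun y hy => sq_le_of_unit fun t ht =>
    (h₁ _ z h ⟨(y, t), hy, ht⟩).trans ?_, fun f hf y hy => (h₂ ⟨f, hf⟩ _ z h ⟨y, hy⟩).trans ?_⟩⟩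
  · bound
  · have := single_le_sum (fun f _ => (hC₂ f).le) (Finset.mem_univ (⟨f, hf⟩ : K.powersetCard n))
    bound

open Classical in
/-- Bounds for the multipliers of the divergence and of the normal components. The pairing is
transported to a fixed simplex by the Piola transform `v ↦ B v`. -/
lemma exists_multiplier_bound (n s : ℕ) (hn : 0 < n) (hs : 2 ≤ s) {σ : ℝ} (hσ : 0 < σ) :
    ∃ C : ℝ, 0 < C ∧ ∀ (K : Finset (Euc n)) (c : Euc n), ShapeReg σ K c →
    ∀ (φ : polySpace n (s - 1)) (ψ : Finset (Euc n) → polySpace n s) (z : Fin n → polySpace n s),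
      cellForm s K (φ, ψ) = cellInner s K z →
      (∫ x in hull K, ∑ i, fderiv ℝ φ.1 x (stdVec i) ^ 2 ≤ C * cellInner s K z z) ∧
      ∀ f ∈ K.powersetCard n, ∫ x in hull f, (ψ f).1 x * (ψ f).1 x ∂(surf n) ≤
        C * diam (hull K) * cellInner s K z z := by
  by_cases hex : ∃ K₀ : Finset (Euc n), IsNSimplex K₀
  swap
  · exact ⟨1, one_pos, fun K c hK => absurd ⟨K, hK.simplex⟩ hex⟩
  obtain ⟨K₀, h₀⟩ := hex
  haveI := h₀.nontrivial hn
  obtain ⟨C, hC, hbd⟩ := h₀.exists_multiplier_bound hn hs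
  set V₀ := (volume : Measure (Euc n)).real (hull K₀) with hV₀
  have hV0 : 0 < V₀ := h₀.volume_pos
  set m := diam (hull K₀) * (n + 1) / σ with hm
  set G := ∑ w, ‖baryGrad h₀.basis w‖ with hG
  have hG0 : 0 ≤ G := by positivity
  refine ⟨1 + n * V₀ * C * (n * G ^ 2) * m ^ 2 + C * (n * G ^ 2) * n * V₀ / σ, by positivity,
    fun K c hK φ ψ z hφ => ?_⟩
  have hK' := hK.simplex
  haveI := hK'.nontrivial hn
  obtain ⟨q, B, e, D, hD, hvert, hco, hvol, hface, hsurf⟩ := h₀.exists_transport hK' hn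
  have hB : ∀ z, q + B (B.symm (z - q)) = z := by simp
  have hV : (volume : Measure (Euc n)).real (hull K) = D * V₀ := by
    simpa [measureReal_restrict_apply MeasurableSet.univ] using hvol fun _ => 1
  have hlin : ∀ w t, (hK'.basis.coord (e w)).linear (B t) = (h₀.basis.coord w).linear t :=
      fun w t => by
    have := linear_coord_sub h₀.basis w t 0
    rw [sub_zero, ← hco, ← hco, ← linear_coord_sub, add_sub_add_left_eq_sub, map_zero,
      sub_zero] at this
    linarith
  set d := diam (hull K) with hdd
  have hd : 0 < d := hK.diam_pos
  have hBd : ∀ t, ‖B t‖ ≤ d * (G * ‖t‖) := fun t => by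
    refine (hK'.norm_le (B t)).trans (mul_le_mul_of_nonneg_left ?_ hd.le)
    rw [← e.sum_comp, sum_mul]
    refine sum_le_sum fun w _ => ?_
    rw [hlin, ← inner_baryGrad]
    exact abs_real_inner_le_norm _ _
  -- the transported data
  let φ₀ : polySpace n (s - 1) := ⟨_, polySpace_transport φ.2 q B⟩
  let ψ₀ : Finset (Euc n) → polySpace n s := fun f =>
    ⟨_, polySpace_transport (ψ (f.image fun y => q + B y)).2 q B⟩
  obtain ⟨z₀, hz⟩ : ∃ z₀ : Fin n → polySpace n s, ∀ i y, (z₀ i).1 y =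
      ∑ j, (B (stdVec i) : Euc n) j * (z j).1 (q + B y) := ⟨fun i =>
    ⟨_, polySpace_sum Finset.univ fun j _ => Submodule.smul_mem _ ((B (stdVec i) : Euc n) j)
      (polySpace_transport (z j).2 q B)⟩, fun i y => by simp⟩
  have hψ₀ : ∀ (w : K₀) y, (ψ₀ (K₀.erase w)).1 y =
      (ψ (K.erase (e w)) : Euc n → ℝ) (q + B y) := fun w y => by
    have : (K₀.erase w.1).image (fun y => q + B y) = K.erase (e w : Euc n) := by
      rw [Finset.image_erase (f := fun y => q + B y) ((add_right_injective q).comp B.injective)]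
      congr 1
      · ext x
        rw [Finset.mem_image]
        exact ⟨fun ⟨y, hy, h⟩ => h ▸ mem_of_eq_of_mem (hvert ⟨y, hy⟩) (e ⟨y, hy⟩).2, fun hx =>
          ⟨e.symm ⟨x, hx⟩, (e.symm ⟨x, hx⟩).2, by simp [hvert]⟩⟩
      bound
    change (ψ ((K₀.erase w.1).image fun y => q + B y) : Euc n → ℝ) (q + B y) = _
    rw [this]
  have hz₀ : cellForm s K₀ (φ₀, ψ₀) = cellInner s K₀ z₀ := by
    refine LinearMap.pi_ext fun i a => ?_
    have hsing : ∀ a : polySpace n s, Pi.single i a = fun k => (stdVec i : Euc n) k • a := fun a => by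
      ext k
      by_cases hk : k = i
      · bound
      · simp [hk]
    have ha := polySpace_transport a.2 (-B.symm q) (B.symm : Euc n →ₗ[ℝ] Euc n)
    have hab : ∀ y, a.1 (-B.symm q + (B.symm : Euc n →ₗ[ℝ] Euc n) (q + B y)) =
        a.1 y := by simp
    have h1 := LinearMap.congr_fun hφ fun k => (B (stdVec i) : Euc n) k • ⟨_, ha⟩
    rw [cellForm_smul, cellInner_apply, pairForm_apply, hvol, hvol, sum_facets hK'] at h1
    rw [hsing, cellForm_smul, cellInner_apply, pairForm_apply, sum_facets h₀]
    refine mul_left_cancel₀ hD.ne' ?_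
    simp only [pairForm_apply] at h1 ⊢
    have hS : ∀ w : K₀, D * (inner ℝ (facetNormal K₀ (K₀.erase w)) (stdVec i) *
        ∫ x, (ψ₀ (K₀.erase w)).1 x * a.1 x ∂faceMeas (K₀.erase w.1)) =
        inner ℝ (facetNormal K (K.erase (e w))) (B (stdVec i)) *
        ∫ x, (ψ (K.erase (e w)) : Euc n → ℝ) x * a.1 (-B.symm q +
          (B.symm : Euc n →ₗ[ℝ] Euc n) x) ∂faceMeas (K.erase (e w : Euc n)) := fun w => by
      rw [faceMeas_eq h₀ hn (erase_mem_powersetCard h₀ w),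
        faceMeas_eq hK' hn (erase_mem_powersetCard hK' (e w)), facetNormal_erase h₀,
        facetNormal_erase hK', inner_outNormal, inner_outNormal, hlin]
      have h2 := hsurf w fun x => (ψ (K.erase (e w)) : Euc n → ℝ) x * a.1 (-B.symm q +
          (B.symm : Euc n →ₗ[ℝ] Euc n) x)
      simp only [hab, ← hψ₀] at h2
      have h3 := norm_pos_iff.2 (baryGrad_ne_zero h₀.basis w)
      have h4 := norm_pos_iff.2 (baryGrad_ne_zero hK'.basis (e w))
      field_simp
      linear_combination (h₀.basis.coord w).linear (stdVec i) * h2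
    rw [mul_add, mul_sum, sum_congr rfl fun w _ => hS w]
    rw [← e.sum_comp] at h1
    refine Eq.trans (congrArg (· + _) (congrArg _ (setIntegral_congr_fun (measurableSet_hull _)
      fun y _ => ?_))) (h1.trans (congrArg _ (setIntegral_congr_fun (measurableSet_hull _)
      fun y _ => ?_)))
    · change fderiv ℝ (fun y => φ.1 (q + B y)) y _ * _ =
        fderiv ℝ φ.1 (q + B y) (B (stdVec i)) * _
      refine congrArg₂ _ ?_ (hab y).symm
      exact fderiv_transport φ.2 q B.toLinearMap y _
    · refine Eq.trans ?_ (sum_eq_single i (fun k _ hk => by simp [hk, stdVec]) (by simp)).symm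
      change ∑ j, (z j).1 (q + B y) * ((B (stdVec i) : Euc n) j * a.1 _) =
        (z₀ i).1 y * ((stdVec i : Euc n) i * a.1 y)
      rw [hab, hz, sum_mul]
      exact sum_congr rfl fun j _ => by simp [stdVec]; ring
  obtain ⟨hb1, hb2⟩ := hbd φ₀ ψ₀ z₀ hz₀
  have hZ0 := cellInner_self_nonneg K z
  have hZ : D * cellInner s K₀ z₀ z₀ ≤ n * G ^ 2 * d ^ 2 * cellInner s K z z := by
    rw [cellInner_apply, cellInner_apply, hvol, mul_left_comm (_ * _) D, ← integral_const_mul (n * G ^ 2 * d ^ 2)]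
    refine mul_le_mul_of_nonneg_left (integral_mono (integrable_hull _ _ (by fun_prop))
      (integrable_hull _ (fun y => n * G ^ 2 * d ^ 2 * ∑ i, (z i).1 (q + B y) *
        (z i).1 (q + B y)) ?_) fun y => ?_) hD.le
    · have := B.toLinearMap.continuous_of_finiteDimensional
      have : Continuous B := this
      fun_prop
    · have h1 : ∀ i, (z₀ i).1 y * (z₀ i).1 y ≤ (d * G) ^ 2 *
          ∑ i, (z i).1 (q + B y) ^ 2 := fun i => by
        have := sq_dot_le (fun j => (z j).1 (q + B y)) (hBd (stdVec i))
        rw [show ‖(stdVec i : Euc n)‖ = 1 by simp, mul_one] at this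
        refine le_of_eq_of_le ?_ this
        simp only [← sq, hz, mul_comm]
      refine (sum_le_sum fun i _ => h1 i).trans_eq ?_
      simp only [sum_const, card_univ, Fintype.card_fin, nsmul_eq_mul, sq]
      ring
  set Z := cellInner s K z z
  set Z₀ := cellInner s K₀ z₀ z₀
  have hZ1 : 0 ≤ Z₀ := cellInner_self_nonneg K₀ z₀
  refine ⟨?_, fun f hf => ?_⟩
  · refine (setIntegral_le (M := n * (C * Z₀ * (m / d) ^ 2)) (isCompact_hull K).measure_lt_top
      (fun _ _ => sum_nonneg fun _ _ => sq_nonneg _) fun x hx => ?_).trans ?_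
    · have h1 : ∀ i, fderiv ℝ φ.1 x (stdVec i) ^ 2 ≤ C * Z₀ * (m / d) ^ 2 := fun i => by
        have h2 := hb1 (B.symm (x - q)) (h₀.mem_hull_iff.2 fun z => by
          rw [← hco, hB]; exact hK'.mem_hull_iff.1 hx _) (B.symm (stdVec i))
        have h3 := fderiv_transport φ.2 q B.toLinearMap (B.symm (x - q)) (B.symm (stdVec i))
        simp only [LinearEquiv.coe_coe, B.apply_symm_apply, add_sub_cancel] at h3
        have h4 := hK.norm_symm_le h₀ hn hco (stdVec i)
        rw [show ‖(stdVec i : Euc n)‖ = 1 by simp, mul_one, ← le_div_iff₀ hd] at h4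
        rw [← h3]
        exact h2.trans (by gcongr)
      refine (sum_le_sum fun i _ => h1 i).trans_eq ?_
      simp
    · rw [hV]
      calc _ = n * V₀ * C * (m / d) ^ 2 * (D * Z₀) := by ring
        _ ≤ n * V₀ * C * (m / d) ^ 2 * (n * G ^ 2 * d ^ 2 * Z) := by gcongr
        _ = n * V₀ * C * (n * G ^ 2) * m ^ 2 * Z := by field_simp
        _ ≤ _ := by
          gcongr
          have : 0 ≤ C * (n * G ^ 2) * n * V₀ / σ := by positivity
          linarith
  · obtain ⟨w, rfl⟩ := exists_eq_erase hK' hf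
    obtain ⟨w, rfl⟩ := e.surjective w
    refine (setIntegral_le (M := C * Z₀) (surf_hull_lt_top (hK'.1.mono (erase_subset _ _)) hn
      (mem_powersetCard.1 hf).2) (fun _ _ => mul_self_nonneg _) fun x hx => ?_).trans ?_
    · rw [hface] at hx
      obtain ⟨y, hy, rfl⟩ := hx
      rw [← sq, ← hψ₀]
      exact hb2 _ (erase_mem_powersetCard h₀ w) y hy
    · rw [hK'.surf_facet hn, hV]
      have h1 := hK.norm_baryGrad_mul_le hn (e w)
      calc _ = C * n * V₀ * ‖baryGrad hK'.basis (e w)‖ * (D * Z₀) := by ring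
        _ ≤ C * n * V₀ * ‖baryGrad hK'.basis (e w)‖ * (n * G ^ 2 * d ^ 2 * Z) := by gcongr
        _ = (‖baryGrad hK'.basis (e w)‖ * (σ * d)) * (C * (n * G ^ 2) * n * V₀ / σ * d * Z) := by
          field_simp
        _ ≤ C * (n * G ^ 2) * n * V₀ / σ * d * Z := mul_le_of_le_one_left (by positivity) h1
        _ ≤ _ := by
          gcongr
          have : 0 ≤ n * V₀ * C * (n * G ^ 2) * m ^ 2 := by positivity
          linarith

end Multiplier

section Abstract

/-- Orthogonal projection with respect to a positive semidefinite form. -/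
lemma exists_projection {E : Type*} [AddCommGroup E] [Module ℝ E] [FiniteDimensional ℝ E]
    {β : LinearMap.BilinForm ℝ E} (hs : ∀ x y, β x y = β y x) (hp : ∀ x, 0 ≤ β x x)
    (N : Submodule ℝ E) (q : E) : ∃ p ∈ N, ∀ y ∈ N, β (q - p) y = 0 := by
  let β' : LinearMap.BilinForm ℝ N := β.compl₁₂ N.subtype N.subtype
  have hβ' : ∀ x y : N, β' x y = β x y := fun x y => rfl
  obtain ⟨ι, _, b, hb1, hb2, hb3⟩ := exists_orthonormal_family (β := β')
    (fun x y => by rw [hβ', hβ', hs]) (fun x => by rw [hβ']; exact hp _)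
  refine ⟨∑ k, β q (b k) • (b k : E), N.sum_mem fun k _ => N.smul_mem _ (b k).2, fun y hy => ?_⟩
  set p := ∑ k, β q (b k) • (b k : E) with hpdef
  have h1 : ∀ k, β (q - p) (b k) = 0 := by
    classical
    intro k
    rw [map_sub, LinearMap.sub_apply, sub_eq_zero, hpdef, map_sum, LinearMap.sum_apply,
      sum_eq_single k]
    · rw [map_smul, LinearMap.smul_apply, ← hβ', hb1, smul_eq_mul, mul_one]
    · intro j _ hj
      rw [map_smul, LinearMap.smul_apply, ← hβ', hb2 j k hj, smul_zero]
    · simp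
  have h2 := hb3 ⟨y, hy⟩
  rw [hβ'] at h2
  have h3 := bilin_eq_zero_of_self_eq_zero hs hp h2 (q - p)
  rw [hs, N.coe_sub, map_sub, sub_eq_zero] at h3
  change β (q - p) y = _ at h3
  rw [h3, N.coe_sum, map_sum]
  exact sum_eq_zero fun k _ => by rw [N.coe_smul, map_smul, h1, smul_zero]

end Abstract

section Forms

variable {n s : ℕ}

lemma divPt_poly {v : Euc n → Fin n → ℝ} (hv : ∀ i, (fun x => v x i) ∈ polySpace n s) x :
    divPt v x = ∑ i, fderiv ℝ (fun y => v y i) x (stdVec i) :=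
  sum_congr rfl fun i _ => (polySpace_differentiable (hv i) x).lineDeriv_eq_fderiv

lemma divPt_mem_polySpace {v : Euc n → Fin n → ℝ} (hv : ∀ i, (fun x => v x i) ∈ polySpace n s) :
    divPt v ∈ polySpace n (s - 1) := by
  rw [show divPt v = fun x => ∑ i, fderiv ℝ (fun y => v y i) x (stdVec i) from
    funext (divPt_poly hv)]
  exact polySpace_sum _ fun i _ => polySpace_fderiv (hv i) _

lemma flux_mem_polySpace {v : Euc n → Fin n → ℝ} (hv : ∀ i, (fun x => v x i) ∈ polySpace n s)
    (K f : Finset (Euc n)) : flux v K f ∈ polySpace n s :=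
  polySpace_sum _ fun i _ => Submodule.smul_mem _ _ (hv i)

lemma flux_sub (v w : Euc n → Fin n → ℝ) (K f : Finset (Euc n)) x :
    flux (fun x i => v x i - w x i) K f x = flux v K f x - flux w K f x := by
  simp [flux, mul_sub, sum_sub_distrib]

lemma flux_sq_le {K f : Finset (Euc n)} (hK : IsNSimplex K) (hn : 0 < n)
    (hf : f ∈ K.powersetCard n) (v : Euc n → Fin n → ℝ) x :
    flux v K f x ^ 2 ≤ ∑ i, v x i ^ 2 := by
  have := sq_dot_le (v x) (norm_facetNormal hK hn hf).le
  simpa [flux, mul_comm] using this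

/-- Green's formula turns a pairing with multipliers into one with the divergence and the normal
components. -/
lemma IsNSimplex.green_multiplier {K : Finset (Euc n)} (hK : IsNSimplex K) (hn : 0 < n)
    {φ : Euc n → ℝ} (hφ : φ ∈ polySpace n (s - 1)) {l : Finset (Euc n) → Euc n → ℝ}
    (hl : ∀ f, Continuous (l f)) {v : Euc n → Fin n → ℝ}
    (hv : ∀ i, LocallyLipschitz fun x => v x i) :
    ((∫ x in hull K, ∑ i, fderiv ℝ φ x (stdVec i) * v x i) +
      ∑ f ∈ K.powersetCard n, ∫ x in hull f, (l f x - φ x) * flux v K f x ∂(surf n)) =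
    (∑ f ∈ K.powersetCard n, ∫ x in hull f, l f x * flux v K f x ∂(surf n)) -
      ∫ x in hull K, φ x * divPt v x := by
  have h1 := hK.green_field hn (polySpace_locallyLipschitz hφ) hv
  have h2 : (fun x => ∑ i, lineDeriv ℝ φ x (stdVec i) * v x i) =
      fun x => ∑ i, fderiv ℝ φ x (stdVec i) * v x i := funext fun x =>
    sum_congr rfl fun i _ => by rw [(polySpace_differentiable hφ x).lineDeriv_eq_fderiv]
  rw [h2] at h1
  have h3 : ∀ f ∈ K.powersetCard n, ∫ x in hull f, (l f x - φ x) * flux v K f x ∂(surf n) =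
      (∫ x in hull f, l f x * flux v K f x ∂(surf n)) -
      ∫ x in hull f, φ x * flux v K f x ∂(surf n) := by
    intro f hf
    have hfc : Continuous (flux v K f) := continuous_flux (fun i => (hv i).continuous) _ _
    rw [← integral_sub (integrableOn_facet hK hn hf (g := fun x => l f x * flux v K f x)
      ((hl f).mul hfc)) (integrableOn_facet hK hn hf (g := fun x => φ x * flux v K f x)
      ((polySpace_continuous hφ).mul hfc))]
    simp only [sub_mul]
  rw [sum_congr rfl h3, sum_sub_distrib, h1]
  ring

end Forms

namespace Triangulation

variable {n s : ℕ} {Ω : Set (Euc n)} (𝒯 : Triangulation Ω)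

/-- Broken polynomial fields of degree at most `s`, as a finite dimensional space. -/
abbrev BrokenSpace (s : ℕ) := 𝒯.cells → Fin n → polySpace n s

/-- The restriction of a broken field to a cell. -/
def cellProj (s : ℕ) (K : 𝒯.cells) : 𝒯.BrokenSpace s →ₗ[ℝ] Fin n → polySpace n s := LinearMap.proj K

/-- The `L²` inner product of broken fields. -/
noncomputable def brokenForm (s : ℕ) : LinearMap.BilinForm ℝ (𝒯.BrokenSpace s) :=
  ∑ K : 𝒯.cells, (cellInner s K).compl₁₂ (𝒯.cellProj s K) (𝒯.cellProj s K)

/-- The pairing of broken fields with multipliers `φ` for the divergence on the cells and `l` for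
the normal components on the facets. -/
noncomputable def multForm (s : ℕ) :
    ((𝒯.cells → polySpace n (s - 1)) × (Finset (Euc n) → polySpace n s)) →ₗ[ℝ]
      Module.Dual ℝ (𝒯.BrokenSpace s) :=
  ∑ K : 𝒯.cells, (cellForm s K).compl₁₂
    { toFun := fun m => (m.1 K, fun f => m.2 f - polyIncl n s (m.1 K))
      map_add' := fun m m' => by
        simp only [Prod.fst_add, Prod.snd_add, Pi.add_apply, map_add, add_sub_add_comm]; rfl
      map_smul' := fun c m => Prod.ext rfl (funext fun f => by simp [smul_sub]) }
    (𝒯.cellProj s K)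

variable {𝒯}

/-- The values of an element of the broken space. -/
def bval (v : 𝒯.BrokenSpace s) (K : 𝒯.cells) (x : Euc n) (i : Fin n) : ℝ := (v K i).1 x

lemma bval_mem (v : 𝒯.BrokenSpace s) (K : 𝒯.cells) (i : Fin n) :
    (fun x => bval v K x i) ∈ polySpace n s := (v K i).2

lemma brokenForm_eq_sum (v w : 𝒯.BrokenSpace s) : 𝒯.brokenForm s v w =
    ∑ K : 𝒯.cells, cellInner s K (v K) (w K) := by
  simp only [brokenForm, LinearMap.sum_apply]
  rfl

lemma multForm_eq_sum (φ : 𝒯.cells → polySpace n (s - 1)) (l : Finset (Euc n) → polySpace n s)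
    (v : 𝒯.BrokenSpace s) : 𝒯.multForm s (φ, l) v = ∑ K : 𝒯.cells,
      cellForm s K (φ K, fun f => l f - polyIncl n s (φ K)) (v K) := by
  simp only [multForm, LinearMap.sum_apply]
  rfl

lemma brokenForm_apply (v w : 𝒯.BrokenSpace s) : 𝒯.brokenForm s v w =
    ∑ K : 𝒯.cells, ∫ x in hull K, ∑ i, bval v K x i * bval w K x i := by
  simp only [brokenForm_eq_sum, cellInner_apply]
  rfl

lemma multForm_apply (hn : 0 < n) (φ : 𝒯.cells → polySpace n (s - 1))
    (l : Finset (Euc n) → polySpace n s) (v : 𝒯.BrokenSpace s) :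
    𝒯.multForm s (φ, l) v = ∑ K : 𝒯.cells,
      ((∫ x in hull K, ∑ i, fderiv ℝ (φ K).1 x (stdVec i) * bval v K x i) +
      ∑ f ∈ (K : Finset (Euc n)).powersetCard n, ∫ x in hull f,
        ((l f).1 x - (φ K).1 x) * flux (bval v K) K f x ∂(surf n)) :=
  (multForm_eq_sum φ l v).trans <| sum_congr rfl fun K _ =>
    cellForm_apply (𝒯.cell_simplex K.2) hn ..

open Classical in
/-- Extension of an element of the broken space by zero to vertex sets that are not cells. -/
noncomputable def bext (v : 𝒯.BrokenSpace s) (K : Finset (Euc n)) (x : Euc n) (i : Fin n) : ℝ :=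
  if hK : K ∈ 𝒯.cells then bval v ⟨K, hK⟩ x i else 0

lemma bext_eq (v : 𝒯.BrokenSpace s) (K : 𝒯.cells) : bext v K = bval v K := by
  ext x i
  simp [bext]

lemma bval_locallyLipschitz (v : 𝒯.BrokenSpace s) (K : 𝒯.cells) (i : Fin n) :
    LocallyLipschitz fun x => bval v K x i := polySpace_locallyLipschitz (bval_mem v K i)

lemma multForm_eq (hn : 0 < n) (φ : 𝒯.cells → polySpace n (s - 1))
    (l : Finset (Euc n) → polySpace n s) (v : 𝒯.BrokenSpace s) : 𝒯.multForm s (φ, l) v =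
      (∑ K : 𝒯.cells, ∑ f ∈ K.1.powersetCard n, ∫ x in hull f,
        (l f).1 x * flux (bval v K) K f x ∂(surf n)) -
      ∑ K : 𝒯.cells, ∫ x in hull K, (φ K).1 x * divPt (bval v K) x := by
  rw [multForm_apply hn, ← sum_sub_distrib]
  refine sum_congr rfl fun K _ => ?_
  exact (𝒯.cell_simplex K.2).green_multiplier hn (φ K).2
    (fun f => polySpace_continuous (l f).2) (bval_locallyLipschitz v K)

lemma multForm_eq_zero (hn : 0 < n) {v : 𝒯.BrokenSpace s} (hv : ∀ m, 𝒯.multForm s m v = 0)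
    (φ : 𝒯.cells → polySpace n (s - 1)) (l : Finset (Euc n) → polySpace n s) :
    (∑ K : 𝒯.cells, ∑ f ∈ K.1.powersetCard n, ∫ x in hull f,
        l f x * flux (bval v K) K f x ∂(surf n)) =
      ∑ K : 𝒯.cells, ∫ x in hull K, φ K x * divPt (bval v K) x := by
  rw [← sub_eq_zero, ← multForm_eq hn, hv]

end Triangulation

namespace Triangulation

variable {n s : ℕ} {Ω : Set (Euc n)} {𝒯 : Triangulation Ω}

/-- A broken field that pairs to zero with all multipliers is divergence free with matching normal
components. -/
lemma divFree_of_multForm (hn : 0 < n) {v : 𝒯.BrokenSpace s}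
    (hv : ∀ m, 𝒯.multForm s m v = 0) : 𝒯.DivFree (bext v) := by
  classical
  have hlip : ∀ K : 𝒯.cells, ∀ i, LocallyLipschitz fun x => bval v K x i := fun K i =>
    polySpace_locallyLipschitz (bval_mem v K i)
  have hdivmem : ∀ K : 𝒯.cells, divPt (bval v K) ∈ polySpace n (s - 1) := fun K =>
    divPt_mem_polySpace (bval_mem v K)
  have hlip' : ∀ K ∈ 𝒯.cells, ∀ i, LocallyLipschitz fun x => bext v K x i := fun K hK i => by
    rw [show bext v K = bval v ⟨K, hK⟩ from bext_eq v ⟨K, hK⟩]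
    simp_all
  have hdiv : ∀ K : 𝒯.cells, ∀ x ∈ interior (hull K), divPt (bval v K) x = 0 := by
    have h : (0 : ℝ) = ∑ K : 𝒯.cells, ∫ x in hull (K : Finset (Euc n)),
        divPt (bval v K) x * divPt (bval v K) x := by
      rw [← multForm_eq_zero hn hv (fun K => ⟨_, hdivmem K⟩) (fun _ => 0)]
      simp
    have h1 := (Finset.sum_eq_zero_iff_of_nonneg fun (K : 𝒯.cells) _ =>
      integral_nonneg (μ := volume.restrict (hull (K : Finset (Euc n)))) fun x =>
        mul_self_nonneg (divPt (bval v K) x)).1 h.symm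
    intro K
    have h2 := h1 K (Finset.mem_univ K)
    exact eq_zero_of_integral_sq (polySpace_continuous (hdivmem K))
      (isCompact_hull (K : Finset (Euc n))) h2
  refine ⟨hlip', fun K hK => ?_, ?_⟩
  · rw [← Measure.restrict_congr_set (interior_hull_ae_eq K)]
    refine ae_restrict_of_forall_mem isOpen_interior.measurableSet fun x hx => ?_
    rw [show bext v K = bval v ⟨K, hK⟩ from bext_eq v ⟨K, hK⟩]
    bound
  · have hjmem : ∀ f, 𝒯.normalJump (bext v) f ∈ polySpace n s := fun f =>
      polySpace_sum _ fun K hK => by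
        have hK := (mem_filter.1 hK).1
        rw [show bext v K = bval v ⟨K, hK⟩ from bext_eq v ⟨K, hK⟩]
        exact flux_mem_polySpace (bval_mem v _) _ _
    have h := multForm_eq_zero hn hv 0 (fun f => ⟨_, hjmem f⟩)
    have h0 : (∑ K : 𝒯.cells, ∫ x in hull (K : Finset (Euc n)),
        (((0 : 𝒯.cells → polySpace n (s - 1)) K : Euc n → ℝ) x) * divPt (bval v K) x) = 0 :=
      by simp
    rw [h0] at h
    have h1 : ∀ K : 𝒯.cells, ∑ f ∈ (K : Finset (Euc n)).powersetCard n, ∫ x in hull f,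
        𝒯.normalJump (bext v) f x * flux (bval v K) K f x ∂(surf n) =
        ∑ f ∈ (K : Finset (Euc n)).powersetCard n, ∫ x in hull f,
        𝒯.normalJump (bext v) f x * flux (bext v K) K f x ∂(surf n) := fun K => by rw [bext_eq]
    rw [sum_congr rfl fun K _ => h1 K, sum_coe_sort 𝒯.cells fun K =>
      ∑ f ∈ K.powersetCard n, ∫ x in hull f,
        𝒯.normalJump (bext v) f x * flux (bext v K) K f x ∂(surf n),
      sum_integral_mul_flux hn hlip' fun f => polySpace_continuous (hjmem f)] at h
    have h2 := (Finset.sum_eq_zero_iff_of_nonneg fun f _ =>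
      integral_nonneg fun x => mul_self_nonneg (𝒯.normalJump (bext v) f x)).1 h
    intro K hK f hf
    exact facet_eq_zero_of_integral_sq (𝒯.cell_simplex hK) hn hf
      (polySpace_continuous (hjmem f)) (h2 f (Finset.mem_biUnion.2 ⟨K, hK, hf⟩))

end Triangulation

/-- Finite dimensional duality: the residual of the projection onto the common kernel of a family
of functionals is represented by a member of the family. -/
lemma exists_projection_ker {E M : Type*} [AddCommGroup E] [Module ℝ E] [FiniteDimensional ℝ E]
    [AddCommGroup M] [Module ℝ M] {β : LinearMap.BilinForm ℝ E} (hs : ∀ x y, β x y = β y x)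
    (hp : ∀ x, 0 ≤ β x x) (L : M →ₗ[ℝ] Module.Dual ℝ E) (q : E) :
    ∃ p : E, (∀ m, L m p = 0) ∧ ∃ m, ∀ v, L m v = β (q - p) v := by
  obtain ⟨p, hpN, hp⟩ := exists_projection hs hp (LinearMap.range L).dualCoannihilator q
  refine ⟨p, fun m => (Submodule.mem_dualCoannihilator _).1 hpN _ ⟨m, rfl⟩, ?_⟩
  have h : β (q - p) ∈ (LinearMap.range L).dualCoannihilator.dualAnnihilator :=
    (Submodule.mem_dualAnnihilator _).2 hp
  rw [Subspace.dualCoannihilator_dualAnnihilator_eq] at h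
  obtain ⟨m, hm⟩ := h
  exact ⟨m, fun v => by rw [hm]⟩

section Local

variable {n s : ℕ}

/-- Young's inequality in integrated form. -/
lemma setIntegral_mul_sum_le {X ι : Type*} [Fintype ι] [MeasurableSpace X] {μ : Measure X}
    {a b : ι → X → ℝ} {ε : ℝ} (hε : 0 < ε)
    (h1 : ∀ i, Integrable (fun x => a i x ^ 2) μ) (h2 : ∀ i, Integrable (fun x => b i x ^ 2) μ) :
    ∫ x, ∑ i, a i x * b i x ∂μ ≤
      ε / 2 * (∫ x, ∑ i, a i x ^ 2 ∂μ) + 1 / (2 * ε) * ∫ x, ∑ i, b i x ^ 2 ∂μ := by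
  have i1 : Integrable (fun x => ∑ i, a i x ^ 2) μ := integrable_finset_sum _ fun i _ => h1 i
  have i2 : Integrable (fun x => ∑ i, b i x ^ 2) μ := integrable_finset_sum _ fun i _ => h2 i
  rw [← integral_const_mul, ← integral_const_mul, ← integral_add (i1.const_mul _) (i2.const_mul _)]
  by_cases h : Integrable (fun x => ∑ i, a i x * b i x) μ
  · refine integral_mono h ((i1.const_mul _).add (i2.const_mul _)) fun x => ?_
    simp only [mul_sum, ← sum_add_distrib]
    refine sum_le_sum fun i _ => ?_
    have h3 : ε / 2 * a i x ^ 2 + 1 / (2 * ε) * b i x ^ 2 - a i x * b i x =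
        (ε * a i x - b i x) ^ 2 / (2 * ε) := by field_simp; ring
    have h4 : 0 ≤ (ε * a i x - b i x) ^ 2 / (2 * ε) := by positivity
    linarith
  · rw [integral_undef h]
    exact integral_nonneg fun x => add_nonneg
      (mul_nonneg (by positivity) (sum_nonneg fun i _ => sq_nonneg _))
      (mul_nonneg (by positivity) (sum_nonneg fun i _ => sq_nonneg _))

/-- The pairing of a field with multipliers, when the multipliers are controlled by `B`. -/
lemma IsNSimplex.pairing_le {K : Finset (Euc n)} (hK : IsNSimplex K) (hn : 0 < n)
    (hd : 0 < diam (hull K)) {φ : Euc n → ℝ}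
    (hφ : φ ∈ polySpace n (s - 1)) {ψ : Finset (Euc n) → Euc n → ℝ}
    (hψ : ∀ f, Continuous (ψ f)) {D : Euc n → Fin n → ℝ} (hD : ∀ i, Continuous fun x => D x i)
    {C B ε : ℝ} (hε : 0 < ε) (hB : 0 ≤ B) (hC : 0 < C)
    (h1 : ∫ x in hull K, ∑ i, fderiv ℝ φ x (stdVec i) ^ 2 ≤ C * B)
    (h2 : ∀ f ∈ K.powersetCard n, ∫ x in hull f, ψ f x * ψ f x ∂(surf n) ≤
      C * diam (hull K) * B) : (∫ x in hull K, ∑ i, fderiv ℝ φ x (stdVec i) * D x i) +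
      ∑ f ∈ K.powersetCard n, ∫ x in hull f, ψ f x * flux D K f x ∂(surf n) ≤
    ε * C * (n + 2) / 2 * B + 1 / (2 * ε) * ((∫ x in hull K, ∑ i, D x i ^ 2) +
      diam (hull K) * ∑ f ∈ K.powersetCard n, ∫ x in hull f, ∑ i, D x i ^ 2 ∂(surf n)) := by
  set d := diam (hull K) with hdd
  have hcell : ∫ x in hull K, ∑ i, fderiv ℝ φ x (stdVec i) * D x i ≤
      ε / 2 * (C * B) + 1 / (2 * ε) * ∫ x in hull K, ∑ i, D x i ^ 2 := by
    refine (setIntegral_mul_sum_le hε (fun i => ?_) fun i => ?_).trans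
      (add_le_add_left (mul_le_mul_of_nonneg_left h1 (by positivity)) _)
    · exact integrableOn_of_continuous ((polySpace_continuous (polySpace_fderiv hφ _)).pow 2)
        (isCompact_hull K)
    · exact integrableOn_of_continuous ((hD i).pow 2) (isCompact_hull K)
  have hfacet : ∀ f ∈ K.powersetCard n, ∫ x in hull f, ψ f x * flux D K f x ∂(surf n) ≤
      ε * C / 2 * B + 1 / (2 * ε) * (d * ∫ x in hull f, ∑ i, D x i ^ 2 ∂(surf n)) := by
    intro f hf
    have hc : Continuous (flux D K f) := continuous_flux hD _ _
    have h3 := setIntegral_mul_sum_le (ι := Unit) (μ := (surf n).restrict (hull f))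
      (a := fun _ => ψ f) (b := fun _ => flux D K f) (ε := ε / d) (by positivity)
      (fun i => integrableOn_facet hK hn hf ((hψ f).pow 2))
      (fun i => integrableOn_facet hK hn hf (hc.pow 2))
    simp only [Finset.univ_unique, Finset.sum_singleton] at h3
    have h4 : ∫ x in hull f, ψ f x ^ 2 ∂(surf n) ≤ C * d * B := by simpa only [sq] using h2 f hf
    have hi : IntegrableOn (fun x => ∑ i, D x i ^ 2) (hull f) (surf n) :=
      integrableOn_facet hK hn hf (continuous_finset_sum _ fun i _ => (hD i).pow 2)
    have h5 : ∫ x in hull f, flux D K f x ^ 2 ∂(surf n) ≤ ∫ x in hull f, ∑ i, D x i ^ 2 ∂(surf n) :=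
      integral_mono (integrableOn_facet hK hn hf (hc.pow 2)) hi fun x => flux_sq_le hK hn hf D x
    refine h3.trans ((add_le_add (mul_le_mul_of_nonneg_left h4 (by positivity))
      (mul_le_mul_of_nonneg_left h5 (by positivity))).trans (le_of_eq ?_))
    field_simp
  refine (add_le_add hcell (sum_le_sum hfacet)).trans (le_of_eq ?_)
  rw [sum_add_distrib, sum_const, Finset.card_powersetCard, hK.2,
    ← mul_sum, ← mul_sum, Nat.choose_succ_self_right]
  simp only [nsmul_eq_mul]
  push_cast
  ring

end Local

namespace Triangulation

variable {n s : ℕ} {Ω : Set (Euc n)} {𝒯 : Triangulation Ω}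

/-- The multipliers realizing the residual of the projection onto the divergence free fields. -/
lemma exists_projection_multForm (q : 𝒯.BrokenSpace s) :
    ∃ p : 𝒯.BrokenSpace s, (∀ m, 𝒯.multForm s m p = 0) ∧
      ∃ m, ∀ v, 𝒯.multForm s m v = 𝒯.brokenForm s (q - p) v := by
  have hsymm : ∀ v w, 𝒯.brokenForm s v w = 𝒯.brokenForm s w v := fun v w => by
    simp only [brokenForm_apply, mul_comm]
  have hnn : ∀ v, 0 ≤ 𝒯.brokenForm s v v := fun v => by
    rw [brokenForm_apply]
    exact sum_nonneg fun K _ => integral_nonneg fun x =>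
      sum_nonneg fun i _ => mul_self_nonneg _
  exact exists_projection_ker hsymm hnn _ q

lemma DivFree.sum_pairing_eq_zero {U : Finset (Euc n) → Euc n → Fin n → ℝ} (hU : 𝒯.DivFree U)
    (hn : 0 < n) {φ : 𝒯.cells → Euc n → ℝ} (hφ : ∀ K, φ K ∈ polySpace n (s - 1))
    {l : Finset (Euc n) → Euc n → ℝ} (hl : ∀ f, Continuous (l f)) :
    ∑ K : 𝒯.cells, ((∫ x in hull K, ∑ i, fderiv ℝ (φ K) x (stdVec i) * U K x i) +
      ∑ f ∈ K.1.powersetCard n,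
        ∫ x in hull f, (l f x - φ K x) * flux (U K) K f x ∂(surf n)) = 0 := by
  have h : ∀ K : 𝒯.cells,
      ((∫ x in hull K, ∑ i, fderiv ℝ (φ K) x (stdVec i) * U K x i) +
      ∑ f ∈ K.1.powersetCard n,
        ∫ x in hull f, (l f x - φ K x) * flux (U K) K f x ∂(surf n)) =
      ∑ f ∈ K.1.powersetCard n,
        ∫ x in hull f, l f x * flux (U K) K f x ∂(surf n) := fun K => by
    rw [(𝒯.cell_simplex K.2).green_multiplier hn (hφ K) hl (hU.lip K K.2), sub_eq_self]
    rw [← integral_zero (Euc n) ℝ (μ := volume.restrict (hull K))]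
    refine integral_congr_ae ?_
    filter_upwards [hU.div K K.2] with x hx
    rw [hx, mul_zero]
  rw [sum_congr rfl fun K _ => h K, sum_coe_sort 𝒯.cells fun K =>
    ∑ f ∈ K.powersetCard n, ∫ x in hull f, l f x * flux (U K) K f x ∂(surf n)]
  exact hU.sum_integral_mul_flux_eq_zero hn hl

/-- **Quasi-interpolation.** A divergence free field that is approximated by a broken polynomial
field is approximated equally well by discrete divergence free fields. -/
theorem exists_quasi_interpolation (n s : ℕ) (hn : 0 < n) (hs : 2 ≤ s) {σ : ℝ} (hσ : 0 < σ) :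
    ∃ C : ℝ, 0 < C ∧ ∀ {Ω : Set (Euc n)} (_ : interior (closure Ω) = Ω) (𝒯 : Triangulation Ω),
      (∀ K ∈ 𝒯.cells, ∃ c, ShapeReg σ K c) → ∀ U : Finset (Euc n) → Euc n → Fin n → ℝ, 𝒯.DivFree U →
      ∀ q : Finset (Euc n) → Euc n → Fin n → ℝ, (∀ K i, (fun x => q K x i) ∈ polySpace n s) →
      ∀ F : ElementFamily, ∃ w ∈ 𝒯.divFreeSpace F s, (∀ K i, (w K i).totalDegree ≤ s) ∧
        ∑ K ∈ 𝒯.cells, ∫ x in hull K, ∑ i, (q K x i - trace w K x i) ^ 2 ≤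
          C * ∑ K ∈ 𝒯.cells, ((∫ x in hull K, ∑ i, (q K x i - U K x i) ^ 2) +
            diam (hull K) * ∑ f ∈ K.powersetCard n,
              ∫ x in hull f, ∑ i, (q K x i - U K x i) ^ 2 ∂(surf n)) := by
  classical
  obtain ⟨C₀, hC₀, hmult⟩ := exists_multiplier_bound n s hn hs hσ
  refine ⟨C₀ * (n + 2), by positivity, fun hΩ 𝒯 hreg U hU q hq F => ?_⟩
  set Q : 𝒯.BrokenSpace s := fun K i => ⟨fun x => q K x i, hq K i⟩ with hQ
  obtain ⟨P, hP, ⟨φ, l⟩, hm⟩ := exists_projection_multForm Q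
  have hPd := divFree_of_multForm hn hP
  -- the discrete field
  choose m hm1 hm2 using fun K i => mem_polySpace.1 (P K i).2
  have htr : ∀ K : 𝒯.cells, ∀ x i, trace (fun K i => if hK : K ∈ 𝒯.cells then m ⟨K, hK⟩ i else 0)
      K x i = bval P K x i := fun K x i => by simp [trace, bval, hm2]
  refine ⟨fun K i => if hK : K ∈ 𝒯.cells then m ⟨K, hK⟩ i else 0,
    mem_divFreeSpace hn hΩ F (fun K hK i => ?_) ?_, fun K i => ?_, ?_⟩
  · simpa [hK] using hm1 ⟨K, hK⟩ i
  · convert hPd using 1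
    ext K x i
    by_cases hK : K ∈ 𝒯.cells
    · simpa [bext, hK] using htr ⟨K, hK⟩ x i
    · simp [bext, hK, trace]
  · by_cases hK : K ∈ 𝒯.cells
    · simpa [hK] using hm1 ⟨K, hK⟩ i
    · simp [hK]
  set B : 𝒯.cells → ℝ := fun K => ∫ x in hull (K : Finset (Euc n)), ∑ i, ((Q - P) K i : Euc n → ℝ) x ^ 2
    with hB
  set R : Finset (Euc n) → ℝ := fun K => (∫ x in hull K, ∑ i, (q K x i - U K x i) ^ 2) +
            diam (hull K) * ∑ f ∈ K.powersetCard n,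
              ∫ x in hull f, ∑ i, (q K x i - U K x i) ^ 2 ∂(surf n) with hR
  have hgoal : ∑ K ∈ 𝒯.cells, ∫ x in hull K, ∑ i, (q K x i - trace
      (fun K i => if hK : K ∈ 𝒯.cells then m ⟨K, hK⟩ i else 0) K x i) ^ 2 = ∑ K, B K := by
    rw [← sum_coe_sort 𝒯.cells]
    refine sum_congr rfl fun K _ => ?_
    simp only [htr]
    rfl
  rw [hgoal, ← sum_coe_sort 𝒯.cells]
  have hBnn : ∀ K, 0 ≤ B K := fun K => integral_nonneg fun x =>
    sum_nonneg fun i _ => sq_nonneg _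
  have hlc : ∀ f, Continuous (l f : Euc n → ℝ) := fun f => polySpace_continuous (l f).2
  have hφc : ∀ K, Continuous (φ K : Euc n → ℝ) := fun K => polySpace_continuous (φ K).2
  have hUc : ∀ K : 𝒯.cells, ∀ i, Continuous fun x => U K x i := fun K i =>
    (hU.lip K K.2 i).continuous
  have hqc : ∀ K : 𝒯.cells, ∀ i, Continuous fun x => q K x i := fun K i =>
    polySpace_continuous (hq K i)
  -- the multipliers are controlled on each cell
  have hloc : ∀ K : 𝒯.cells,
      (∫ x in hull (K : Finset (Euc n)), ∑ i, fderiv ℝ (φ K : Euc n → ℝ) x (stdVec i) ^ 2 ≤ C₀ * B K) ∧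
      ∀ f ∈ (K : Finset (Euc n)).powersetCard n,
        ∫ x in hull f, ((l f : Euc n → ℝ) x - (φ K : Euc n → ℝ) x) *
          ((l f : Euc n → ℝ) x - (φ K : Euc n → ℝ) x) ∂(surf n) ≤
          C₀ * diam (hull (K : Finset (Euc n))) * B K := by
    intro K
    obtain ⟨c, hK⟩ := hreg K K.2
    have h := hmult K c hK (φ K) (fun f => l f - polyIncl n s (φ K)) ((Q - P) K)
      (LinearMap.ext fun v => by
        have h := hm (Pi.single K v)
        rw [multForm_eq_sum, brokenForm_eq_sum, sum_eq_single K (fun L _ hL => by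
          rw [Pi.single_eq_of_ne hL, map_zero]) (by simp), sum_eq_single K (fun L _ hL => by
          rw [Pi.single_eq_of_ne hL, map_zero]) (by simp), Pi.single_eq_same] at h
        exact h)
    have hBK : cellInner s (K : Finset (Euc n)) ((Q - P) K) ((Q - P) K) = B K := by
      simp only [cellInner_apply, hB, sq]
    rw [hBK] at h
    exact h
  have hkey : ∑ K, B K = ∑ K : 𝒯.cells,
      ((∫ x in hull (K : Finset (Euc n)), ∑ i, fderiv ℝ (φ K : Euc n → ℝ) x (stdVec i) *
        (q K x i - U K x i)) + ∑ f ∈ (K : Finset (Euc n)).powersetCard n, ∫ x in hull f,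
        ((l f : Euc n → ℝ) x - (φ K : Euc n → ℝ) x) *
          flux (fun x i => q K x i - U K x i) K f x ∂(surf n)) := by
    have h1 : ∑ K, B K = 𝒯.multForm s (φ, l) Q := by
      have h2 := hm (Q - P)
      rw [map_sub, hP, sub_zero] at h2
      rw [h2, brokenForm_apply]
      refine sum_congr rfl fun K _ => ?_
      simp only [hB, bval, sq]
    rw [h1, multForm_apply hn, ← sub_zero (∑ K : 𝒯.cells, _),
      ← hU.sum_pairing_eq_zero hn (fun K => (φ K).2) hlc, ← sum_sub_distrib]
    refine sum_congr rfl fun K _ => ?_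
    rw [add_sub_add_comm, ← sum_sub_distrib]
    have hφd : ∀ i, Continuous fun x => fderiv ℝ (φ K : Euc n → ℝ) x (stdVec i) := fun i =>
      polySpace_continuous (polySpace_fderiv (φ K).2 _)
    congr 1
    · have i1 : IntegrableOn (fun x => ∑ i, fderiv ℝ (φ K : Euc n → ℝ) x (stdVec i) * bval Q K x i)
          (hull (K : Finset (Euc n))) :=
        integrableOn_of_continuous (continuous_finset_sum _ fun i _ => (hφd i).mul (hqc K i))
          (isCompact_hull _)
      have i2 : IntegrableOn (fun x => ∑ i, fderiv ℝ (φ K : Euc n → ℝ) x (stdVec i) * U K x i)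
          (hull (K : Finset (Euc n))) :=
        integrableOn_of_continuous (continuous_finset_sum _ fun i _ => (hφd i).mul (hUc K i))
          (isCompact_hull _)
      rw [← integral_sub i1 i2]
      simp only [← sum_sub_distrib, ← mul_sub]
      rfl
    · refine sum_congr rfl fun f hf => ?_
      have i1 : IntegrableOn (fun x => ((l f : Euc n → ℝ) x - (φ K : Euc n → ℝ) x) *
          flux (bval Q K) K f x) (hull f) (surf n) := integrableOn_facet (𝒯.cell_simplex K.2) hn hf
          (((hlc f).sub (hφc K)).mul (continuous_flux (hqc K) _ _))
      have i2 : IntegrableOn (fun x => ((l f : Euc n → ℝ) x - (φ K : Euc n → ℝ) x) *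
          flux (U K) K f x) (hull f) (surf n) := integrableOn_facet (𝒯.cell_simplex K.2) hn hf
          (((hlc f).sub (hφc K)).mul (continuous_flux (hUc K) _ _))
      rw [← integral_sub i1 i2]
      simp only [← mul_sub, ← flux_sub]
      rfl
  have hε : (0 : ℝ) < 1 / (C₀ * (n + 2)) := by positivity
  have hest : ∑ K, B K ≤ ∑ K : 𝒯.cells, (1 / (C₀ * (n + 2)) * C₀ * (n + 2) / 2 * B K +
      1 / (2 * (1 / (C₀ * (n + 2)))) * R K) := by
    rw [hkey]
    refine sum_le_sum fun K _ => ?_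
    obtain ⟨c, hK⟩ := hreg K K.2
    exact hK.simplex.pairing_le hn hK.diam_pos (φ K).2
      (ψ := fun f x => (l f : Euc n → ℝ) x - (φ K : Euc n → ℝ) x)
      (fun f => (hlc f).sub (hφc K)) (fun i => (hqc K i).sub (hUc K i)) hε (hBnn K) hC₀
      (hloc K).1 (hloc K).2
  rw [sum_add_distrib, ← mul_sum, ← mul_sum] at hest
  have e1 : 1 / (C₀ * ((n : ℝ) + 2)) * C₀ * (n + 2) / 2 = 1 / 2 := by field_simp
  have e2 : 1 / (2 * (1 / (C₀ * ((n : ℝ) + 2)))) = C₀ * (n + 2) / 2 := by field_simp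
  rw [e1, e2] at hest
  linarith

end Triangulation

section Mollification

open scoped Convolution

variable {V : Type*} [NormedAddCommGroup V] [NormedSpace ℝ V] [MeasureSpace V] [BorelSpace V]
  [FiniteDimensional ℝ V] [(volume : Measure V).IsAddHaarMeasure]

/-- The mollification `ρ * f`. -/
noncomputable def moll (ρ f : V → ℝ) (x : V) : ℝ := ∫ y, ρ (x - y) * f y

lemma moll_eq_right (ρ f : V → ℝ) : moll ρ f = f ⋆[ContinuousLinearMap.lsmul ℝ ℝ, volume] ρ := by
  ext x
  simp [moll, convolution_def, mul_comm]

lemma moll_eq_left (ρ f : V → ℝ) : moll ρ f = ρ ⋆[ContinuousLinearMap.lsmul ℝ ℝ, volume] f := by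
  ext x
  rw [convolution_eq_swap]
  simp [moll]

lemma moll_contDiff {ρ f : V → ℝ} (hρ : ContDiff ℝ ∞ ρ) (hc : HasCompactSupport ρ)
    (hf : LocallyIntegrable f) : ContDiff ℝ ∞ (moll ρ f) := by
  rw [moll_eq_right]
  exact hc.contDiff_convolution_right _ hf hρ

lemma fderiv_moll {ρ f : V → ℝ} (hρ : ContDiff ℝ ∞ ρ) (hc : HasCompactSupport ρ)
    (hf : LocallyIntegrable f) (x v : V) :
    fderiv ℝ (moll ρ f) x v = moll (fun z => fderiv ℝ ρ z v) f x := by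
  have h1 : ContDiff ℝ 1 ρ := hρ.of_le (by simp)
  have h := hc.hasFDerivAt_convolution_right (ContinuousLinearMap.lsmul ℝ ℝ) hf h1 x
  rw [moll_eq_right, h.fderiv, moll_eq_right,
    convolution_precompR_apply _ hf (hc.fderiv (𝕜 := ℝ)) (h1.continuous_fderiv (by simp))]

lemma contDiff_iteratedFDeriv_apply {f : V → ℝ} (hf : ContDiff ℝ ∞ f) {k : ℕ} (w : Fin k → V) :
    ContDiff ℝ ∞ fun z => iteratedFDeriv ℝ k f z w := by
  have h : ContDiff ℝ ∞ (iteratedFDeriv ℝ k f) := hf.iteratedFDeriv_right (by exact_mod_cast le_top)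
  exact (ContinuousMultilinearMap.apply ℝ (fun _ : Fin k => V) ℝ w).contDiff.comp h

lemma iteratedFDeriv_succ_apply {f : V → ℝ} (hf : ContDiff ℝ ∞ f) {k : ℕ} (w : Fin (k + 1) → V)
    (x : V) : iteratedFDeriv ℝ (k + 1) f x w =
      fderiv ℝ (fun z => iteratedFDeriv ℝ k f z (Fin.tail w)) x (w 0) := by
  rw [iteratedFDeriv_succ_apply_left]
  have h : ContDiff ℝ ∞ (iteratedFDeriv ℝ k f) := hf.iteratedFDeriv_right (by exact_mod_cast le_top)
  have hd : DifferentiableAt ℝ (iteratedFDeriv ℝ k f) x := h.differentiable (by simp) x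
  have h1 := ((ContinuousMultilinearMap.apply ℝ (fun _ : Fin k => V) ℝ
    (Fin.tail w)).hasFDerivAt (x := iteratedFDeriv ℝ k f x)).comp x hd.hasFDerivAt
  have h2 := h1.fderiv
  simp only [Function.comp_def, ContinuousMultilinearMap.apply_apply] at h2
  rw [h2]
  rfl

lemma hasCompactSupport_iteratedFDeriv_apply {f : V → ℝ} (hf : HasCompactSupport f) {k : ℕ}
    (w : Fin k → V) : HasCompactSupport fun z => iteratedFDeriv ℝ k f z w :=
  (hf.iteratedFDeriv (𝕜 := ℝ) k).comp_left
    (g := fun m : ContinuousMultilinearMap ℝ (fun _ : Fin k => V) ℝ => m w) rfl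

lemma iteratedFDeriv_moll {ρ f : V → ℝ} (hρ : ContDiff ℝ ∞ ρ) (hc : HasCompactSupport ρ)
    (hf : LocallyIntegrable f) {k : ℕ} (w : Fin k → V) (x : V) :
    iteratedFDeriv ℝ k (moll ρ f) x w = moll (fun z => iteratedFDeriv ℝ k ρ z w) f x := by
  induction k generalizing x with
  | zero => simp
  | succ k ih =>
    rw [iteratedFDeriv_succ_apply (moll_contDiff hρ hc hf)]
    simp only [ih (Fin.tail w)]
    rw [fderiv_moll (contDiff_iteratedFDeriv_apply hρ _)
      (hasCompactSupport_iteratedFDeriv_apply hc _) hf]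
    simp only [iteratedFDeriv_succ_apply hρ]

lemma iteratedFDeriv_reflect {ρ : V → ℝ} (hρ : ContDiff ℝ ∞ ρ) {k : ℕ} (w : Fin k → V) (x z : V) :
    iteratedFDeriv ℝ k (fun y => ρ (x - y)) z w = (-1) ^ k * iteratedFDeriv ℝ k ρ (x - z) w := by
  have h1 : ContDiff ℝ k (fun y => ρ (x + y)) :=
    (hρ.comp (contDiff_const.add contDiff_id)).of_le (by exact_mod_cast le_top)
  have h2 := iteratedFDeriv_comp_const_smul (-1 : ℝ) h1
  have h3 : (fun y => ρ (x - y)) = fun y => (fun y => ρ (x + y)) ((-1 : ℝ) • y) := by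
    ext y
    simp [sub_eq_add_neg]
  rw [h3, h2]
  simp only [iteratedFDeriv_comp_add_left, ContinuousMultilinearMap.smul_apply, smul_eq_mul]
  simp [sub_eq_add_neg]

lemma _root_.IsTestFunction.eq_zero {Q : Set V} {φ : V → ℝ} (h : IsTestFunction Q φ) {x : V}
    (hx : x ∉ Q) : φ x = 0 := image_eq_zero_of_notMem_tsupport fun h' => hx (h.support h')

lemma iteratedFDeriv_apply_eq_zero {φ : V → ℝ} {x : V} (hx : x ∉ tsupport φ) {k : ℕ}
    (w : Fin k → V) : iteratedFDeriv ℝ k φ x w = 0 := by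
  rw [show iteratedFDeriv ℝ k φ x = 0 from
    of_not_not fun h => hx (support_iteratedFDeriv_subset k h)]
  rfl

/-- Mollification turns weak derivatives into derivatives, wherever the mollifier only sees the
domain `Q`. The functions `f'`, `g'` are any extensions of `f`, `g`. -/
lemma iteratedFDeriv_moll_of_hasWeakDeriv {Q : Set V} (hQ : MeasurableSet Q) {k : ℕ}
    {w : Fin k → V} {f g f' g' : V → ℝ}
    (h : HasWeakDeriv Q w f g) {ρ : V → ℝ} (hρ : ContDiff ℝ ∞ ρ) (hc : HasCompactSupport ρ)
    (hf : LocallyIntegrable f') {x : V}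
    (hx : ∀ z, x - z ∈ tsupport ρ → z ∈ Q ∧ f' z = f z ∧ g' z = g z) :
    iteratedFDeriv ℝ k (moll ρ f') x w = moll ρ g' x := by
  rw [iteratedFDeriv_moll hρ hc hf]
  have hts : tsupport (fun y => ρ (x - y)) = (fun y => x - y) ⁻¹' tsupport ρ := by
    have := (Homeomorph.subLeft x).isOpenMap.preimage_closure_eq_closure_preimage
      (Homeomorph.subLeft x).continuous (Function.support ρ)
    exact this.symm
  have htest : IsTestFunction Q fun y => ρ (x - y) := by
    refine ⟨hρ.comp (contDiff_const.sub contDiff_id), ?_, fun z hz => ?_⟩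
    · exact hc.comp_homeomorph (Homeomorph.subLeft x)
    · rw [hts] at hz
      exact (hx z hz).1
  have h1 := h.parts _ htest
  simp only [iteratedFDeriv_reflect hρ] at h1
  have e1 : ∫ z in Q, f z * ((-1) ^ k * iteratedFDeriv ℝ k ρ (x - z) w) =
      (-1) ^ k * moll (fun z => iteratedFDeriv ℝ k ρ z w) f' x := by
    rw [moll, ← integral_const_mul, ← integral_indicator hQ]
    refine integral_congr_ae (.of_forall fun z => ?_)
    by_cases hzz : x - z ∈ tsupport ρ
    · rw [indicator_of_mem (hx z hzz).1]
      simp only [(hx z hzz).2.1]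
      ring
    · simp [iteratedFDeriv_apply_eq_zero hzz, indicator_apply]
  have e2 : ∫ z in Q, g z * ρ (x - z) = moll ρ g' x := by
    rw [moll, ← integral_indicator hQ]
    refine integral_congr_ae (.of_forall fun z => ?_)
    by_cases hzz : x - z ∈ tsupport ρ
    · rw [indicator_of_mem (hx z hzz).1]
      simp only [(hx z hzz).2.2]
      ring
    · simp [image_eq_zero_of_notMem_tsupport hzz, indicator_apply]
  rw [e1, e2] at h1
  exact mul_left_cancel₀ (pow_ne_zero k (by norm_num)) h1

/-- A mollifier: a smooth probability density supported in the ball of radius `ε`. -/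
structure IsMollifier (ε : ℝ) (ρ : V → ℝ) : Prop where
  smooth : ContDiff ℝ ∞ ρ
  compact : HasCompactSupport ρ
  nonneg : ∀ x, 0 ≤ ρ x
  integral : ∫ x, ρ x = 1
  support : tsupport ρ ⊆ closedBall 0 ε

lemma isMollifier_normed (φ : ContDiffBump (0 : V)) : IsMollifier φ.rOut (φ.normed volume) where
  smooth := φ.contDiff_normed
  compact := φ.hasCompactSupport_normed
  nonneg := φ.nonneg_normed
  integral := φ.integral_normed
  support := φ.tsupport_normed_eq.le

lemma exists_isMollifier {ε : ℝ} (hε : 0 < ε) : ∃ ρ : V → ℝ, IsMollifier ε ρ :=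
  ⟨_, isMollifier_normed ⟨ε / 2, ε, by positivity, by linarith⟩⟩

variable {ε : ℝ} {ρ : V → ℝ}

lemma IsMollifier.integrable (h : IsMollifier ε ρ) : Integrable ρ :=
  h.smooth.continuous.integrable_of_hasCompactSupport h.compact

lemma IsMollifier.integral_sub (h : IsMollifier ε ρ) (x : V) : ∫ y, ρ (x - y) = 1 := by
  rw [integral_sub_left_eq_self ρ volume x, h.integral]

lemma IsMollifier.norm_le (h : IsMollifier ε ρ) {x z : V} (hz : x - z ∈ tsupport ρ) :
    ‖x - z‖ ≤ ε := by simpa using h.support hz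

lemma IsMollifier.integrable_sub (h : IsMollifier ε ρ) (x : V) : Integrable fun y => ρ (x - y) :=
  h.integrable.comp_sub_left x

lemma IsMollifier.abs_moll_le (h : IsMollifier ε ρ) {g : V → ℝ} {M : ℝ} {x : V}
    (hg : ∀ᵐ z, x - z ∈ tsupport ρ → |g z| ≤ M) : |moll ρ g x| ≤ M := by
  rw [← Real.norm_eq_abs, moll, ← one_mul M, ← h.integral_sub x, ← integral_mul_const]
  refine norm_integral_le_of_norm_le ((h.integrable_sub x).mul_const M) ?_
  filter_upwards [hg] with z hz
  rw [norm_mul, Real.norm_of_nonneg (h.nonneg _), Real.norm_eq_abs]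
  by_cases hs : x - z ∈ tsupport ρ
  · exact mul_le_mul_of_nonneg_left (hz hs) (h.nonneg _)
  · simp [image_eq_zero_of_notMem_tsupport hs]

lemma integrable_mul_of_tsupport_subset {Q : Set V} {ϕ g : V → ℝ}
    (hg : LocallyIntegrableOn g Q) (h1 : Continuous ϕ) (h2 : HasCompactSupport ϕ)
    (h3 : tsupport ϕ ⊆ Q) : Integrable fun x => ϕ x * g x := by
  have h := (hg.integrableOn_compact_subset h3 h2).continuousOn_mul h1.continuousOn h2
  refine (integrableOn_iff_integrable_of_support_subset fun x hx => ?_).1 h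
  exact subset_tsupport _ fun h0 => hx (by simp [h0])

/-- The weak derivative is unique up to null sets. -/
lemma HasWeakDeriv.ae_unique {Q : Set V} (hQ : IsOpen Q) {k : ℕ}
    {w : Fin k → V} {f g g' : V → ℝ} (h : HasWeakDeriv Q w f g) (h' : HasWeakDeriv Q w f g') :
    g =ᵐ[volume.restrict Q] g' := by
  have h0 := hQ.ae_eq_zero_of_integral_contDiff_smul_eq_zero
    (h.locInt_deriv.sub h'.locInt_deriv) fun φ h1 h2 h3 => by
      have e := h.parts φ ⟨h1, h2, h3⟩
      rw [h'.parts φ ⟨h1, h2, h3⟩] at e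
      have e' := mul_left_cancel₀ (pow_ne_zero k (by norm_num)) e
      have hz : ∀ γ : V → ℝ, ∀ x ∉ Q, γ x * φ x = 0 := fun γ x hx => by
        rw [image_eq_zero_of_notMem_tsupport fun h => hx (h3 h), mul_zero]
      rw [setIntegral_eq_integral_of_forall_compl_eq_zero (hz g'),
        setIntegral_eq_integral_of_forall_compl_eq_zero (hz g)] at e'
      simp only [Pi.sub_apply, smul_eq_mul, mul_sub]
      rw [MeasureTheory.integral_sub
        (integrable_mul_of_tsupport_subset h.locInt_deriv h1.continuous h2 h3)
        (integrable_mul_of_tsupport_subset h'.locInt_deriv h1.continuous h2 h3)]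
      simp only [mul_comm (φ _), e', sub_self]
  rw [Filter.EventuallyEq, ae_restrict_iff' hQ.measurableSet]
  filter_upwards [h0] with x hx hxQ
  exact sub_eq_zero.1 (hx hxQ)

/-- The directional derivatives of a Lipschitz function are its weak derivatives. -/
lemma hasWeakDeriv_of_lipschitz {Q : Set V} (hQ : IsOpen Q) {F f : V → ℝ} {C : ℝ≥0}
    (hF : LipschitzWith C F) (hf : LocallyIntegrableOn f Q) (hfF : f =ᵐ[volume.restrict Q] F)
    (e : V) : HasWeakDeriv Q ![e] f fun x => lineDeriv ℝ F x e where
  locInt_fun := hf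
  locInt_deriv := ((locallyIntegrable_const (C * ‖e‖)).mono
    (stronglyMeasurable_lineDeriv hF.continuous).aestronglyMeasurable (.of_forall fun x => by
      rw [Real.norm_of_nonneg (by positivity : (0 : ℝ) ≤ C * ‖e‖)]
      exact norm_lineDeriv_le_of_lipschitz ℝ hF)).locallyIntegrableOn Q
  parts φ hφ := by
    have hφ1 : ContDiff ℝ 1 φ := hφ.smooth.of_le (by simp)
    obtain ⟨D, hD⟩ := hφ1.lipschitzWith_of_hasCompactSupport hφ.compact (by simp)
    have hl : ∀ x, lineDeriv ℝ φ x (-e) = -iteratedFDeriv ℝ 1 φ x ![e] := fun x => by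
      rw [iteratedFDeriv_one_apply, lineDeriv_neg,
        ((hφ1.differentiable (by simp)) x).lineDeriv_eq_fderiv]
      simp
    rw [integral_congr_ae (g := fun x => F x * iteratedFDeriv ℝ 1 φ x ![e])
        (hfF.mono fun x hx => by simp only [hx]),
      setIntegral_eq_integral_of_forall_compl_eq_zero fun x hx => by
        rw [iteratedFDeriv_apply_eq_zero fun h => hx (hφ.support h), mul_zero],
      setIntegral_eq_integral_of_forall_compl_eq_zero fun x hx => by rw [hφ.eq_zero hx, mul_zero],
      hF.integral_lineDeriv_mul_eq hD hφ.compact e, pow_one, neg_one_mul, ← integral_neg]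
    simp only [hl, mul_comm, mul_neg, neg_neg, neg_mul]

/-- A function on a convex open set with bounded weak derivatives in spanning directions agrees
almost everywhere with a Lipschitz function, whose directional derivatives are the weak ones. -/
lemma exists_lipschitz_of_hasWeakDeriv {ι : Type*} [Fintype ι] {e : ι → V}
    (he : ∀ v, ∃ c : ι → ℝ, v = ∑ i, c i • e i ∧ ∀ i, |c i| ≤ ‖v‖) {Q : Set V} (hQo : IsOpen Q)
    (hQc : Convex ℝ Q) {f : V → ℝ} {g : ι → V → ℝ} {M : ℝ≥0}
    (hw : ∀ i, HasWeakDeriv Q ![e i] f (g i)) (hf : LocallyIntegrableOn f Q)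
    (hb : ∀ i, ∀ᵐ x ∂(volume.restrict Q), |g i x| ≤ M) :
    ∃ F : V → ℝ, LipschitzWith (Fintype.card ι * M) F ∧ f =ᵐ[volume.restrict Q] F ∧
      ∀ i, (fun x => lineDeriv ℝ F x (e i)) =ᵐ[volume.restrict Q] g i := by
  have := hQo.locallyCompactSpace
  let ce := CompactExhaustion.choice Q
  set S : ℕ → Set V := fun k => Subtype.val '' ce k
  have hScomp : ∀ k, IsCompact (S k) := fun k => (ce.isCompact k).image continuous_subtype_val
  have hSQ : ∀ k, S k ⊆ Q := fun k x ⟨y, _, hy⟩ => hy ▸ y.2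
  have hfk : ∀ k, LocallyIntegrable ((S k).indicator f) := fun k =>
    ((integrable_indicator_iff (hScomp k).measurableSet).2
      (hf.integrableOn_compact_subset (hSQ k) (hScomp k))).locallyIntegrable
  let φ : ℕ → ContDiffBump (0 : V) := fun j => ⟨1 / (2 * ((j : ℝ) + 1)), 1 / ((j : ℝ) + 1),
    by positivity, one_div_lt_one_div_of_lt (by positivity) (by linarith [j.cast_nonneg (α := ℝ)])⟩
  have hφ0 : Filter.Tendsto (fun j => (φ j).rOut) Filter.atTop (nhds 0) :=
    tendsto_one_div_add_atTop_nhds_zero_nat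
  have hae : ∀ᵐ x, ∀ k, Filter.Tendsto (fun j => moll ((φ j).normed volume) ((S k).indicator f) x)
      Filter.atTop (nhds ((S k).indicator f x)) := by
    rw [ae_all_iff]
    intro k
    simp only [moll_eq_left]
    refine ContDiffBump.ae_convolution_tendsto_right_of_locallyIntegrable (K := 2) hφ0
      (.of_forall fun j => le_of_eq ?_) (hfk k)
    change 1 / ((j : ℝ) + 1) = 2 * (1 / (2 * ((j : ℝ) + 1)))
    field_simp
  set N : Set V := {x | ∀ k, Filter.Tendsto (fun j => moll ((φ j).normed volume)
    ((S k).indicator f) x) Filter.atTop (nhds ((S k).indicator f x))} with hN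
  have hgM : ∀ i, ∀ᵐ z, |Q.indicator (g i) z| ≤ M := fun i => by
    filter_upwards [(ae_restrict_iff' hQo.measurableSet).1 (hb i)] with z hz
    by_cases hzQ : z ∈ Q
    · simpa [hzQ] using hz hzQ
    · simp [hzQ]
  have hlip : LipschitzOnWith (Fintype.card ι * M) f (Q ∩ N) := by
    refine LipschitzOnWith.of_dist_le_mul fun x hx y hy => ?_
    have hseg : IsCompact (segment ℝ x y) := by
      rw [segment_eq_image_lineMap]
      exact isCompact_Icc.image AffineMap.lineMap_continuous
    obtain ⟨δ, hδ, hsub⟩ := hseg.exists_cthickening_subset_open hQo (hQc.segment_subset hx.1 hy.1)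
    obtain ⟨k, hk⟩ := ce.exists_superset_of_isCompact
      (Topology.IsInducing.subtypeVal.isCompact_preimage' (hseg.cthickening (r := δ)) (by simpa))
    have hnear : ∀ p ∈ segment ℝ x y, ∀ q, ‖p - q‖ ≤ δ → q ∈ S k := fun p hp q h => by
      have hq : q ∈ Metric.cthickening δ (segment ℝ x y) :=
        Metric.mem_cthickening_of_dist_le q p δ _ hp (by rwa [dist_comm, dist_eq_norm])
      exact ⟨⟨q, hsub hq⟩, hk hq, rfl⟩
    have hlim : ∀ z ∈ N, z ∈ segment ℝ x y → Filter.Tendsto (fun j => moll ((φ j).normed volume)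
        ((S k).indicator f) z) Filter.atTop (nhds (f z)) := by
      intro z hz hzD
      have h1 := hz k
      rwa [indicator_of_mem (hnear z hzD z (by simpa using hδ.le))] at h1
    have hev : ∀ᶠ j in Filter.atTop, dist (moll ((φ j).normed volume) ((S k).indicator f) x)
        (moll ((φ j).normed volume) ((S k).indicator f) y) ≤
        ((Fintype.card ι * M : ℝ≥0) : ℝ) * dist x y := by
      filter_upwards [hφ0.eventually_lt_const hδ] with j hj
      have hmol := isMollifier_normed (φ j)
      rw [dist_eq_norm, dist_eq_norm]
      refine (convex_segment x y).norm_image_sub_le_of_norm_fderiv_le (𝕜 := ℝ)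
        (fun p _ => (moll_contDiff hmol.smooth hmol.compact (hfk k)).differentiable (by simp) p)
        (fun p hp => ?_) (right_mem_segment ℝ x y) (left_mem_segment ℝ x y)
      have hi : ∀ i, |fderiv ℝ (moll ((φ j).normed volume) ((S k).indicator f)) p (e i)| ≤ M := by
        intro i
        have h1 := iteratedFDeriv_moll_of_hasWeakDeriv (f' := (S k).indicator f)
          (g' := Q.indicator (g i)) hQo.measurableSet (hw i) hmol.smooth hmol.compact (hfk k)
          (x := p) (fun z hz => by
            have hzS := hnear p hp z ((hmol.norm_le hz).trans hj.le)
            exact ⟨hSQ k hzS, indicator_of_mem hzS f, indicator_of_mem (hSQ k hzS) _⟩)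
        rw [iteratedFDeriv_one_apply] at h1
        simp only [Matrix.cons_val_zero] at h1
        rw [h1]
        exact hmol.abs_moll_le ((hgM i).mono fun _ h _ => h)
      refine ContinuousLinearMap.opNorm_le_bound _ (by positivity) fun v => ?_
      obtain ⟨c, hc1, hc2⟩ := he v
      conv_lhs => rw [hc1]
      rw [map_sum, Real.norm_eq_abs]
      refine (abs_sum_le_sum_abs _ _).trans ?_
      have : ∀ i ∈ Finset.univ, |fderiv ℝ (moll ((φ j).normed volume) ((S k).indicator f)) p
          (c i • e i)| ≤ M * ‖v‖ := fun i _ => by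
        rw [map_smul, smul_eq_mul, abs_mul, mul_comm]
        exact mul_le_mul (hi i) (hc2 i) (abs_nonneg _) M.2
      refine (sum_le_sum this).trans (le_of_eq ?_)
      simp [mul_assoc]
    exact le_of_tendsto ((hlim x hx.2 (left_mem_segment ℝ x y)).dist (hlim y hy.2 (right_mem_segment ℝ x y))) hev
  obtain ⟨F, hF, hFf⟩ := hlip.extend_real
  have hfF : f =ᵐ[volume.restrict Q] F := by
    rw [Filter.EventuallyEq, ae_restrict_iff' hQo.measurableSet]
    filter_upwards [hae] with x hx hxQ
    exact hFf ⟨hxQ, hx⟩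
  exact ⟨F, hF, hfF, fun i => (hasWeakDeriv_of_lipschitz hQo hF hf hfF _).ae_unique hQo (hw i)⟩

end Mollification

section Taylor

variable {n : ℕ}

/-- Expansion of a multilinear form on the diagonal in coordinates. -/
lemma multilinear_diag_eq {m : ℕ} (D : ContinuousMultilinearMap ℝ (fun _ : Fin m => Euc n) ℝ)
    v : D (fun _ => v) = ∑ I : Fin m → Fin n, (∏ l, v (I l)) * D fun l => stdVec (I l) := by
  classical
  conv_lhs => rw [← sum_smul_stdVec v]
  rw [D.map_sum]
  refine sum_congr rfl fun I _ => ?_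
  rw [D.map_smul_univ, smul_eq_mul]

lemma multilinear_diag_sq_le {m : ℕ} (D : ContinuousMultilinearMap ℝ (fun _ : Fin m => Euc n) ℝ)
    v : D (fun _ => v) ^ 2 ≤
      (‖v‖ ^ 2) ^ m * ∑ I : Fin m → Fin n, D (fun l => stdVec (I l)) ^ 2 := by
  rw [multilinear_diag_eq]
  refine (Finset.sum_mul_sq_le_sq_mul_sq _ _ _).trans (le_of_eq ?_)
  congr 1
  rw [EuclideanSpace.norm_sq_eq, ← Fin.prod_const, Finset.prod_univ_sum, Fintype.piFinset_univ]
  refine sum_congr rfl fun I _ => ?_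
  rw [← Finset.prod_pow]
  simp

/-- The Taylor polynomial of degree `s` at `y`. -/
noncomputable def taylorAt (Φ : Euc n → ℝ) (s : ℕ) (y x : Euc n) : ℝ :=
  ∑ k ∈ Finset.range (s + 1), (k.factorial : ℝ)⁻¹ * ∑ I : Fin k → Fin n,
    (∏ l, (x - y) (I l)) * iteratedFDeriv ℝ k Φ y fun l => stdVec (I l)

/-- The sum of the squares of all derivatives of order `m`. -/
noncomputable def derivSq (m : ℕ) (Φ : Euc n → ℝ) (x : Euc n) : ℝ :=
  ∑ I : Fin m → Fin n, (iteratedFDeriv ℝ m Φ x fun l => stdVec (I l)) ^ 2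

lemma taylorAt_mem_polySpace Φ (s : ℕ) y :
    taylorAt Φ s y ∈ polySpace n s := by
  refine polySpace_sum _ fun k hk => (polySpace n s).smul_mem _ (polySpace_sum _ fun I _ => ?_)
  have h : (fun x : Euc n => ∏ l, (x - y) (I l)) ∈ polySpace n (∑ _l : Fin k, 1) :=
    polySpace_prod _ fun l _ =>
      (polySpace n 1).sub_mem (polySpace_coord (I l)) (polySpace_const (y (I l)))
  have hk' : ∑ _l : Fin k, 1 ≤ s := by
    have := Finset.mem_range.1 hk
    simp
    omega
  have h2 := (polySpace n s).smul_mem (iteratedFDeriv ℝ k Φ y fun l => stdVec (I l))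
    (polySpace_mono hk' h)
  convert h2 using 1
  ext x
  simp [mul_comm]

lemma continuous_taylorAt {Φ : Euc n → ℝ} (hΦ : ContDiff ℝ ∞ Φ) (s : ℕ) :
    Continuous fun p : Euc n × Euc n => taylorAt Φ s p.1 p.2 := by
  refine continuous_finset_sum _ fun k _ => continuous_const.mul
    (continuous_finset_sum _ fun I _ => Continuous.mul ?_ ?_)
  · fun_prop
  · exact (contDiff_iteratedFDeriv_apply hΦ _).continuous.comp continuous_fst

lemma continuous_derivSq {Φ : Euc n → ℝ} (hΦ : ContDiff ℝ ∞ Φ) (m : ℕ) : Continuous (derivSq m Φ) :=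
  continuous_finset_sum _ fun I _ => (contDiff_iteratedFDeriv_apply hΦ _).continuous.pow 2

lemma derivSq_nonneg (m : ℕ) (Φ : Euc n → ℝ) (x : Euc n) : 0 ≤ derivSq m Φ x :=
  sum_nonneg fun _ _ => sq_nonneg _

lemma sq_integral_le {X : Type*} [MeasurableSpace X] {μ : Measure X} [IsProbabilityMeasure μ]
    {g : X → ℝ} (hg : Integrable g μ) (hg2 : Integrable (fun x => g x ^ 2) μ) :
    (∫ x, g x ∂μ) ^ 2 ≤ ∫ x, g x ^ 2 ∂μ :=
  even_two.convexOn_pow.map_integral_le (continuous_pow 2).continuousOn isClosed_univ (by simp) hg hg2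

lemma taylor_remainder_sq_le {Φ : Euc n → ℝ} (hΦ : ContDiff ℝ ∞ Φ) {s : ℕ}
    {K : Set (Euc n)} (hK : IsCompact K) {x y : Euc n} (hx : x ∈ K) (hy : y ∈ K) :
    (Φ x - taylorAt Φ s y x) ^ 2 ≤ (diam K ^ 2) ^ (s + 1) *
      ∫ r in Icc (0 : ℝ) 1, (1 - r) ^ (2 * s) * derivSq (s + 1) Φ (y + r • (x - y)) := by
  have h := map_add_eq_sum_add_integral_iteratedFDeriv (f := Φ) (x := y) (y := x - y) (n := s)
    fun t _ => (hΦ.of_le (by exact_mod_cast le_top)).contDiffAt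
  rw [add_sub_cancel, intervalIntegral.integral_of_le zero_le_one, ← integral_Icc_eq_integral_Ioc,
    show ∑ k ∈ Finset.range (s + 1), (k.factorial : ℝ)⁻¹ • (iteratedFDeriv ℝ k Φ y fun _ => x - y) =
      taylorAt Φ s y x from sum_congr rfl fun k _ => by rw [multilinear_diag_eq, smul_eq_mul],
    ← sub_eq_iff_eq_add'] at h
  have hc : Continuous fun r : ℝ =>
      (1 - r) ^ s • iteratedFDeriv ℝ (s + 1) Φ (y + r • (x - y)) fun _ => x - y :=
    .smul (f := fun r : ℝ => (1 - r) ^ s) (by fun_prop) ((contDiff_iteratedFDeriv_apply hΦ _).continuous.comp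
      (f := fun r : ℝ => y + r • (x - y)) (by fun_prop))
  have hd := (continuous_derivSq hΦ (s + 1)).comp (f := fun r : ℝ => y + r • (x - y)) (by fun_prop)
  haveI : IsProbabilityMeasure ((volume : Measure ℝ).restrict (Icc 0 1)) := ⟨by simp⟩
  have hi := integrableOn_of_continuous (hc.pow 2) isCompact_Icc (S := Icc (0 : ℝ) 1)
    (μ := volume)
  rw [h, smul_eq_mul, mul_pow]
  refine (mul_le_of_le_one_left (sq_nonneg _) (pow_le_one₀ (by positivity) (inv_le_one_of_one_le₀
    (mod_cast s.factorial_pos)))).trans ((sq_integral_le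
      (integrableOn_of_continuous hc isCompact_Icc) hi).trans ?_)
  rw [← integral_const_mul]
  refine integral_mono hi ((integrableOn_of_continuous (.mul (by fun_prop) hd)
    isCompact_Icc).const_mul _) fun r => ?_
  beta_reduce
  rw [smul_eq_mul, mul_pow, ← pow_mul, mul_comm s 2, mul_left_comm]
  refine mul_le_mul_of_nonneg_left ((multilinear_diag_sq_le _ _).trans
    (mul_le_mul_of_nonneg_right ?_ (derivSq_nonneg _ _ _))) ((even_two_mul s).pow_nonneg _)
  rw [← dist_eq_norm]
  have := Metric.dist_le_diam_of_mem hK.isBounded hx hy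
  gcongr

/-- A continuous function is integrable for a finite measure carried by a compact set. -/
lemma integrable_of_restrict_eq {X : Type*} [TopologicalSpace X] [MeasurableSpace X]
    [OpensMeasurableSpace X] [SecondCountableTopology X] [T2Space X] {μ : Measure X}
    [IsFiniteMeasure μ] {S : Set X} (hS : IsCompact S) (hμ : μ.restrict S = μ) {g : X → ℝ}
    (hg : Continuous g) : Integrable g μ := by
  obtain ⟨C, hC⟩ := hS.exists_bound_of_continuousOn hg.continuousOn
  rw [← hμ]
  exact Measure.integrableOn_of_bounded (measure_ne_top _ _) hg.aestronglyMeasurable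
    (ae_restrict_of_forall_mem hS.measurableSet hC)

lemma integrable_prod_of_continuous {X Y : Type*} [TopologicalSpace X] [TopologicalSpace Y]
    [MeasurableSpace X] [MeasurableSpace Y] [OpensMeasurableSpace X] [OpensMeasurableSpace Y]
    [SecondCountableTopology X] [T2Space X] [T2Space Y]
    [SecondCountableTopology Y] {μ : Measure X} {ν : Measure Y} [IsFiniteMeasure μ]
    [IsFiniteMeasure ν] {S : Set X} {S' : Set Y} (hS : IsCompact S) (hS' : IsCompact S')
    (hμ : μ.restrict S = μ) (hν : ν.restrict S' = ν) {g : X × Y → ℝ} (hg : Continuous g) :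
    Integrable g (μ.prod ν) :=
  integrable_of_restrict_eq (hS.prod hS') (by rw [← Measure.prod_restrict, hμ, hν]) hg

/-- Contracting a compact convex set towards one of its points. -/
lemma setIntegral_contract_le {K : Set (Euc n)} (hK : IsCompact K) (hKc : Convex ℝ K) {x : Euc n}
    (hx : x ∈ K) {H : Euc n → ℝ} (hH : Continuous H) (hH0 : ∀ y, 0 ≤ H y) {r : ℝ} (hr0 : 0 ≤ r)
    (hr1 : r < 1) : (1 - r) ^ n * ∫ y in K, H (y + r • (x - y)) ≤ ∫ y in K, H y := by
  have hr : 0 < 1 - r := by linarith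
  have hi : Integrable (K.indicator H) :=
    (integrable_indicator_iff hK.measurableSet).2 (integrableOn_of_continuous hH hK)
  have e1 : ∫ y, K.indicator H (r • x + (1 - r) • y) = ((1 - r) ^ n)⁻¹ * ∫ y in K, H y := by
    rw [Measure.integral_comp_smul volume (fun y => K.indicator H (r • x + y)),
      integral_add_left_eq_self (K.indicator H), integral_indicator hK.measurableSet]
    simp [abs_of_pos hr]
  have e2 : ∫ y in K, H (y + r • (x - y)) ≤ ∫ y, K.indicator H (r • x + (1 - r) • y) := by
    rw [← integral_indicator hK.measurableSet]
    refine integral_mono ((integrable_indicator_iff hK.measurableSet).2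
      (integrableOn_of_continuous (hH.comp (by fun_prop)) hK)) ?_ fun y => ?_
    · exact (hi.comp_add_left (r • x)).comp_smul hr.ne'
    · by_cases hy : y ∈ K
      · have h1 : r • x + (1 - r) • y ∈ K := hKc hx hy hr0 hr.le (by ring)
        rw [indicator_of_mem hy, indicator_of_mem h1]
        refine le_of_eq (congrArg H ?_)
        rw [smul_sub, sub_smul, one_smul]
        abel
      · rw [indicator_of_notMem hy]
        exact indicator_nonneg (fun z _ => hH0 z) _
  rw [e1] at e2
  rwa [← le_inv_mul_iff₀ (by positivity)]

lemma integral_segment_le {H : Euc n → ℝ} (hHc : Continuous H) (hH0 : ∀ y, 0 ≤ H y) {s : ℕ}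
    (hs : n < 2 * s) {K : Set (Euc n)} (hK : IsCompact K) (hKc : Convex ℝ K) {x : Euc n}
    (hx : x ∈ K) :
    Integrable (fun y => ∫ r in Icc (0 : ℝ) 1, (1 - r) ^ (2 * s) * H (y + r • (x - y)))
      (volume.restrict K) ∧
    ∫ y in K, ∫ r in Icc (0 : ℝ) 1, (1 - r) ^ (2 * s) * H (y + r • (x - y)) ≤ ∫ y in K, H y := by
  have hgc : Continuous fun p : Euc n × ℝ => (1 - p.2) ^ (2 * s) * H (p.1 + p.2 • (x - p.1)) :=
    Continuous.mul (by fun_prop) (hHc.comp (by fun_prop))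
  haveI : IsFiniteMeasure (volume.restrict K) := ⟨by simpa using hK.measure_lt_top⟩
  have hprod : Integrable (fun p : Euc n × ℝ => (1 - p.2) ^ (2 * s) * H (p.1 + p.2 • (x - p.1)))
      ((volume.restrict K).prod (volume.restrict (Icc (0 : ℝ) 1))) :=
    integrable_prod_of_continuous hK isCompact_Icc (Measure.restrict_restrict_of_subset subset_rfl)
      (Measure.restrict_restrict_of_subset subset_rfl) hgc
  refine ⟨hprod.integral_prod_left, ?_⟩
  have hI2 : Integrable (fun r => ∫ y in K, (1 - r) ^ (2 * s) * H (y + r • (x - y)))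
      (volume.restrict (Icc (0 : ℝ) 1)) := hprod.integral_prod_right
  rw [integral_integral_swap hprod]
  have hr : ∀ r ∈ Icc (0 : ℝ) 1, ∫ y in K, (1 - r) ^ (2 * s) * H (y + r • (x - y)) ≤
      ∫ y in K, H y := by
    intro r hr
    rw [integral_const_mul]
    rcases hr.2.lt_or_eq with h1 | h1
    · have h2 := setIntegral_contract_le hK hKc hx hHc hH0 hr.1 h1
      have h3 : (1 - r) ^ (2 * s) ≤ (1 - r) ^ n :=
        pow_le_pow_of_le_one (by linarith [hr.2]) (by linarith [hr.1]) hs.le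
      exact (mul_le_mul_of_nonneg_right h3 (integral_nonneg fun _ => hH0 _)).trans h2
    · rw [h1, sub_self, zero_pow (by omega), zero_mul]
      exact integral_nonneg fun _ => hH0 _
  have hstep2 := setIntegral_mono_on hI2 (integrableOn_const (by simp)) measurableSet_Icc hr
  refine hstep2.trans (le_of_eq ?_)
  simp

/-- The Taylor remainder at a fixed point, averaged over the centre of expansion. -/
lemma integral_taylor_remainder_le {Φ : Euc n → ℝ} (hΦ : ContDiff ℝ ∞ Φ) {s : ℕ} (hs : n < 2 * s)
    {K : Set (Euc n)} (hK : IsCompact K) (hKc : Convex ℝ K) {x : Euc n} (hx : x ∈ K) :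
    ∫ y in K, (Φ x - taylorAt Φ s y x) ^ 2 ≤
      (diam K ^ 2) ^ (s + 1) * ∫ y in K, derivSq (s + 1) Φ y := by
  obtain ⟨hI1, hle⟩ := integral_segment_le (continuous_derivSq hΦ (s + 1))
    (derivSq_nonneg (s + 1) Φ) hs hK hKc hx
  have hpair : Continuous fun y : Euc n => (y, x) := continuous_id.prodMk continuous_const
  have hTc := (continuous_taylorAt hΦ s).comp hpair
  simp only [Function.comp_def] at hTc
  have hI3 : IntegrableOn (fun y => (Φ x - taylorAt Φ s y x) ^ 2) K :=
    integrableOn_of_continuous ((continuous_const.sub hTc).pow 2) hK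
  have hstep1 := setIntegral_mono_on hI3 (hI1.const_mul ((diam K ^ 2) ^ (s + 1)))
    hK.measurableSet fun y hy => taylor_remainder_sq_le hΦ hK hx hy
  rw [integral_const_mul] at hstep1
  exact hstep1.trans (mul_le_mul_of_nonneg_left hle (by positivity))

/-- Approximation of a smooth function by polynomials in `L²(ν)`, for a finite measure `ν` on a
compact convex set. -/
lemma exists_taylor_approx {Φ : Euc n → ℝ} (hΦ : ContDiff ℝ ∞ Φ) {s : ℕ} (hs : n < 2 * s)
    {K : Set (Euc n)} (hK : IsCompact K) (hKc : Convex ℝ K) (hK0 : volume K ≠ 0)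
    {ν : Measure (Euc n)} [IsFiniteMeasure ν] (hν : ν.restrict K = ν) :
    ∃ q ∈ polySpace n s, ∫ x, (Φ x - q x) ^ 2 ∂ν ≤
      (volume.real K)⁻¹ * (ν.real univ * ((diam K ^ 2) ^ (s + 1) *
        ∫ y in K, derivSq (s + 1) Φ y)) := by
  haveI : IsFiniteMeasure (volume.restrict K) := ⟨by simpa using hK.measure_lt_top⟩
  have hc : Continuous fun p : Euc n × Euc n => (Φ p.2 - taylorAt Φ s p.1 p.2) ^ 2 :=
    ((hΦ.continuous.comp continuous_snd).sub (continuous_taylorAt hΦ s)).pow 2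
  have hprod : Integrable (fun p : Euc n × Euc n => (Φ p.2 - taylorAt Φ s p.1 p.2) ^ 2)
      ((volume.restrict K).prod ν) :=
    integrable_prod_of_continuous hK hK (Measure.restrict_restrict_of_subset subset_rfl) hν hc
  obtain ⟨y, hy, hyle⟩ := exists_le_setAverage hK0 hK.measure_lt_top.ne
    (f := fun y => ∫ x, (Φ x - taylorAt Φ s y x) ^ 2 ∂ν) hprod.integral_prod_left
  refine ⟨_, taylorAt_mem_polySpace Φ s y, hyle.trans ?_⟩
  rw [setAverage_eq, smul_eq_mul]
  refine mul_le_mul_of_nonneg_left ?_ (by positivity)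
  rw [integral_integral_swap hprod]
  have h1 : ∀ᵐ x ∂ν, ∫ y in K, (Φ x - taylorAt Φ s y x) ^ 2 ≤
      (diam K ^ 2) ^ (s + 1) * ∫ y in K, derivSq (s + 1) Φ y := by
    rw [← hν]
    exact ae_restrict_of_forall_mem hK.measurableSet fun x hx =>
      integral_taylor_remainder_le hΦ hs hK hKc hx
  refine (integral_mono_ae hprod.integral_prod_right (integrable_const _) h1).trans (le_of_eq ?_)
  rw [integral_const, smul_eq_mul]

/-- A one dimensional Sobolev inequality. -/
lemma sq_le_integral_sq_add_deriv {T : ℝ} (hT : 0 < T) {φ φ' : ℝ → ℝ}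
    (hφ : ∀ t, HasDerivAt φ (φ' t) t) (hφ' : Continuous φ') {t : ℝ} (ht : t ∈ Icc 0 T) :
    φ t ^ 2 ≤ (T⁻¹ + 1) * ∫ r in Icc 0 T, (φ r ^ 2 + φ' r ^ 2) := by
  have hφc : Continuous φ := continuous_iff_continuousAt.2 fun t => (hφ t).continuousAt
  have hi : ∀ {g : ℝ → ℝ}, Continuous g → IntegrableOn g (Icc 0 T) :=
    fun hg => integrableOn_of_continuous hg isCompact_Icc
  have hsum := hi (show Continuous fun r => φ r ^ 2 + φ' r ^ 2 by fun_prop)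
  have hc : Continuous fun τ => 2 * φ τ * φ' τ := by fun_prop
  -- at some time the square is at most its mean
  obtain ⟨r, hr, hrle⟩ := exists_le_setAverage (by simpa using hT) (by simp) (hi (hφc.pow 2))
  have e := intervalIntegral.integral_eq_sub_of_hasDerivAt (a := r) (b := t)
    (fun τ _ => by simpa using (hφ τ).fun_pow 2) (hc.intervalIntegrable _ _)
  have hle := (le_abs_self _).trans (intervalIntegral.norm_integral_le_integral_norm_uIoc.trans
    ((setIntegral_mono_set (hi hc.norm) (.of_forall fun _ => norm_nonneg _)
      ((uIoc_subset_uIcc.trans (uIcc_subset_Icc hr ht)).eventuallyLE)).trans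
        (setIntegral_mono (hi hc.norm) hsum fun τ => by
          rw [Real.norm_eq_abs, abs_le]
          constructor <;> nlinarith [sq_nonneg (φ τ - φ' τ), sq_nonneg (φ τ + φ' τ)])))
  have hm := setIntegral_mono (hi (hφc.pow 2)) hsum fun r => le_add_of_nonneg_right (sq_nonneg _)
  rw [setAverage_eq, smul_eq_mul, Real.volume_real_Icc_of_le hT.le, sub_zero] at hrle
  have := hrle.trans (mul_le_mul_of_nonneg_left hm (inv_nonneg.2 hT.le))
  rw [e] at hle
  change φ r ^ 2 ≤ _ at this
  linarith

end Taylor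

section MollifierBounds

variable {V : Type*} [NormedAddCommGroup V] [NormedSpace ℝ V] [MeasureSpace V] [BorelSpace V]
  [FiniteDimensional ℝ V] [(volume : Measure V).IsAddHaarMeasure] {ε : ℝ} {ρ : V → ℝ}

lemma IsMollifier.integrable_mul (h : IsMollifier ε ρ) {g : V → ℝ} (hg : LocallyIntegrable g)
    (x : V) : Integrable fun y => ρ (x - y) * g y := by
  have h1 : HasCompactSupport fun y => ρ (x - y) := h.compact.comp_homeomorph (Homeomorph.subLeft x)
  exact integrable_mul_of_tsupport_subset (hg.locallyIntegrableOn univ)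
    (h.smooth.continuous.comp (continuous_const.sub continuous_id)) h1 (subset_univ _)

lemma IsMollifier.abs_moll_sub_le (h : IsMollifier ε ρ) {f : V → ℝ} {L : ℝ≥0}
    (hf : LipschitzWith L f) (x : V) : |moll ρ f x - f x| ≤ L * ε := by
  have h1 : moll ρ f x - f x = moll ρ (fun y => f y - f x) x := by
    simp only [moll, mul_sub]
    rw [MeasureTheory.integral_sub (h.integrable_mul hf.continuous.locallyIntegrable x)
      ((h.integrable_sub x).mul_const _), integral_mul_const, h.integral_sub, one_mul]
  rw [h1]
  refine h.abs_moll_le (.of_forall fun y hy => (hf.dist_le_mul y x).trans ?_)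
  rw [dist_comm, dist_eq_norm]
  exact mul_le_mul_of_nonneg_left (h.norm_le hy) L.2

lemma IsMollifier.sq_moll_le (h : IsMollifier ε ρ) {g : V → ℝ} (hg : LocallyIntegrable g)
    (hg2 : LocallyIntegrable fun x => g x ^ 2) (x : V) :
    moll ρ g x ^ 2 ≤ moll ρ (fun y => g y ^ 2) x := by
  have h0 : 0 ≤ ∫ y, ρ (x - y) * (g y - moll ρ g x) ^ 2 :=
    integral_nonneg fun y => mul_nonneg (h.nonneg _) (sq_nonneg _)
  have i1 := h.integrable_mul hg2 x
  have i2 := (h.integrable_mul hg x).const_mul (2 * moll ρ g x)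
  have i12 : Integrable fun y => ρ (x - y) * g y ^ 2 - 2 * moll ρ g x * (ρ (x - y) * g y) := i1.sub i2
  have e : ∀ y, ρ (x - y) * (g y - moll ρ g x) ^ 2 = ρ (x - y) * g y ^ 2 -
      2 * moll ρ g x * (ρ (x - y) * g y) + moll ρ g x ^ 2 * ρ (x - y) := fun y => by ring
  simp only [e] at h0
  rw [integral_add i12 ((h.integrable_sub x).const_mul _),
    MeasureTheory.integral_sub i1 i2, integral_const_mul, integral_const_mul, h.integral_sub] at h0
  change 0 ≤ moll ρ (fun y => g y ^ 2) x - 2 * moll ρ g x * moll ρ g x + _ at h0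
  linarith

/-- Mollification is a contraction of `L²`. -/
lemma IsMollifier.integral_sq_moll_le (h : IsMollifier ε ρ) {g : V → ℝ} (hg : MemLp g 2) :
    Integrable (fun x => moll ρ g x ^ 2) ∧ ∫ x, moll ρ g x ^ 2 ≤ ∫ x, g x ^ 2 := by
  have hg1 : LocallyIntegrable g := hg.locallyIntegrable one_le_two
  have hg2 : Integrable fun x => g x ^ 2 := hg.integrable_sq
  have hi : Integrable (moll ρ fun y => g y ^ 2) := by
    rw [moll_eq_left]
    exact h.integrable.integrable_convolution _ hg2
  have hle := h.sq_moll_le hg1 hg2.locallyIntegrable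
  have hint : Integrable (fun x => moll ρ g x ^ 2) :=
    hi.mono' ((moll_contDiff h.smooth h.compact hg1).continuous.pow 2).aestronglyMeasurable
      (.of_forall fun x => by
        rw [Real.norm_of_nonneg (sq_nonneg _)]
        exact hle x)
  refine ⟨hint, (integral_mono hint hi hle).trans (le_of_eq ?_)⟩
  rw [moll_eq_left, integral_convolution _ h.integrable hg2, h.integral]
  simp

end MollifierBounds

section SpaceTime

variable {n : ℕ}

instance : (volume : Measure (ℝ × Euc n)).IsAddHaarMeasure :=
  Measure.prod.instIsAddHaarMeasure (volume : Measure ℝ) (volume : Measure (Euc n))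

lemma iteratedFDeriv_slice {G : ℝ × Euc n → ℝ} (hG : ContDiff ℝ ∞ G) (k : ℕ) (t : ℝ) x
    (w : Fin k → Euc n) : iteratedFDeriv ℝ k (fun y => G (t, y)) x w =
      iteratedFDeriv ℝ k G (t, x) fun l => ((0 : ℝ), w l) := by
  have h1 : (fun y => G (t, y)) =
      (fun p => G ((t, 0) + p)) ∘ ContinuousLinearMap.inr ℝ ℝ (Euc n) := by
    ext y
    simp
  have h2 : ContDiff ℝ ∞ fun p => G ((t, 0) + p) := hG.comp (contDiff_const.add contDiff_id)
  rw [h1, ContinuousLinearMap.iteratedFDeriv_comp_right _ h2 x (i := k)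
    (by exact_mod_cast le_top), iteratedFDeriv_comp_add_left]
  simp [ContinuousMultilinearMap.compContinuousLinearMap_apply]

lemma hasDerivAt_slice {ψ : ℝ × Euc n → ℝ} (hψ : Differentiable ℝ ψ) x (t : ℝ) :
    HasDerivAt (fun τ => ψ (τ, x)) (fderiv ℝ ψ (t, x) dirT) t := by
  have h1 : HasDerivAt (fun τ : ℝ => (τ, x)) ((1 : ℝ), 0) t :=
    (hasDerivAt_id t).prodMk (hasDerivAt_const t x)
  exact (hψ (t, x)).hasFDerivAt.comp_hasDerivAt t h1

/-- The space and space-time derivatives of a smooth function that control its approximation. -/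
lemma integral_derivSq_slice_le {G : ℝ × Euc n → ℝ} (hG : ContDiff ℝ ∞ G) (m : ℕ) {T : ℝ}
    (hT : 0 < T) {K : Set (Euc n)} (hK : IsCompact K) {t : ℝ} (ht : t ∈ Icc 0 T) :
    ∫ y in K, derivSq m (fun x => G (t, x)) y ≤ (T⁻¹ + 1) * ∑ I : Fin m → Fin n,
      ((∫ p in Icc 0 T ×ˢ K, (iteratedFDeriv ℝ m G p fun l => dirX (I l)) ^ 2) +
        ∫ p in Icc 0 T ×ˢ K, (iteratedFDeriv ℝ (m + 1) G p
          (Fin.cons dirT fun l => dirX (I l))) ^ 2) := by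
  haveI : IsFiniteMeasure ((volume : Measure (Euc n)).restrict K) :=
    ⟨by simpa using hK.measure_lt_top⟩
  have hA : ∀ I : Fin m → Fin n, Continuous fun p => iteratedFDeriv ℝ m G p fun l => dirX (I l) :=
    fun I => (contDiff_iteratedFDeriv_apply hG _).continuous
  have hB : ∀ I : Fin m → Fin n, Continuous fun p => iteratedFDeriv ℝ (m + 1) G p
      (Fin.cons dirT fun l => dirX (I l) : Fin (m + 1) → ℝ × Euc n) :=
    fun I => (contDiff_iteratedFDeriv_apply hG _).continuous
  have hDK : IsCompact (Icc 0 T ×ˢ K) := isCompact_Icc.prod hK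
  have hpt : ∀ y, derivSq m (fun x => G (t, x)) y ≤ ∑ I : Fin m → Fin n, (T⁻¹ + 1) *
      ∫ r in Icc 0 T, ((iteratedFDeriv ℝ m G (r, y) fun l => dirX (I l)) ^ 2 +
        (iteratedFDeriv ℝ (m + 1) G (r, y) (Fin.cons dirT fun l => dirX (I l))) ^ 2) := by
    intro y
    refine sum_le_sum fun I _ => ?_
    rw [iteratedFDeriv_slice hG]
    have h1 : ∀ τ, HasDerivAt (fun τ => iteratedFDeriv ℝ m G (τ, y) fun l => dirX (I l))
        (iteratedFDeriv ℝ (m + 1) G (τ, y) (Fin.cons dirT fun l => dirX (I l))) τ := fun τ => by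
      rw [iteratedFDeriv_succ_apply hG]
      exact hasDerivAt_slice ((contDiff_iteratedFDeriv_apply hG _).differentiable (by simp)) y τ
    have h2 := sq_le_integral_sq_add_deriv hT h1 ((hB I).comp (by fun_prop)) ht
    exact h2
  have hprod : ∀ I : Fin m → Fin n, Integrable (fun p : Euc n × ℝ =>
      (iteratedFDeriv ℝ m G (p.2, p.1) fun l => dirX (I l)) ^ 2 +
        (iteratedFDeriv ℝ (m + 1) G (p.2, p.1) (Fin.cons dirT fun l => dirX (I l))) ^ 2)
      ((volume.restrict K).prod (volume.restrict (Icc (0 : ℝ) T))) := fun I => by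
    have hsw : Continuous fun p : Euc n × ℝ => (p.2, p.1) := continuous_swap
    exact integrable_prod_of_continuous hK isCompact_Icc
      (Measure.restrict_restrict_of_subset subset_rfl)
      (Measure.restrict_restrict_of_subset subset_rfl)
      ((((hA I).comp hsw).pow 2).add (((hB I).comp hsw).pow 2))
  have hsmooth : ContDiff ℝ ∞ fun x => G (t, x) := hG.comp (contDiff_const.prodMk contDiff_id)
  refine (integral_mono (integrableOn_of_continuous (continuous_derivSq hsmooth m) hK)
    (integrable_finset_sum _ fun I _ => ((hprod I).integral_prod_left).const_mul _) hpt).trans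
    (le_of_eq ?_)
  rw [integral_finset_sum _ fun I _ => ((hprod I).integral_prod_left).const_mul _, mul_sum]
  refine sum_congr rfl fun I _ => ?_
  rw [integral_const_mul]
  congr 1
  have iA : IntegrableOn (fun p => (iteratedFDeriv ℝ m G p fun l => dirX (I l)) ^ 2)
    (Icc 0 T ×ˢ K) := integrableOn_of_continuous ((hA I).pow 2) hDK
  have iB : IntegrableOn (fun p => (iteratedFDeriv ℝ (m + 1) G p
      (Fin.cons dirT fun l => dirX (I l) : Fin (m + 1) → ℝ × Euc n)) ^ 2)
    (Icc 0 T ×ˢ K) := integrableOn_of_continuous ((hB I).pow 2) hDK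
  rw [integral_integral_swap (hprod I), ← integral_add iA iB]
  rw [Measure.volume_eq_prod]
  exact (setIntegral_prod _ (iA.add iB)).symm

lemma iteratedFDeriv_dilate {V : Type*} [NormedAddCommGroup V] [NormedSpace ℝ V] {F : V → ℝ}
    (hF : ContDiff ℝ ∞ F) (a : V) (r : ℝ) (k : ℕ) (p : V) (w : Fin k → V) :
    iteratedFDeriv ℝ k (fun p => F (a + r • p)) p w =
      r ^ k * iteratedFDeriv ℝ k F (a + r • p) w := by
  have h1 : ContDiff ℝ k fun y => F (a + y) :=
    (hF.comp (contDiff_const.add contDiff_id)).of_le (by exact_mod_cast le_top)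
  rw [iteratedFDeriv_comp_const_smul r h1]
  simp [iteratedFDeriv_comp_add_left]

/-- The derivatives of the dilated mollification are bounded in `L²` by the weak derivatives. -/
lemma integral_dilated_moll_le {f g : ℝ × Euc n → ℝ} {Q D : Set (ℝ × Euc n)}
    (hQ : MeasurableSet Q) (hD : IsCompact D) {k : ℕ} {w : Fin k → ℝ × Euc n}
    (h : HasWeakDeriv Q w f g) (hg : MemLp g 2 (volume.restrict Q)) (hf : Continuous f) {ε : ℝ}
    {ρ : ℝ × Euc n → ℝ} (hρ : IsMollifier ε ρ) {a : ℝ × Euc n} {r : ℝ} (hr0 : 0 < r) (hr1 : r ≤ 1)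
    (hk : n + 1 ≤ 2 * k) (hnear : ∀ p ∈ D, ∀ z, ‖a + r • p - z‖ ≤ ε → z ∈ Q) :
    ∫ p in D, (iteratedFDeriv ℝ k (fun p => moll ρ f (a + r • p)) p w) ^ 2 ≤ ∫ p in Q, g p ^ 2 := by
  have hfl : LocallyIntegrable f := hf.locallyIntegrable
  have hF := moll_contDiff hρ.smooth hρ.compact hfl
  have hg' : MemLp (Q.indicator g) 2 := (memLp_indicator_iff_restrict hQ).2 hg
  obtain ⟨hi, hle⟩ := hρ.integral_sq_moll_le hg'
  have e1 : ∀ p ∈ D, (iteratedFDeriv ℝ k (fun p => moll ρ f (a + r • p)) p w) ^ 2 =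
      (r ^ k) ^ 2 * moll ρ (Q.indicator g) (a + r • p) ^ 2 := fun p hp => by
    rw [iteratedFDeriv_dilate hF, mul_pow,
      iteratedFDeriv_moll_of_hasWeakDeriv (g' := Q.indicator g) hQ h hρ.smooth hρ.compact hfl
        fun z hz => ?_]
    have hzQ := hnear p hp z (hρ.norm_le hz)
    exact ⟨hzQ, rfl, indicator_of_mem hzQ g⟩
  have e2 : ∫ p, moll ρ (Q.indicator g) (a + r • p) ^ 2 =
      (r ^ (n + 1))⁻¹ * ∫ p, moll ρ (Q.indicator g) p ^ 2 := by
    rw [Measure.integral_comp_smul volume (fun p => moll ρ (Q.indicator g) (a + p) ^ 2),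
      integral_add_left_eq_self (fun p => moll ρ (Q.indicator g) p ^ 2)]
    simp [abs_of_pos hr0, add_comm 1 n]
  have hi2 : Integrable fun p => moll ρ (Q.indicator g) (a + r • p) ^ 2 :=
    (hi.comp_add_left a).comp_smul hr0.ne'
  have e3 : ∫ p, (Q.indicator g) p ^ 2 = ∫ p in Q, g p ^ 2 := by
    rw [← integral_indicator hQ]
    refine integral_congr_ae (.of_forall fun p => ?_)
    by_cases hp : p ∈ Q <;> simp [hp]
  rw [setIntegral_congr_fun hD.measurableSet e1, integral_const_mul]
  have h1 : ∫ p in D, moll ρ (Q.indicator g) (a + r • p) ^ 2 ≤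
      (r ^ (n + 1))⁻¹ * ∫ p in Q, g p ^ 2 := by
    refine (setIntegral_le_integral hi2 (.of_forall fun _ => sq_nonneg _)).trans ?_
    rw [e2, ← e3]
    exact mul_le_mul_of_nonneg_left hle (by positivity)
  have hI : 0 ≤ ∫ p in Q, g p ^ 2 := integral_nonneg fun _ => sq_nonneg _
  have h2 : (r ^ k) ^ 2 * (r ^ (n + 1))⁻¹ ≤ 1 := by
    rw [← pow_mul, mul_comm k 2, mul_inv_le_iff₀ (by positivity), one_mul]
    exact pow_le_pow_of_le_one hr0.le hr1 hk
  refine (mul_le_mul_of_nonneg_left h1 (by positivity)).trans ?_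
  rw [← mul_assoc]
  exact mul_le_of_le_one_left hI h2

/-- Polynomial approximation, at every time, of a Lipschitz function with square integrable weak
derivatives on the space-time cylinder over a compact convex set. -/
lemma exists_poly_approx {s : ℕ} (hs : n < 2 * s) {T : ℝ} (hT : 0 < T) {K : Set (Euc n)}
    (hK : IsCompact K) (hKc : Convex ℝ K) (hKi : (interior K).Nonempty) {f : ℝ × Euc n → ℝ}
    {L : ℝ≥0} (hf : LipschitzWith L f) {g gt : (Fin (s + 1) → Fin n) → ℝ × Euc n → ℝ}
    (hg : ∀ I, HasWeakDeriv (cylinder T (interior K)) (fun l => dirX (I l)) f (g I))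
    (hgt : ∀ I, HasWeakDeriv (cylinder T (interior K))
      (Fin.cons dirT fun l => dirX (I l) : Fin (s + 2) → ℝ × Euc n) f (gt I))
    (hg2 : ∀ I, MemLp (g I) 2 (volume.restrict (cylinder T (interior K))))
    (hgt2 : ∀ I, MemLp (gt I) 2 (volume.restrict (cylinder T (interior K))))
    {ν : Measure (Euc n)} [IsFiniteMeasure ν] (hν : ν.restrict K = ν) {t : ℝ} (ht : t ∈ Icc 0 T)
    {η : ℝ} (hη : 0 < η) : ∃ q ∈ polySpace n s, ∫ x, (f (t, x) - q x) ^ 2 ∂ν ≤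
      2 * ((volume.real K)⁻¹ * (ν.real univ * ((diam K ^ 2) ^ (s + 1) *
        ((T⁻¹ + 1) * ∑ I, ((∫ p in cylinder T (interior K), g I p ^ 2) +
          ∫ p in cylinder T (interior K), gt I p ^ 2))))) + η := by
  set Q := cylinder T (interior K) with hQ
  have hQo : IsOpen Q := isOpen_Ioo.prod isOpen_interior
  obtain ⟨c, hc⟩ := hKi
  set D : Set (ℝ × Euc n) := Icc 0 T ×ˢ K with hDdef
  have hD : IsCompact D := isCompact_Icc.prod hK
  set p₀ : ℝ × Euc n := (T / 2, c) with hp₀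
  -- the tolerance
  obtain ⟨c₁, hc₁, hcη⟩ := exists_pos_mul_lt hη (2 * ν.real univ)
  obtain ⟨δ, hδ, hδη⟩ : ∃ δ : ℝ, 0 < δ ∧ 2 * (ν.real univ * δ ^ 2) ≤ η :=
    ⟨√c₁, by positivity, by rw [Real.sq_sqrt hc₁.le, ← mul_assoc]; exact hcη.le⟩
  obtain ⟨R, hR⟩ := hD.isBounded.exists_norm_le
  have hR' : ∀ p ∈ D, ‖p - p₀‖ ≤ |R| + ‖p₀‖ := fun p hp =>
    (norm_sub_le _ _).trans (add_le_add_left ((hR p hp).trans (le_abs_self R)) _)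
  set B := |R| + ‖p₀‖ with hB
  have hB0 : 0 ≤ B := by positivity
  -- the dilation
  obtain ⟨θ, hθ, hθδ⟩ := exists_pos_mul_lt (half_pos hδ) (L * B + δ)
  have hLB : 0 ≤ L * B := by positivity
  obtain ⟨r, hr0, hr1, hrδ⟩ : ∃ r : ℝ, 0 < r ∧ r < 1 ∧ L * ((1 - r) * B) ≤ δ / 2 :=
    ⟨1 - θ, by nlinarith, by linarith, by nlinarith⟩
  set a : ℝ × Euc n := (1 - r) • p₀ with ha
  have hmapQ : ∀ p ∈ D, a + r • p ∈ Q := by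
    intro p hp
    refine ⟨?_, ?_⟩
    · have h1 := hp.1.1
      have h2 := hp.1.2
      simp only [ha, hp₀, Prod.fst_add, Prod.smul_fst, smul_eq_mul]
      constructor <;> nlinarith
    · exact hKc.combo_interior_self_mem_interior hc hp.2 (by linarith) hr0.le (by ring)
  have himg : IsCompact ((fun p => a + r • p) '' D) := hD.image (by fun_prop)
  obtain ⟨ε₁, hε₁, hthick⟩ := himg.exists_cthickening_subset_open hQo
    (by rintro _ ⟨p, hp, rfl⟩; exact hmapQ p hp)
  obtain ⟨ε₂, hε₂, hLε₂⟩ := exists_pos_mul_lt (half_pos hδ) L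
  set ε := min ε₁ ε₂ with hε
  have hε0 : 0 < ε := lt_min hε₁ hε₂
  have hLε : L * ε ≤ δ / 2 := (mul_le_mul_of_nonneg_left (min_le_right _ _) L.2).trans hLε₂.le
  obtain ⟨ρ, hρ⟩ := exists_isMollifier (V := ℝ × Euc n) hε0
  have hnear : ∀ p ∈ D, ∀ z, ‖a + r • p - z‖ ≤ ε → z ∈ Q := fun p hp z hz =>
    hthick (Metric.mem_cthickening_of_dist_le z (a + r • p) ε₁ _ ⟨p, hp, rfl⟩ (by
      rw [dist_comm, dist_eq_norm]
      exact hz.trans (min_le_left _ _)))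
  set G : ℝ × Euc n → ℝ := fun p => moll ρ f (a + r • p) with hG
  have hGs : ContDiff ℝ ∞ G := (moll_contDiff hρ.smooth hρ.compact
    hf.continuous.locallyIntegrable).comp (contDiff_const.add (contDiff_id.const_smul r))
  have hclose : ∀ p ∈ D, |f p - G p| ≤ δ := by
    intro p hp
    have h1 := hρ.abs_moll_sub_le hf (a + r • p)
    have h2 := hf.dist_le_mul p (a + r • p)
    have h3 : dist p (a + r • p) ≤ (1 - r) * B := by
      have : p - (a + r • p) = (1 - r) • (p - p₀) := by
        rw [ha, smul_sub, sub_smul 1 r p, one_smul]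
        abel
      rw [dist_eq_norm, this, norm_smul, Real.norm_of_nonneg (by linarith)]
      exact mul_le_mul_of_nonneg_left (hR' p hp) (by linarith)
    have h4 : |f p - f (a + r • p)| ≤ δ / 2 := by
      rw [← Real.dist_eq]
      exact h2.trans ((mul_le_mul_of_nonneg_left h3 L.2).trans hrδ)
    refine (abs_sub_le _ _ _).trans ((add_le_add h4 ?_).trans (add_halves δ).le)
    rw [abs_sub_comm]
    exact h1.trans hLε
  have hvol : volume K ≠ 0 :=
    ((isOpen_interior.measure_pos volume ⟨c, hc⟩).trans_le (measure_mono interior_subset)).ne'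
  have hslice : ContDiff ℝ ∞ fun x => G (t, x) := hGs.comp (contDiff_const.prodMk contDiff_id)
  obtain ⟨q, hq, hqle⟩ := exists_taylor_approx hslice hs hK hKc hvol hν
  refine ⟨q, hq, ?_⟩
  have hder : ∫ y in K, derivSq (s + 1) (fun x => G (t, x)) y ≤
      (T⁻¹ + 1) * ∑ I, ((∫ p in Q, g I p ^ 2) + ∫ p in Q, gt I p ^ 2) := by
    refine (integral_derivSq_slice_le hGs (s + 1) hT hK ht).trans
      (mul_le_mul_of_nonneg_left (sum_le_sum fun I _ => add_le_add ?_ ?_) (by positivity))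
    · exact integral_dilated_moll_le hQo.measurableSet hD (hg I) (hg2 I) hf.continuous hρ hr0 hr1.le
        (by omega) hnear
    · exact integral_dilated_moll_le hQo.measurableSet hD (hgt I) (hgt2 I) hf.continuous hρ hr0
        hr1.le (by omega) hnear
  have hfc : Continuous fun x => f (t, x) := hf.continuous.comp (by fun_prop)
  have hintν : ∀ {φ : Euc n → ℝ}, Continuous φ → Integrable φ ν := integrable_of_restrict_eq hK hν
  have hqc := polySpace_continuous hq
  have i1 : Integrable (fun x => (G (t, x) - q x) ^ 2) ν :=
    hintν ((hslice.continuous.sub hqc).pow 2)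
  have hae : ∀ᵐ x ∂ν, (f (t, x) - q x) ^ 2 ≤ 2 * (G (t, x) - q x) ^ 2 + 2 * δ ^ 2 := by
    rw [← hν]
    refine ae_restrict_of_forall_mem hK.measurableSet fun x hx => ?_
    have h1 := hclose (t, x) ⟨ht, hx⟩
    have h2 : (f (t, x) - G (t, x)) ^ 2 ≤ δ ^ 2 := sq_le_sq' (by linarith [(abs_le.1 h1).1])
      (abs_le.1 h1).2
    nlinarith [sq_nonneg ((f (t, x) - G (t, x)) - (G (t, x) - q x))]
  have hmain := integral_mono_ae (hintν ((hfc.sub hqc).pow 2))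
    ((i1.const_mul 2).add (integrable_const (2 * δ ^ 2))) hae
  have e1 : ∫ x, (2 * (G (t, x) - q x) ^ 2 + 2 * δ ^ 2) ∂ν =
      2 * (∫ x, (G (t, x) - q x) ^ 2 ∂ν) + 2 * (ν.real univ * δ ^ 2) := by
    rw [integral_add (i1.const_mul 2) (integrable_const _), integral_const_mul, integral_const,
      smul_eq_mul]
    ring
  refine hmain.trans ((le_of_eq e1).trans (add_le_add (mul_le_mul_of_nonneg_left
    (hqle.trans ?_) two_pos.le) hδη))
  gcongr

end SpaceTime

section WeakDerivatives

variable {V : Type*} [NormedAddCommGroup V] [NormedSpace ℝ V] [MeasureSpace V]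

lemma exists_hasWeakDeriv_of_le {Q : Set V} {k : ℕ} {w : Fin k → V} {f : V → ℝ} {p : ℝ≥0∞} {M : ℝ≥0}
    (h : weakDerivNorm Q w f p ≤ M) :
    ∃ g, HasWeakDeriv Q w f g ∧ eLpNorm g p (volume.restrict Q) ≤ (M + 1 : ℝ≥0) := by
  have h1 : weakDerivNorm Q w f p < (M + 1 : ℝ≥0) :=
    h.trans_lt (ENNReal.coe_lt_coe.2 (lt_add_one M))
  obtain ⟨g, hg⟩ := iInf_lt_iff.1 h1
  obtain ⟨hg1, hg2⟩ := iInf_lt_iff.1 hg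
  exact ⟨g, hg1, hg2.le⟩

lemma ae_abs_le_of_eLpNorm_top {X : Type*} [MeasurableSpace X] {μ : Measure X} {g : X → ℝ}
    {M : ℝ≥0} (h : eLpNorm g ⊤ μ ≤ M) : ∀ᵐ x ∂μ, |g x| ≤ M := by
  rw [eLpNorm_exponent_top] at h
  filter_upwards [ae_le_eLpNormEssSup (f := g) (μ := μ)] with x hx
  have := hx.trans h
  rwa [Real.enorm_eq_ofReal_abs, ENNReal.ofReal_le_coe] at this

variable [BorelSpace V] [FiniteDimensional ℝ V] [(volume : Measure V).IsAddHaarMeasure]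

lemma HasWeakDeriv.mono {Q Q' : Set V} (hQ : MeasurableSet Q)
    (hsub : Q' ⊆ Q) {k : ℕ} {w : Fin k → V} {f g : V → ℝ} (h : HasWeakDeriv Q w f g) :
    HasWeakDeriv Q' w f g where
  locInt_fun := h.locInt_fun.mono_set hsub
  locInt_deriv := h.locInt_deriv.mono_set hsub
  parts φ hφ := by
    have h1 := h.parts φ ⟨hφ.smooth, hφ.compact, hφ.support.trans hsub⟩
    have h2 := fun x (hx : x ∉ Q') => iteratedFDeriv_apply_eq_zero (fun h => hx (hφ.support h)) w
    have h3 := fun x (hx : x ∉ Q') => hφ.eq_zero hx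
    rwa [setIntegral_eq_of_subset_of_forall_diff_eq_zero hQ hsub fun x hx => by simp [h2 x hx.2],
      setIntegral_eq_of_subset_of_forall_diff_eq_zero hQ hsub fun x hx => by simp [h3 x hx.2]] at h1

end WeakDerivatives

lemma ae_restrict_mono {X : Type*} [MeasurableSpace X] {μ : Measure X} {s t : Set X} (h : s ⊆ t)
    {P : X → Prop} (hP : ∀ᵐ x ∂(μ.restrict t), P x) : ∀ᵐ x ∂(μ.restrict s), P x :=
  ae_restrict_of_ae_restrict_of_subset h hP

section Spanning

variable {n : ℕ}

lemma exists_coeff_stdVec v :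
    ∃ c : Fin n → ℝ, v = ∑ i, c i • stdVec i ∧ ∀ i, |c i| ≤ ‖v‖ :=
  ⟨fun i => v i, (sum_smul_stdVec v).symm, fun i => by simpa using PiLp.norm_apply_le v i⟩

/-- The coordinate directions of space-time. -/
noncomputable def dirTX : Option (Fin n) → ℝ × Euc n := fun o => o.elim dirT dirX

lemma exists_coeff_dirTX (v : ℝ × Euc n) :
    ∃ c : Option (Fin n) → ℝ, v = ∑ i, c i • dirTX i ∧ ∀ i, |c i| ≤ ‖v‖ := by
  refine ⟨fun o => o.elim v.1 fun i => v.2 i, ?_, ?_⟩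
  · rw [Fintype.sum_option]
    refine Prod.ext ?_ ?_
    · simp [dirTX, dirT, dirX, Prod.fst_sum]
    · have := (sum_smul_stdVec v.2).symm
      simpa [dirTX, dirT, dirX, Prod.snd_sum] using this
  · rintro (_ | i)
    · simpa using norm_fst_le v
    · simpa using (PiLp.norm_apply_le v.2 i).trans (norm_snd_le v)

lemma lineDeriv_dirX {f : ℝ × Euc n → ℝ} (t : ℝ) x (j : Fin n) :
    lineDeriv ℝ f (t, x) (dirX j) = lineDeriv ℝ (fun y => f (t, y)) x (stdVec j) := by
  simp [lineDeriv, dirX]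

end Spanning

section Pressure

variable {n : ℕ} {Ω : Set (Euc n)} {T : ℝ}

lemma isOpen_cylinder (hΩ : IsOpen Ω) : IsOpen (cylinder T Ω) := isOpen_Ioo.prod hΩ

notation "cyl" => (_root_.cylinder)

/-- The space-time cylinder over the interior of the simplex `K`. -/
notation:max "cellCyl" T:max K:max => (_root_.cylinder T (interior (hull K)))

lemma restrict_cylinder (S : Set (Euc n)) : (volume : Measure (ℝ × Euc n)).restrict (cylinder T S) =
    (volume.restrict (Ioo 0 T)).prod (volume.restrict S) := by
  rw [_root_.cylinder, Measure.volume_eq_prod, Measure.prod_restrict]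

/-- Averaging a function over time, with a test function as the weight, averages its weak
derivatives in space. -/
lemma HasWeakDeriv.time_average (hΩ : IsOpen Ω) {p g : ℝ × Euc n → ℝ} {i : Fin n}
    (h : HasWeakDeriv (cylinder T Ω) ![dirX i] p g) {η : ℝ → ℝ} (hη : IsTestFunction (Ioo 0 T) η) :
    HasWeakDeriv Ω ![stdVec i] (fun x => ∫ t in Ioo 0 T, η t * p (t, x))
      (fun x => ∫ t in Ioo 0 T, η t * g (t, x)) := by
  have hcyl := (isOpen_cylinder (T := T) hΩ).measurableSet
  have hloc : ∀ q : ℝ × Euc n → ℝ, LocallyIntegrableOn q (cylinder T Ω) →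
      LocallyIntegrableOn (fun x => ∫ t in Ioo 0 T, η t * q (t, x)) Ω := by
    intro q hq
    rw [locallyIntegrableOn_iff hΩ.isLocallyClosed]
    intro k hk hkc
    have h1 : IntegrableOn q (tsupport η ×ˢ k) := hq.integrableOn_compact_subset
      (prod_mono hη.support hk) (IsCompact.prod hη.compact hkc)
    have h2 : IntegrableOn (fun z : ℝ × Euc n => η z.1 * q z) (tsupport η ×ˢ k) :=
      h1.continuousOn_mul (hη.smooth.continuous.comp continuous_fst).continuousOn
        (IsCompact.prod hη.compact hkc)
    rw [IntegrableOn, Measure.volume_eq_prod, ← Measure.prod_restrict] at h2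
    refine h2.integral_prod_right.congr (.of_forall fun x => ?_)
    beta_reduce
    rw [setIntegral_eq_integral_of_forall_compl_eq_zero fun t ht => by
        simp [image_eq_zero_of_notMem_tsupport ht],
      setIntegral_eq_integral_of_forall_compl_eq_zero fun t ht => by
        simp [image_eq_zero_of_notMem_tsupport fun h => ht (hη.support h)]]
  refine ⟨hloc p h.locInt_fun, hloc g h.locInt_deriv, fun φ hφ => ?_⟩
  have hts : tsupport (fun z : ℝ × Euc n => η z.1 * φ z.2) ⊆ tsupport η ×ˢ tsupport φ :=
    closure_minimal (fun z hz => ⟨subset_tsupport _ (left_ne_zero_of_mul hz),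
      subset_tsupport _ (right_ne_zero_of_mul hz)⟩) ((isClosed_tsupport _).prod (isClosed_tsupport _))
  have htest : IsTestFunction (cylinder T Ω) fun z => η z.1 * φ z.2 :=
    ⟨(hη.smooth.comp contDiff_fst).mul (hφ.smooth.comp contDiff_snd),
      (IsCompact.prod hη.compact hφ.compact).of_isClosed_subset (isClosed_tsupport _) hts,
      hts.trans (prod_mono hη.support hφ.support)⟩
  have hd : ∀ z : ℝ × Euc n, iteratedFDeriv ℝ 1 (fun z : ℝ × Euc n => η z.1 * φ z.2) z ![dirX i] =
      η z.1 * iteratedFDeriv ℝ 1 φ z.2 ![stdVec i] := fun z => by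
    rw [iteratedFDeriv_one_apply, iteratedFDeriv_one_apply]
    simp only [Matrix.cons_val_zero]
    rw [← ((htest.smooth.differentiable (by simp)) z).lineDeriv_eq_fderiv,
      ← ((hφ.smooth.differentiable (by simp)) z.2).lineDeriv_eq_fderiv,
      show z = (z.1, z.2) from rfl, lineDeriv_dirX]
    simp only [lineDeriv]
    rw [deriv_const_mul_field]
  -- Fubini's theorem for products with a function supported in the cylinder
  have hfub : ∀ (q : ℝ × Euc n → ℝ) ψ, LocallyIntegrableOn q (cylinder T Ω) →
      Continuous ψ → HasCompactSupport ψ → tsupport ψ ⊆ Ω →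
      ∫ z in cylinder T Ω, q z * (η z.1 * ψ z.2) =
        ∫ x in Ω, (∫ t in Ioo 0 T, η t * q (t, x)) * ψ x := by
    intro q ψ hq hψ1 hψ2 hψ3
    have hs : tsupport (fun z : ℝ × Euc n => η z.1 * ψ z.2) ⊆ tsupport η ×ˢ tsupport ψ :=
      closure_minimal (fun z hz => ⟨subset_tsupport _ (left_ne_zero_of_mul hz),
        subset_tsupport _ (right_ne_zero_of_mul hz)⟩)
        ((isClosed_tsupport _).prod (isClosed_tsupport _))
    have hi := integrable_mul_of_tsupport_subset hq
      ((hη.smooth.continuous.comp continuous_fst).mul (hψ1.comp continuous_snd))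
      ((IsCompact.prod hη.compact hψ2).of_isClosed_subset (isClosed_tsupport _) hs)
      (hs.trans (prod_mono hη.support hψ3))
    have hi' : Integrable (fun z : ℝ × Euc n => q z * (η z.1 * ψ z.2))
        ((volume.restrict (Ioo 0 T)).prod (volume.restrict Ω)) := by
      rw [← restrict_cylinder]
      refine hi.integrableOn.congr (.of_forall fun z => ?_)
      simp [mul_comm]
    rw [restrict_cylinder, integral_prod_symm _ hi']
    refine integral_congr_ae (.of_forall fun x => ?_)
    change ∫ t in Ioo 0 T, q (t, x) * (η t * ψ x) = (∫ t in Ioo 0 T, η t * q (t, x)) * ψ x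
    rw [← integral_mul_const]
    exact integral_congr_ae (.of_forall fun t => by simp only; ring)
  have hp := h.parts _ htest
  simp only [hd] at hp
  rw [hfub p _ h.locInt_fun (contDiff_iteratedFDeriv_apply hφ.smooth _).continuous
      (hasCompactSupport_iteratedFDeriv_apply hφ.compact _) fun x hx => hφ.support ?_,
    hfub g φ h.locInt_deriv hφ.smooth.continuous hφ.compact hφ.support] at hp
  · exact hp
  · refine closure_minimal (fun y hy => ?_) (isClosed_tsupport φ) hx
    refine support_iteratedFDeriv_subset 1 (f := φ) (𝕜 := ℝ) fun h0 => hy ?_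
    simp only [h0]
    rfl

end Pressure

namespace Triangulation

variable {n : ℕ} {Ω : Set (Euc n)} {𝒯 : Triangulation Ω}

/-- A function with a bounded weak gradient on `Ω` is represented on the cells by Lipschitz
functions with matching traces. -/
lemma exists_cell_representatives (hn : 0 < n) (hΩo : IsOpen Ω) (hΩ : interior (closure Ω) = Ω)
    {P : Euc n → ℝ} {G : Fin n → Euc n → ℝ} {B : ℝ≥0} (hP : ∀ i, HasWeakDeriv Ω ![stdVec i] P (G i))
    (hloc : LocallyIntegrableOn P Ω) (hB : ∀ i, ∀ᵐ x ∂(volume.restrict Ω), |G i x| ≤ B) :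
    ∃ φ : Finset (Euc n) → Euc n → ℝ, (∀ K ∈ 𝒯.cells, LocallyLipschitz (φ K) ∧
      ∀ i, (fun x => lineDeriv ℝ (φ K) x (stdVec i)) =ᵐ[volume.restrict (interior (hull K))] G i) ∧
      ∀ K ∈ 𝒯.cells, ∀ L ∈ 𝒯.cells, ∀ f, f ∈ K.powersetCard n → f ∈ L.powersetCard n →
        EqOn (φ K) (φ L) (hull f) := by
  have key : ∀ Q : Set (Euc n), IsOpen Q → Convex ℝ Q → Q ⊆ Ω → ∃ F : Euc n → ℝ,
      LocallyLipschitz F ∧ P =ᵐ[volume.restrict Q] F ∧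
      ∀ i, (fun x => lineDeriv ℝ F x (stdVec i)) =ᵐ[volume.restrict Q] G i := by
    intro Q hQ hQc hsub
    obtain ⟨F, h1, h2, h3⟩ := exists_lipschitz_of_hasWeakDeriv exists_coeff_stdVec hQ hQc
      (fun i => (hP i).mono hΩo.measurableSet hsub) (hloc.mono_set hsub)
      (fun i => ae_restrict_mono hsub (hB i))
    exact ⟨F, h1.locallyLipschitz, h2, h3⟩
  have hcell : ∀ K : Finset (Euc n), ∃ F : Euc n → ℝ, K ∈ 𝒯.cells → LocallyLipschitz F ∧
      P =ᵐ[volume.restrict (interior (hull K))] F ∧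
      ∀ i, (fun x => lineDeriv ℝ F x (stdVec i)) =ᵐ[volume.restrict (interior (hull K))] G i := by
    intro K
    by_cases hK : K ∈ 𝒯.cells
    · obtain ⟨F, hF⟩ := key _ isOpen_interior (convex_hull K).interior (𝒯.interior_cell_subset hΩ hK)
      exact ⟨F, fun _ => hF⟩
    · exact ⟨0, fun h => (hK h).elim⟩
  choose φ hφ using hcell
  refine ⟨φ, fun K hK => ⟨(hφ K hK).1, (hφ K hK).2.2⟩, fun K hK L hL f hfK hfL => ?_⟩
  rcases eq_or_ne K L with rfl | hne
  · exact fun _ _ => rfl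
  have hf' := mem_powersetCard.1 hfK
  have hfI : f ∈ 𝒯.interiorFacets := 𝒯.mem_interiorFacets.2 ⟨𝒯.mem_faces_of_facet hn hK hfK, hf'.2,
    K, hK, L, hL, hne, hf'.1, (mem_powersetCard.1 hfL).1⟩
  have hrel : EqOn (φ K) (φ L) (relFace f) := by
    intro y hy
    obtain ⟨r, hr, hball⟩ := Metric.isOpen_iff.1 hΩo y (𝒯.relFace_subset_interior hn hΩ hfI hy)
    obtain ⟨F, hF1, hF2, -⟩ := key _ Metric.isOpen_ball (convex_ball y r) hball
    have hEq : ∀ N ∈ 𝒯.cells, f ∈ N.powersetCard n → φ N y = F y := by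
      intro N hN hfN
      have hNs := 𝒯.cell_simplex hN
      have ho : IsOpen (interior (hull N) ∩ Metric.ball y r) := isOpen_interior.inter Metric.isOpen_ball
      have h1 : φ N =ᵐ[volume.restrict (interior (hull N) ∩ Metric.ball y r)] F := by
        filter_upwards [ae_restrict_mono inter_subset_left (hφ N hN).2.1,
          ae_restrict_mono inter_subset_right hF2] with x hx1 hx2
        rw [← hx1, hx2]
      have h2 := Measure.eqOn_open_of_ae_eq h1 ho (hφ N hN).1.continuous.continuousOn
        hF1.continuous.continuousOn
      have h3 : y ∈ closure (interior (hull N) ∩ Metric.ball y r) := by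
        refine mem_closure_iff_nhds.2 fun S hS => ?_
        have hy' : y ∈ closure (interior (hull N)) := by
          rw [hNs.closure_interior]
          exact hull_mono (mem_powersetCard.1 hfN).1 (relFace_subset hy)
        obtain ⟨z, hz1, hz2⟩ := mem_closure_iff_nhds.1 hy' _
          (Filter.inter_mem hS (Metric.ball_mem_nhds y hr))
        exact ⟨z, hz1.1, hz2, hz1.2⟩
      exact h2.closure (hφ N hN).1.continuous hF1.continuous h3
    rw [hEq K hK hfK, hEq L hL hfL]
  exact fun x hx => hrel.closure (hφ K hK).1.continuous (hφ L hL).1.continuous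
    (hull_subset_closure_relFace (facet_nonempty hn hfK) hx)

/-- A bounded weak gradient on `Ω` is orthogonal to the divergence free broken fields. -/
lemma DivFree.integral_gradient_eq_zero {V : Finset (Euc n) → Euc n → Fin n → ℝ}
    (hV : 𝒯.DivFree V) (hn : 0 < n) (hΩo : IsOpen Ω) (hΩ : interior (closure Ω) = Ω)
    {P : Euc n → ℝ} {G : Fin n → Euc n → ℝ} {B : ℝ≥0} (hP : ∀ i, HasWeakDeriv Ω ![stdVec i] P (G i))
    (hB : ∀ i, ∀ᵐ x ∂(volume.restrict Ω), |G i x| ≤ B) :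
    ∑ K ∈ 𝒯.cells, ∫ x in hull K, ∑ i, G i x * V K x i = 0 := by
  classical
  obtain ⟨φ, hφ, htr⟩ := exists_cell_representatives (𝒯 := 𝒯) hn hΩo hΩ hP (hP ⟨0, hn⟩).locInt_fun hB
  have hcell : ∀ K ∈ 𝒯.cells, ∫ x in hull K, ∑ i, G i x * V K x i =
      ∑ f ∈ K.powersetCard n, ∫ x in hull f, φ K x * flux (V K) K f x ∂(surf n) := by
    intro K hK
    rw [(𝒯.cell_simplex hK).green_field hn (hφ K hK).1 (hV.lip K hK)]
    rw [integral_mul_divPt_eq_zero (hV.div K hK), add_zero, ← Measure.restrict_congr_set (interior_hull_ae_eq K)]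
    refine integral_congr_ae ?_
    filter_upwards [ae_all_iff.2 (hφ K hK).2] with x hx
    exact sum_congr rfl fun i _ => by rw [← hx i]
  rw [sum_congr rfl hcell]
  set χ : Finset (Euc n) → Euc n → ℝ := fun f =>
    if h : ∃ K ∈ 𝒯.cells, f ∈ K.powersetCard n then φ h.choose else 0 with hχ
  have hχc : ∀ f, Continuous (χ f) := fun f => by
    simp only [hχ]
    split_ifs with h
    · exact (hφ _ h.choose_spec.1).1.continuous
    · exact continuous_const
  rw [← hV.sum_integral_mul_flux_eq_zero hn hχc]
  refine sum_congr rfl fun K hK => sum_congr rfl fun f hf =>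
    setIntegral_congr_fun (measurableSet_hull f) fun x hx => ?_
  have h : ∃ K ∈ 𝒯.cells, f ∈ K.powersetCard n := ⟨K, hK, hf⟩
  simp only [hχ, dif_pos h]
  rw [htr K hK _ h.choose_spec.1 f hf h.choose_spec.2 hx]

end Triangulation

namespace Triangulation

variable {n : ℕ} {Ω : Set (Euc n)} {T : ℝ}

/-- Lipschitz representatives `F` of a velocity field on the space-time cylinders over the cells,
with pressure gradient `Dp`, for which the momentum equation holds almost everywhere. -/
structure EulerRep (𝒯 : Triangulation Ω) (T : ℝ) (u : ℝ → Euc n → Euc n) (L B : ℝ≥0)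
    (F : Finset (Euc n) → Fin n → ℝ × Euc n → ℝ) (p : ℝ × Euc n → ℝ)
    (Dp : Fin n → ℝ × Euc n → ℝ) : Prop where
  lip : ∀ K ∈ 𝒯.cells, ∀ i, LipschitzWith L (F K i)
  rep : ∀ t ∈ Icc 0 T, 𝒯.Represents (fun K x i => F K i (t, x)) (u t)
  bound : ∀ K ∈ 𝒯.cells, ∀ i, ∀ t ∈ Icc 0 T, ∀ x ∈ hull K, |F K i (t, x)| ≤ L
  pressure : ∀ i, HasWeakDeriv (cyl T Ω) ![dirX i] p (Dp i)
  pressure_bound : ∀ i, ∀ᵐ q ∂(volume.restrict (cyl T Ω)), |Dp i q| ≤ B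
  momentum : ∀ K ∈ 𝒯.cells, ∀ᵐ q ∂(volume.restrict (cellCyl T K)), ∀ i,
    lineDeriv ℝ (F K i) q dirT + ∑ j, F K j q * lineDeriv ℝ (F K i) q (dirX j) + Dp i q = 0

lemma closure_cylinder (hT : 0 < T) {K : Finset (Euc n)} (hK : IsNSimplex K) :
    closure (cellCyl T K) = Icc 0 T ×ˢ hull K := by
  rw [_root_.cylinder, closure_prod_eq, closure_Ioo hT.ne, hK.closure_interior]

lemma cellCyl_subset {𝒯 : Triangulation Ω} (hΩ : interior (closure Ω) = Ω) {K : Finset (Euc n)}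
    (hK : K ∈ 𝒯.cells) : cellCyl T K ⊆ cyl T Ω :=
  prod_mono subset_rfl (𝒯.interior_cell_subset hΩ hK)

/-- Existence of the representatives of an Euler solution that is bounded in `W^{1,∞}`. -/
theorem exists_eulerRep (hΩo : IsOpen Ω) (hΩ : interior (closure Ω) = Ω) (hT : 0 < T) {M : ℝ≥0}
    {u : ℝ → Euc n → Euc n} (hu : IsEulerSolution Ω T u) (hM : lipNorm Ω T u ≤ M)
    (𝒯 : Triangulation Ω) : ∃ F p Dp, 𝒯.EulerRep T u ((n + 1) * (M + 1))
      ((M + 1) + n * ((M + 1) * (M + 1))) F p Dp := by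
  classical
  have hcylo := isOpen_cylinder (T := T) hΩo
  have hterm : ∀ i, weakDerivNorm (cyl T Ω) ![] (fun q => u q.1 q.2 i) ∞ +
      weakDerivNorm (cyl T Ω) ![dirT] (fun q => u q.1 q.2 i) ∞ +
      ∑ j, weakDerivNorm (cyl T Ω) ![dirX j] (fun q => u q.1 q.2 i) ∞ ≤ M := fun i =>
    (single_le_sum (fun _ _ => zero_le) (Finset.mem_univ i)).trans hM
  choose g0 hg0 hg0b using fun i => exists_hasWeakDeriv_of_le
    (le_self_add.trans (le_self_add.trans (hterm i)))
  choose gT hgT hgTb using fun i => exists_hasWeakDeriv_of_le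
    (le_add_self.trans (le_self_add.trans (hterm i)))
  choose gX hgX hgXb using fun i j => exists_hasWeakDeriv_of_le
    ((le_add_self.trans (hterm i)).trans' (single_le_sum (f := fun j => weakDerivNorm _ ![dirX j] _ _)
      (fun _ _ => zero_le) (Finset.mem_univ j)))
  set M' : ℝ≥0 := M + 1 with hM'
  have hub : ∀ i, ∀ᵐ q ∂(volume.restrict (cyl T Ω)), |u q.1 q.2 i| ≤ M' := fun i => by
    have h1 : HasWeakDeriv (cyl T Ω) ![] (fun q => u q.1 q.2 i)
        (fun q => u q.1 q.2 i) := ⟨(hg0 i).locInt_fun, (hg0 i).locInt_fun, fun φ _ => by simp⟩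
    filter_upwards [h1.ae_unique hcylo (hg0 i), ae_abs_le_of_eLpNorm_top (hg0b i)] with q h2 h3
    rw [h2]
    exact h3
  obtain ⟨p, ut, Du, Dp, hut, hDu, hDp, hmom⟩ := hu.momentum
  have hcell : ∀ K (i : Fin n), ∃ F : ℝ × Euc n → ℝ, K ∈ 𝒯.cells →
      LipschitzWith ((n + 1) * M') F ∧
      (fun q : ℝ × Euc n => u q.1 q.2 i) =ᵐ[volume.restrict (cellCyl T K)] F ∧
      (fun q => lineDeriv ℝ F q dirT) =ᵐ[volume.restrict (cellCyl T K)] gT i ∧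
      ∀ j, (fun q => lineDeriv ℝ F q (dirX j))
        =ᵐ[volume.restrict (cellCyl T K)] gX i j := by
    intro K i
    by_cases hK : K ∈ 𝒯.cells
    swap
    · exact ⟨0, fun h => (hK h).elim⟩
    have hQo : IsOpen (cellCyl T K) := isOpen_cylinder isOpen_interior
    have hsub := cellCyl_subset (T := T) hΩ hK
    obtain ⟨F, h1, h2, h3⟩ := exists_lipschitz_of_hasWeakDeriv (e := dirTX) (M := M')
      (g := fun o => o.elim (gT i) (gX i)) exists_coeff_dirTX hQo
      ((convex_Ioo _ _).prod (convex_hull K).interior) (f := fun q => u q.1 q.2 i) (by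
        rintro (_ | j)
        · exact (hgT i).mono hcylo.measurableSet hsub
        · exact (hgX i j).mono hcylo.measurableSet hsub)
      ((hg0 i).locInt_fun.mono_set hsub)
      (by
        rintro (_ | j)
        · exact ae_restrict_mono hsub (ae_abs_le_of_eLpNorm_top (hgTb i))
        · exact ae_restrict_mono hsub (ae_abs_le_of_eLpNorm_top (hgXb i j)))
    refine ⟨F, fun _ => ⟨?_, h2, h3 none, fun j => h3 (some j)⟩⟩
    simpa using h1
  choose F hF using hcell
  have hsub := fun K hK => cellCyl_subset (𝒯 := 𝒯) (T := T) (K := K) hΩ hK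
  have hucont : ∀ i, ContinuousOn (fun q : ℝ × Euc n => u q.1 q.2 i) (Icc 0 T ×ˢ Ω) := fun i =>
    ((EuclideanSpace.proj i).continuous.comp_continuousOn hu.continuousOn)
  refine ⟨F, p, Dp, fun K hK i => (hF K i hK).1, ?_, ?_, hDp, ?_, ?_⟩
  · intro t ht K hK x hx i
    have h1 := Measure.eqOn_open_of_ae_eq (hF K i hK).2.1 (isOpen_cylinder isOpen_interior)
      ((hucont i).mono ((hsub K hK).trans (prod_mono Ioo_subset_Icc_self subset_rfl)))
      (hF K i hK).1.continuous.continuousOn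
    have h2 : EqOn (fun τ => u τ x i) (fun τ => F K i (τ, x)) (Ioo 0 T) := fun τ hτ =>
      h1 (show ((τ, x) : ℝ × Euc n) ∈ cyl T _ from ⟨hτ, hx⟩)
    have h3 : ContinuousOn (fun τ => u τ x i) (Icc 0 T) := (hucont i).comp (f := fun τ => (τ, x))
      (by fun_prop) fun τ hτ => ⟨hτ, 𝒯.interior_cell_subset hΩ hK hx⟩
    have h4 : Continuous fun τ => F K i (τ, x) := (hF K i hK).1.continuous.comp (by fun_prop)
    exact h2.of_subset_closure h3 h4.continuousOn Ioo_subset_Icc_self (by rw [closure_Ioo hT.ne]) ht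
  · intro K hK i t ht x hx
    have hc := (hF K i hK).1.continuous
    have h1 : F K i =ᵐ[volume.restrict (cellCyl T K)]
        fun q => max (-(M' : ℝ)) (min (F K i q) M') := by
      filter_upwards [(hF K i hK).2.1, ae_restrict_mono (hsub K hK) (hub i)]
        with q h2 h3
      rw [h2, abs_le] at h3
      rw [min_eq_left h3.2, max_eq_right h3.1]
    have h2 := Measure.eqOn_open_of_ae_eq h1 (isOpen_cylinder isOpen_interior) hc.continuousOn
      (continuous_const.max (hc.min continuous_const)).continuousOn
    have h3 := h2.closure hc (continuous_const.max (hc.min continuous_const))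
    rw [closure_cylinder hT (𝒯.cell_simplex hK)] at h3
    have h4 : F K i (t, x) = _ := h3 (show ((t, x) : ℝ × Euc n) ∈ Icc 0 T ×ˢ hull K from ⟨ht, hx⟩)
    have h5 : |F K i (t, x)| ≤ M' := by
      rw [h4, abs_le]
      exact ⟨le_max_left _ _, max_le (by linarith [M'.2, M'.coe_nonneg]) (min_le_right _ _)⟩
    refine h5.trans ?_
    have h6 : M' ≤ ((n : ℝ≥0) + 1) * M' := le_mul_of_one_le_left zero_le le_add_self
    exact_mod_cast h6
  · intro i
    filter_upwards [hmom, ae_all_iff.2 hub, (hut i).ae_unique hcylo (hgT i),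
      ae_all_iff.2 fun j => (hDu i j).ae_unique hcylo (hgX i j), ae_abs_le_of_eLpNorm_top (hgTb i),
      ae_all_iff.2 fun j => ae_abs_le_of_eLpNorm_top (hgXb i j)] with q h1 h2 h3 h4 h5 h6
    have h7 : Dp i q = -(ut i q + ∑ j, u q.1 q.2 j * Du i j q) := by linarith [h1 i]
    rw [h7, abs_neg]
    refine (abs_add_le _ _).trans ?_
    push_cast
    refine add_le_add (by rw [h3]; exact_mod_cast h5) ((abs_sum_le_sum_abs _ _).trans ?_)
    refine (sum_le_sum (g := fun _ => (M' : ℝ) * M') fun j _ => ?_).trans (by simp [hM'])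
    rw [abs_mul, h4 j]
    exact mul_le_mul (h2 j) (h6 j) (abs_nonneg _) M'.2
  · intro K hK
    filter_upwards [ae_restrict_mono (hsub K hK) hmom,
      ae_all_iff.2 fun i => ae_restrict_mono (hsub K hK)
        ((hut i).ae_unique hcylo (hgT i)),
      ae_all_iff.2 fun i => ae_all_iff.2 fun j => ae_restrict_mono (hsub K hK)
        ((hDu i j).ae_unique hcylo (hgX i j)),
      ae_all_iff.2 fun i => (hF K i hK).2.1, ae_all_iff.2 fun i => (hF K i hK).2.2.1,
      ae_all_iff.2 fun i => ae_all_iff.2 (hF K i hK).2.2.2] with q h1 h2 h3 h4 h5 h6 i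
    rw [← h1 i, h5 i, h2 i]
    simp only [h6, ← h3, ← h4]

/-- The convection form `∑_K [-∫_K U_i U_j ∂_j V_i + ∫_∂K (U · n) (U · V)]`. -/
noncomputable def convForm (𝒯 : Triangulation Ω) (U V : Finset (Euc n) → Euc n → Fin n → ℝ) : ℝ :=
  ∑ K ∈ 𝒯.cells, ((∑ f ∈ K.powersetCard n, ∫ x in hull f, (∑ i, U K x i * V K x i) *
      flux (U K) K f x ∂(surf n)) -
    ∫ x in hull K, ∑ j, ∑ i, U K x i * ∇ (V K) x i j * U K x j)

/-- Integration by parts in the convection term. -/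
lemma convection_green (hn : 0 < n) {K : Finset (Euc n)} (hK : IsNSimplex K)
    {U V Z : Euc n → Fin n → ℝ} (hU : ∀ i, LocallyLipschitz fun x => U x i)
    (hV : ∀ i, LocallyLipschitz fun x => V x i) (hZ : ∀ i, LocallyLipschitz fun x => Z x i)
    (hdiv : ∀ᵐ x ∂(volume.restrict (hull K)), divPt Z x = 0) :
    ∫ x in hull K, ∑ i, (∑ j, Z x j * ∇ U x i j) * V x i =
      (∑ f ∈ K.powersetCard n, ∫ x in hull f, (∑ i, U x i * V x i) * flux Z K f x ∂(surf n)) -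
      ∫ x in hull K, ∑ j, ∑ i, U x i * ∇ V x i j * Z x j := by
  have hUV : LocallyLipschitz fun x => ∑ i, U x i * V x i :=
    LocallyLipschitz.sum_real _ fun i _ => (hU i).mul_real (hV i)
  rw [hK.green_field hn hUV hZ]
  have hi1 : IntegrableOn (fun x => ∑ j, lineDeriv ℝ (fun x => ∑ i, U x i * V x i) x (stdVec j) *
      Z x j) (hull K) :=
    integrable_finset_sum _ fun j _ => integrableOn_lineDeriv_mul hUV (hZ j).continuous K _
  have hi2 : IntegrableOn (fun x => ∑ j, ∑ i, U x i * ∇ V x i j *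
      Z x j) (hull K) := integrable_finset_sum _ fun j _ => integrable_finset_sum _ fun i _ =>
      (integrableOn_lineDeriv_mul (g := fun x => U x i * Z x j) (hV i)
        ((hU i).continuous.mul (hZ j).continuous) K
        (stdVec j)).congr (.of_forall fun x => by simp only; ring)
  rw [integral_mul_divPt_eq_zero hdiv, add_zero, ← integral_sub hi1 hi2]
  refine integral_congr_ae ?_
  filter_upwards [ae_restrict_of_ae (ae_all_iff.2 fun i => (hU i).ae_differentiableAt_real),
    ae_restrict_of_ae (ae_all_iff.2 fun i => (hV i).ae_differentiableAt_real)] with x hx1 hx2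
  have hl : ∀ j, lineDeriv ℝ (fun x => ∑ i, U x i * V x i) x (stdVec j) =
      ∑ i, (U x i * ∇ V x i j +
        ∇ U x i j * V x i) := fun j => by
    rw [(DifferentiableAt.fun_sum fun i _ => (hx1 i).fun_mul (hx2 i)).lineDeriv_eq_fderiv,
      fderiv_fun_sum fun i _ => (hx1 i).fun_mul (hx2 i), ContinuousLinearMap.sum_apply]
    refine sum_congr rfl fun i _ => ?_
    rw [fderiv_fun_mul (hx1 i) (hx2 i), (hx1 i).lineDeriv_eq_fderiv, (hx2 i).lineDeriv_eq_fderiv]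
    simp [mul_comm]
  simp only [hl, ← sum_sub_distrib, sum_mul]
  rw [sum_comm]
  refine sum_congr rfl fun j _ => sum_congr rfl fun i _ => by ring

section Equation

variable {𝒯 : Triangulation Ω} {u : ℝ → Euc n → Euc n} {L B : ℝ≥0}
    {F : Finset (Euc n) → Fin n → ℝ × Euc n → ℝ} {p : ℝ × Euc n → ℝ} {Dp : Fin n → ℝ × Euc n → ℝ}

lemma EulerRep.lip_slice (hF : 𝒯.EulerRep T u L B F p Dp) {K : Finset (Euc n)} (hK : K ∈ 𝒯.cells) (i : Fin n) (t : ℝ) :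
    LipschitzWith L fun x => F K i (t, x) := by
  simpa only [mul_one, Function.comp_def] using (hF.lip K hK i).comp (LipschitzWith.prodMk_left t)

lemma EulerRep.lip_time (hF : 𝒯.EulerRep T u L B F p Dp) {K : Finset (Euc n)} (hK : K ∈ 𝒯.cells) (i : Fin n)
    x : LipschitzWith L fun t => F K i (t, x) := by
  simpa only [mul_one, Function.comp_def] using (hF.lip K hK i).comp (LipschitzWith.prodMk_right x)

lemma EulerRep.divFree (hF : 𝒯.EulerRep T u L B F p Dp) (hn : 0 < n) (hΩ : interior (closure Ω) = Ω)
    (hu : IsEulerSolution Ω T u) {t : ℝ} (ht : t ∈ Icc 0 T) : 𝒯.DivFree fun K x i => F K i (t, x) :=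
  divFree_of_isSolenoidal hn hΩ (hu.solenoidal t ht) (hF.rep t ht) fun _ hK i =>
    (hF.lip_slice hK i t).locallyLipschitz

lemma EulerRep.integrable_pressure_mul (hF : 𝒯.EulerRep T u L B F p Dp)
    (hΩ : interior (closure Ω) = Ω) {K : Finset (Euc n)} (hK : K ∈ 𝒯.cells) (i : Fin n)
    {g : ℝ × Euc n → ℝ} (hg : Continuous g) : Integrable (fun q => g q * Dp i q)
      ((volume.restrict (Ioo 0 T)).prod (volume.restrict (interior (hull K)))) := by
  have hsub := cellCyl_subset (T := T) hΩ hK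
  rw [← restrict_cylinder]
  exact Integrable.mul_bdd (c := B) ((integrableOn_of_continuous hg (isCompact_Icc.prod
    (isCompact_hull K))).mono_set (prod_mono Ioo_subset_Icc_self interior_subset))
    ((hF.pressure i).locInt_deriv.mono_set hsub).aestronglyMeasurable
    (ae_restrict_mono hsub (hF.pressure_bound i))

lemma EulerRep.integrable_pressure (hF : 𝒯.EulerRep T u L B F p Dp)
    (hΩ : interior (closure Ω) = Ω) {V : Finset (Euc n) → Euc n → Fin n → ℝ} (hV : 𝒯.DivFree V)
    {K : Finset (Euc n)} (hK : K ∈ 𝒯.cells) :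
    Integrable (fun q : ℝ × Euc n => ∑ i, Dp i q * V K q.2 i)
      ((volume.restrict (Ioo 0 T)).prod (volume.restrict (interior (hull K)))) := by
  simpa only [mul_comm] using integrable_finset_sum _ fun i _ => hF.integrable_pressure_mul hΩ hK i
    (g := fun q => V K q.2 i) ((hV.lip K hK i).continuous.comp continuous_snd)

/-- The pressure gradient does not contribute to the momentum balance tested with divergence free
fields. -/
lemma EulerRep.pressure_orthogonal (hF : 𝒯.EulerRep T u L B F p Dp) (hn : 0 < n) (hΩo : IsOpen Ω)
    (hΩ : interior (closure Ω) = Ω) {V : Finset (Euc n) → Euc n → Fin n → ℝ} (hV : 𝒯.DivFree V) :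
    ∀ᵐ t ∂(volume.restrict (Ioo 0 T)),
      ∑ K ∈ 𝒯.cells, ∫ x in interior (hull K), ∑ i, Dp i (t, x) * V K x i = 0 := by
  have hint := fun K hK => hF.integrable_pressure hΩ hV (K := K) hK
  have hloc : LocallyIntegrableOn (fun t => ∑ K ∈ 𝒯.cells,
      ∫ x in interior (hull K), ∑ i, Dp i (t, x) * V K x i) (Ioo 0 T) :=
    IntegrableOn.locallyIntegrableOn (integrable_finset_sum _ fun K hK =>
      (hint K hK).integral_prod_left)
  rw [ae_restrict_iff' measurableSet_Ioo]
  refine isOpen_Ioo.ae_eq_zero_of_integral_contDiff_smul_eq_zero hloc fun η h1 h2 h3 => ?_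
  have hη : IsTestFunction (Ioo 0 T) η := ⟨h1, h2, h3⟩
  obtain ⟨C, hC⟩ := h2.exists_bound_of_continuous h1.continuous
  have hbd : ∀ i, ∀ᵐ x ∂(volume.restrict Ω), |∫ t in Ioo 0 T, η t * Dp i (t, x)| ≤
      (∫ t in Ioo 0 T, ‖η t‖ * B).toNNReal := fun i => by
    have h := hF.pressure_bound i
    rw [restrict_cylinder] at h
    have h' := Measure.ae_ae_of_ae_prod ((Measure.measurePreserving_swap (μ := volume.restrict Ω)
        (ν := (volume : Measure ℝ).restrict (Ioo 0 T))).quasiMeasurePreserving.ae h)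
    filter_upwards [h'] with x hx
    refine le_trans ?_ (Real.le_coe_toNNReal _)
    rw [← Real.norm_eq_abs]
    refine (norm_integral_le_integral_norm _).trans (integral_mono_of_nonneg
      (.of_forall fun _ => norm_nonneg _)
      ((h1.continuous.norm.integrable_of_hasCompactSupport h2.norm).integrableOn.mul_const _) ?_)
    filter_upwards [hx] with t ht
    rw [norm_mul]
    exact mul_le_mul_of_nonneg_left ht (norm_nonneg _)
  have h0 := hV.integral_gradient_eq_zero hn hΩo hΩ
    (fun i => (hF.pressure i).time_average hΩo hη) hbd
  rw [← setIntegral_eq_integral_of_forall_compl_eq_zero (s := Ioo 0 T) fun t ht => by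
    rw [image_eq_zero_of_notMem_tsupport fun h => ht (h3 h), zero_smul]]
  have hint2 : ∀ K ∈ 𝒯.cells, Integrable (fun q : ℝ × Euc n => η q.1 * ∑ i, Dp i q * V K q.2 i)
      ((volume.restrict (Ioo 0 T)).prod (volume.restrict (interior (hull K)))) := fun K hK =>
    (hint K hK).bdd_mul (c := C) (h1.continuous.comp continuous_fst).aestronglyMeasurable
      (.of_forall fun q => hC q.1)
  simp only [smul_eq_mul, mul_sum 𝒯.cells, ← integral_const_mul]
  rw [integral_finset_sum _ fun K hK => (hint2 K hK).integral_prod_left]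
  refine Eq.trans ?_ h0
  refine sum_congr rfl fun K hK => ?_
  rw [integral_integral_swap (hint2 K hK), ← Measure.restrict_congr_set (interior_hull_ae_eq K)]
  refine integral_congr_ae ?_
  have hD := fun i => hF.integrable_pressure_mul hΩ hK i (g := fun q => η q.1) (h1.continuous.comp continuous_fst)
  filter_upwards [ae_all_iff.2 fun i => (hD i).prod_left_ae] with x hx
  simp only [mul_sum, ← mul_assoc]
  rw [integral_finset_sum _ fun i _ => (hx i).mul_const _]
  exact sum_congr rfl fun i _ => integral_mul_const _ _

/-- The weak form of the Euler equations in time, tested with divergence free fields. -/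
theorem EulerRep.hasDerivAt (hF : 𝒯.EulerRep T u L B F p Dp) (hn : 0 < n) (hΩo : IsOpen Ω)
    (hΩ : interior (closure Ω) = Ω) (hu : IsEulerSolution Ω T u)
    {V : Finset (Euc n) → Euc n → Fin n → ℝ} (hV : 𝒯.DivFree V) : ∀ᵐ t ∂(volume.restrict (Ioo 0 T)),
      HasDerivAt (fun τ => ∑ K ∈ 𝒯.cells, ∫ x in hull K, ∑ i, F K i (τ, x) * V K x i)
        (-𝒯.convForm (fun K x i => F K i (t, x)) V) t := by
  have hdiff : ∀ᵐ t : ℝ, ∀ K ∈ 𝒯.cells, ∀ i, ∀ᵐ x : Euc n,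
      LineDifferentiableAt ℝ (F K i) (t, x) dirT := by
    rw [Filter.eventually_all_finset]
    refine fun K hK => ae_all_iff.2 fun i => ?_
    have h := (hF.lip K hK i).ae_lineDifferentiableAt (μ := volume) dirT
    rw [Measure.volume_eq_prod] at h
    exact Measure.ae_ae_of_ae_prod h
  have hmom : ∀ᵐ t ∂(volume.restrict (Ioo 0 T)), ∀ K ∈ 𝒯.cells,
      ∀ᵐ x ∂(volume.restrict (interior (hull K))), ∀ i, lineDeriv ℝ (F K i) (t, x) dirT +
          ∑ j, F K j (t, x) * lineDeriv ℝ (F K i) (t, x) (dirX j) + Dp i (t, x) = 0 := by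
    rw [Filter.eventually_all_finset]
    intro K hK
    have h := hF.momentum K hK
    rw [restrict_cylinder] at h
    exact Measure.ae_ae_of_ae_prod h
  have hpint : ∀ᵐ t ∂(volume.restrict (Ioo 0 T)), ∀ K ∈ 𝒯.cells,
      IntegrableOn (fun x => ∑ i, Dp i (t, x) * V K x i) (interior (hull K)) := by
    rw [Filter.eventually_all_finset]
    exact fun K hK => (hF.integrable_pressure hΩ hV hK).prod_right_ae
  filter_upwards [ae_restrict_of_ae hdiff, hmom, hpint, hF.pressure_orthogonal hn hΩo hΩ hV,
    ae_restrict_mem measurableSet_Ioo] with t h1 h2 h3 h4 ht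
  have hUd := hF.divFree hn hΩ hu (Ioo_subset_Icc_self ht)
  have hval : -𝒯.convForm (fun K x i => F K i (t, x)) V = ∑ K ∈ 𝒯.cells,
      ∫ x in hull K, ∑ i, lineDeriv ℝ (F K i) (t, x) dirT * V K x i := by
    rw [← sub_zero (∑ K ∈ 𝒯.cells, _), ← neg_zero, ← h4, convForm, ← sum_neg_distrib,
      ← sum_neg_distrib, ← sum_sub_distrib]
    refine sum_congr rfl fun K hK => ?_
    rw [← convection_green hn (𝒯.cell_simplex hK) (hUd.lip K hK) (hV.lip K hK) (hUd.lip K hK)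
      (hUd.div K hK),
      ← Measure.restrict_congr_set (interior_hull_ae_eq K), sub_neg_eq_add, eq_comm, ← eq_sub_iff_add_eq,
      ← integral_neg]
    have hic : IntegrableOn (fun x => -∑ i, (∑ j, F K j (t, x) *
        lineDeriv ℝ (fun y => F K i (t, y)) x (stdVec j)) * V K x i) (interior (hull K)) := by
      refine Integrable.neg (integrable_finset_sum _ fun i _ => ?_)
      simp only [sum_mul]
      refine integrable_finset_sum _ fun j _ => ?_
      refine ((integrableOn_lineDeriv_mul (g := fun x => F K j (t, x) * V K x i) (hUd.lip K hK i)
        ((hUd.lip K hK j).continuous.mul (hV.lip K hK i).continuous) K (stdVec j)).mono_set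
        interior_subset).congr (.of_forall fun x => by simp only; ring)
    rw [← integral_sub hic (h3 K hK)]
    refine integral_congr_ae ?_
    filter_upwards [h2 K hK] with x hx
    rw [← sum_neg_distrib, ← sum_sub_distrib]
    refine sum_congr rfl fun i _ => ?_
    have h5 := hx i
    simp only [lineDeriv_dirX] at h5
    rw [← neg_mul, ← sub_mul]
    congr 1
    linarith
  rw [hval]
  refine HasDerivAt.fun_sum fun K hK => ?_
  have hVc : ∀ i, Continuous fun x => V K x i := fun i => (hV.lip K hK i).continuous
  have hFc : ∀ τ i, Continuous fun x => F K i (τ, x) := fun τ i => (hF.lip_slice hK i τ).continuous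
  have hsc : ∀ τ, Continuous fun x => ∑ i, F K i (τ, x) * V K x i :=
    fun τ => continuous_finset_sum _ fun i _ => (hFc τ i).mul (hVc i)
  refine (hasDerivAt_integral_of_dominated_loc_of_lip (μ := volume.restrict (hull K))
    (F := fun τ x => ∑ i, F K i (τ, x) * V K x i)
    (bound := fun x => ∑ i, L * |V K x i|) (Metric.ball_mem_nhds t one_pos)
    (.of_forall fun τ => (hsc τ).aestronglyMeasurable)
    (integrableOn_of_continuous (hsc t) (isCompact_hull K)) ?_ ?_ ?_ ?_).2
  · refine Finset.aestronglyMeasurable_fun_sum _ fun i _ => ?_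
    refine AEStronglyMeasurable.mul ?_ (hVc i).aestronglyMeasurable
    exact ((measurable_lineDeriv (hF.lip K hK i).continuous).comp
      measurable_prodMk_left).aestronglyMeasurable
  · refine .of_forall fun x => LipschitzWith.lipschitzOnWith ?_
    refine LipschitzWith.of_dist_le_mul fun τ τ' => ?_
    rw [Real.coe_nnabs, abs_of_nonneg (sum_nonneg fun i _ => by positivity), Real.dist_eq,
      ← sum_sub_distrib, sum_mul]
    refine (abs_sum_le_sum_abs _ _).trans (sum_le_sum fun i _ => ?_)
    rw [← sub_mul, abs_mul, mul_right_comm]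
    exact mul_le_mul_of_nonneg_right ((hF.lip_time hK i x).dist_le_mul τ τ') (abs_nonneg _)
  · exact integrableOn_of_continuous (continuous_finset_sum _ fun i _ =>
      continuous_const.mul (hVc i).abs) (isCompact_hull K)
  · filter_upwards [ae_restrict_of_ae (ae_all_iff.2 fun i => h1 K hK i)] with x hx
    refine HasDerivAt.fun_sum fun i _ => HasDerivAt.mul_const ?_ _
    have h6 := (hx i).hasLineDerivAt
    rw [HasLineDerivAt] at h6
    have h7 := h6.scomp_of_eq t ((hasDerivAt_id t).sub_const t) (by simp)
    simp only [one_smul] at h7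
    refine h7.congr_of_eventuallyEq (.of_forall fun τ => ?_)
    simp [dirT]

end Equation

end Triangulation

section Cross

variable {n : ℕ}

lemma crossInner_cross (a b c d : Fin n → ℝ) : crossInner (cross a b) (cross c d) =
    (∑ i, a i * c i) * (∑ i, b i * d i) - (∑ i, a i * d i) * ∑ i, b i * c i := by
  simp only [crossInner, cross, Finset.sum_mul_sum]
  have h : ∀ i j, (a i * b j - a j * b i) * (c i * d j - c j * d i) =
      (a i * c i * (b j * d j) - a i * d i * (b j * c j)) +
      (a j * c j * (b i * d i) - a j * d j * (b i * c i)) := fun i j => by ring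
  simp only [h, sum_add_distrib, sum_sub_distrib]
  rw [sum_comm (f := fun i j => a j * c j * (b i * d i)),
    sum_comm (f := fun i j => a j * d j * (b i * c i))]
  ring

lemma crossInner_sub (a b c : Fin n → Fin n → ℝ) :
    crossInner a (b - c) = crossInner a b - crossInner a c := by
  simp only [crossInner, Pi.sub_apply, mul_sub, sum_sub_distrib]

end Cross

section Pointwise

variable {H : Type*} [NormedAddCommGroup H] [InnerProductSpace ℝ H]

local notation "⟪" x ", " y "⟫" => inner ℝ x y

lemma facet_identity {ν U a b x y : H} (hw : ⟪ν, a⟫ = ⟪ν, b⟫) (he : ⟪ν, x⟫ = ⟪ν, y⟫) :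
    (‖U + a + x‖ ^ 2 / 2 * ⟪ν, x⟫ - ‖x‖ ^ 2 / 2 * ⟪ν, U + a + x⟫ - ⟪U + a, x⟫ * ⟪ν, x⟫ -
        ⟪U, x⟫ * ⟪ν, U⟫) -
      (‖U + b + y‖ ^ 2 / 2 * ⟪ν, y⟫ - ‖y‖ ^ 2 / 2 * ⟪ν, U + b + y⟫ - ⟪U + b, y⟫ * ⟪ν, y⟫ -
        ⟪U, y⟫ * ⟪ν, U⟫) + (⟪ν, U + a + x⟫ * ⟪(2 : ℝ)⁻¹ • (U + a + x + (U + b + y)), x - y⟫ -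
        ⟪ν, x⟫ * ⟪(2 : ℝ)⁻¹ • (U + a + x + (U + b + y)), (U + a + x) - (U + b + y)⟫) =
      -(⟪ν, x⟫ * ⟪a - b, x + y⟫ / 2) + ⟪ν, a⟫ * ⟪U + (2 : ℝ)⁻¹ • (a + b), x - y⟫ +
        ⟪ν, U⟫ * ⟪a + b, x - y⟫ / 2 := by
  simp only [← real_inner_self_eq_norm_sq, inner_add_left, inner_add_right, inner_sub_left,
    inner_sub_right, real_inner_smul_left, ← hw, ← he]
  rw [real_inner_comm U a, real_inner_comm U b, real_inner_comm U x, real_inner_comm U y,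
    real_inner_comm a b, real_inner_comm a x, real_inner_comm a y, real_inner_comm b x,
    real_inner_comm b y, real_inner_comm x y]
  ring

lemma absorb_products {h Λ : ℝ} (hh : 0 < h) (hΛ : 1 ≤ Λ) (a b x y : ℝ) :
    11 * Λ ^ 2 * ((a + b) * (x + y)) + Λ * h * (x + y) ^ 2 ≤
      100 * Λ ^ 3 * (h⁻¹ * (a ^ 2 + b ^ 2) + h * (x ^ 2 + y ^ 2)) := by
  have hAE : (a + b) * (x + y) ≤ h⁻¹ * (a + b) ^ 2 / 2 + h * (x + y) ^ 2 / 2 := by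
    have h1 : 0 ≤ h⁻¹ * ((a + b) - h * (x + y)) ^ 2 := by positivity
    have h2 : h⁻¹ * ((a + b) - h * (x + y)) ^ 2 =
        h⁻¹ * (a + b) ^ 2 - 2 * ((a + b) * (x + y)) + h * (x + y) ^ 2 := by
      field_simp
      ring
    linarith
  have hA2 : h⁻¹ * (a + b) ^ 2 ≤ h⁻¹ * (2 * (a ^ 2 + b ^ 2)) := by
    gcongr
    nlinarith [sq_nonneg (a - b)]
  have hE2 : h * (x + y) ^ 2 ≤ h * (2 * (x ^ 2 + y ^ 2)) := by
    gcongr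
    nlinarith [sq_nonneg (x - y)]
  set P := h⁻¹ * (a ^ 2 + b ^ 2) with hP
  set Q := h * (x ^ 2 + y ^ 2) with hQ
  have hP0 : 0 ≤ P := by positivity
  have hQ0 : 0 ≤ Q := by positivity
  have f1 : Λ ^ 2 * ((a + b) * (x + y)) ≤ Λ ^ 2 * (P + Q) :=
    mul_le_mul_of_nonneg_left (by linarith) (by positivity)
  have f2 : Λ * (h * (x + y) ^ 2) ≤ Λ * (2 * Q) :=
    mul_le_mul_of_nonneg_left (by linarith) (by linarith)
  have f3 : Λ ^ 2 * (P + Q) ≤ Λ ^ 3 * (P + Q) := by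
    gcongr
    norm_num
  have f4 : Λ ^ 1 * Q ≤ Λ ^ 3 * Q := by
    gcongr
    norm_num
  have f6 : 0 ≤ Λ ^ 3 * P := by positivity
  have f7 : 0 ≤ Λ ^ 3 * Q := by positivity
  rw [pow_one] at f4
  linarith

/-- The facet contributions to the energy balance, after integration by parts. Here `U` is the exact
velocity, `U + a` and `U + b` are the traces of the discrete approximation from both sides, `x`
and `y` those of the error; the upwind term `c (ν · β) |[e]|²` has the favourable sign. -/
lemma facet_lower_bound {ν U a b x y : H} {c h Λ : ℝ} (hh : 0 < h) (hΛ : 1 ≤ Λ) (hhΛ : h ≤ Λ)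
    (hν : ‖ν‖ = 1) (hw : ⟪ν, a⟫ = ⟪ν, b⟫) (he : ⟪ν, x⟫ = ⟪ν, y⟫) (hU : ‖U‖ ≤ Λ) (ha : ‖a‖ ≤ Λ * h)
    (hb : ‖b‖ ≤ Λ * h) (hx : ‖x‖ ≤ Λ * h) (hy : ‖y‖ ≤ Λ * h) (hc : |c| ≤ 1 / 2)
    (hcν : c * ⟪ν, U + a + x⟫ = |⟪ν, U + a + x⟫| / 2) :
    -(100 * Λ ^ 3 * (h⁻¹ * (‖a‖ ^ 2 + ‖b‖ ^ 2) + h * (‖x‖ ^ 2 + ‖y‖ ^ 2))) ≤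
    (‖U + a + x‖ ^ 2 / 2 * ⟪ν, x⟫ - ‖x‖ ^ 2 / 2 * ⟪ν, U + a + x⟫ - ⟪U + a, x⟫ * ⟪ν, x⟫ -
        ⟪U, x⟫ * ⟪ν, U⟫) -
      (‖U + b + y‖ ^ 2 / 2 * ⟪ν, y⟫ - ‖y‖ ^ 2 / 2 * ⟪ν, U + b + y⟫ - ⟪U + b, y⟫ * ⟪ν, y⟫ -
        ⟪U, y⟫ * ⟪ν, U⟫) + (⟪ν, U + a + x⟫ * ⟪(2 : ℝ)⁻¹ • (U + a + x + (U + b + y)), x - y⟫ -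
        ⟪ν, x⟫ * ⟪(2 : ℝ)⁻¹ • (U + a + x + (U + b + y)), (U + a + x) - (U + b + y)⟫) +
      c * (⟪ν, U + a + x⟫ * ⟪U + a + x - (U + b + y), x - y⟫ -
        ⟪ν, x⟫ * ⟪U + a + x - (U + b + y), U + a + x - (U + b + y)⟫) := by
  rw [facet_identity hw he]
  have CS : ∀ p q : H, |⟪p, q⟫| ≤ ‖p‖ * ‖q‖ := abs_real_inner_le_norm
  have Cν : ∀ q : H, |⟪ν, q⟫| ≤ ‖q‖ := fun q => (CS ν q).trans (by rw [hν, one_mul])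
  set A := ‖a‖ + ‖b‖ with hA
  set E := ‖x‖ + ‖y‖ with hE
  have hA0 : 0 ≤ A := by positivity
  have hE0 : 0 ≤ E := by positivity
  have hΛ0 : 0 < Λ := by linarith
  have hah := norm_nonneg a
  have hbh := norm_nonneg b
  have hxh := norm_nonneg x
  have hyh := norm_nonneg y
  have nab : ‖a - b‖ ≤ A := norm_sub_le a b
  have nab' : ‖a + b‖ ≤ A := norm_add_le a b
  have nxy : ‖x - y‖ ≤ E := norm_sub_le x y
  have nxy' : ‖x + y‖ ≤ E := norm_add_le x y
  have hΛh : Λ * h ≤ Λ ^ 2 := by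
    rw [sq]
    gcongr
  have hAΛ : A ≤ 2 * Λ ^ 2 := by linarith
  have hEΛ : E ≤ 2 * Λ ^ 2 := by linarith
  have hEh : E ≤ 2 * (Λ * h) := by linarith
  have hΛΛ : Λ ≤ Λ ^ 2 := by nlinarith
  have t1 : |⟪ν, x⟫ * ⟪a - b, x + y⟫ / 2| ≤ Λ ^ 2 * (A * E) := by
    rw [abs_div, abs_mul, abs_two]
    have h1 : |⟪ν, x⟫| ≤ 2 * Λ ^ 2 := (Cν x).trans (by linarith)
    have h2 : |⟪a - b, x + y⟫| ≤ A * E := (CS _ _).trans (by gcongr)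
    have := mul_le_mul h1 h2 (abs_nonneg _) (by positivity)
    linarith
  have t2 : |⟪ν, a⟫ * ⟪U + (2 : ℝ)⁻¹ • (a + b), x - y⟫| ≤ 2 * Λ ^ 2 * (A * E) := by
    rw [abs_mul]
    have h1 : |⟪ν, a⟫| ≤ A := (Cν a).trans (by linarith)
    have h3 : ‖U + (2 : ℝ)⁻¹ • (a + b)‖ ≤ 2 * Λ ^ 2 := by
      refine (norm_add_le _ _).trans ?_
      rw [norm_smul, Real.norm_of_nonneg (by norm_num)]
      linarith
    have h2 : |⟪U + (2 : ℝ)⁻¹ • (a + b), x - y⟫| ≤ 2 * Λ ^ 2 * E := (CS _ _).trans (by gcongr)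
    have := mul_le_mul h1 h2 (abs_nonneg _) hA0
    linarith
  have t3 : |⟪ν, U⟫ * ⟪a + b, x - y⟫ / 2| ≤ Λ ^ 2 * (A * E) := by
    rw [abs_div, abs_mul, abs_two]
    have h1 : |⟪ν, U⟫| ≤ Λ ^ 2 := (Cν U).trans (by linarith)
    have h2 : |⟪a + b, x - y⟫| ≤ A * E := (CS _ _).trans (by gcongr)
    have := mul_le_mul h1 h2 (abs_nonneg _) (by positivity)
    have : 0 ≤ Λ ^ 2 * (A * E) := by positivity
    linarith
  have e1 : U + a + x - (U + b + y) = (a - b) + (x - y) := by abel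
  rw [e1]
  have t4 : -(3 * Λ ^ 2 * (A * E)) ≤ c * (⟪ν, U + a + x⟫ * ⟪(a - b) + (x - y), x - y⟫) := by
    have h0 : ∀ r, c * (⟪ν, U + a + x⟫ * r) = |⟪ν, U + a + x⟫| / 2 * r := fun r => by
      rw [← hcν, mul_assoc]
    rw [h0, inner_add_left, mul_add]
    have h1 : |⟪ν, U + a + x⟫| ≤ 5 * Λ ^ 2 := (Cν _).trans ((norm_add₃_le).trans (by linarith))
    have h2 : |⟪a - b, x - y⟫| ≤ A * E := (CS _ _).trans (by gcongr)
    have h3 : 0 ≤ ⟪x - y, x - y⟫ := real_inner_self_nonneg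
    have h4 : |⟪ν, U + a + x⟫| * |⟪a - b, x - y⟫| ≤ 5 * Λ ^ 2 * (A * E) :=
      mul_le_mul h1 h2 (abs_nonneg _) (by positivity)
    have h5 : -(|⟪ν, U + a + x⟫| * |⟪a - b, x - y⟫|) ≤ |⟪ν, U + a + x⟫| * ⟪a - b, x - y⟫ := by
      rw [← mul_neg]
      exact mul_le_mul_of_nonneg_left (neg_abs_le _) (abs_nonneg _)
    have h6 : 0 ≤ |⟪ν, U + a + x⟫| * ⟪x - y, x - y⟫ := mul_nonneg (abs_nonneg _) h3
    have : 0 ≤ Λ ^ 2 * (A * E) := by positivity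
    linarith
  have t5 : |c * (⟪ν, x⟫ * ⟪(a - b) + (x - y), (a - b) + (x - y)⟫)| ≤
      4 * Λ ^ 2 * (A * E) + Λ * h * E ^ 2 := by
    rw [abs_mul, abs_mul, abs_of_nonneg (real_inner_self_nonneg (x := (a - b) + (x - y))),
      real_inner_self_eq_norm_sq]
    have h1 : ‖(a - b) + (x - y)‖ ≤ A + E := (norm_add_le _ _).trans (by linarith)
    have h2 : ‖(a - b) + (x - y)‖ ^ 2 ≤ (A + E) ^ 2 := by gcongr
    have h3 : |⟪ν, x⟫| ≤ E := (Cν x).trans (by linarith)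
    have h4 : |⟪ν, x⟫| * ‖(a - b) + (x - y)‖ ^ 2 ≤ E * (A + E) ^ 2 := by gcongr
    have h5 : |c| * (|⟪ν, x⟫| * ‖(a - b) + (x - y)‖ ^ 2) ≤ 1 / 2 * (E * (A + E) ^ 2) :=
      mul_le_mul hc h4 (by positivity) (by norm_num)
    have h6 : E * A * A ≤ E * A * (2 * Λ ^ 2) := by gcongr
    have h7 : E * A * E ≤ E * A * (2 * Λ ^ 2) := by gcongr
    have h8 : E ^ 2 * E ≤ E ^ 2 * (2 * (Λ * h)) := by gcongr
    have h9 : E * (A + E) ^ 2 = E * A * A + 2 * (E * A * E) + E ^ 2 * E := by ring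
    have h10 : 0 ≤ Λ ^ 2 * (A * E) := by positivity
    linarith
  refine le_trans (neg_le_neg (absorb_products hh hΛ ‖a‖ ‖b‖ ‖x‖ ‖y‖)) ?_
  rw [← hA, ← hE, mul_sub]
  linarith [neg_abs_le (⟪ν, x⟫ * ⟪a - b, x + y⟫ / 2), le_abs_self (⟪ν, x⟫ * ⟪a - b, x + y⟫ / 2),
    neg_abs_le (⟪ν, a⟫ * ⟪U + (2 : ℝ)⁻¹ • (a + b), x - y⟫),
    neg_abs_le (⟪ν, U⟫ * ⟪a + b, x - y⟫ / 2),
    le_abs_self (c * (⟪ν, x⟫ * ⟪(a - b) + (x - y), (a - b) + (x - y)⟫))]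

/-- The element contributions to the energy balance. -/
lemma cell_lower_bound {n : ℕ} {U w e : Fin n → ℝ} {Dw De : Fin n → Fin n → ℝ} {h Λ : ℝ} (hh : 0 < h)
    (hΛ : 1 ≤ Λ) (hhΛ : h ≤ Λ) (hU : ∀ i, |U i| ≤ Λ) (ha : ∀ i, |w i - U i| ≤ Λ * h)
    (hD : ∀ i j, |Dw i j| ≤ Λ) :
    -(8 * (n + 1) * Λ ^ 2 * ((∑ i, e i ^ 2) + (h ^ 2)⁻¹ * (∑ i, (w i - U i) ^ 2) +
      h ^ 2 * ∑ i, ∑ j, De i j ^ 2)) ≤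
    ∑ j, ∑ i, (e i * Dw i j * e j - (w i * w j - U i * U j) * De i j) := by
  have hΛΛ : Λ ≤ Λ ^ 2 := by nlinarith
  have key : ∀ i j, -(Λ ^ 2 * (e i ^ 2 + e j ^ 2 + 4 * ((h ^ 2)⁻¹ * (w i - U i) ^ 2) +
      4 * ((h ^ 2)⁻¹ * (w j - U j) ^ 2) + h ^ 2 * De i j ^ 2)) ≤
      e i * Dw i j * e j - (w i * w j - U i * U j) * De i j := by
    intro i j
    have h1 : |e i * Dw i j * e j| ≤ Λ ^ 2 * (e i ^ 2 + e j ^ 2) := by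
      rw [mul_right_comm, abs_mul]
      have h2 : |e i * e j| ≤ e i ^ 2 + e j ^ 2 := by
        rw [abs_le]
        constructor <;> nlinarith [sq_nonneg (e i + e j), sq_nonneg (e i - e j)]
      have := mul_le_mul h2 ((hD i j).trans hΛΛ) (abs_nonneg _) (by positivity)
      linarith
    have hw : |w j| ≤ 2 * Λ ^ 2 := by
      have h2 : |w j| ≤ |w j - U j| + |U j| := by simpa using abs_add_le (w j - U j) (U j)
      have h3 : Λ * h ≤ Λ ^ 2 := by nlinarith
      linarith [ha j, hU j]
    have e1 : (w i * w j - U i * U j) * De i j =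
      (w j * ((w i - U i) * De i j)) + U i * ((w j - U j) * De i j) := by ring
    have hy : ∀ a d : ℝ, |a * d| ≤ (h ^ 2)⁻¹ * a ^ 2 * 2 + h ^ 2 * d ^ 2 / 8 := fun a d => by
      have h3 : ∀ ε : ℝ, ε ^ 2 = 1 → 0 ≤ 2 * (h⁻¹ * a + ε * (h * d / 4)) ^ 2 := fun ε _ => by
        positivity
      have h4 : ∀ ε : ℝ, ε ^ 2 = 1 → 2 * (h⁻¹ * a + ε * (h * d / 4)) ^ 2 =
          (h ^ 2)⁻¹ * a ^ 2 * 2 + ε * (a * d) + h ^ 2 * d ^ 2 / 8 := fun ε hε => by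
        field_simp
        linear_combination 16 * h ^ 4 * d ^ 2 * hε
      have h5 := h3 1 (by norm_num)
      have h6 := h3 (-1) (by norm_num)
      rw [h4 1 (by norm_num)] at h5
      rw [h4 (-1) (by norm_num)] at h6
      rw [abs_le]
      constructor <;> linarith
    have h5 : |w j * ((w i - U i) * De i j)| ≤
        2 * Λ ^ 2 * ((h ^ 2)⁻¹ * (w i - U i) ^ 2 * 2 + h ^ 2 * De i j ^ 2 / 8) := by
      rw [abs_mul]
      exact mul_le_mul hw (hy _ _) (abs_nonneg _) (by positivity)
    have h6 : |U i * ((w j - U j) * De i j)| ≤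
        Λ ^ 2 * ((h ^ 2)⁻¹ * (w j - U j) ^ 2 * 2 + h ^ 2 * De i j ^ 2 / 8) := by
      rw [abs_mul]
      exact mul_le_mul ((hU i).trans hΛΛ) (hy _ _) (abs_nonneg _) (by positivity)
    rw [e1]
    have h7 : 0 ≤ Λ ^ 2 * ((h ^ 2)⁻¹ * (w j - U j) ^ 2) := by positivity
    have h8 : 0 ≤ Λ ^ 2 * (h ^ 2 * De i j ^ 2) := by positivity
    linarith [neg_abs_le (e i * Dw i j * e j), le_abs_self (w j * ((w i - U i) * De i j)),
      le_abs_self (U i * ((w j - U j) * De i j))]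
  refine le_trans ?_ (sum_le_sum fun j _ => sum_le_sum fun i _ => key i j)
  simp only [sum_neg_distrib, ← mul_sum, sum_add_distrib, sum_const,
    card_univ, Fintype.card_fin, nsmul_eq_mul, neg_le_neg_iff]
  rw [sum_comm (f := fun j i => De i j ^ 2)]
  have ha0 : 0 ≤ ∑ i, e i ^ 2 := sum_nonneg fun i _ => sq_nonneg _
  have hb0 : 0 ≤ (h ^ 2)⁻¹ * ∑ i, (w i - U i) ^ 2 :=
    mul_nonneg (by positivity) (sum_nonneg fun i _ => sq_nonneg _)
  have hd0 : 0 ≤ h ^ 2 * ∑ i, ∑ j, De i j ^ 2 := mul_nonneg (by positivity)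
    (sum_nonneg fun i _ => sum_nonneg fun j _ => sq_nonneg _)
  generalize ∑ i, e i ^ 2 = a at *
  generalize h ^ 2 * ∑ i, ∑ j, De i j ^ 2 = d at *
  generalize ∑ i, (w i - U i) ^ 2 = b at *
  have hn0 : (0 : ℝ) ≤ n := n.cast_nonneg
  have h3 : 0 ≤ Λ ^ 2 * (8 * ((h ^ 2)⁻¹ * b) + 8 * a + 7 * d + 6 * (n * a) + 8 * (n * d)) := by positivity
  linarith

end Pointwise

section Facet

variable {n : ℕ}

lemma norm_toLp_sq (v : Fin n → ℝ) : ‖(WithLp.toLp 2 v : Euc n)‖ ^ 2 = ∑ i, v i ^ 2 := by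
  rw [EuclideanSpace.norm_sq_eq]
  simp

lemma inner_toLp (v w : Fin n → ℝ) :
    inner ℝ (WithLp.toLp 2 v : Euc n) (WithLp.toLp 2 w : Euc n) = ∑ i, v i * w i := by
  simp [PiLp.inner_apply, mul_comm]

lemma norm_toLp_le {v : Fin n → ℝ} {b : ℝ} (hb : 0 ≤ b) (h : ∀ i, |v i| ≤ b) :
    ‖(WithLp.toLp 2 v : Euc n)‖ ≤ (n + 1) * b := by
  refine abs_le_of_sq_le_sq' ?_ (by positivity) |>.2
  rw [norm_toLp_sq]
  calc ∑ i, v i ^ 2 ≤ ∑ _i : Fin n, b ^ 2 := sum_le_sum fun i _ => sq_le_sq.2 (by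
        rw [abs_of_nonneg hb]
        exact h i)
    _ = n * b ^ 2 := by simp
    _ ≤ ((n + 1) * b) ^ 2 := by
      have : (0 : ℝ) ≤ n := n.cast_nonneg
      nlinarith [sq_nonneg b, mul_nonneg this (sq_nonneg b), sq_nonneg ((n : ℝ) * b)]

/-- The facet terms of the discrete Lie derivative at a point with normal `ν`, where the two traces
of the transported field are `p`, `q` and those of the test field are `x`, `y`. -/
noncomputable def upwindTerm (ν : Fin n → ℝ) (c : ℝ) (p q x y : Fin n → ℝ) : ℝ :=
  crossInner (cross ν ((2 : ℝ)⁻¹ • (p + q))) (cross p x - cross q y) +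
    c * crossInner (cross ν (p - q)) (cross p x - cross q y)

/-- `facet_lower_bound` in coordinates. -/
lemma facet_lower_bound_coord {ν : Euc n} {U wp wm ep em : Fin n → ℝ} {c h Λ : ℝ} (hh : 0 < h)
    (hΛ : 1 ≤ Λ) (hhΛ : h ≤ Λ) (hν : ‖ν‖ = 1) (hw : ∑ i, ν i * wp i = ∑ i, ν i * wm i)
    (he : ∑ i, ν i * ep i = ∑ i, ν i * em i) (hU : ∀ i, |U i| ≤ Λ) (ha : ∀ i, |wp i - U i| ≤ Λ * h)
    (hb : ∀ i, |wm i - U i| ≤ Λ * h) (hx : ∀ i, |ep i| ≤ Λ * h) (hy : ∀ i, |em i| ≤ Λ * h)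
    (hc : |c| ≤ 1 / 2) (hcν : c * ∑ i, ν i * (wp i + ep i) = |∑ i, ν i * (wp i + ep i)| / 2) :
    -(100 * ((n + 1) * Λ) ^ 3 * ((h⁻¹ * (∑ i, (wp i - U i) ^ 2) + h * ∑ i, ep i ^ 2) +
      (h⁻¹ * (∑ i, (wm i - U i) ^ 2) + h * ∑ i, em i ^ 2))) ≤
    ((∑ i, (wp i + ep i) ^ 2) / 2 * (∑ i, ν i * ep i) -
        (∑ i, ep i ^ 2) / 2 * (∑ i, ν i * (wp i + ep i)) -
        (∑ i, wp i * ep i) * (∑ i, ν i * ep i) - (∑ i, U i * ep i) * ∑ i, ν i * U i) -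
      ((∑ i, (wm i + em i) ^ 2) / 2 * (∑ i, ν i * em i) -
        (∑ i, em i ^ 2) / 2 * (∑ i, ν i * (wm i + em i)) -
        (∑ i, wm i * em i) * (∑ i, ν i * em i) - (∑ i, U i * em i) * ∑ i, ν i * U i) +
      upwindTerm (fun i => ν i) c (wp + ep) (wm + em) ep em := by
  set E : (Fin n → ℝ) → Euc n := fun v => WithLp.toLp 2 v with hE
  have hν' : E (fun i => ν i) = ν := rfl
  have e1 : E U + E (fun i => wp i - U i) = E wp := by
    ext i
    simp [hE]
  have e2 : E U + E (fun i => wm i - U i) = E wm := by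
    ext i
    simp [hE]
  have e3 : E wp + E ep = E (wp + ep) := rfl
  have e4 : E wm + E em = E (wm + em) := rfl
  have i1 : ∀ v w, inner ℝ (E v) (E w) = ∑ i, v i * w i := inner_toLp
  have i2 : ∀ v, inner ℝ ν (E v) = ∑ i, ν i * v i := fun v => by rw [← hν', i1]
  have hn1 : (1 : ℝ) ≤ n + 1 := by linarith [(n.cast_nonneg : (0 : ℝ) ≤ n)]
  have hΛ1 : 1 ≤ (n + 1) * Λ := by nlinarith
  have hΛ2 : Λ ≤ (n + 1) * Λ := by nlinarith
  have hΛh : 0 ≤ Λ * h := by nlinarith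
  have key := facet_lower_bound (ν := ν) (U := E U) (a := E fun i => wp i - U i)
    (b := E fun i => wm i - U i) (x := E ep) (y := E em) (c := c) hh hΛ1 (hhΛ.trans hΛ2) hν (by
      simp only [i2, mul_sub, sum_sub_distrib]
      rw [hw])
    (by rw [i2, i2, he]) (norm_toLp_le (by linarith) hU)
    (by rw [mul_assoc]; exact norm_toLp_le hΛh ha)
    (by rw [mul_assoc]; exact norm_toLp_le hΛh hb)
    (by rw [mul_assoc]; exact norm_toLp_le hΛh hx)
    (by rw [mul_assoc]; exact norm_toLp_le hΛh hy) hc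
    (by
      rw [e1, e3, i2]
      exact hcν)
  rw [e1, e2, e3, e4] at key
  have s1 : (2 : ℝ)⁻¹ • (E (wp + ep) + E (wm + em)) = E ((2 : ℝ)⁻¹ • (wp + ep + (wm + em))) := rfl
  have s2 : E (wp + ep) - E (wm + em) = E (wp + ep - (wm + em)) := rfl
  have s3 : E ep - E em = E (ep - em) := rfl
  have n1 : ∀ v, ‖E v‖ ^ 2 = ∑ i, v i ^ 2 := norm_toLp_sq
  rw [s1, s2, s3] at key
  simp only [i1, i2, n1] at key
  have C : ∀ b : Fin n → ℝ, crossInner (cross (fun i => ν i) b)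
      (cross (wp + ep) ep - cross (wm + em) em) =
      (∑ i, ν i * (wp + ep) i) * (∑ i, b i * (ep - em) i) -
        (∑ i, ν i * ep i) * ∑ i, b i * (wp + ep - (wm + em)) i := fun b => by
    have hβ : ∑ i, ν i * (wm + em) i = ∑ i, ν i * (wp + ep) i := by
      simp only [Pi.add_apply, mul_add, sum_add_distrib, hw, he]
    rw [crossInner_sub, crossInner_cross, crossInner_cross, hβ, ← he]
    simp only [Pi.sub_apply, mul_sub, sum_sub_distrib]
    ring
  rw [upwindTerm, C, C]
  refine le_trans (le_of_eq ?_) (key.trans (le_of_eq (add_assoc _ _ _)))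
  ring

end Facet

namespace Triangulation

section Cell

variable {n : ℕ} {K : Finset (Euc n)}

lemma lineDeriv_trace (v : BrokenField n) K (i j : Fin n) x :
    ∇ (trace v K) x i j =
      eval (fun j => x j) (MvPolynomial.pderiv j (v K i)) := by
  have hd : DifferentiableAt ℝ (fun y : Euc n => trace v K y i) x :=
    polySpace_differentiable (trace_mem_polySpace le_rfl) x
  rw [hd.lineDeriv_eq_fderiv]
  refine (fderiv_eval (v K i) x (stdVec j)).trans ?_
  rw [sum_eq_single j] <;> simp +contextual [stdVec]

@[fun_prop]
lemma continuous_trace_apply (v : BrokenField n) K (i : Fin n) :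
    Continuous fun x => trace v K x i := (trace_locallyLipschitz v K i).continuous

@[fun_prop]
lemma continuous_lineDeriv_trace (v : BrokenField n) K (i j : Fin n) :
    Continuous fun x => ∇ (trace v K) x i j := by
  simp only [lineDeriv_trace]
  exact polySpace_continuous (eval_mem_polySpace le_rfl)

/-- The element term of the discrete Lie derivative after expanding the curl,
`curl(β × b) - β div b = (b · ∇) β - (β · ∇) b - b div β`. -/
lemma lie_cell_eq (w b : BrokenField n) x (hdiv : divPt (trace w K) x = 0) :
    ∑ i, trace w K x i * eval (fun j => x j)
      (polyCurl (cross (w K) (b K)) i - w K i * polyDiv (b K)) =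
    ∑ i, (∑ j, trace b K x j * ∇ (trace w K) x i j) * trace w K x i -
      ∑ j, ∑ i, trace w K x i * ∇ (trace b K) x i j *
        trace w K x j := by
  have h1 : ∀ i, eval (fun j => x j)
      (polyCurl (cross (w K) (b K)) i - w K i * polyDiv (b K)) =
      (∑ j, trace b K x j * ∇ (trace w K) x i j) -
      (∑ j, ∇ (trace b K) x i j * trace w K x j) -
      trace b K x i * divPt (trace w K) x := fun i => by
    simp only [polyCurl, cross, polyDiv, divPt, lineDeriv_trace, map_sub, map_sum, map_mul,
      Derivation.leibniz, smul_eq_mul, map_add, mul_sum, ← sum_sub_distrib]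
    simp only [trace]
    exact sum_congr rfl fun j _ => by ring
  simp only [h1, hdiv, mul_zero, sub_zero, mul_sub, sum_sub_distrib]
  congr 1
  · exact sum_congr rfl fun i _ => mul_comm _ _
  · rw [sum_comm]
    refine sum_congr rfl fun i _ => ?_
    rw [mul_sum]
    exact sum_congr rfl fun j _ => by ring

/-- The self-convection term integrates to a boundary term. -/
lemma convection_self (hn : 0 < n) (hK : IsNSimplex K) {X Z : Euc n → Fin n → ℝ}
    (hX : ∀ i, LocallyLipschitz fun x => X x i) (hZ : ∀ i, LocallyLipschitz fun x => Z x i)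
    (hdiv : ∀ᵐ x ∂(volume.restrict (hull K)), divPt Z x = 0) :
    ∫ x in hull K, ∑ i, (∑ j, Z x j * ∇ X x i j) * X x i =
      ∑ f ∈ K.powersetCard n, ∫ x in hull f, (∑ i, X x i ^ 2) / 2 * flux Z K f x ∂(surf n) := by
  have h := convection_green hn hK hX hX hZ hdiv
  have e : ∀ x, ∑ j, ∑ i, X x i * ∇ X x i j * Z x j =
      ∑ i, (∑ j, Z x j * ∇ X x i j) * X x i := fun x => by
    rw [sum_comm]
    refine sum_congr rfl fun i _ => ?_
    rw [sum_mul]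
    exact sum_congr rfl fun j _ => by ring
  simp only [e] at h
  have e2 : ∀ f, ∫ x in hull f, (∑ i, X x i ^ 2) / 2 * flux Z K f x ∂(surf n) =
      (∫ x in hull f, (∑ i, X x i * X x i) * flux Z K f x ∂(surf n)) / 2 := fun f => by
    rw [← integral_div]
    congr 1
    ext x
    simp only [sq]
    ring
  simp only [e2, ← Finset.sum_div]
  linarith

lemma integral_sub₃ {X : Type*} [MeasurableSpace X] {μ : Measure X} {a b c d : X → ℝ}
    (ha : Integrable a μ) (hb : Integrable b μ) (hc : Integrable c μ) (hd : Integrable d μ) :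
    ∫ x, a x - b x - c x - d x ∂μ =
      (∫ x, a x ∂μ) - (∫ x, b x ∂μ) - (∫ x, c x ∂μ) - ∫ x, d x ∂μ := by
  rw [← integral_sub' ha hb, ← integral_sub' (ha.sub hb) hc, ← integral_sub' ((ha.sub hb).sub hc) hd]
  rfl

lemma integral_combine {X : Type*} [MeasurableSpace X] {μ : Measure X} {a b c d e f : X → ℝ}
    (ha : Integrable a μ) (hb : Integrable b μ) (hc : Integrable c μ) (hd : Integrable d μ)
    (he : Integrable e μ) (hf : Integrable f μ) (h : ∀ x, a x - b x = c x + d x + e x - f x) :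
    (∫ x, a x ∂μ) - ∫ x, b x ∂μ = (∫ x, c x ∂μ) + (∫ x, d x ∂μ) + (∫ x, e x ∂μ) - ∫ x, f x ∂μ := by
  rw [← integral_sub' ha hb, ← integral_add' hc hd, ← integral_add' (hc.add hd) he,
    ← integral_sub' ((hc.add hd).add he) hf]
  exact integral_congr_ae (.of_forall h)

section

variable (K : Finset (Euc n)) {d dw de : Fin n → Fin n → Euc n → ℝ} {U v z w e : Euc n → Fin n → ℝ}

lemma integrable_sum_mul_mul (hd : ∀ i j, Continuous (d i j)) (hv : ∀ i, Continuous fun x => v x i)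
    (hz : ∀ i, Continuous fun x => z x i) :
    Integrable (fun x => ∑ j, ∑ i, v x i * d i j x * z x j) (volume.restrict (hull K)) :=
  integrableOn_of_continuous (by fun_prop) (isCompact_hull K)

lemma integrable_sum_mul_mul' (hd : ∀ i j, Continuous (d i j)) (hv : ∀ i, Continuous fun x => v x i)
    (hz : ∀ i, Continuous fun x => z x i) :
    Integrable (fun x => ∑ i, (∑ j, v x j * d i j x) * z x i) (volume.restrict (hull K)) :=
  integrableOn_of_continuous (by fun_prop) (isCompact_hull K)

lemma integrable_cell_density (hU : ∀ i, Continuous fun x => U x i)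
    (hw : ∀ i, Continuous fun x => w x i)
    (he : ∀ i, Continuous fun x => e x i) (hdw : ∀ i j, Continuous (dw i j))
    (hde : ∀ i j, Continuous (de i j)) : Integrable (fun x => ∑ j, ∑ i, (e x i * dw i j x * e x j -
      (w x i * w x j - U x i * U x j) * de i j x)) (volume.restrict (hull K)) :=
  integrableOn_of_continuous (by fun_prop) (isCompact_hull K)

lemma integral_convection_split (hU : ∀ i, Continuous fun x => U x i)
    (hw : ∀ i, Continuous fun x => w x i)
    (he : ∀ i, Continuous fun x => e x i) (hdw : ∀ i j, Continuous (dw i j))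
    (hde : ∀ i j, Continuous (de i j)) :
    (∫ x in hull K, ∑ j, ∑ i, (w x i + e x i) * de i j x * (w x j + e x j)) -
      (∫ x in hull K, ∑ j, ∑ i, U x i * de i j x * U x j) =
    (∫ x in hull K, ∑ i, (∑ j, (w x j + e x j) * de i j x) * e x i) +
      (∫ x in hull K, ∑ i, (∑ j, e x j * dw i j x) * e x i) +
      (∫ x in hull K, ∑ j, ∑ i, w x i * de i j x * e x j) -
      ∫ x in hull K, ∑ j, ∑ i, (e x i * dw i j x * e x j -
        (w x i * w x j - U x i * U x j) * de i j x) := by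
  have hb : ∀ i, Continuous fun x => w x i + e x i := fun i => (hw i).add (he i)
  refine integral_combine
    (integrable_sum_mul_mul (v := fun x i => w x i + e x i) (z := fun x i => w x i + e x i) K hde
      hb hb) (integrable_sum_mul_mul K hde hU hU)
    (integrable_sum_mul_mul' (v := fun x i => w x i + e x i) K hde hb he)
    (integrable_sum_mul_mul' K hdw he he) (integrable_sum_mul_mul K hde hw he)
    (integrable_cell_density K hU hw he hdw hde) fun x => ?_
  have c1 : ∀ (a : Fin n → Fin n → ℝ) (v z : Fin n → ℝ), ∑ i, (∑ j, v j * a i j) * z i =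
      ∑ j, ∑ i, v j * a i j * z i := fun a v z => by
    simp only [sum_mul]
    exact sum_comm
  have c2 := c1 (fun i j => de i j x) (fun j => w x j + e x j) (e x)
  have c3 := c1 (fun i j => dw i j x) (e x) (e x)
  rw [c2, c3]
  simp only [← sum_add_distrib, ← sum_sub_distrib]
  exact sum_congr rfl fun j _ => sum_congr rfl fun i _ => by ring

end

/-- The term of the energy balance on the facet `f` of the element `K`. -/
noncomputable def facetTerm (U : Euc n → Fin n → ℝ) (w e : BrokenField n) (K f : Finset (Euc n))
    (x : Euc n) : ℝ := (∑ i, trace (w + e) K x i ^ 2) / 2 * flux (trace e K) K f x -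
    (∑ i, trace e K x i ^ 2) / 2 * flux (trace (w + e) K) K f x -
    (∑ i, trace w K x i * trace e K x i) * flux (trace e K) K f x -
    (∑ i, U x i * trace e K x i) * flux U K f x

/-- The term of the energy balance inside the element `K`. -/
noncomputable def cellTerm (U : Euc n → Fin n → ℝ) (w e : BrokenField n) (K : Finset (Euc n))
    (x : Euc n) : ℝ := ∑ j, ∑ i, (trace e K x i * ∇ (trace w K) x i j * trace e K x j -
      (trace w K x i * trace w K x j - U x i * U x j) * ∇ (trace e K) x i j)

/-- The element contributions to the energy balance after integration by parts. -/
lemma energy_cell_eq (hn : 0 < n) (hK : IsNSimplex K) (w e : BrokenField n) {U : Euc n → Fin n → ℝ}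
    (hU : ∀ i, Continuous fun x => U x i)
    (hw : ∀ᵐ x ∂(volume.restrict (hull K)), divPt (trace w K) x = 0)
    (he : ∀ᵐ x ∂(volume.restrict (hull K)), divPt (trace e K) x = 0) :
    (∫ x in hull K, ∑ i, trace (w + e) K x i * eval (fun j => x j)
      (polyCurl (cross ((w + e) K) (e K)) i - (w + e) K i * polyDiv (e K))) -
      ((∑ f ∈ K.powersetCard n, ∫ x in hull f, (∑ i, U x i * trace e K x i) *
        flux U K f x ∂(surf n)) - ∫ x in hull K, ∑ j, ∑ i, U x i * ∇ (trace e K) x i j * U x j) =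
    (∑ f ∈ K.powersetCard n, ∫ x in hull f, facetTerm U w e K f x ∂(surf n)) +
      ∫ x in hull K, cellTerm U w e K x := by
  have tadd : ∀ x i, trace (w + e) K x i = trace w K x i + trace e K x i := fun x i => by
    simp [trace]
  have ladd : ∀ x i j, ∇ (trace (w + e) K) x i j = ∇ (trace w K) x i j + ∇ (trace e K) x i j :=
    fun x i j => by simp [lineDeriv_trace]
  have hb : ∀ᵐ x ∂(volume.restrict (hull K)), divPt (trace (w + e) K) x = 0 := by
    filter_upwards [hw, he] with x h1 h2
    simp only [divPt, ladd, sum_add_distrib] at h1 h2 ⊢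
    rw [h1, h2, add_zero]
  have le := trace_locallyLipschitz e K
  have ce := continuous_trace_apply e K
  have cb := continuous_trace_apply (w + e) K
  have de := continuous_lineDeriv_trace e K
  have g3 := convection_green hn hK (trace_locallyLipschitz w K) le le he
  have hI := integral_convection_split K (U := U) hU (continuous_trace_apply w K) ce
    (continuous_lineDeriv_trace w K) de
  simp only [← tadd] at hI
  have hf : ∀ f ∈ K.powersetCard n, ∫ x in hull f, facetTerm U w e K f x ∂(surf n) = _ :=
    fun f hf => integral_sub₃ (integrableOn_facet hK hn hf (by fun_prop))
      (integrableOn_facet hK hn hf (by fun_prop)) (integrableOn_facet hK hn hf (by fun_prop))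
      (integrableOn_facet hK hn hf (by fun_prop))
  rw [sum_congr rfl hf, sum_sub_distrib, sum_sub_distrib, sum_sub_distrib,
    ← convection_self hn hK (trace_locallyLipschitz (w + e) K) le he,
    ← convection_self hn hK le (trace_locallyLipschitz (w + e) K) hb,
    integral_congr_ae (hb.mono fun x hx => lie_cell_eq (w + e) e x hx),
    integral_sub (integrable_sum_mul_mul' K (continuous_lineDeriv_trace (w + e) K) ce cb)
      (integrable_sum_mul_mul K de cb cb)]
  simp only [cellTerm]
  linarith

end Cell

end Triangulation

namespace Triangulation

variable {n : ℕ} {Ω : Set (Euc n)} {𝒯 : Triangulation Ω}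

/-- The density of the facet part of the energy bound. -/
noncomputable def facetError (h : ℝ) (U : Euc n → Fin n → ℝ) (w e : BrokenField n)
    (K : Finset (Euc n)) (x : Euc n) : ℝ :=
  h⁻¹ * (∑ i, (trace w K x i - U x i) ^ 2) + h * ∑ i, trace e K x i ^ 2

/-- The right-hand side of the energy estimate: the error `e` and the approximation error `w - U` in
mesh-dependent norms. -/
noncomputable def energyBound (𝒯 : Triangulation Ω) (h : ℝ) (U : Finset (Euc n) → Euc n → Fin n → ℝ)
    (w e : BrokenField n) : ℝ := ∑ K ∈ 𝒯.cells, ((∫ x in hull K, ((∑ i, trace e K x i ^ 2) +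
      (h ^ 2)⁻¹ * (∑ i, (trace w K x i - U K x i) ^ 2) +
      h ^ 2 * ∑ i, ∑ j, ∇ (trace e K) x i j ^ 2)) +
    ∑ f ∈ K.powersetCard n, ∫ x in hull f, facetError h (U K) w e K x ∂(surf n))

lemma continuous_crossInner {X : Type*} [TopologicalSpace X] {a b c d p q : X → Fin n → ℝ}
    (ha : Continuous a) (hb : Continuous b) (hc : Continuous c) (hd : Continuous d)
    (hp : Continuous p) (hq : Continuous q) :
    Continuous fun x => crossInner (cross (a x) (b x)) (cross (c x) (d x) - cross (p x) (q x)) := by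
  simp only [crossInner_sub, crossInner_cross]
  fun_prop

lemma IsUpwindCoeff.mul_eq {o : 𝒯.Orientation} {β : BrokenField n}
    {c : Finset (Euc n) → Euc n → ℝ} (hc : 𝒯.IsUpwindCoeff o β c) {f : Finset (Euc n)}
    (hf : f ∈ 𝒯.interiorFacets) {x : Euc n} (hx : x ∈ hull f) :
    c f x * 𝒯.normalTrace o β f x = |𝒯.normalTrace o β f x| / 2 := by
  by_cases h0 : 𝒯.normalTrace o β f x = 0
  · simp [h0]
  · rw [((hc f hf).2 x hx).2 h0]
    have h1 := abs_ne_zero.2 h0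
    field_simp
    exact (sq_abs _).symm

section

variable {U : Finset (Euc n) → Euc n → Fin n → ℝ} {w e : BrokenField n} {h Λ : ℝ}

/-- The facet terms of the discrete Lie derivative of `v`, tested with `e`. -/
noncomputable def Orientation.jumpTerm (o : 𝒯.Orientation) (c : Finset (Euc n) → Euc n → ℝ)
    (v e : BrokenField n) (f : Finset (Euc n)) (x : Euc n) : ℝ :=
  upwindTerm (fun i => o.normal f i) (c f x) (trace v (o.plus f) x) (trace v (o.minus f) x)
    (trace e (o.plus f) x) (trace e (o.minus f) x)

lemma continuous_facetError {U : Euc n → Fin n → ℝ} (hU : ∀ i, Continuous fun x => U x i) (h : ℝ)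
    (w e : BrokenField n) K : Continuous (facetError h U w e K) := by
  unfold facetError
  fun_prop

lemma continuous_facetTerm {U : Euc n → Fin n → ℝ} (hU : ∀ i, Continuous fun x => U x i)
    (w e : BrokenField n) (K f : Finset (Euc n)) : Continuous (facetTerm U w e K f) := by
  unfold facetTerm
  fun_prop

lemma energy_balance (hn : 0 < n) (o : 𝒯.Orientation) (hU : 𝒯.DivFree U)
    (hw : 𝒯.DivFree fun K => trace w K) (he : 𝒯.DivFree fun K => trace e K)
    (c : Finset (Euc n) → Euc n → ℝ) :
    𝒯.lieForm o c (w + e) (w + e) e - 𝒯.convForm U (fun K => trace e K) =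
    (∑ K ∈ 𝒯.cells, ∑ f ∈ K.powersetCard n, ∫ x in hull f, facetTerm (U K) w e K f x ∂(surf n)) +
    (∑ K ∈ 𝒯.cells, ∫ x in hull K, cellTerm (U K) w e K x) +
      ∑ f ∈ 𝒯.interiorFacets, ∫ x in hull f, o.jumpTerm c (w + e) e f x ∂(surf n) := by
  have hcell := sum_congr rfl fun K hK => energy_cell_eq hn (𝒯.cell_simplex hK) w e
    (fun i => (hU.lip K hK i).continuous) (hw.div K hK) (he.div K hK)
  rw [sum_sub_distrib, sum_add_distrib] at hcell
  rw [← hcell, sub_add_eq_add_sub]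
  rfl

lemma facet_energy_bound (hn : 0 < n) (o : 𝒯.Orientation) (hU : 𝒯.DivFree U)
    (hw : 𝒯.DivFree fun K => trace w K) (he : 𝒯.DivFree fun K => trace e K)
    {c : Finset (Euc n) → Euc n → ℝ} (hc : 𝒯.IsUpwindCoeff o (w + e) c)
    (hh : 0 < h) (hΛ : 1 ≤ Λ) (hhΛ : h ≤ Λ)
    (hUc : ∀ f ∈ 𝒯.interiorFacets, ∀ x ∈ hull f, U (o.plus f) x = U (o.minus f) x)
    (hUb : ∀ K ∈ 𝒯.cells, ∀ x ∈ hull K, ∀ i, |U K x i| ≤ Λ)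
    (ha : ∀ K ∈ 𝒯.cells, ∀ x ∈ hull K, ∀ i, |trace w K x i - U K x i| ≤ Λ * h)
    (heb : ∀ K ∈ 𝒯.cells, ∀ x ∈ hull K, ∀ i, |trace e K x i| ≤ Λ * h)
    {f : Finset (Euc n)} (hf : f ∈ 𝒯.interiorFacets) : -(100 * ((n + 1) * Λ) ^ 3 *
      ((∫ x in hull f, facetError h (U (o.plus f)) w e (o.plus f) x ∂(surf n)) +
      ∫ x in hull f, facetError h (U (o.minus f)) w e (o.minus f) x ∂(surf n))) ≤
    ((∫ x in hull f, facetTerm (U (o.plus f)) w e (o.plus f) f x ∂(surf n)) +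
      ∫ x in hull f, facetTerm (U (o.minus f)) w e (o.minus f) f x ∂(surf n)) +
    ∫ x in hull f, o.jumpTerm c (w + e) e f x ∂(surf n) := by
  simp only [Orientation.jumpTerm, upwindTerm]
  have hp := (o.plus_mem f hf).1
  have hm := (o.minus_mem f hf).1
  have int : ∀ {g : Euc n → ℝ}, Continuous g → Integrable g ((surf n).restrict (hull f)) :=
    fun hg => integrableOn_facet (𝒯.cell_simplex hp) hn (o.mem_plus hf) hg
  have hUp := fun i => (hU.lip _ hp i).continuous
  have hUm := fun i => (hU.lip _ hm i).continuous
  have pe := fun K => continuous_pi (continuous_trace_apply e K)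
  have pb := fun K => continuous_pi (continuous_trace_apply (w + e) K)
  have j1 := int (continuous_facetTerm hUp w e (o.plus f) f)
  have j2 := int (continuous_facetTerm hUm w e (o.minus f) f)
  have r1 := int (continuous_facetError hUp h w e (o.plus f))
  have r2 := int (continuous_facetError hUm h w e (o.minus f))
  have c1 := fun {b : Euc n → Fin n → ℝ} (hb : Continuous b) =>
    int (continuous_crossInner (a := fun _ i => o.normal f i) continuous_const hb (pb (o.plus f))
      (pe (o.plus f)) (pb (o.minus f)) (pe (o.minus f)))
  have hmem : ∀ᵐ x ∂((surf n).restrict (hull f)), x ∈ hull f :=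
    ae_restrict_mem (measurableSet_hull f)
  have c3 := (c1 (b := fun x => (2 : ℝ)⁻¹ • (trace (w + e) (o.plus f) x + trace (w + e) (o.minus f) x))
    (by fun_prop)).add (Integrable.bdd_mul (c := 1 / 2)
      (c1 ((pb (o.plus f)).sub (pb (o.minus f)))) ((hc f hf).1.aestronglyMeasurable)
      (hmem.mono fun x hx => ((hc f hf).2 x hx).1))
  rw [← integral_add r1 r2, ← integral_const_mul, ← integral_neg, ← integral_add j1 j2]
  refine le_trans ?_ (integral_add (j1.add j2) c3).le
  refine integral_mono_ae ((r1.add r2).const_mul _).neg ((j1.add j2).add c3)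
    (hmem.mono fun x hx => ?_)
  have hxp : x ∈ hull (o.plus f) := hull_mono (o.plus_mem f hf).2 hx
  have hxm : x ∈ hull (o.minus f) := hull_mono (o.minus_mem f hf).2 hx
  have hUeq := hUc f hf x hx
  have key := facet_lower_bound_coord (ν := o.normal f) (U := U (o.plus f) x)
    (wp := trace w (o.plus f) x) (wm := trace w (o.minus f) x) (ep := trace e (o.plus f) x)
    (em := trace e (o.minus f) x) (c := c f x) hh hΛ hhΛ (o.norm_normal f hf)
    (hw.normal_eq hn o hf hx) (he.normal_eq hn o hf hx) (hUb _ hp x hxp) (ha _ hp x hxp) (by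
      rw [hUeq]
      exact ha _ hm x hxm) (heb _ hp x hxp) (heb _ hm x hxm) ((hc f hf).2 x hx).1
    (by
      have := hc.mul_eq hf hx
      simp only [normalTrace, trace, Pi.add_apply, map_add] at this
      simp only [trace]
      simpa only [mul_comm] using this)
  have tadd : ∀ K, trace (w + e) K x = trace w K x + trace e K x := fun K => by
    ext i
    simp [trace]
  simp only [facetTerm, facetError, flux, o.facetNormal_plus hn hf, o.facetNormal_minus hn hf, tadd,
    Pi.add_apply, Pi.sub_apply, PiLp.neg_apply, neg_mul, sum_neg_distrib, ← hUeq]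
  rw [upwindTerm] at key
  refine key.trans (le_of_eq ?_)
  ring

/-- The energy estimate: for fields `w + e` close to the exact velocity `U`, the difference of the
continuous and the discrete convection terms, tested with the error `e`, is controlled by norms of
`e` and `w - U`. -/
theorem energy_estimate (hn : 0 < n) (o : 𝒯.Orientation) (hU : 𝒯.DivFree U)
    (hw : 𝒯.DivFree fun K => trace w K) (he : 𝒯.DivFree fun K => trace e K)
    {c : Finset (Euc n) → Euc n → ℝ} (hc : 𝒯.IsUpwindCoeff o (w + e) c)
    (hh : 0 < h) (hΛ : 1 ≤ Λ) (hhΛ : h ≤ Λ)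
    (hUc : ∀ f ∈ 𝒯.interiorFacets, ∀ x ∈ hull f, U (o.plus f) x = U (o.minus f) x)
    (hUb : ∀ K ∈ 𝒯.cells, ∀ x ∈ hull K, ∀ i, |U K x i| ≤ Λ)
    (ha : ∀ K ∈ 𝒯.cells, ∀ x ∈ hull K, ∀ i, |trace w K x i - U K x i| ≤ Λ * h)
    (hD : ∀ K ∈ 𝒯.cells, ∀ x ∈ hull K, ∀ i j,
      |∇ (trace w K) x i j| ≤ Λ)
    (heb : ∀ K ∈ 𝒯.cells, ∀ x ∈ hull K, ∀ i, |trace e K x i| ≤ Λ * h) :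
    𝒯.convForm U (fun K => trace e K) - 𝒯.lieForm o c (w + e) (w + e) e ≤
      100 * ((n + 1) * Λ) ^ 3 * 𝒯.energyBound h U w e := by
  rw [← neg_le_neg_iff, neg_sub, energy_balance hn o hU hw he c]
  have hn0 : (0 : ℝ) ≤ n := n.cast_nonneg
  rw [o.sum_cells_facets hn (fun K f => ∫ x in hull f, facetTerm (U K) w e K f x ∂(surf n))
    fun K hK f hf hfi => by
      refine (setIntegral_congr_fun (g := fun _ => (0 : ℝ)) (measurableSet_hull f)
        fun x hx => ?_).trans (by simp)
      have tadd : trace (w + e) K = fun x => trace w K x + trace e K x := by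
        ext x i
        simp [trace]
      have h1 := he.flux_eq_zero hK hn hf hfi hx
      have h2 := hw.flux_eq_zero hK hn hf hfi hx
      have h3 := hU.flux_eq_zero hK hn hf hfi hx
      have h4 : flux (trace (w + e) K) K f x = 0 := by
        rw [← add_zero (0 : ℝ), ← h1, tadd]
        nth_rw 2 [h1]
        rw [← h2]
        simp only [flux, Pi.add_apply, mul_add, sum_add_distrib]
        ring
      simp only [facetTerm, h1, h3, h4]
      ring]
  set R : Finset (Euc n) → Finset (Euc n) → ℝ := fun K f => ∫ x in hull f,
    facetError h (U K) w e K x ∂(surf n) with hR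
  have hR0 : ∀ K f, 0 ≤ R K f := fun K f => integral_nonneg fun x => by
    unfold facetError
    positivity
  have hfac : ∑ f ∈ 𝒯.interiorFacets, (R (o.plus f) f + R (o.minus f) f) ≤
      ∑ K ∈ 𝒯.cells, ∑ f ∈ K.powersetCard n, R K f := by
    have h1 := o.sum_cells_facets hn (fun K f => if f ∈ 𝒯.interiorFacets then R K f else 0)
      fun K _ f _ hfi => if_neg hfi
    refine (sum_congr rfl fun f hf => ?_).trans_le (h1.symm.trans_le ?_)
    · rw [if_pos hf, if_pos hf]
    refine sum_le_sum fun K _ => sum_le_sum fun f _ => ?_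
    split_ifs
    · exact le_rfl
    · exact hR0 K f
  have hcellb : ∀ K ∈ 𝒯.cells, -(100 * ((n + 1) * Λ) ^ 3 * (∫ x in hull K,
      ((∑ i, trace e K x i ^ 2) + (h ^ 2)⁻¹ * (∑ i, (trace w K x i - U K x i) ^ 2) +
      h ^ 2 * ∑ i, ∑ j, ∇ (trace e K) x i j ^ 2))) ≤
      ∫ x in hull K, cellTerm (U K) w e K x := by
    intro K hK
    have hUK := fun i => (hU.lip K hK i).continuous
    rw [← integral_const_mul, ← integral_neg]
    refine setIntegral_mono_on ?_ (integrable_cell_density K hUK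
      (continuous_trace_apply w K) (continuous_trace_apply e K) (continuous_lineDeriv_trace w K)
      (continuous_lineDeriv_trace e K))
      (measurableSet_hull K) fun x hx => ?_
    · exact integrableOn_of_continuous (by fun_prop) (isCompact_hull K)
    · refine le_trans (neg_le_neg ?_) (cell_lower_bound hh hΛ hhΛ (hUb K hK x hx) (ha K hK x hx)
        (hD K hK x hx))
      gcongr ?_ * _
      have h1 : 8 * ((n : ℝ) + 1) * Λ ^ 2 ≤ 8 * ((n + 1) * Λ) ^ 2 := by
        rw [mul_pow, mul_assoc]
        gcongr
        nlinarith
      have h2 : (1 : ℝ) ≤ (n + 1) * Λ := by nlinarith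
      have h3 : ((n + 1) * Λ) ^ 2 ≤ ((n + 1) * Λ) ^ 3 := pow_le_pow_right₀ h2 (by norm_num)
      have h4 : 0 ≤ ((n + 1) * Λ) ^ 3 := by positivity
      linarith
  have hsum1 := sum_le_sum fun K hK => hcellb K hK
  have hsum2 := sum_le_sum fun f hf =>
    facet_energy_bound hn o hU hw he hc hh hΛ hhΛ hUc hUb ha heb (f := f) hf
  have hC : 0 ≤ 100 * (((n : ℝ) + 1) * Λ) ^ 3 := by positivity
  have hfac' := mul_le_mul_of_nonneg_left hfac hC
  simp only [sum_neg_distrib, ← mul_sum] at hsum1 hsum2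
  simp only [hR] at hfac'
  rw [energyBound]
  simp only [sum_add_distrib] at hsum2 hfac' ⊢
  linarith

end

end Triangulation

section Regularity

variable {n : ℕ} {Ω : Set (Euc n)} {T : ℝ}

lemma weakDerivNorm_le_of_sobolevTimeNorm {m : ℕ} {u : ℝ → Euc n → Euc n} {M : ℝ≥0}
    (h : sobolevTimeNorm Ω T m u ≤ M) (i : Fin n) (I : Fin m → Fin n) :
    weakDerivNorm (cyl T Ω) (fun l => dirX (I l)) (fun q => u q.1 q.2 i) 2 ≤ M ∧
    weakDerivNorm (cyl T Ω) (Fin.cons dirT (fun l => dirX (I l)) : Fin (m + 1) → ℝ × Euc n)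
      (fun q => u q.1 q.2 i) 2 ≤ M := by
  have h1 := ENNReal.rpow_le_rpow h (z := 2) (by norm_num)
  rw [sobolevTimeNorm, ← ENNReal.rpow_mul, one_div, inv_mul_cancel₀ (by norm_num),
    ENNReal.rpow_one] at h1
  have h2 := ((single_le_sum (fun _ _ => zero_le) (Finset.mem_univ I)).trans
    (single_le_sum (f := fun k => ∑ I : Fin k → Fin n,
    (weakDerivNorm (cyl T Ω) (fun l => dirX (I l)) (fun q => u q.1 q.2 i) 2 ^ 2 +
     weakDerivNorm (cyl T Ω) (Fin.cons dirT (fun l => dirX (I l)) : Fin (k + 1) → ℝ × Euc n)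
      (fun q => u q.1 q.2 i) 2 ^ 2)) (fun _ _ => zero_le) (Finset.mem_range.2 m.lt_succ_self))).trans
    ((single_le_sum (fun _ _ => zero_le) (Finset.mem_univ i)).trans h1)
  have h3 : ∀ a : ℝ≥0∞, a ^ 2 ≤ (M : ℝ≥0∞) ^ (2 : ℝ) → a ≤ M := fun a ha => by
    rw [ENNReal.rpow_two] at ha
    exact (ENNReal.pow_le_pow_left_iff two_ne_zero).1 ha
  exact ⟨h3 _ (le_self_add.trans h2), h3 _ (le_add_self.trans h2)⟩

lemma HasWeakDeriv.congr {V : Type*} [NormedAddCommGroup V] [NormedSpace ℝ V] [MeasureSpace V]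
    {Q : Set V} (hQ : MeasurableSet Q) {k : ℕ} {w : Fin k → V} {f f' g : V → ℝ}
    (h : HasWeakDeriv Q w f g) (hf : LocallyIntegrableOn f' Q) (he : EqOn f f' Q) :
    HasWeakDeriv Q w f' g := ⟨hf, h.locInt_deriv, fun φ hφ => by
    rw [← h.parts φ hφ]
    exact setIntegral_congr_fun hQ fun x hx => by simp only [he hx]⟩

lemma memLp_two_of_eLpNorm_le {X : Type*} [MeasurableSpace X] {μ : Measure X} {g : X → ℝ}
    (hm : AEStronglyMeasurable g μ) {M : ℝ≥0} (h : eLpNorm g 2 μ ≤ M) :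
    MemLp g 2 μ ∧ ∫ x, g x ^ 2 ∂μ ≤ M ^ 2 := by
  have hg : MemLp g 2 μ := ⟨hm, h.trans_lt ENNReal.coe_lt_top⟩
  refine ⟨hg, ?_⟩
  have h1 := hg.eLpNorm_eq_integral_rpow_norm (by norm_num) (by norm_num)
  simp only [ENNReal.toReal_ofNat, Real.rpow_two, Real.norm_eq_abs, sq_abs] at h1
  have h0 : 0 ≤ ∫ x, g x ^ 2 ∂μ := integral_nonneg fun _ => sq_nonneg _
  rw [h1, ← ENNReal.ofReal_coe_nnreal, ENNReal.ofReal_le_ofReal_iff M.coe_nonneg] at h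
  have h2 := pow_le_pow_left₀ (Real.rpow_nonneg h0 _) h 2
  rwa [← Real.rpow_two, ← Real.rpow_mul h0, inv_mul_cancel₀ (by norm_num), Real.rpow_one] at h2

lemma Triangulation.ShapeRegular.shapeReg {𝒯 : Triangulation Ω} {σ : ℝ} (h : 𝒯.ShapeRegular σ)
    (hσ : 0 < σ) (hn : 0 < n) : ∀ K ∈ 𝒯.cells, ∃ c, ShapeReg σ K c := fun K hK =>
  (h K hK).imp fun _ hc => ⟨𝒯.cell_simplex hK, hσ, 𝒯.diam_pos hn hK, hc⟩

/-- The measure on an element and its boundary in which polynomial approximations are sought. -/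
noncomputable def cellMeas (K : Finset (Euc n)) : Measure (Euc n) := volume.restrict (hull K) +
    ENNReal.ofReal (diam (hull K)) • ∑ f ∈ K.powersetCard n, faceMeas f

lemma integral_cellMeas (hn : 0 < n) {K : Finset (Euc n)} (hK : IsNSimplex K) {g : Euc n → ℝ}
    (hg : Continuous g) : ∫ x, g x ∂(cellMeas K) = (∫ x in hull K, g x) +
      diam (hull K) * ∑ f ∈ K.powersetCard n, ∫ x in hull f, g x ∂(surf n) := by
  have h1 : ∀ f ∈ K.powersetCard n, Integrable g (faceMeas f) := fun f _ =>
    integrable_faceMeas f g hg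
  rw [cellMeas, integral_add_measure (integrable_hull K g hg)
    ((integrable_finset_sum_measure.2 h1).smul_measure ENNReal.ofReal_ne_top), integral_smul_measure,
    integral_finset_sum_measure h1, ENNReal.toReal_ofReal diam_nonneg, smul_eq_mul]
  congr 2
  exact sum_congr rfl fun f hf => by rw [faceMeas_eq hK hn hf]

lemma isFiniteMeasure_cellMeas (K : Finset (Euc n)) : IsFiniteMeasure (cellMeas K) := by
  have h : Integrable (fun _ => (1 : ℝ)) (cellMeas K) :=
    (integrable_hull K _ continuous_const).add_measure ((integrable_finset_sum_measure.2 fun f _ =>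
      integrable_faceMeas f _ continuous_const).smul_measure ENNReal.ofReal_ne_top)
  exact (integrable_const_iff_isFiniteMeasure one_ne_zero).1 h

lemma cellMeas_restrict (hn : 0 < n) {K : Finset (Euc n)} (hK : IsNSimplex K) :
    (cellMeas K).restrict (hull K) = cellMeas K := by
  have h : ∀ f ∈ K.powersetCard n, (faceMeas f).restrict (hull K) = faceMeas f := fun f hf => by
    rw [faceMeas_eq hK hn hf, Measure.restrict_restrict (measurableSet_hull K),
      inter_eq_right.2 (hull_mono (mem_powersetCard.1 hf).1)]
  have h2 : (∑ f ∈ K.powersetCard n, faceMeas f).restrict (hull K) =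
      ∑ f ∈ K.powersetCard n, faceMeas f := by
    refine Eq.trans ?_ (sum_congr rfl h)
    ext s hs
    simp [Measure.restrict_apply hs, Measure.finset_sum_apply]
  rw [cellMeas, Measure.restrict_add, Measure.restrict_smul, h2,
    Measure.restrict_restrict (measurableSet_hull K), inter_self]

lemma ShapeReg.cellMeas_univ_le {σ : ℝ} {K : Finset (Euc n)} {c : Euc n} (h : ShapeReg σ K c)
    (hn : 0 < n) : ((volume : Measure (Euc n)).real (hull K))⁻¹ * (cellMeas K).real univ ≤
      1 + (n + 1) * n / σ := by
  have hV : 0 < (volume : Measure (Euc n)).real (hull K) := h.simplex.volume_pos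
  have hf := isFiniteMeasure_cellMeas K
  have h1 := integral_cellMeas hn h.simplex (g := fun _ => (1 : ℝ)) continuous_const
  simp only [integral_const, smul_eq_mul, mul_one, measureReal_restrict_apply_univ] at h1
  have h2 : ∀ f ∈ K.powersetCard n, diam (hull K) * (surf n).real (hull f) ≤
      n / σ * volume.real (hull K) := by
    intro f hf
    obtain ⟨z, rfl⟩ := exists_eq_erase h.simplex hf
    rw [h.simplex.surf_facet hn z]
    have h3 := (h.norm_baryGrad_le hn z).trans
      (h.coord_le_one (h.ball (Metric.mem_closedBall_self (by have := h.sigma_pos; have := h.diam_pos; positivity))) z)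
    rw [div_mul_eq_mul_div, le_div_iff₀ h.sigma_pos]
    have h4 : 0 ≤ n * volume.real (hull K) := by positivity
    nlinarith
  rw [h1, mul_sum, inv_mul_le_iff₀ hV]
  have h3 := sum_le_sum h2
  rw [sum_const, Finset.card_powersetCard, h.simplex.2, Nat.choose_succ_self_right,
    nsmul_eq_mul] at h3
  push_cast at h3
  have e : volume.real (hull K) * (1 + (n + 1) * n / σ) =
    volume.real (hull K) +
      (n + 1) * (n / σ * volume.real (hull K)) := by ring
  linarith

namespace Triangulation

lemma sum_integral_cylinder_le (𝒯 : Triangulation Ω) (hΩo : IsOpen Ω)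
    (hΩ : interior (closure Ω) = Ω) {g : ℝ × Euc n → ℝ}
    (hg : IntegrableOn g (cyl T Ω)) (h0 : ∀ p, 0 ≤ g p) :
    ∑ K ∈ 𝒯.cells, ∫ p in cellCyl T K, g p ≤
      ∫ p in cyl T Ω, g p := by
  have hsub : ∀ K ∈ 𝒯.cells, cellCyl T K ⊆ cyl T Ω :=
    fun K hK => prod_mono subset_rfl (𝒯.interior_cell_subset hΩ hK)
  rw [← integral_biUnion_finset _ (fun K _ => (isOpen_cylinder isOpen_interior).measurableSet)
    (fun K hK L hL hne => Disjoint.set_prod_right (𝒯.disjoint_interior hK hL hne) _ _)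
    fun K hK => hg.mono_set (hsub K hK)]
  exact setIntegral_mono_set hg (.of_forall h0) (iUnion₂_subset hsub).eventuallyLE

/-- Piecewise polynomial approximation of the exact solution at every time, in the element and on
its facets. -/
theorem exists_broken_approx {s : ℕ} (hn : 0 < n) (hs : n < 2 * s) (hT : 0 < T) {σ : ℝ} (hσ : 0 < σ)
    (M : ℝ≥0) : ∃ C : ℝ, 0 < C ∧ ∀ {Ω : Set (Euc n)} (_ : IsOpen Ω) (_ : Ω.Nonempty)
      (_ : interior (closure Ω) = Ω) {u : ℝ → Euc n → Euc n} (_ : sobolevTimeNorm Ω T (s + 1) u ≤ M)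
      {𝒯 : Triangulation Ω} (_ : 𝒯.ShapeRegular σ) {L B : ℝ≥0}
      {F : Finset (Euc n) → Fin n → ℝ × Euc n → ℝ} {p : ℝ × Euc n → ℝ} {Dp : Fin n → ℝ × Euc n → ℝ}
      (_ : 𝒯.EulerRep T u L B F p Dp) {t : ℝ} (_ : t ∈ Icc 0 T),
      ∃ q : Finset (Euc n) → Euc n → Fin n → ℝ, (∀ K i, (fun x => q K x i) ∈ polySpace n s) ∧
        ∑ K ∈ 𝒯.cells, ((∫ x in hull K, ∑ i, (q K x i - F K i (t, x)) ^ 2) +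
            diam (hull K) * ∑ f ∈ K.powersetCard n,
              ∫ x in hull f, ∑ i, (q K x i - F K i (t, x)) ^ 2 ∂(surf n)) ≤
          C * 𝒯.meshSize ^ (2 * (s + 1)) := by
  set A : ℝ := 2 * ((1 + (n + 1) * n / σ) * (T⁻¹ + 1)) with hA
  set N : ℝ := (Fintype.card (Fin (s + 1) → Fin n) : ℝ) with hN
  have hA0 : 0 < A := by positivity
  refine ⟨n * (A * (N * (2 * (M + 1) ^ 2))) + n, by positivity, ?_⟩
  intro Ω hΩo hΩne hΩ u hu 𝒯 hreg L B F p Dp hF t ht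
  have hh := 𝒯.meshSize_pos hn hΩo hΩne hΩ
  have hcyl := isOpen_cylinder (T := T) hΩo
  choose g hg hgb using fun i I =>
    exists_hasWeakDeriv_of_le (weakDerivNorm_le_of_sobolevTimeNorm hu i I).1
  choose gt hgt hgtb using fun i I =>
    exists_hasWeakDeriv_of_le (weakDerivNorm_le_of_sobolevTimeNorm hu i I).2
  have hg2 := fun i I => memLp_two_of_eLpNorm_le (hg i I).locInt_deriv.aestronglyMeasurable (hgb i I)
  have hgt2 := fun i I =>
    memLp_two_of_eLpNorm_le (hgt i I).locInt_deriv.aestronglyMeasurable (hgtb i I)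
  set η : ℝ := 𝒯.meshSize ^ (2 * (s + 1)) / 𝒯.cells.card with hη
  have hcard : (0 : ℝ) < 𝒯.cells.card :=
    Nat.cast_pos.2 (Finset.card_pos.2 (𝒯.cells_nonempty hΩo hΩne hΩ))
  have hη0 : 0 < η := by positivity
  have hcell : ∀ (K : Finset (Euc n)) (i : Fin n), ∃ q ∈ polySpace n s, K ∈ 𝒯.cells →
      ∫ x, (F K i (t, x) - q x) ^ 2 ∂(cellMeas K) ≤ A * 𝒯.meshSize ^ (2 * (s + 1)) *
        (∑ I, ((∫ p in cellCyl T K, g i I p ^ 2) +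
          ∫ p in cellCyl T K, gt i I p ^ 2)) + η := by
    intro K i
    by_cases hK : K ∈ 𝒯.cells
    swap
    · exact ⟨0, Submodule.zero_mem _, fun h => (hK h).elim⟩
    obtain ⟨c, hc⟩ := hreg.shapeReg hσ hn K hK
    have hfin := isFiniteMeasure_cellMeas K
    have hco : IsOpen (cellCyl T K) := isOpen_cylinder isOpen_interior
    have hsub : cellCyl T K ⊆ cyl T Ω :=
      prod_mono subset_rfl (𝒯.interior_cell_subset hΩ hK)
    have heq : EqOn (fun q : ℝ × Euc n => u q.1 q.2 i) (F K i)
        (cellCyl T K) := fun q hq =>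
      hF.rep q.1 (Ioo_subset_Icc_self hq.1) K hK q.2 hq.2 i
    have hFl : LocallyIntegrableOn (F K i) (cellCyl T K) :=
      (hF.lip K hK i).continuous.locallyIntegrable.locallyIntegrableOn _
    obtain ⟨q, hq, hqb⟩ := exists_poly_approx hs hT (isCompact_hull K) (convex_hull K)
      hc.simplex.interior_nonempty (hF.lip K hK i)
      (fun I => ((hg i I).mono hcyl.measurableSet hsub).congr hco.measurableSet
        hFl heq)
      (fun I => ((hgt i I).mono hcyl.measurableSet hsub).congr hco.measurableSet
        hFl heq) (fun I => (hg2 i I).1.mono_measure (Measure.restrict_mono hsub le_rfl))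
      (fun I => (hgt2 i I).1.mono_measure (Measure.restrict_mono hsub le_rfl))
      (cellMeas_restrict hn hc.simplex) ht hη0
    refine ⟨q, hq, fun _ => hqb.trans (add_le_add_left ?_ η)⟩
    set S := ∑ I, ((∫ p in cellCyl T K, g i I p ^ 2) +
          ∫ p in cellCyl T K, gt i I p ^ 2)
    have hS : 0 ≤ S := sum_nonneg fun I _ =>
      add_nonneg (integral_nonneg fun _ => sq_nonneg _) (integral_nonneg fun _ => sq_nonneg _)
    have h1 : (diam (hull K) ^ 2) ^ (s + 1) ≤ 𝒯.meshSize ^ (2 * (s + 1)) := by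
      rw [← pow_mul]
      exact pow_le_pow_left₀ diam_nonneg (𝒯.diam_le_meshSize hK) _
    calc _ = 2 * ((((volume : Measure (Euc n)).real (hull K))⁻¹ * (cellMeas K).real univ) *
          ((diam (hull K) ^ 2) ^ (s + 1) * ((T⁻¹ + 1) * S))) := by ring
      _ ≤ 2 * ((1 + (n + 1) * n / σ) * (𝒯.meshSize ^ (2 * (s + 1)) * ((T⁻¹ + 1) * S))) := by
        gcongr
        exact hc.cellMeas_univ_le hn
      _ = _ := by
        rw [hA]
        ring
  choose q hq hqb using hcell
  refine ⟨fun K x i => q K i x, hq, ?_⟩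
  have hstep : ∀ K ∈ 𝒯.cells, (∫ x in hull K, ∑ i, (q K i x - F K i (t, x)) ^ 2) +
      diam (hull K) * ∑ f ∈ K.powersetCard n,
        ∫ x in hull f, ∑ i, (q K i x - F K i (t, x)) ^ 2 ∂(surf n) ≤
      ∑ i, (A * 𝒯.meshSize ^ (2 * (s + 1)) *
        (∑ I, ((∫ p in cellCyl T K, g i I p ^ 2) +
          ∫ p in cellCyl T K, gt i I p ^ 2)) + η) := by
    intro K hK
    have hc : ∀ i, Continuous fun x => (q K i x - F K i (t, x)) ^ 2 := fun i =>
      ((polySpace_continuous (hq K i)).sub (hF.lip_slice hK i t).continuous).pow 2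
    have hfin := isFiniteMeasure_cellMeas K
    have hint : ∀ i, Integrable (fun x => (q K i x - F K i (t, x)) ^ 2) (cellMeas K) := fun i =>
      (integrable_hull K _ (hc i)).add_measure ((integrable_finset_sum_measure.2 fun f _ =>
        integrable_faceMeas f _ (hc i)).smul_measure ENNReal.ofReal_ne_top)
    rw [← integral_cellMeas hn (𝒯.cell_simplex hK) (continuous_finset_sum _ fun i _ => hc i),
      integral_finset_sum _ fun i _ => hint i]
    refine sum_le_sum fun i _ => (le_of_eq ?_).trans (hqb K i hK)
    congr 1
    ext x
    ring
  refine (sum_le_sum hstep).trans ?_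
  rw [sum_comm]
  have hi : ∀ i : Fin n, ∑ K ∈ 𝒯.cells, (A * 𝒯.meshSize ^ (2 * (s + 1)) *
        (∑ I, ((∫ p in cellCyl T K, g i I p ^ 2) +
          ∫ p in cellCyl T K, gt i I p ^ 2)) + η) ≤
      A * 𝒯.meshSize ^ (2 * (s + 1)) * (N * (2 * (M + 1) ^ 2)) + 𝒯.meshSize ^ (2 * (s + 1)) := by
    intro i
    rw [sum_add_distrib, sum_const, nsmul_eq_mul, hη, mul_div_cancel₀ _ hcard.ne',
      ← mul_sum, sum_comm]
    gcongr
    refine (sum_le_sum (g := fun _ => 2 * ((M : ℝ) + 1) ^ 2) fun I _ => ?_).trans_eq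
      (by simp [hN])
    rw [sum_add_distrib, two_mul]
    refine add_le_add ?_ ?_
    · exact (𝒯.sum_integral_cylinder_le hΩo hΩ (hg2 i I).1.integrable_sq fun _ =>
        sq_nonneg _).trans (by simpa using (hg2 i I).2)
    · exact (𝒯.sum_integral_cylinder_le hΩo hΩ (hgt2 i I).1.integrable_sq fun _ =>
        sq_nonneg _).trans (by simpa using (hgt2 i I).2)
  refine (sum_le_sum fun i _ => hi i).trans (le_of_eq ?_)
  rw [sum_const, card_univ, Fintype.card_fin, nsmul_eq_mul]
  ring

end Triangulation

end Regularity

namespace Triangulation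

variable {n : ℕ} {Ω : Set (Euc n)} {T : ℝ} {𝒯 : Triangulation Ω}

/-- The representatives of a continuous velocity agree on the interior facets. -/
lemma EulerRep.facet_eq {u : ℝ → Euc n → Euc n} {L B : ℝ≥0}
    {F : Finset (Euc n) → Fin n → ℝ × Euc n → ℝ} {p : ℝ × Euc n → ℝ} {Dp : Fin n → ℝ × Euc n → ℝ}
    (hF : 𝒯.EulerRep T u L B F p Dp) (hn : 0 < n) (hΩ : interior (closure Ω) = Ω)
    (hu : IsEulerSolution Ω T u) {t : ℝ} (ht : t ∈ Icc 0 T) (o : 𝒯.Orientation)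
    {f : Finset (Euc n)} (hf : f ∈ 𝒯.interiorFacets) {x : Euc n} (hx : x ∈ hull f) (i : Fin n) :
    F (o.plus f) i (t, x) = F (o.minus f) i (t, x) := by
  have key : ∀ K ∈ 𝒯.cells, f ⊆ K → ∀ y ∈ relFace f, F K i (t, y) = u t y i := fun K hK hfK y hy => by
    have h1 : EqOn (fun y => F K i (t, y)) (fun y => u t y i) (interior (hull K)) := fun z hz =>
      (hF.rep t ht K hK z hz i).symm
    have h2 : ContinuousOn (fun y => u t y i) Ω := (EuclideanSpace.proj i).continuous.comp_continuousOn
      (hu.continuousOn.comp (f := fun y => (t, y)) (by fun_prop) fun y hy => ⟨ht, hy⟩)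
    exact h1.of_subset_closure (t := hull K ∩ Ω) (hF.lip_slice hK i t).continuous.continuousOn
      (h2.mono inter_subset_right) (subset_inter interior_subset (𝒯.interior_cell_subset hΩ hK))
      (by rw [(𝒯.cell_simplex hK).closure_interior]; exact inter_subset_left)
      ⟨hull_mono hfK (relFace_subset hy), 𝒯.relFace_subset_interior hn hΩ hf hy⟩
  obtain ⟨hp, hfp⟩ := o.plus_mem f hf
  obtain ⟨hm, hfm⟩ := o.minus_mem f hf
  exact eq_on_hull_of_relFace (facet_nonempty hn (o.mem_plus hf))
    (hF.lip_slice hp i t).continuous (hF.lip_slice hm i t).continuous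
    (fun y hy => (key _ hp hfp y hy).trans (key _ hm hfm y hy).symm) x hx

/-- The square of the `L²` norm of a broken field. -/
noncomputable def sqNorm (𝒯 : Triangulation Ω) (V : Finset (Euc n) → Euc n → Fin n → ℝ) : ℝ :=
  ∑ K ∈ 𝒯.cells, ∫ x in hull K, ∑ i, V K x i ^ 2

lemma sqNorm_nonneg (V : Finset (Euc n) → Euc n → Fin n → ℝ) : 0 ≤ 𝒯.sqNorm V :=
  sum_nonneg fun _ _ => integral_nonneg fun _ => sum_nonneg fun _ _ => sq_nonneg _

lemma integral_le_sqNorm {V : Finset (Euc n) → Euc n → Fin n → ℝ} {K : Finset (Euc n)}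
    (hK : K ∈ 𝒯.cells) : ∫ x in hull K, ∑ i, V K x i ^ 2 ≤ 𝒯.sqNorm V :=
  single_le_sum (f := fun K => ∫ x in hull K, ∑ i, V K x i ^ 2) (fun _ _ =>
    integral_nonneg fun _ => sum_nonneg fun _ _ => sq_nonneg _) hK

lemma integral_sum_sq_sub_le {X : Type*} [TopologicalSpace X] [MeasurableSpace X] {μ : Measure X}
    (hμ : ∀ g : X → ℝ, Continuous g → Integrable g μ) {a b c : X → Fin n → ℝ}
    (ha : ∀ i, Continuous fun x => a x i) (hb : ∀ i, Continuous fun x => b x i)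
    (hc : ∀ i, Continuous fun x => c x i) : ∫ x, ∑ i, (a x i - c x i) ^ 2 ∂μ ≤
      2 * (∫ x, ∑ i, (a x i - b x i) ^ 2 ∂μ) + 2 * ∫ x, ∑ i, (b x i - c x i) ^ 2 ∂μ := by
  have i1 := hμ (fun x => ∑ i, (a x i - b x i) ^ 2) (by fun_prop)
  have i2 := hμ (fun x => ∑ i, (b x i - c x i) ^ 2) (by fun_prop)
  rw [← integral_const_mul, ← integral_const_mul, ← integral_add (i1.const_mul 2) (i2.const_mul 2)]
  refine integral_mono (hμ _ (by fun_prop)) ((i1.const_mul 2).add (i2.const_mul 2)) fun x => ?_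
  simp only [Pi.add_apply, mul_sum, ← sum_add_distrib]
  exact sum_le_sum fun i _ => by nlinarith [sq_nonneg (a x i - b x i - (b x i - c x i))]

end Triangulation

namespace Triangulation

variable {n : ℕ} {Ω : Set (Euc n)} {T : ℝ} {𝒯 : Triangulation Ω}

/-- The energy bound of one element, in terms of a piecewise polynomial `q`. -/
lemma energyBound_le (hn : 0 < n) {s : ℕ} {σ κ h C : ℝ} (hκ : 0 < κ) (hh : 0 < h) (hC : 1 ≤ C)
    (hreg : ∀ K ∈ 𝒯.cells, ∃ c, ShapeReg σ K c) (hqu : ∀ K ∈ 𝒯.cells, κ * h ≤ diam (hull K))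
    (hinv : ∀ {K : Finset (Euc n)} {c : Euc n} {h : ℝ}, ShapeReg σ K c → 0 < h →
      κ * h ≤ diam (hull K) → ∀ {v : Euc n → Fin n → ℝ}, (∀ i, (fun x => v x i) ∈ polySpace n s) →
      (∀ y ∈ hull K, ∀ i, h ^ n * v y i ^ 2 ≤ C * ∫ x in hull K, ∑ i, v x i ^ 2) ∧
      (∀ y ∈ hull K, ∀ i j, h ^ (n + 2) * ∇ v y i j ^ 2 ≤
        C * ∫ x in hull K, ∑ i, v x i ^ 2) ∧
      (h ^ 2 * ∫ x in hull K, ∑ i, ∑ j, ∇ v x i j ^ 2) ≤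
        C * (∫ x in hull K, ∑ i, v x i ^ 2) ∧
      h * ∑ f ∈ K.powersetCard n, ∫ x in hull f, ∑ i, v x i ^ 2 ∂(surf n) ≤
        C * ∫ x in hull K, ∑ i, v x i ^ 2)
    {w e : BrokenField n} (hw : ∀ K ∈ 𝒯.cells, ∀ i, (fun x => trace w K x i) ∈ polySpace n s)
    (he : ∀ K ∈ 𝒯.cells, ∀ i, (fun x => trace e K x i) ∈ polySpace n s)
    {U q : Finset (Euc n) → Euc n → Fin n → ℝ}
    (hU : ∀ K ∈ 𝒯.cells, ∀ i, Continuous fun x => U K x i)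
    (hq : ∀ K i, (fun x => q K x i) ∈ polySpace n s) :
    𝒯.energyBound h U w e ≤ (1 + 2 * C) * 𝒯.sqNorm (fun K => trace e K) +
      (h ^ 2)⁻¹ * ((1 + 4 * C) * 𝒯.sqNorm (fun K x i => trace w K x i - U K x i) +
        (4 * C + 2 * κ⁻¹) * ∑ K ∈ 𝒯.cells, ((∫ x in hull K, ∑ i, (q K x i - U K x i) ^ 2) +
            diam (hull K) * ∑ f ∈ K.powersetCard n,
              ∫ x in hull f, ∑ i, (q K x i - U K x i) ^ 2 ∂(surf n))) := by
  simp only [energyBound, facetError, sqNorm, mul_sum 𝒯.cells, ← sum_add_distrib]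
  refine sum_le_sum fun K hK => ?_
  obtain ⟨c, hc⟩ := hreg K hK
  have hUc := hU K hK
  have hqc : ∀ i, Continuous fun x => q K x i := fun i => polySpace_continuous (hq K i)
  have cw := continuous_trace_apply w K
  have ce := continuous_trace_apply e K
  have de := continuous_lineDeriv_trace e K
  have ie := integrable_hull K (fun x => ∑ i, trace e K x i ^ 2) (by fun_prop)
  have ia := integrable_hull K (fun x => ∑ i, (trace w K x i - U K x i) ^ 2) (by fun_prop)
  have id := integrable_hull K
    (fun x => ∑ i, ∑ j, ∇ (trace e K) x i j ^ 2) (by fun_prop)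
  have ifac : ∀ f ∈ K.powersetCard n, ∀ g : Euc n → ℝ, Continuous g →
      Integrable g ((surf n).restrict (hull f)) := fun f hf g hg =>
    integrableOn_facet hc.simplex hn hf hg
  have e1 : ∫ x in hull K, ((∑ i, trace e K x i ^ 2) +
      (h ^ 2)⁻¹ * (∑ i, (trace w K x i - U K x i) ^ 2) +
      h ^ 2 * ∑ i, ∑ j, ∇ (trace e K) x i j ^ 2) =
      (∫ x in hull K, ∑ i, trace e K x i ^ 2) +
      (h ^ 2)⁻¹ * (∫ x in hull K, ∑ i, (trace w K x i - U K x i) ^ 2) +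
      h ^ 2 * ∫ x in hull K, ∑ i, ∑ j, ∇ (trace e K) x i j ^ 2 := by
    rw [← integral_const_mul, ← integral_const_mul, ← integral_add' ie (ia.const_mul _),
      ← integral_add' (ie.add (ia.const_mul _)) (id.const_mul _)]
    rfl
  have e2 : ∑ f ∈ K.powersetCard n, ∫ x in hull f, (h⁻¹ * (∑ i, (trace w K x i - U K x i) ^ 2) +
      h * ∑ i, trace e K x i ^ 2) ∂(surf n) = (h ^ 2)⁻¹ * (h * ∑ f ∈ K.powersetCard n,
        ∫ x in hull f, ∑ i, (trace w K x i - U K x i) ^ 2 ∂(surf n)) +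
      h * ∑ f ∈ K.powersetCard n, ∫ x in hull f, ∑ i, trace e K x i ^ 2 ∂(surf n) := by
    rw [← mul_assoc, show (h ^ 2)⁻¹ * h = h⁻¹ by field_simp, mul_sum, mul_sum,
      ← sum_add_distrib]
    refine sum_congr rfl fun f hf => ?_
    rw [← integral_const_mul, ← integral_const_mul, ← integral_add]
    · exact (ifac f hf _ (by fun_prop)).const_mul _
    · exact (ifac f hf _ (by fun_prop)).const_mul _
  obtain ⟨-, -, h3, h4⟩ := hinv hc hh (hqu K hK) (he K hK)
  obtain ⟨-, -, -, h5⟩ := hinv (v := fun x i => trace w K x i - q K x i) hc hh (hqu K hK)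
    fun i => Submodule.sub_mem _ (hw K hK i) (hq K i)
  have h6 : h * ∑ f ∈ K.powersetCard n, ∫ x in hull f, ∑ i, (trace w K x i - U K x i) ^ 2 ∂(surf n) ≤
      2 * (h * ∑ f ∈ K.powersetCard n, ∫ x in hull f, ∑ i, (trace w K x i - q K x i) ^ 2 ∂(surf n)) +
      2 * (h * ∑ f ∈ K.powersetCard n, ∫ x in hull f, ∑ i, (q K x i - U K x i) ^ 2 ∂(surf n)) := by
    rw [mul_left_comm 2, mul_left_comm 2, ← mul_add, mul_sum _ _ (2 : ℝ),
      mul_sum _ _ (2 : ℝ), ← sum_add_distrib]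
    exact mul_le_mul_of_nonneg_left (sum_le_sum fun f hf =>
      integral_sum_sq_sub_le (ifac f hf) cw hqc hUc) hh.le
  have h7 := integral_sum_sq_sub_le (integrable_hull K) cw hUc hqc
  have h7' : ∫ x in hull K, ∑ i, (U K x i - q K x i) ^ 2 =
      ∫ x in hull K, ∑ i, (q K x i - U K x i) ^ 2 := by
    congr 1
    ext x
    exact sum_congr rfl fun i _ => by ring
  rw [h7'] at h7
  rw [e1, e2]
  set a := ∫ x in hull K, ∑ i, (trace w K x i - U K x i) ^ 2
  set b := ∫ x in hull K, ∑ i, (q K x i - U K x i) ^ 2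
  set S := ∑ f ∈ K.powersetCard n, ∫ x in hull f, ∑ i, (q K x i - U K x i) ^ 2 ∂(surf n)
  have hS0 : 0 ≤ S := sum_nonneg fun _ _ => integral_nonneg fun _ =>
    sum_nonneg fun _ _ => sq_nonneg _
  have hb0 : 0 ≤ b := integral_nonneg fun _ => sum_nonneg fun _ _ => sq_nonneg _
  have h8 : h * S ≤ κ⁻¹ * (diam (hull K) * S) := by
    rw [← mul_assoc]
    refine mul_le_mul_of_nonneg_right ?_ hS0
    rw [inv_mul_eq_div, le_div_iff₀ hκ, mul_comm]
    exact hqu K hK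
  have h9 : 0 ≤ κ⁻¹ * b := mul_nonneg (inv_nonneg.2 hκ.le) hb0
  have h10 : 0 ≤ C * (diam (hull K) * S) := mul_nonneg (by linarith)
    (mul_nonneg diam_nonneg hS0)
  have h11 := mul_le_mul_of_nonneg_left h7 (show 0 ≤ C by linarith)
  have h12 : (h ^ 2)⁻¹ * (h * ∑ f ∈ K.powersetCard n,
      ∫ x in hull f, ∑ i, (trace w K x i - U K x i) ^ 2 ∂(surf n)) ≤
      (h ^ 2)⁻¹ * (4 * C * a + (4 * C + 2 * κ⁻¹) * (b + diam (hull K) * S)) :=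
    mul_le_mul_of_nonneg_left (by linarith) (by positivity)
  linarith

lemma abs_le_of_sq_mul_le {a h X r : ℝ} (hr : 0 < r) (hh : 0 < h) (hX : 0 ≤ X)
    (H : r * a ^ 2 ≤ X * (r * h ^ 2)) : |a| ≤ (1 + X) * h := by
  refine abs_le_of_sq_le_sq ?_ (by positivity)
  have h1 : a ^ 2 ≤ X * h ^ 2 := le_of_mul_le_mul_left (by linarith) hr
  nlinarith [mul_nonneg hX (sq_nonneg h), mul_nonneg (mul_nonneg hX hX) (sq_nonneg h), sq_nonneg h]

/-- The growth rate of the error at a fixed time: as long as the error is small compared to the mesh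
size, the energy estimate closes. -/
theorem exists_error_growth (n s : ℕ) (hn : 0 < n) (hs : n < 2 * s) (hT : 0 < T) {σ κ D₀ C₀ : ℝ}
    (hσ : 0 < σ) (hκ : 0 < κ) (hD₀ : 0 ≤ D₀) (hC₀ : 0 ≤ C₀) (M L B : ℝ≥0) :
    ∃ C : ℝ, 0 < C ∧ ∀ {Ω : Set (Euc n)} (_ : IsOpen Ω) (_ : Ω.Nonempty)
      (_ : interior (closure Ω) = Ω) {u : ℝ → Euc n → Euc n} (_ : IsEulerSolution Ω T u)
      (_ : sobolevTimeNorm Ω T (s + 1) u ≤ M)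
      {𝒯 : Triangulation Ω} (_ : 𝒯.ShapeRegular σ) (_ : 𝒯.QuasiUniform κ) (_ : 𝒯.meshSize ≤ D₀)
      {F : Finset (Euc n) → Fin n → ℝ × Euc n → ℝ} {p : ℝ × Euc n → ℝ} {Dp : Fin n → ℝ × Euc n → ℝ}
      (_ : 𝒯.EulerRep T u L B F p Dp) {t : ℝ} (_ : t ∈ Icc 0 T) (o : 𝒯.Orientation)
      {w e : BrokenField n} (_ : ∀ K ∈ 𝒯.cells, ∀ i, (fun x => trace w K x i) ∈ polySpace n (s + 1))
      (_ : ∀ K ∈ 𝒯.cells, ∀ i, (fun x => trace e K x i) ∈ polySpace n (s + 1))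
      (_ : 𝒯.DivFree fun K => trace w K) (_ : 𝒯.DivFree fun K => trace e K)
      {c : Finset (Euc n) → Euc n → ℝ} (_ : 𝒯.IsUpwindCoeff o (w + e) c)
      (_ : 𝒯.sqNorm (fun K x i => trace w K x i - F K i (t, x)) ≤ C₀ * 𝒯.meshSize ^ (2 * (s + 1)))
      (_ : 𝒯.sqNorm (fun K => trace e K) ≤ 𝒯.meshSize ^ (n + 2)),
      𝒯.convForm (fun K x i => F K i (t, x)) (fun K => trace e K) -
        𝒯.lieForm o c (w + e) (w + e) e ≤
        C * (𝒯.meshSize ^ (2 * s) + 𝒯.sqNorm (fun K => trace e K)) := by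
  obtain ⟨C₁, hC₁, hinv⟩ := exists_inverse_estimates n (s + 1) hn hσ hκ
  obtain ⟨C₂, hC₂, happ⟩ := exists_broken_approx hn hs hT hσ M
  set V₁ := (volume : Measure (Euc n)).real (closedBall 0 1)
  have hV₁ : 0 ≤ V₁ := measureReal_nonneg
  set P := C₁ * (2 * (C₀ * D₀ ^ (2 * s - n)) + 2 * (n * L ^ 2 * V₁)) with hP
  have hP0 : 0 ≤ P := by positivity
  set Λ : ℝ := 1 + P + C₁ + L + D₀ with hΛ
  set C₃ := 1 + 2 * C₁ + (1 + 4 * C₁) * C₀ + (4 * C₁ + 2 * κ⁻¹) * C₂ with hC₃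
  have hκ0 : 0 < κ⁻¹ := inv_pos.2 hκ
  have hL0 : (0 : ℝ) ≤ L := L.2
  refine ⟨100 * ((n + 1) * Λ) ^ 3 * C₃, by positivity, ?_⟩
  intro Ω hΩo hΩne hΩ u hu hsob 𝒯 hreg hqu hhD F p Dp hF t ht o w e hw he hwd hed c hc hwU heh
  set h := 𝒯.meshSize with hhdef
  have hh : 0 < h := 𝒯.meshSize_pos hn hΩo hΩne hΩ
  have hreg' := hreg.shapeReg hσ hn
  have hqu' : ∀ K ∈ 𝒯.cells, κ * h ≤ diam (hull K) := hqu
  obtain ⟨q, hq, hqb⟩ := happ hΩo hΩne hΩ hsob hreg hF ht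
  have hUc : ∀ K ∈ 𝒯.cells, ∀ i, Continuous fun x => F K i (t, x) := fun K hK i =>
    (hF.lip_slice hK i t).continuous
  have hcell : ∀ K ∈ 𝒯.cells, ∀ x ∈ hull K, (∀ i, |trace w K x i - F K i (t, x)| ≤ Λ * h) ∧
      ∀ i j, |∇ (trace w K) x i j| ≤ Λ := by
    intro K hK x hx
    obtain ⟨x₀, hc₀⟩ := hreg' K hK
    have hd0 := hc₀.diam_pos
    have hdh : diam (hull K) ≤ h := 𝒯.diam_le_meshSize hK
    have hx₀ : x₀ ∈ hull K := hc₀.ball (Metric.mem_closedBall_self (by positivity))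
    have hlip : ∀ y ∈ hull K, ∀ i, |F K i (t, y) - F K i (t, x₀)| ≤ L * h := fun y hy i =>
      ((hF.lip_slice hK i t).dist_le_mul y x₀).trans (mul_le_mul_of_nonneg_left
        ((Metric.dist_le_diam_of_mem (isCompact_hull K).isBounded hy hx₀).trans hdh) hL0)
    have h1 := integral_sum_sq_sub_le (integrable_hull K) (continuous_trace_apply w K) (hUc K hK)
      (c := fun _ i => F K i (t, x₀)) fun i => continuous_const
    have h2 : ∫ y in hull K, ∑ i, (F K i (t, y) - F K i (t, x₀)) ^ 2 ≤
        n * L ^ 2 * V₁ * (h ^ n * h ^ 2) := by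
      have h3 : ∀ y ∈ hull K, ∑ i, (F K i (t, y) - F K i (t, x₀)) ^ 2 ≤ n * (L * h) ^ 2 := fun y hy =>
        (sum_le_sum fun i _ => sq_le_sq' (neg_le_of_abs_le (hlip y hy i))
          (le_of_abs_le (hlip y hy i))).trans_eq (by simp)
      have h4 := setIntegral_mono_on (integrable_hull K _ (continuous_finset_sum _ fun i _ =>
        ((hUc K hK i).sub continuous_const).pow 2)) (integrable_hull K _ continuous_const)
        (measurableSet_hull K) h3
      rw [setIntegral_const, smul_eq_mul] at h4
      refine h4.trans ?_
      have h5 : (volume : Measure (Euc n)).real (hull K) ≤ h ^ n * V₁ :=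
        hc₀.volume_le.trans (by gcongr)
      calc _ ≤ h ^ n * V₁ * (n * (L * h) ^ 2) := by gcongr
        _ = _ := by ring
    have h3 : ∫ y in hull K, ∑ i, (trace w K y i - F K i (t, y)) ^ 2 ≤
        C₀ * D₀ ^ (2 * s - n) * (h ^ n * h ^ 2) := by
      refine (integral_le_sqNorm (V := fun K x i => trace w K x i - F K i (t, x)) hK).trans
        (hwU.trans ?_)
      have e1 : h ^ (2 * (s + 1)) = h ^ (2 * s - n) * (h ^ n * h ^ 2) := by
        rw [← pow_add, ← pow_add]
        congr 1
        omega
      rw [e1, ← mul_assoc]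
      gcongr
    have h4 : C₁ * ∫ y in hull K, ∑ i, (trace w K y i - F K i (t, x₀)) ^ 2 ≤ P * (h ^ n * h ^ 2) := by
      rw [hP, mul_assoc]
      refine mul_le_mul_of_nonneg_left ?_ (by linarith)
      linarith
    obtain ⟨h5, h6, -, -⟩ := hinv (v := fun y i => trace w K y i - F K i (t, x₀)) hc₀ hh (hqu' K hK)
      fun i => Submodule.sub_mem _ (hw K hK i) (polySpace_const _)
    have hPΛ : 1 + P + L ≤ Λ := by linarith
    refine ⟨fun i => ?_, fun i j => ?_⟩
    · have h7 := abs_le_of_sq_mul_le (pow_pos hh n) hh hP0 ((h5 x hx i).trans h4)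
      have h8 := hlip x hx i
      rw [abs_sub_comm] at h8
      have h9 := abs_add_le (trace w K x i - F K i (t, x₀)) (F K i (t, x₀) - F K i (t, x))
      rw [sub_add_sub_cancel] at h9
      calc _ ≤ (1 + P + L) * h := by linarith
        _ ≤ Λ * h := by gcongr
    · have h7 := h6 x hx i j
      simp only [lineDeriv, deriv_sub_const] at h7
      have h8 := abs_le_of_sq_mul_le (pow_pos hh (n + 2)) one_pos hP0 ((h7.trans h4).trans_eq
        (by ring))
      exact h8.trans (by linarith)
  have heb : ∀ K ∈ 𝒯.cells, ∀ x ∈ hull K, ∀ i, |trace e K x i| ≤ Λ * h := fun K hK x hx i => by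
    obtain ⟨x₀, hc₀⟩ := hreg' K hK
    have h1 := (hinv hc₀ hh (hqu' K hK) (he K hK)).1 x hx i
    have h2 := (integral_le_sqNorm (V := fun K => trace e K) hK).trans heh
    have h3 := abs_le_of_sq_mul_le (pow_pos hh n) hh (show 0 ≤ C₁ by linarith) (h1.trans
      ((mul_le_mul_of_nonneg_left h2 (by linarith)).trans_eq (by rw [pow_add])))
    refine h3.trans ?_
    gcongr
    linarith
  have hΛ1 : 1 ≤ Λ := by linarith
  refine (energy_estimate (h := h) hn o (hF.divFree hn hΩ hu ht) hwd hed hc hh hΛ1 (by linarith)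
    (fun f hf x hx => funext fun i => hF.facet_eq hn hΩ hu ht o hf hx i)
    (fun K hK x hx i => (hF.bound K hK i t ht x hx).trans (by linarith))
    (fun K hK x hx => (hcell K hK x hx).1) (fun K hK x hx => (hcell K hK x hx).2) heb).trans ?_
  refine le_trans (mul_le_mul_of_nonneg_left (b := 𝒯.energyBound h (fun K x i => F K i (t, x)) w e)
    (c := C₃ * (h ^ (2 * s) + 𝒯.sqNorm fun K => trace e K)) ?_ (by positivity)) (le_of_eq (by ring))
  refine (energyBound_le hn hκ hh hC₁ hreg' hqu' hinv hw he hUc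
    fun K i => polySpace_mono s.le_succ (hq K i)).trans ?_
  have h1 : (h ^ 2)⁻¹ * ((1 + 4 * C₁) * (C₀ * h ^ (2 * (s + 1))) + (4 * C₁ + 2 * κ⁻¹) *
      (C₂ * h ^ (2 * (s + 1)))) = ((1 + 4 * C₁) * C₀ + (4 * C₁ + 2 * κ⁻¹) * C₂) * h ^ (2 * s) := by
    have : h ^ (2 * (s + 1)) = h ^ 2 * h ^ (2 * s) := by ring
    rw [this]
    field_simp
  have h2 : (h ^ 2)⁻¹ * ((1 + 4 * C₁) * 𝒯.sqNorm (fun K x i => trace w K x i - F K i (t, x)) +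
        (4 * C₁ + 2 * κ⁻¹) * ∑ K ∈ 𝒯.cells, ((∫ x in hull K, ∑ i, (q K x i - F K i (t, x)) ^ 2) +
            diam (hull K) * ∑ f ∈ K.powersetCard n,
              ∫ x in hull f, ∑ i, (q K x i - F K i (t, x)) ^ 2 ∂(surf n))) ≤ (h ^ 2)⁻¹ *
      ((1 + 4 * C₁) * (C₀ * h ^ (2 * (s + 1))) + (4 * C₁ + 2 * κ⁻¹) *
      (C₂ * h ^ (2 * (s + 1)))) := by gcongr
  rw [h1] at h2
  refine (add_le_add_right h2 _).trans ?_
  have h3 := 𝒯.sqNorm_nonneg (fun K => trace e K)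
  have h4 : 0 ≤ h ^ (2 * s) := by positivity
  have h5 : 0 ≤ (1 + 4 * C₁) * C₀ + (4 * C₁ + 2 * κ⁻¹) * C₂ := by positivity
  have h6 := mul_nonneg h5 h3
  have h7 : 0 ≤ (1 + 2 * C₁) * h ^ (2 * s) := by positivity
  rw [hC₃]
  linarith

end Triangulation

namespace Triangulation

variable {n : ℕ} {Ω : Set (Euc n)} {𝒯 : Triangulation Ω}

lemma mem_divFreeSpace_iff (hn : 0 < n) (hΩ : interior (closure Ω) = Ω) {F : ElementFamily} {s : ℕ}
    {v : BrokenField n} : v ∈ 𝒯.divFreeSpace F s ↔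
      (∀ K ∈ 𝒯.cells, v K ∈ F.localSpace n s) ∧ 𝒯.DivFree fun K => trace v K := by
  refine ⟨fun h => ⟨h.1.2, divFree_of_mem hn hΩ h⟩, fun ⟨h1, h2⟩ => ?_⟩
  have hsol := h2.isSolenoidal_glue hn hΩ
  refine ⟨⟨⟨hsol.1, fun _ => 0, by simp, fun φ hφ => ?_⟩, h1⟩, hsol⟩
  simpa using hsol.2 φ ⟨hφ.smooth, hφ.compact, subset_univ _⟩

lemma trace_add_smul (v w : BrokenField n) (c : ℝ) K x (i : Fin n) :
    trace (v + c • w) K x i = trace v K x i + c * trace w K x i := by simp [trace]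

lemma divFree_add_smul {v w : BrokenField n} (hv : 𝒯.DivFree fun K => trace v K)
    (hw : 𝒯.DivFree fun K => trace w K) (c : ℝ) : 𝒯.DivFree fun K => trace (v + c • w) K where
  lip K _ i := trace_locallyLipschitz _ K i
  div K hK := by
    filter_upwards [hv.div K hK, hw.div K hK] with x h1 h2
    simp only [divPt, lineDeriv_trace, Pi.add_apply, Pi.smul_apply, map_add, map_smul,
      Derivation.map_smul, MvPolynomial.smul_eval, sum_add_distrib, ← mul_sum]
      at h1 h2 ⊢
    rw [h1, h2, mul_zero, add_zero]
  jump K hK f hf x hx := by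
    have h1 := hv.jump K hK f hf x hx
    have h2 := hw.jump K hK f hf x hx
    simp only [normalJump, flux, trace_add_smul, mul_add, sum_add_distrib,
      mul_left_comm _ c, ← mul_sum] at h1 h2 ⊢
    rw [h1, h2, mul_zero, add_zero]

/-- The divergence free finite element space as a submodule of the broken polynomial fields. -/
def divFreeSubmodule (𝒯 : Triangulation Ω) (hn : 0 < n) (hΩ : interior (closure Ω) = Ω)
    (F : ElementFamily) (s : ℕ) : Submodule ℝ (BrokenField n) :=
  have key : ∀ (v w : BrokenField n) (c : ℝ), v ∈ 𝒯.divFreeSpace F s → w ∈ 𝒯.divFreeSpace F s →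
      v + c • w ∈ 𝒯.divFreeSpace F s := fun v w c hv hw => by
    rw [mem_divFreeSpace_iff hn hΩ] at hv hw ⊢
    refine ⟨fun K hK => ?_, divFree_add_smul hv.2 hw.2 c⟩
    have h1 := hv.1 K hK
    have h2 := hw.1 K hK
    have hdeg : ∀ p q : MvPolynomial (Fin n) ℝ, p.totalDegree ≤ s → q.totalDegree ≤ s →
        (p + c • q).totalDegree ≤ s := fun p q hp hq => (MvPolynomial.totalDegree_add _ _).trans
      (max_le hp ((MvPolynomial.totalDegree_smul_le _ _).trans hq))
    cases F
    · obtain ⟨q, r, hq, hr, e⟩ := h1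
      obtain ⟨q', r', hq', hr', e'⟩ := h2
      refine ⟨q + c • q', r + c • r', fun i => hdeg _ _ (hq i) (hq' i), hdeg _ _ hr hr', fun i => ?_⟩
      simp only [Pi.add_apply, Pi.smul_apply, e, e', smul_add, mul_add, mul_smul_comm]
      abel
    · exact fun i => hdeg _ _ (h1 i) (h2 i)
  have zero : (0 : BrokenField n) ∈ 𝒯.divFreeSpace F s :=
    mem_divFreeSpace hn hΩ F (fun _ _ _ => by simp) ⟨fun K _ i => trace_locallyLipschitz _ K i,
      fun K _ => .of_forall fun x => by simp [divPt, lineDeriv_trace],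
      fun K _ f _ x _ => by simp [normalJump, flux, trace]⟩
  { carrier := 𝒯.divFreeSpace F s
    zero_mem' := zero
    add_mem' := fun {v w} hv hw => by simpa using key v w 1 hv hw
    smul_mem' := fun c v hv => by simpa using key 0 v c zero hv }

/-- The `L²` pairing of broken fields. -/
noncomputable def l2pair (𝒯 : Triangulation Ω) (U V : Finset (Euc n) → Euc n → Fin n → ℝ) : ℝ :=
  ∑ K ∈ 𝒯.cells, ∫ x in hull K, ∑ i, U K x i * V K x i

lemma l2pair_comm (U V : Finset (Euc n) → Euc n → Fin n → ℝ) : 𝒯.l2pair U V = 𝒯.l2pair V U := by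
  simp only [l2pair, mul_comm]

lemma sqNorm_eq_l2pair (V : Finset (Euc n) → Euc n → Fin n → ℝ) : 𝒯.sqNorm V = 𝒯.l2pair V V := by
  simp only [sqNorm, l2pair, sq]

lemma l2pair_sum {ι : Type*} [Fintype ι] {U V : Finset (Euc n) → Euc n → Fin n → ℝ}
    {b : ι → BrokenField n} {c : ι → ℝ} (hU : ∀ K ∈ 𝒯.cells, ∀ i, Continuous fun x => U K x i)
    (hV : ∀ K ∈ 𝒯.cells, ∀ x i, V K x i = ∑ k, c k * trace (b k) K x i) :
    𝒯.l2pair U V = ∑ k, c k * 𝒯.l2pair U fun K => trace (b k) K := by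
  simp only [l2pair, mul_sum 𝒯.cells]
  rw [sum_comm]
  refine sum_congr rfl fun K hK => ?_
  have hc : ∀ k, Continuous fun x => c k * ∑ i, U K x i * trace (b k) K x i := fun k =>
    continuous_const.mul (continuous_finset_sum _ fun i _ =>
      (hU K hK i).mul (continuous_trace_apply (b k) K i))
  simp only [← integral_const_mul]
  rw [← integral_finset_sum _ fun k _ => integrable_hull K _ (hc k)]
  congr 1
  ext x
  simp only [hV K hK, mul_sum]
  rw [sum_comm]
  exact sum_congr rfl fun k _ => sum_congr rfl fun i _ => by ring

/-- An `L²`-orthonormal basis of the divergence free finite element space. -/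
theorem exists_basis (𝒯 : Triangulation Ω) (hn : 0 < n) (hΩ : interior (closure Ω) = Ω)
    (F : ElementFamily) (s : ℕ) : ∃ (ι : Type) (_ : Fintype ι) (_ : DecidableEq ι)
    (b : ι → BrokenField n), (∀ k, b k ∈ 𝒯.divFreeSpace F s) ∧
      (∀ k l, 𝒯.l2pair (fun K => trace (b k) K) (fun K => trace (b l) K) = if k = l then 1 else 0) ∧
      ∀ v ∈ 𝒯.divFreeSpace F s, ∀ K ∈ 𝒯.cells, ∀ x i, trace v K x i =
        ∑ k, 𝒯.l2pair (fun K => trace v K) (fun K => trace (b k) K) * trace (b k) K x i := by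
  classical
  let N : Submodule ℝ (𝒯.BrokenSpace (s + 1)) :=
    { carrier := {x | ∃ v ∈ 𝒯.divFreeSubmodule hn hΩ F s, ∀ K : 𝒯.cells, ∀ y i,
        bval x K y i = trace v K y i}
      zero_mem' := ⟨0, Submodule.zero_mem _, fun K y i => by simp [bval, trace]⟩
      add_mem' := by
        rintro x x' ⟨v, hv, h⟩ ⟨v', hv', h'⟩
        refine ⟨v + v', Submodule.add_mem _ hv hv', fun K y i => ?_⟩
        have := congrArg₂ (· + ·) (h K y i) (h' K y i)
        simpa [bval, trace] using this
      smul_mem' := by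
        rintro c x ⟨v, hv, h⟩
        refine ⟨c • v, Submodule.smul_mem _ c hv, fun K y i => ?_⟩
        have := congrArg (c * ·) (h K y i)
        simpa [bval, trace] using this }
  have hpair : ∀ (x y : N) (v w : BrokenField n), (∀ K : 𝒯.cells, ∀ z i, bval x.1 K z i = trace v K z i) →
      (∀ K : 𝒯.cells, ∀ z i, bval y.1 K z i = trace w K z i) →
      (𝒯.brokenForm (s + 1)).restrict N x y =
        𝒯.l2pair (fun K => trace v K) (fun K => trace w K) := fun x y v w hv hw => by
    rw [LinearMap.BilinForm.restrict_apply, LinearMap.domRestrict_apply, brokenForm_apply]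
    simp only [hv, hw]
    exact sum_coe_sort 𝒯.cells fun K => ∫ z in hull K, ∑ i, trace v K z i * trace w K z i
  obtain ⟨ι, _, b, hb1, hb0, hbx⟩ := exists_orthonormal_family (E := N)
    (β := (𝒯.brokenForm (s + 1)).restrict N) (fun x y => by
      obtain ⟨v, -, hv⟩ := x.2
      obtain ⟨w, -, hw⟩ := y.2
      rw [hpair x y v w hv hw, hpair y x w v hw hv, l2pair_comm])
    (fun x => by
      obtain ⟨v, -, hv⟩ := x.2
      rw [hpair x x v v hv hv, ← sqNorm_eq_l2pair]
      exact sqNorm_nonneg _)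
  choose v hv hbv using fun k => (b k).2
  refine ⟨ι, inferInstance, Classical.decEq ι, v, hv, fun k l => ?_, fun u hu K hK x i => ?_⟩
  · rw [← hpair (b k) (b l) _ _ (hbv k) (hbv l)]
    split_ifs with h
    · rw [h, hb1]
    · exact hb0 k l h
  · let x' : N := ⟨fun K i => ⟨fun y => trace u K y i,
      trace_mem_polySpace (totalDegree_le_of_mem hu K.2 i)⟩, u, hu, fun K y i => rfl⟩
    set z := x' - ∑ k, (𝒯.brokenForm (s + 1)).restrict N x' (b k) • b k with hz
    have hzv : ∀ K : 𝒯.cells, ∀ y i, bval z.1 K y i = trace u K y i -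
        ∑ k, 𝒯.l2pair (fun K => trace u K) (fun K => trace (v k) K) * trace (v k) K y i := by
      intro K y i
      have h1 : ∀ k, (𝒯.brokenForm (s + 1)).restrict N x' (b k) =
          𝒯.l2pair (fun K => trace u K) (fun K => trace (v k) K) := fun k =>
        hpair x' (b k) _ _ (fun _ _ _ => rfl) (hbv k)
      rw [hz]
      simp only [h1, ← hbv]
      simp [bval, x']
    have h0 := hbx x'
    rw [← hz, LinearMap.BilinForm.restrict_apply, LinearMap.domRestrict_apply, brokenForm_apply] at h0
    have hcont : ∀ K : 𝒯.cells, ∀ i, Continuous fun y => bval z.1 K y i := fun K i =>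
      polySpace_continuous (bval_mem z.1 K i)
    have h2 := (Finset.sum_eq_zero_iff_of_nonneg fun K _ => integral_nonneg fun y =>
      sum_nonneg fun i _ => mul_self_nonneg _).1 h0 ⟨K, hK⟩ (Finset.mem_univ _)
    replace h2 := (integral_finset_sum Finset.univ (f := fun i y => bval z.1 ⟨K, hK⟩ y i *
      bval z.1 ⟨K, hK⟩ y i) fun i _ => integrable_hull K _
        ((hcont ⟨K, hK⟩ i).mul (hcont ⟨K, hK⟩ i))).symm.trans h2
    have h3 := (Finset.sum_eq_zero_iff_of_nonneg fun i _ => integral_nonneg fun y =>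
      mul_self_nonneg _).1 h2 i (Finset.mem_univ _)
    have h4 := polySpace_eq_zero (bval_mem z.1 ⟨K, hK⟩ i) isOpen_interior (𝒯.cell_simplex hK).interior_nonempty
      (eq_zero_of_integral_sq (hcont ⟨K, hK⟩ i) (isCompact_hull K) h3) x
    rw [hzv] at h4
    linarith

/-- Linear functionals on polynomials are combinations of point evaluations. -/
lemma exists_eval_representation (n s : ℕ) (l : polySpace n s →ₗ[ℝ] ℝ) :
    ∃ c : Euc n →₀ ℝ, ∀ p : polySpace n s, l p = c.sum fun x a => a * p x := by
  let ev : Euc n → Module.Dual ℝ (polySpace n s) := fun x =>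
    (LinearMap.proj x).comp (polySpace n s).subtype
  have htop : Submodule.span ℝ (range ev) = ⊤ := by
    rw [← Subspace.dualCoannihilator_dualAnnihilator_eq (W := Submodule.span ℝ (range ev)),
      Submodule.dualAnnihilator_eq_top_iff, Submodule.eq_bot_iff]
    intro p hp
    rw [Submodule.mem_dualCoannihilator] at hp
    ext x
    exact hp _ (Submodule.subset_span ⟨x, rfl⟩)
  obtain ⟨c, hc⟩ := Finsupp.mem_span_range_iff_exists_finsupp.1 (htop ▸ Submodule.mem_top (x := l))
  refine ⟨c, fun p => ?_⟩
  rw [← hc]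
  simp [Finsupp.sum, ev]

end Triangulation

section Gronwall

lemma absolutelyContinuousOnInterval_sum {ι : Type*} (S : Finset ι) {f : ι → ℝ → ℝ} {a b : ℝ}
    (h : ∀ i ∈ S, AbsolutelyContinuousOnInterval (f i) a b) :
    AbsolutelyContinuousOnInterval (fun t => ∑ i ∈ S, f i t) a b := by
  classical
  induction S using Finset.induction_on with
  | empty => simpa using (LipschitzWith.const (0 : ℝ)).lipschitzOnWith.absolutelyContinuousOnInterval
  | insert i S hi ih =>
    simp only [Finset.sum_insert hi]
    exact (h i (Finset.mem_insert_self _ _)).fun_add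
      (ih fun j hj => h j (Finset.mem_insert_of_mem hj))

/-- Gronwall's inequality for absolutely continuous functions. -/
lemma AbsolutelyContinuousOnInterval.le_exp_mul {E : ℝ → ℝ} {T C δ : ℝ} (hT : 0 ≤ T)
    (hE : AbsolutelyContinuousOnInterval E 0 T)
    (hd : ∀ᵐ t ∂(volume.restrict (Ioo 0 T)), ∃ E', HasDerivAt E E' t ∧ E' ≤ C * (δ + E t)) :
    E T + δ ≤ Real.exp (C * T) * (E 0 + δ) := by
  have hex : AbsolutelyContinuousOnInterval (fun t => Real.exp (-(C * t))) 0 T :=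
    (by fun_prop : ContDiff ℝ 1 fun t => Real.exp (-(C * t))).contDiffOn.absolutelyContinuousOnInterval
  have hG := hex.fun_mul (hE.fun_add
    (LipschitzWith.const δ).lipschitzOnWith.absolutelyContinuousOnInterval)
  have h1 := hG.integral_deriv_eq_sub
  have h2 : ∫ t in (0)..T, deriv (fun t => Real.exp (-(C * t)) * (E t + δ)) t ≤ 0 := by
    rw [intervalIntegral.integral_of_le hT, integral_Ioc_eq_integral_Ioo]
    refine integral_nonpos_of_ae ?_
    filter_upwards [hd] with t ⟨E', h3, h4⟩
    have h5 : HasDerivAt (fun t => Real.exp (-(C * t))) (Real.exp (-(C * t)) * -(C * 1)) t :=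
      (((hasDerivAt_id t).const_mul C).neg).exp
    have h6 := (h5.fun_mul (h3.add_const δ)).deriv
    rw [h6]
    change _ ≤ (0 : ℝ)
    nlinarith [Real.exp_pos (-(C * t))]
  rw [h1] at h2
  have h7 : Real.exp (C * T) * Real.exp (-(C * T)) = 1 := by rw [← Real.exp_add]; simp
  simp only [mul_zero, neg_zero, Real.exp_zero, one_mul, sub_nonpos] at h2
  calc E T + δ = Real.exp (C * T) * (Real.exp (-(C * T)) * (E T + δ)) := by
        rw [← mul_assoc, h7, one_mul]
    _ ≤ _ := mul_le_mul_of_nonneg_left h2 (Real.exp_pos _).le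

/-- Gronwall's inequality when the growth is only controlled below a threshold, which the resulting
bound does not reach. -/
lemma AbsolutelyContinuousOnInterval.le_exp_mul_of_threshold {E : ℝ → ℝ} {T C δ H : ℝ} (hC : 0 ≤ C)
    (hδ : 0 ≤ δ) (hE : AbsolutelyContinuousOnInterval E 0 T) (h0 : 0 ≤ E 0)
    (hd : ∀ᵐ t ∂(volume.restrict (Ioo 0 T)), E t ≤ H → ∃ E', HasDerivAt E E' t ∧ E' ≤ C * (δ + E t))
    (hH : Real.exp (C * T) * (E 0 + δ) < H) : ∀ t ∈ Icc 0 T, E t ≤ Real.exp (C * T) * (E 0 + δ) := by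
  intro t ht
  have hT : 0 ≤ T := ht.1.trans ht.2
  have step : ∀ τ ∈ Icc 0 T, (∀ t ∈ Ico 0 τ, E t ≤ H) → E τ ≤ Real.exp (C * T) * (E 0 + δ) := by
    intro τ hτ hb
    have hsub : Ioo 0 τ ⊆ Ioo 0 T := Ioo_subset_Ioo_right hτ.2
    have h1 := (hE.mono (c := 0) (d := τ) (by
      rw [uIcc_of_le hτ.1, uIcc_of_le hT]
      exact Icc_subset_Icc_right hτ.2)).le_exp_mul (C := C) (δ := δ) hτ.1 (by
        filter_upwards [ae_restrict_mono hsub hd,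
          ae_restrict_mem measurableSet_Ioo] with t h2 h3
        exact h2 (hb t ⟨h3.1.le, h3.2⟩))
    have h4 : Real.exp (C * τ) ≤ Real.exp (C * T) :=
      Real.exp_le_exp.2 (mul_le_mul_of_nonneg_left hτ.2 hC)
    have h5 := mul_le_mul_of_nonneg_right h4 (add_nonneg h0 hδ)
    linarith
  have hcont : ContinuousOn E (Icc 0 T) := by simpa [uIcc_of_le hT] using hE.continuousOn
  have hS : IsCompact {t | t ∈ Icc 0 T ∧ H ≤ E t} :=
    isCompact_Icc.of_isClosed_subset (hcont.preimage_isClosed_of_isClosed isClosed_Icc isClosed_Ici)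
      fun _ h => h.1
  rcases Set.eq_empty_or_nonempty {t | t ∈ Icc 0 T ∧ H ≤ E t} with hemp | hne
  · refine step t ht fun r hr => ?_
    by_contra hlt
    exact (hemp.subset ⟨⟨hr.1, hr.2.le.trans ht.2⟩, (not_le.1 hlt).le⟩ : r ∈ (∅ : Set ℝ))
  · obtain ⟨τ, hτ, hmin⟩ := hS.exists_isLeast hne
    have h1 := step τ hτ.1 fun r hr => by
      by_contra hlt
      exact absurd (hmin ⟨⟨hr.1, hr.2.le.trans hτ.1.2⟩, (not_le.1 hlt).le⟩) (not_le.2 hr.2)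
    linarith [hτ.2]

end Gronwall

namespace Triangulation

variable {n : ℕ} {Ω : Set (Euc n)} {𝒯 : Triangulation Ω}

/-- The `L²` pairings of piecewise polynomial fields with a fixed one are combinations of point
values. -/
lemma exists_l2pair_representation {s : ℕ} {b : BrokenField n}
    (hb : ∀ K ∈ 𝒯.cells, ∀ i, (b K i).totalDegree ≤ s) :
    ∃ c : Finset (Euc n) → Fin n → (Euc n →₀ ℝ), ∀ v : BrokenField n,
      (∀ K ∈ 𝒯.cells, ∀ i, (v K i).totalDegree ≤ s) →
      𝒯.l2pair (fun K => trace v K) (fun K => trace b K) =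
        ∑ K ∈ 𝒯.cells, ∑ i, ∑ x ∈ (c K i).support, c K i x * trace v K x i := by
  have key : ∀ K i, ∃ c : Euc n →₀ ℝ, K ∈ 𝒯.cells → ∀ v : BrokenField n, (v K i).totalDegree ≤ s →
      ∫ x in hull K, trace v K x i * trace b K x i = ∑ x ∈ c.support, c x * trace v K x i := by
    intro K i
    by_cases hK : K ∈ 𝒯.cells
    · obtain ⟨c, hc⟩ := exists_eval_representation n s ((pairForm s (volume.restrict (hull K))
        (integrable_hull K)).flip ⟨_, trace_mem_polySpace (hb K hK i)⟩)
      exact ⟨c, fun _ v hv => hc ⟨_, trace_mem_polySpace hv⟩⟩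
    · exact ⟨0, fun h => absurd h hK⟩
  choose c hc using key
  refine ⟨c, fun v hv => sum_congr rfl fun K hK => ?_⟩
  refine (integral_finset_sum _ fun i _ => integrable_hull K _
    ((continuous_trace_apply v K i).mul (continuous_trace_apply b K i))).trans ?_
  exact sum_congr rfl fun i _ => hc K i hK v (hv K hK i)

lemma integral_inner_glue (hΩ : interior (closure Ω) = Ω) (v w : BrokenField n) :
    ∫ x in Ω, inner ℝ (𝒯.glue v x) (𝒯.glue w x) =
      𝒯.l2pair (fun K => trace v K) (fun K => trace w K) := by
  have h1 : ∀ K ∈ 𝒯.cells, (fun x => inner ℝ (𝒯.glue v x) (𝒯.glue w x)) =ᵐ[volume.restrict (hull K)]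
      fun x => ∑ i, trace v K x i * trace w K x i := fun K hK => by
    filter_upwards [(𝒯.represents_glue v).ae hK, (𝒯.represents_glue w).ae hK] with x h1 h2
    simp only [PiLp.inner_apply, h1, h2]
    exact sum_congr rfl fun i _ => mul_comm _ _
  rw [𝒯.setIntegral_eq_sum hΩ fun K hK => Integrable.congr (integrable_hull K _
    (continuous_finset_sum _ fun i _ => (continuous_trace_apply v K i).mul
      (continuous_trace_apply w K i))) (h1 K hK).symm]
  exact sum_congr rfl fun K hK => integral_congr_ae (h1 K hK)

/-- The evolution of the pairings of a semi-discrete solution with discrete fields. -/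
lemma IsUpwindSolution.evolution {o : 𝒯.Orientation} {F : ElementFamily} {s : ℕ} {T : ℝ}
    {uh : ℝ → BrokenField n} (huh : 𝒯.IsUpwindSolution o F s T uh) (hT : 0 < T)
    (hΩ : interior (closure Ω) = Ω)
    {ι : Type} {b : ι → BrokenField n} (hb : ∀ k, b k ∈ 𝒯.divFreeSpace F s) :
    (∀ k, AbsolutelyContinuousOnInterval
      (fun t => 𝒯.l2pair (fun K => trace (uh t) K) fun K => trace (b k) K) 0 T) ∧
    ∀ᵐ t ∂(volume.restrict (Ioo 0 T)), ∃ (ud : BrokenField n) (c : Finset (Euc n) → Euc n → ℝ),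
      𝒯.IsUpwindCoeff o (uh t) c ∧
      (∀ k, HasDerivAt (fun τ => 𝒯.l2pair (fun K => trace (uh τ) K) fun K => trace (b k) K)
        (𝒯.l2pair (fun K => trace ud K) fun K => trace (b k) K) t) ∧
      ∀ v ∈ 𝒯.divFreeSpace F s, 𝒯.l2pair (fun K => trace ud K) (fun K => trace v K) =
        -𝒯.lieForm o c (uh t) (uh t) v := by
  choose c hc using fun k => exists_l2pair_representation (𝒯 := 𝒯) (s := s + 1)
    fun K hK i => totalDegree_le_of_mem (hb k) hK i
  have hdeg : ∀ {v}, v ∈ 𝒯.divFreeSpace F s → ∀ K ∈ 𝒯.cells, ∀ i, (v K i).totalDegree ≤ s + 1 :=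
    fun hv K hK i => totalDegree_le_of_mem hv hK i
  refine ⟨fun k => ?_, ?_⟩
  · have h := absolutelyContinuousOnInterval_sum 𝒯.cells fun K hK =>
      absolutelyContinuousOnInterval_sum Finset.univ fun i _ =>
        absolutelyContinuousOnInterval_sum (c k K i).support fun x _ =>
          (huh.absCont K hK x i).const_mul (c k K i x)
    rw [absolutelyContinuousOnInterval_iff] at h ⊢
    intro ε hε
    obtain ⟨δ, hδ, h⟩ := h ε hε
    refine ⟨δ, hδ, fun E hE hE' => ?_⟩
    refine (sum_congr rfl fun j hj => ?_).trans_lt (h E hE hE')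
    have h2 := hE.1 j hj
    rw [uIcc_of_le hT.le] at h2
    rw [hc k _ (hdeg (huh.mem _ h2.1)), hc k _ (hdeg (huh.mem _ h2.2))]
  · filter_upwards [ae_restrict_mono Ioo_subset_Icc_self huh.equation,
      ae_restrict_mem measurableSet_Ioo] with t ⟨ud, hud, hder, c', hc', heq⟩ ht
    refine ⟨ud, c', hc', fun k => ?_, fun v hv => ?_⟩
    · rw [hc k _ (hdeg hud)]
      refine HasDerivAt.congr_of_eventuallyEq (HasDerivAt.fun_sum fun K hK =>
        HasDerivAt.fun_sum fun i _ => HasDerivAt.fun_sum fun x _ =>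
          (hder K hK x i).const_mul (c k K i x)) ?_
      filter_upwards [isOpen_Ioo.mem_nhds ht] with τ hτ
      exact hc k _ (hdeg (huh.mem τ (Ioo_subset_Icc_self hτ)))
    · rw [← integral_inner_glue hΩ]
      linarith [heq v hv]

end Triangulation

namespace Triangulation

variable {n : ℕ} {Ω : Set (Euc n)} {𝒯 : Triangulation Ω} {ι : Type} [Fintype ι] [DecidableEq ι]
  {b : ι → BrokenField n}

lemma trace_sum (c : ι → ℝ) K x (i : Fin n) :
    trace (∑ k, c k • b k) K x i = ∑ k, c k * trace (b k) K x i := by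
  simp [trace, Finset.sum_apply, map_sum]

lemma sqNorm_sub {U V : Finset (Euc n) → Euc n → Fin n → ℝ}
    (hU : ∀ K ∈ 𝒯.cells, ∀ i, Continuous fun x => U K x i)
    (hV : ∀ K ∈ 𝒯.cells, ∀ i, Continuous fun x => V K x i) :
    𝒯.sqNorm (fun K x i => U K x i - V K x i) = 𝒯.sqNorm U - 2 * 𝒯.l2pair U V + 𝒯.sqNorm V := by
  simp only [sqNorm, l2pair, mul_sum]
  rw [← sum_sub_distrib, ← sum_add_distrib]
  refine sum_congr rfl fun K hK => ?_
  have c1 := hU K hK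
  have c2 := hV K hK
  have i1 := integrable_hull K (fun x => ∑ i, U K x i ^ 2) (by fun_prop)
  have i2 := integrable_hull K (fun x => ∑ i, U K x i * V K x i) (by fun_prop)
  have i3 := integrable_hull K (fun x => ∑ i, V K x i ^ 2) (by fun_prop)
  rw [← integral_const_mul, ← integral_sub i1 (i2.const_mul 2)]
  refine Eq.trans ?_ (integral_add (i1.sub (i2.const_mul 2)) i3)
  congr 1
  ext x
  simp only [Pi.sub_apply, mul_sum, ← sum_sub_distrib, ← sum_add_distrib]
  exact sum_congr rfl fun i _ => by ring

lemma sqNorm_eq_sum_sq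
    (horth : ∀ k l, 𝒯.l2pair (fun K => trace (b k) K) (fun K => trace (b l) K) = if k = l then 1 else 0)
    {V : Finset (Euc n) → Euc n → Fin n → ℝ} (hVc : ∀ K ∈ 𝒯.cells, ∀ i, Continuous fun x => V K x i)
    {c : ι → ℝ} (hV : ∀ K ∈ 𝒯.cells, ∀ x i, V K x i = ∑ k, c k * trace (b k) K x i) :
    𝒯.sqNorm V = ∑ k, c k ^ 2 := by
  rw [sqNorm_eq_l2pair, l2pair_sum hVc hV]
  refine sum_congr rfl fun k _ => ?_
  rw [l2pair_comm, l2pair_sum (fun K _ i => continuous_trace_apply (b k) K i) hV]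
  simp [horth, sq]

/-- The truncated Fourier series is the best approximation. -/
lemma sqNorm_sub_le_of_coeff
    (horth : ∀ k l, 𝒯.l2pair (fun K => trace (b k) K) (fun K => trace (b l) K) = if k = l then 1 else 0)
    {U V : Finset (Euc n) → Euc n → Fin n → ℝ} (hU : ∀ K ∈ 𝒯.cells, ∀ i, Continuous fun x => U K x i)
    (hVc : ∀ K ∈ 𝒯.cells, ∀ i, Continuous fun x => V K x i)
    {c : ι → ℝ} (hV : ∀ K ∈ 𝒯.cells, ∀ x i, V K x i = ∑ k, c k * trace (b k) K x i)
    {W : BrokenField n} (hW : W = ∑ k, 𝒯.l2pair U (fun K => trace (b k) K) • b k) :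
    𝒯.sqNorm (fun K x i => trace W K x i - U K x i) ≤
      𝒯.sqNorm (fun K x i => V K x i - U K x i) := by
  have hWt : ∀ K ∈ 𝒯.cells, ∀ x i, trace W K x i =
      ∑ k, 𝒯.l2pair U (fun K => trace (b k) K) * trace (b k) K x i := fun K _ x i => by
    rw [hW, trace_sum]
  have hWc : ∀ K ∈ 𝒯.cells, ∀ i, Continuous fun x => trace W K x i := fun K _ i =>
    continuous_trace_apply W K i
  rw [sqNorm_sub hWc hU, sqNorm_sub hVc hU, l2pair_comm, l2pair_comm V, l2pair_sum hU hV,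
    l2pair_sum (V := fun K => trace W K) hU hWt, sqNorm_eq_sum_sq horth hVc hV,
    sqNorm_eq_sum_sq (V := fun K => trace W K) horth hWc hWt]
  have h : 0 ≤ ∑ k, (c k - 𝒯.l2pair U fun K => trace (b k) K) ^ 2 :=
    sum_nonneg fun _ _ => sq_nonneg _
  simp only [sub_sq, sum_add_distrib, sum_sub_distrib, mul_assoc, ← mul_sum,
    ← sq] at h ⊢
  linarith

lemma convForm_sum (hn : 0 < n) {U V : Finset (Euc n) → Euc n → Fin n → ℝ}
    (hU : ∀ K ∈ 𝒯.cells, ∀ i, Continuous fun x => U K x i)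
    {c : ι → ℝ} (hV : ∀ K ∈ 𝒯.cells, ∀ x i, V K x i = ∑ k, c k * trace (b k) K x i) :
    𝒯.convForm U V = ∑ k, c k * 𝒯.convForm U fun K => trace (b k) K := by
  simp only [convForm, mul_sum 𝒯.cells]
  rw [sum_comm]
  refine sum_congr rfl fun K hK => ?_
  have cU := hU K hK
  have cb := fun k i => continuous_trace_apply (b k) K i
  have cd := fun k i j => continuous_lineDeriv_trace (b k) K i j
  simp only [mul_sub, sum_sub_distrib, mul_sum (K.powersetCard n)]
  congr 1
  · rw [sum_comm]
    refine sum_congr rfl fun f hf => ?_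
    simp only [← integral_const_mul]
    have cf := continuous_flux cU K f
    rw [← integral_finset_sum _ fun k _ => integrableOn_facet (𝒯.cell_simplex hK) hn hf (by fun_prop)]
    congr 1
    ext x
    simp only [hV K hK, mul_sum, sum_mul]
    rw [sum_comm]
    exact sum_congr rfl fun k _ => sum_congr rfl fun i _ => by ring
  · simp only [← integral_const_mul]
    rw [← integral_finset_sum _ fun k _ => integrable_hull K _ (by fun_prop)]
    congr 1
    ext x
    have hd : ∀ i j, ∇ (V K) x i j =
        ∑ k, c k * ∇ (trace (b k) K) x i j := fun i j => by
      have h : (fun y => V K y i) = fun y => trace (∑ k, c k • b k) K y i := by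
        ext y
        rw [hV K hK, trace_sum]
      rw [h, lineDeriv_trace]
      simp only [lineDeriv_trace]
      simp [Finset.sum_apply, map_sum, Derivation.map_smul]
    simp only [hd, mul_sum, sum_mul]
    rw [sum_comm (s := Finset.univ (α := ι))]
    refine sum_congr rfl fun j _ => ?_
    rw [sum_comm (s := Finset.univ (α := ι))]
    exact sum_congr rfl fun i _ => sum_congr rfl fun k _ => by ring

lemma EulerRep.lipschitz_l2pair {T : ℝ} {u : ℝ → Euc n → Euc n} {L B : ℝ≥0}
    {F : Finset (Euc n) → Fin n → ℝ × Euc n → ℝ} {p : ℝ × Euc n → ℝ} {Dp : Fin n → ℝ × Euc n → ℝ}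
    (hF : 𝒯.EulerRep T u L B F p Dp) (v : BrokenField n) : ∃ C : ℝ≥0,
    LipschitzWith C fun t => 𝒯.l2pair (fun K x i => F K i (t, x)) (fun K => trace v K) := by
  have ct := fun K i => continuous_trace_apply v K i
  have hB0 : 0 ≤ ∑ K ∈ 𝒯.cells, ∫ x in hull K, ∑ i, L * |trace v K x i| :=
    sum_nonneg fun K _ => integral_nonneg fun x => sum_nonneg fun i _ => by positivity
  refine ⟨⟨_, hB0⟩, LipschitzWith.of_dist_le_mul fun t t' => ?_⟩
  change _ ≤ (∑ K ∈ 𝒯.cells, ∫ x in hull K, ∑ i, L * |trace v K x i|) * _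
  rw [Real.dist_eq, l2pair, l2pair, ← sum_sub_distrib, sum_mul]
  refine (abs_sum_le_sum_abs _ _).trans (sum_le_sum fun K hK => ?_)
  have cF := fun τ i => (hF.lip_slice hK i τ).continuous
  have hi : ∀ τ, Integrable (fun x => ∑ i, F K i (τ, x) * trace v K x i) (volume.restrict (hull K)) :=
    fun τ => integrable_hull K _ (continuous_finset_sum _ fun i _ => (cF τ i).mul (ct K i))
  rw [← integral_sub (hi t) (hi t'), ← integral_mul_const]
  refine abs_integral_le_integral_abs.trans (integral_mono_of_nonneg
    (.of_forall fun _ => abs_nonneg _)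
    ((integrable_hull K _ (by fun_prop)).mul_const _) (.of_forall fun x => ?_))
  simp only [← sum_sub_distrib, ← sub_mul, sum_mul]
  refine (abs_sum_le_sum_abs _ _).trans (sum_le_sum fun i _ => ?_)
  rw [abs_mul, mul_right_comm]
  exact mul_le_mul_of_nonneg_right ((hF.lip_time hK i x).dist_le_mul t t') (abs_nonneg _)

/-- The energy identity for the difference of a semi-discrete solution and the `L²` projection of
the exact solution. -/
theorem IsUpwindSolution.exists_energy {T : ℝ} {u : ℝ → Euc n → Euc n} {L B : ℝ≥0}
    {F : Finset (Euc n) → Fin n → ℝ × Euc n → ℝ} {p : ℝ × Euc n → ℝ} {Dp : Fin n → ℝ × Euc n → ℝ}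
    (hF : 𝒯.EulerRep T u L B F p Dp) (hn : 0 < n) (hΩo : IsOpen Ω) (hΩ : interior (closure Ω) = Ω)
    (hT : 0 < T) (hu : IsEulerSolution Ω T u) {o : 𝒯.Orientation} {X : ElementFamily} {s : ℕ}
    {uh : ℝ → BrokenField n} (huh : 𝒯.IsUpwindSolution o X s T uh) :
    ∃ (w : ℝ → BrokenField n) (E : ℝ → ℝ), (∀ t, w t ∈ 𝒯.divFreeSpace X s) ∧
      (∀ t ∈ Icc 0 T, uh t - w t ∈ 𝒯.divFreeSpace X s) ∧
      (∀ t, ∀ v ∈ 𝒯.divFreeSpace X s, 𝒯.sqNorm (fun K x i => trace (w t) K x i - F K i (t, x)) ≤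
        𝒯.sqNorm (fun K x i => trace v K x i - F K i (t, x))) ∧
      AbsolutelyContinuousOnInterval E 0 T ∧
      (∀ t ∈ Icc 0 T, E t = 𝒯.sqNorm fun K => trace (uh t - w t) K) ∧
      ∀ᵐ t ∂(volume.restrict (Ioo 0 T)), ∃ c, 𝒯.IsUpwindCoeff o (uh t) c ∧
        HasDerivAt E (2 * (𝒯.convForm (fun K x i => F K i (t, x)) (fun K => trace (uh t - w t) K) -
          𝒯.lieForm o c (uh t) (uh t) (uh t - w t))) t := by
  obtain ⟨ι, _, _, b, hb, horth, hspan⟩ := 𝒯.exists_basis hn hΩ X s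
  obtain ⟨hac, hev⟩ := huh.evolution hT hΩ hb
  set a : ι → ℝ → ℝ := fun k t => 𝒯.l2pair (fun K => trace (uh t) K) fun K => trace (b k) K with ha
  set l : ι → ℝ → ℝ := fun k t => 𝒯.l2pair (fun K x i => F K i (t, x)) fun K => trace (b k) K with hl
  set w : ℝ → BrokenField n := fun t => ∑ k, l k t • b k with hw
  have hwmem : ∀ t, w t ∈ 𝒯.divFreeSpace X s := fun t =>
    (𝒯.divFreeSubmodule hn hΩ X s).sum_mem fun k _ =>
      (𝒯.divFreeSubmodule hn hΩ X s).smul_mem _ (hb k)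
  have hemem : ∀ t ∈ Icc 0 T, uh t - w t ∈ 𝒯.divFreeSpace X s := fun t ht =>
    (𝒯.divFreeSubmodule hn hΩ X s).sub_mem (huh.mem t ht) (hwmem t)
  have het : ∀ t ∈ Icc 0 T, ∀ K ∈ 𝒯.cells, ∀ x i,
      trace (uh t - w t) K x i = ∑ k, (a k t - l k t) * trace (b k) K x i := fun t ht K hK x i => by
    have h1 : trace (uh t - w t) K x i = trace (uh t) K x i - trace (w t) K x i := by simp [trace]
    rw [h1, hspan _ (huh.mem t ht) K hK, hw, trace_sum]
    simp only [sub_mul, sum_sub_distrib, ha]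
  have hFc : ∀ t, ∀ K ∈ 𝒯.cells, ∀ i, Continuous fun x => F K i (t, x) := fun t K hK i =>
    (hF.lip_slice hK i t).continuous
  have hlac : ∀ k, AbsolutelyContinuousOnInterval (l k) 0 T := fun k => by
    obtain ⟨C, hC⟩ := hF.lipschitz_l2pair (b k)
    exact hC.lipschitzOnWith.absolutelyContinuousOnInterval
  refine ⟨w, fun t => ∑ k, (a k t - l k t) * (a k t - l k t), hwmem, hemem, fun t v hv => ?_,
    absolutelyContinuousOnInterval_sum _ fun k _ =>
      ((hac k).fun_sub (hlac k)).fun_mul ((hac k).fun_sub (hlac k)), fun t ht => ?_, ?_⟩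
  · exact sqNorm_sub_le_of_coeff horth (hFc t) (fun K _ i => continuous_trace_apply v K i)
      (hspan v hv) rfl
  · rw [sqNorm_eq_sum_sq horth (fun K _ i => continuous_trace_apply (uh t - w t) K i) (het t ht)]
    simp only [sq]
  · have hld : ∀ᵐ t ∂(volume.restrict (Ioo 0 T)), ∀ k, HasDerivAt (l k)
        (-𝒯.convForm (fun K x i => F K i (t, x)) fun K => trace (b k) K) t :=
      ae_all_iff.2 fun k => hF.hasDerivAt hn hΩo hΩ hu (divFree_of_mem hn hΩ (hb k))
    filter_upwards [hev, hld, ae_restrict_mem measurableSet_Ioo] with t ⟨ud, c, hc, hda, heq⟩ hdl ht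
    have ht' := Ioo_subset_Icc_self ht
    refine ⟨c, hc, ?_⟩
    have hd := HasDerivAt.fun_sum (u := Finset.univ) fun k _ =>
      ((hda k).sub (hdl k)).fun_mul ((hda k).sub (hdl k))
    refine hd.congr_deriv ?_
    have h1 := heq _ (hemem t ht')
    rw [l2pair_sum (fun K _ i => continuous_trace_apply ud K i) (het t ht')] at h1
    rw [convForm_sum hn (hFc t) (het t ht'), sub_eq_add_neg _ (𝒯.lieForm _ _ _ _ _), ← h1,
      ← sum_add_distrib, mul_sum]
    refine sum_congr rfl fun k _ => ?_
    simp only [Pi.sub_apply, ha]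
    ring

/-- The scheme conserves the energy. -/
theorem IsUpwindSolution.sqNorm_eq (hn : 0 < n) (hΩ : interior (closure Ω) = Ω) {T : ℝ}
    (hT : 0 < T) {o : 𝒯.Orientation} {X : ElementFamily} {s : ℕ}
    {uh : ℝ → BrokenField n} (huh : 𝒯.IsUpwindSolution o X s T uh) {t : ℝ} (ht : t ∈ Icc 0 T) :
    𝒯.sqNorm (fun K => trace (uh t) K) = 𝒯.sqNorm fun K => trace (uh 0) K := by
  obtain ⟨ι, _, _, b, hb, horth, hspan⟩ := 𝒯.exists_basis hn hΩ X s
  obtain ⟨hac, hev⟩ := huh.evolution hT hΩ hb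
  set a : ι → ℝ → ℝ := fun k t => 𝒯.l2pair (fun K => trace (uh t) K) fun K => trace (b k) K with ha
  have hE : ∀ t ∈ Icc 0 T, 𝒯.sqNorm (fun K => trace (uh t) K) = ∑ k, a k t * a k t := fun t ht => by
    rw [sqNorm_eq_sum_sq horth (fun K _ i => continuous_trace_apply (uh t) K i)
      (hspan _ (huh.mem t ht))]
    simp only [sq, ha]
  have hlie : ∀ c, ∀ β ∈ 𝒯.divFreeSpace X s, 𝒯.lieForm o c β β β = 0 := fun c β hβ => by
    have h0 : ∀ K x, cross (trace β K x) (trace β K x) = 0 := fun K x => by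
      ext i j
      simp [cross, mul_comm]
    have h1 : ∀ K, polyCurl (cross (β K) (β K)) = 0 := fun K => by
      ext1 i
      simp [polyCurl, cross, mul_comm]
    refine (congrArg₂ (· + ·) (sum_eq_zero fun K hK => integral_eq_zero_of_ae ?_)
      (sum_eq_zero fun f _ => by simp [h0, crossInner])).trans (add_zero 0)
    filter_upwards [(divFree_of_mem hn hΩ hβ).div K hK] with x hx
    have h2 : eval (fun j => x j) (polyDiv (β K)) = 0 := by
      rw [← hx]
      simp [polyDiv, divPt, lineDeriv_trace]
    simp [h1, h2]
  obtain ⟨C, hC⟩ := (absolutelyContinuousOnInterval_sum Finset.univ fun k _ =>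
    (hac k).fun_mul (hac k)).const_of_ae_hasDerivAt_zero (by
      rw [uIcc_of_le hT.le, ← ae_restrict_iff' measurableSet_Icc, ← restrict_Ioo_eq_restrict_Icc]
      filter_upwards [hev, ae_restrict_mem measurableSet_Ioo] with t ⟨ud, c, hc, hda, heq⟩ ht
      have ht' := Ioo_subset_Icc_self ht
      refine (HasDerivAt.fun_sum (u := Finset.univ) fun k _ =>
        (hda k).fun_mul (hda k)).congr_deriv ?_
      have h1 := heq _ (huh.mem t ht')
      rw [hlie c _ (huh.mem t ht'), l2pair_sum (fun K _ i => continuous_trace_apply ud K i)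
        (hspan _ (huh.mem t ht'))] at h1
      rw [sum_add_distrib]
      have h2 : ∑ k, 𝒯.l2pair (fun K => trace ud K) (fun K => trace (b k) K) * a k t =
          ∑ k, a k t * 𝒯.l2pair (fun K => trace ud K) fun K => trace (b k) K :=
        sum_congr rfl fun k _ => mul_comm _ _
      rw [h2]
      simp only [ha]
      rw [h1]
      simp)
  rw [uIcc_of_le hT.le] at hC
  rw [hE t ht, hE 0 ⟨le_rfl, hT.le⟩, hC t ht, hC 0 ⟨le_rfl, hT.le⟩]

end Triangulation

namespace Triangulation

variable {n : ℕ} {Ω : Set (Euc n)} {𝒯 : Triangulation Ω}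

lemma sqNorm_sub_le {U V W : Finset (Euc n) → Euc n → Fin n → ℝ}
    (hU : ∀ K ∈ 𝒯.cells, ∀ i, Continuous fun x => U K x i)
    (hV : ∀ K ∈ 𝒯.cells, ∀ i, Continuous fun x => V K x i)
    (hW : ∀ K ∈ 𝒯.cells, ∀ i, Continuous fun x => W K x i) :
    𝒯.sqNorm (fun K x i => U K x i - W K x i) ≤ 2 * 𝒯.sqNorm (fun K x i => U K x i - V K x i) +
      2 * 𝒯.sqNorm fun K x i => V K x i - W K x i := by
  simp only [sqNorm, mul_sum, ← sum_add_distrib]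
  exact sum_le_sum fun K hK =>
    integral_sum_sq_sub_le (integrable_hull K) (hU K hK) (hV K hK) (hW K hK)

lemma sqNorm_sub_comm (U V : Finset (Euc n) → Euc n → Fin n → ℝ) :
    𝒯.sqNorm (fun K x i => U K x i - V K x i) = 𝒯.sqNorm fun K x i => V K x i - U K x i := by
  simp only [sqNorm, sub_sq_comm]

lemma errorNorm_eq (hΩ : interior (closure Ω) = Ω) {w : Euc n → Euc n}
    (hw : MemLp w 2 (volume.restrict Ω)) {U : Finset (Euc n) → Euc n → Fin n → ℝ}
    (hr : 𝒯.Represents U w) (hU : ∀ K ∈ 𝒯.cells, ∀ i, Continuous fun x => U K x i)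
    (v : BrokenField n) : 𝒯.errorNorm w v =
      ENNReal.ofReal (√(𝒯.sqNorm fun K x i => U K x i - trace v K x i)) := by
  have h1 := (hw.sub (memLp_glue 𝒯 v 2)).eLpNorm_eq_integral_rpow_norm (by norm_num) (by norm_num)
  simp only [ENNReal.toReal_ofNat, Real.rpow_two] at h1
  refine h1.trans ?_
  rw [← one_div, ← Real.sqrt_eq_rpow]
  have h2 : ∀ K ∈ 𝒯.cells, (fun x => ‖(w - 𝒯.glue v) x‖ ^ 2) =ᵐ[volume.restrict (hull K)]
      fun x => ∑ i, (U K x i - trace v K x i) ^ 2 := fun K hK => by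
    filter_upwards [hr.ae hK, (𝒯.represents_glue v).ae hK] with x h1 h2
    simp [EuclideanSpace.norm_sq_eq, h1, h2]
  have ct := fun K i => continuous_trace_apply v K i
  rw [𝒯.setIntegral_eq_sum hΩ fun K hK => Integrable.congr (integrable_hull K _ (by
    have := hU K hK
    fun_prop)) (h2 K hK).symm]
  rw [sqNorm, sum_congr rfl fun K hK => integral_congr_ae (h2 K hK)]

/-- Fields with bounded components have bounded `L²` norm. -/
lemma sqNorm_le_of_bound (hΩ : interior (closure Ω) = Ω) {U : Finset (Euc n) → Euc n → Fin n → ℝ}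
    {L : ℝ} (hU : ∀ K ∈ 𝒯.cells, ∀ i, Continuous fun x => U K x i)
    (h : ∀ K ∈ 𝒯.cells, ∀ i, ∀ x ∈ hull K, |U K x i| ≤ L) :
    𝒯.sqNorm U ≤ n * L ^ 2 * volume.real Ω := by
  have h1 := 𝒯.setIntegral_eq_sum hΩ (G := fun _ => n * L ^ 2) fun K _ =>
    integrable_hull K _ continuous_const
  rw [setIntegral_const, smul_eq_mul, mul_comm] at h1
  rw [h1]
  refine sum_le_sum fun K hK => setIntegral_mono_on (integrable_hull K _ (by
    have := hU K hK
    fun_prop)) (integrable_hull K _ continuous_const) (measurableSet_hull K) fun x hx => ?_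
  calc ∑ i, U K x i ^ 2 ≤ ∑ _i : Fin n, L ^ 2 := sum_le_sum fun i _ =>
        sq_le_sq' (neg_le_of_abs_le (h K hK i x hx)) (le_of_abs_le (h K hK i x hx))
    _ = n * L ^ 2 := by simp

/-- The approximation power of the divergence free finite element space. -/
theorem exists_divFree_approx {s : ℕ} (hn : 0 < n) (hs : n < 2 * s) (hs2 : 2 ≤ s) {T : ℝ}
    (hT : 0 < T) {σ : ℝ} (hσ : 0 < σ) (M : ℝ≥0) :
    ∃ C : ℝ, 0 < C ∧ ∀ {Ω : Set (Euc n)} (_ : IsOpen Ω) (_ : Ω.Nonempty)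
      (_ : interior (closure Ω) = Ω) {u : ℝ → Euc n → Euc n} (_ : IsEulerSolution Ω T u)
      (_ : sobolevTimeNorm Ω T (s + 1) u ≤ M)
      {𝒯 : Triangulation Ω} (_ : 𝒯.ShapeRegular σ) {L B : ℝ≥0}
      {F : Finset (Euc n) → Fin n → ℝ × Euc n → ℝ} {p : ℝ × Euc n → ℝ} {Dp : Fin n → ℝ × Euc n → ℝ}
      (_ : 𝒯.EulerRep T u L B F p Dp) {t : ℝ} (_ : t ∈ Icc 0 T) (X : ElementFamily),
      ∃ v ∈ 𝒯.divFreeSpace X s, 𝒯.sqNorm (fun K x i => trace v K x i - F K i (t, x)) ≤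
        C * 𝒯.meshSize ^ (2 * (s + 1)) := by
  obtain ⟨C₁, hC₁, h1⟩ := exists_broken_approx hn hs hT hσ M
  obtain ⟨C₂, hC₂, h2⟩ := exists_quasi_interpolation n s hn hs2 hσ
  refine ⟨2 * (C₂ * C₁) + 2 * C₁, by positivity, fun {Ω} hΩo hΩne hΩ {u} hu hM {𝒯} hreg {L B F p Dp}
    hF {t} ht X => ?_⟩
  obtain ⟨q, hq, hqb⟩ := h1 hΩo hΩne hΩ hM hreg hF ht
  obtain ⟨v, hv, -, hvb⟩ := h2 hΩ 𝒯 (hreg.shapeReg hσ hn) (fun K x i => F K i (t, x))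
    (hF.divFree hn hΩ hu ht) q hq X
  refine ⟨v, hv, ?_⟩
  have h3 : 𝒯.sqNorm (fun K x i => q K x i - F K i (t, x)) ≤ C₁ * 𝒯.meshSize ^ (2 * (s + 1)) :=
    (sum_le_sum fun K _ => le_add_of_nonneg_right (mul_nonneg diam_nonneg
      (sum_nonneg fun f _ => integral_nonneg fun x => sum_nonneg fun i _ =>
        sq_nonneg _))).trans hqb
  have h4 : 𝒯.sqNorm (fun K x i => q K x i - trace v K x i) ≤
      C₂ * (C₁ * 𝒯.meshSize ^ (2 * (s + 1))) := hvb.trans (mul_le_mul_of_nonneg_left hqb hC₂.le)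
  rw [sqNorm_sub_comm] at h4
  have h5 := 𝒯.sqNorm_sub_le (U := fun K => trace v K) (V := q) (W := fun K x i => F K i (t, x))
    (fun K _ i => continuous_trace_apply v K i) (fun K _ i => polySpace_continuous (hq K i))
    fun K hK i => (hF.lip_slice hK i t).continuous
  linarith

end Triangulation

theorem theorem4p2 (n : ℕ) (hn : n = 2 ∨ n = 3) (s : ℕ) (hs : 1 + (n : ℝ) / 2 < s)
    (Ω : Set (Euc n)) (hΩ_open : IsOpen Ω) (hΩ_bdd : Bornology.IsBounded Ω)
    (hΩ_ne : Ω.Nonempty) (hΩ_reg : interior (closure Ω) = Ω)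
    (T : ℝ) (hT : 0 < T) (σ κ : ℝ) (hσ : 0 < σ) (hκ : 0 < κ) (M A : ℝ≥0) :
    ∃ C : ℝ, 0 < C ∧
      ∀ u : ℝ → Euc n → Euc n, IsEulerSolution Ω T u →
        sobolevNorm Ω (s + 1) (u 0) ≤ M →
        sobolevTimeNorm Ω T (s + 1) u ≤ M →
        lipNorm Ω T u ≤ M →
      ∀ (𝒯 : Triangulation Ω), 𝒯.ShapeRegular σ → 𝒯.QuasiUniform κ →
      ∀ (o : 𝒯.Orientation) (F : ElementFamily) (uh : ℝ → BrokenField n),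
        𝒯.IsUpwindSolution o F s T uh →
        (∀ w ∈ 𝒯.divFreeSpace F s,
          𝒯.errorNorm (u 0) (uh 0) ≤
            A * (𝒯.errorNorm (u 0) w + ENNReal.ofReal (𝒯.meshSize ^ s))) →
        ∀ t ∈ Icc 0 T, 𝒯.errorNorm (u t) (uh t) ≤ ENNReal.ofReal (C * 𝒯.meshSize ^ s) := by
  obtain ⟨hn0, hs3, hs2, hs1⟩ : 0 < n ∧ n + 3 ≤ 2 * s ∧ 2 ≤ s ∧ n < 2 * s := by
    have h1 : ((n + 2 : ℕ) : ℝ) < ((2 * s : ℕ) : ℝ) := by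
      push_cast
      linarith
    have h2 : n + 2 < 2 * s := by exact_mod_cast h1
    omega
  set L : ℝ≥0 := (n + 1) * (M + 1)
  set D := diam Ω
  have hD : 0 ≤ D := diam_nonneg
  obtain ⟨C₀, hC₀, happ⟩ := Triangulation.exists_divFree_approx hn0 hs1 hs2 hT hσ M
  obtain ⟨C₁, hC₁, hgrow⟩ := Triangulation.exists_error_growth n s hn0 hs1 hT hσ hκ hD hC₀.le M L
    ((M + 1) + n * ((M + 1) * (M + 1)))
  -- the bounds, relative to `h ^ (2 * s)`, of the squared projection error, the squared initial
  -- error and its discrete part, and the squared discrete error at later times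
  set P := C₀ * D ^ 2
  have hP : 0 ≤ P := by positivity
  set I := (A * (√P + 1)) ^ 2
  have hI : 0 ≤ I := sq_nonneg _
  set G := Real.exp (2 * C₁ * T) * (2 * I + 2 * P + 1) with hG
  have hG1 : 1 ≤ G := one_le_mul_of_one_le_of_one_le (Real.one_le_exp (by positivity)) (by linarith)
  set V := n * (L : ℝ) ^ 2 * volume.real Ω
  have hV : 0 ≤ V := by positivity
  set Q := 2 * G + 2 * P + (6 * V * G ^ (2 * s) + 4 * I)
  have hQ : 0 < Q := by positivity
  refine ⟨√Q, Real.sqrt_pos.2 hQ, fun u hu _ hsob hlip 𝒯 hreg hqu o X uh huh hinit t ht => ?_⟩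
  obtain ⟨F, p, Dp, hF⟩ := Triangulation.exists_eulerRep hΩ_open hΩ_reg hT hu hlip 𝒯
  have hh := 𝒯.meshSize_pos hn0 hΩ_open hΩ_ne hΩ_reg
  have hhD := 𝒯.meshSize_le_diam hΩ_bdd
  set h := 𝒯.meshSize
  have h0 : (0 : ℝ) ∈ Icc 0 T := ⟨le_rfl, hT.le⟩
  have cF : ∀ t, ∀ K ∈ 𝒯.cells, ∀ i, Continuous fun x => F K i (t, x) := fun t K hK i =>
    (hF.lip_slice hK i t).continuous
  have ct : ∀ v : BrokenField n, ∀ K ∈ 𝒯.cells, ∀ i, Continuous fun x => trace v K x i :=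
    fun v K _ i => Triangulation.continuous_trace_apply v K i
  have hnorm : ∀ t ∈ Icc 0 T, ∀ v, 𝒯.errorNorm (u t) v =
      ENNReal.ofReal (√(𝒯.sqNorm fun K x i => F K i (t, x) - trace v K x i)) := fun t ht v =>
    Triangulation.errorNorm_eq hΩ_reg (hu.solenoidal t ht).1 (hF.rep t ht) (cF t) v
  obtain ⟨w, E, hw, he, hbest, hEac, hE, hder⟩ :=
    huh.exists_energy hF hn0 hΩ_open hΩ_reg hT hu
  have hproj : ∀ t ∈ Icc 0 T, 𝒯.sqNorm (fun K x i => trace (w t) K x i - F K i (t, x)) ≤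
      C₀ * h ^ (2 * (s + 1)) := fun t ht => by
    obtain ⟨v, hv, hvb⟩ := happ hΩ_open hΩ_ne hΩ_reg hu hsob hreg hF ht X
    exact (hbest t v hv).trans hvb
  have hPh : C₀ * h ^ (2 * (s + 1)) ≤ P * h ^ (2 * s) := by
    have : h ^ 2 ≤ D ^ 2 := pow_le_pow_left₀ hh.le hhD 2
    calc C₀ * h ^ (2 * (s + 1)) = C₀ * h ^ 2 * h ^ (2 * s) := by ring
      _ ≤ _ := mul_le_mul_of_nonneg_right (mul_le_mul_of_nonneg_left this hC₀.le) (by positivity)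
  have hinit' : 𝒯.sqNorm (fun K x i => F K i (0, x) - trace (uh 0) K x i) ≤ I * h ^ (2 * s) := by
    have h1 := hinit (w 0) (hw 0)
    rw [hnorm 0 h0, hnorm 0 h0, ← ENNReal.ofReal_add (Real.sqrt_nonneg _) (by positivity),
      ← ENNReal.ofReal_coe_nnreal (p := A), ← ENNReal.ofReal_mul A.coe_nonneg,
      ENNReal.ofReal_le_ofReal_iff (by positivity), Triangulation.sqNorm_sub_comm (𝒯 := 𝒯)
        (fun K x i => F K i (0, x)) (fun K => trace (w 0) K)] at h1
    have h2 : √(𝒯.sqNorm fun K x i => trace (w 0) K x i - F K i (0, x)) ≤ √P * h ^ s := by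
      refine (Real.sqrt_le_sqrt ((hproj 0 h0).trans hPh)).trans (le_of_eq ?_)
      rw [Real.sqrt_mul hP, pow_mul', Real.sqrt_sq (by positivity)]
    have h3 := h1.trans (mul_le_mul_of_nonneg_left (add_le_add_left h2 (h ^ s)) A.coe_nonneg)
    rw [show (A : ℝ) * (√P * h ^ s + h ^ s) = A * (√P + 1) * h ^ s by ring,
      Real.sqrt_le_left (by positivity), mul_pow, ← pow_mul'] at h3
    exact h3
  rw [hnorm t ht]
  refine ENNReal.ofReal_le_ofReal ?_
  rw [Real.sqrt_le_left (by positivity), mul_pow, Real.sq_sqrt hQ.le, ← pow_mul']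
  have hh2 : 0 < h ^ (2 * s) := by positivity
  by_cases hsmall : G * h < 1
  · have hE0 : E 0 ≤ (2 * I + 2 * P) * h ^ (2 * s) := by
      have h1 := 𝒯.sqNorm_sub_le (ct (uh 0)) (cF 0) (ct (w 0))
      rw [Triangulation.sqNorm_sub_comm (fun K => trace (uh 0) K) fun K x i => F K i (0, x),
        Triangulation.sqNorm_sub_comm (fun K x i => F K i (0, x)) fun K => trace (w 0) K] at h1
      have h2 : E 0 = 𝒯.sqNorm fun K x i => trace (uh 0) K x i - trace (w 0) K x i := by
        rw [hE 0 h0]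
        simp [trace, Triangulation.sqNorm]
      linarith [(hproj 0 h0).trans hPh]
    have hE1 : Real.exp (2 * C₁ * T) * (E 0 + h ^ (2 * s)) ≤ G * h ^ (2 * s) := by
      have h1 : E 0 + h ^ (2 * s) ≤ (2 * I + 2 * P + 1) * h ^ (2 * s) := by linarith
      rw [hG, mul_assoc (Real.exp _)]
      exact mul_le_mul_of_nonneg_left h1 (Real.exp_pos _).le
    -- the threshold is met since `2 * s ≥ n + 3`
    have hlt : G * h ^ (2 * s) < h ^ (n + 2) := by
      have h1 : h ≤ 1 := by nlinarith
      calc G * h ^ (2 * s) ≤ G * h ^ (n + 3) := mul_le_mul_of_nonneg_left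
            (pow_le_pow_of_le_one hh.le h1 hs3) (by positivity)
        _ = G * h * h ^ (n + 2) := by ring
        _ < 1 * h ^ (n + 2) := mul_lt_mul_of_pos_right hsmall (by positivity)
        _ = _ := one_mul _
    have hEt := hEac.le_exp_mul_of_threshold (C := 2 * C₁) (δ := h ^ (2 * s)) (H := h ^ (n + 2))
      (by positivity) hh2.le (by
        rw [hE 0 h0]
        exact 𝒯.sqNorm_nonneg _) (by
        filter_upwards [hder, ae_restrict_mem measurableSet_Ioo] with r ⟨c, hc, hd⟩ hr hle
        have hr' := Ioo_subset_Icc_self hr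
        refine ⟨_, hd, ?_⟩
        have hadd : w r + (uh r - w r) = uh r := by abel
        have h1 := hgrow hΩ_open hΩ_ne hΩ_reg hu hsob hreg hqu hhD hF hr' o
          (fun K hK i => Triangulation.trace_mem_polySpace
            (Triangulation.totalDegree_le_of_mem (hw r) hK i))
          (fun K hK i => Triangulation.trace_mem_polySpace
            (Triangulation.totalDegree_le_of_mem (he r hr') hK i))
          (Triangulation.divFree_of_mem hn0 hΩ_reg (hw r))
          (Triangulation.divFree_of_mem hn0 hΩ_reg (he r hr')) (hadd.symm ▸ hc) (hproj r hr')
          (hE r hr' ▸ hle)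
        rw [hadd, ← hE r hr'] at h1
        linarith) (hE1.trans_lt hlt) t ht
    have h1 := 𝒯.sqNorm_sub_le (cF t) (ct (w t)) (ct (uh t))
    rw [Triangulation.sqNorm_sub_comm (fun K x i => F K i (t, x)) fun K => trace (w t) K,
      Triangulation.sqNorm_sub_comm (fun K => trace (w t) K) fun K => trace (uh t) K] at h1
    have h2 : E t = 𝒯.sqNorm fun K x i => trace (uh t) K x i - trace (w t) K x i := by
      rw [hE t ht]
      simp [trace, Triangulation.sqNorm]
    have h3 : 0 ≤ (6 * V * G ^ (2 * s) + 4 * I) * h ^ (2 * s) := by positivity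
    linarith [(hproj t ht).trans hPh]
  · -- on coarse meshes the conservation of energy suffices
    have hbd : ∀ t ∈ Icc 0 T, 𝒯.sqNorm (fun K x i => F K i (t, x)) ≤ V := fun t ht =>
      Triangulation.sqNorm_le_of_bound hΩ_reg (cF t) fun K hK i x hx => hF.bound K hK i t ht x hx
    have c0 : ∀ K ∈ 𝒯.cells, ∀ i : Fin n, Continuous fun _ : Euc n => (0 : ℝ) := fun _ _ _ =>
      continuous_const
    have h1 := 𝒯.sqNorm_sub_le (V := fun _ _ _ => 0) (cF t) c0 (ct (uh t))
    have h2 := 𝒯.sqNorm_sub_le (W := fun _ _ _ => 0) (ct (uh 0)) (cF 0) c0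
    rw [Triangulation.sqNorm_sub_comm (fun _ _ _ => 0) fun K => trace (uh t) K] at h1
    rw [Triangulation.sqNorm_sub_comm (fun K => trace (uh 0) K) fun K x i => F K i (0, x)] at h2
    simp only [sub_zero] at h1 h2
    rw [huh.sqNorm_eq hn0 hΩ_reg hT ht] at h1
    have h3 : V ≤ V * G ^ (2 * s) * h ^ (2 * s) := by
      rw [mul_assoc, ← mul_pow]
      exact le_mul_of_one_le_right hV (one_le_pow₀ (not_lt.1 hsmall))
    have h4 : 0 ≤ (2 * G + 2 * P) * h ^ (2 * s) := by positivity
    linarith [hbd t ht, hbd 0 h0]
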